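/- Let $d\ge 2$, let $\mathbb T^d=\mathbb R^d/\mathbb Z^d$, and let $\varphi\in C_c^\infty(\mathbb R^d;\mathbb R)$ be a mollifier with $\int\varphi=1$, $\varphi\ge0$, $\varphi(-h)=\varphi(h)$, $\varphi(h)=0$ for $|h|\ge1$ and $\varphi(h)>0$ for $|h|\le\frac12$. For a kernel $k$ on $\mathbb R^d$ and $r>0$ write $k_r(h)=r^{-d}k(h/r)$. Functions and measures on $\mathbb T^d$ are extended periodically to $\mathbb R^d$ in convolutions, and $|\cdot|$ is the Euclidean norm of vectors and matrices. There is a constant $C>0$, depending only on $d$ and $\varphi$, such that the following holds. Let $u\in BV(\mathbb T^d;\mathbb R^d)$ be divergence-free with $\int_{\mathbb T^d}u=0$. Its gradient $(\nabla u)_{ij}=\partial_iu_j$ is a finite matrix-valued measure, $|\nabla u|$ is its total variation measure, and $\|\nabla u\|_{L^1}=|\nabla u|(\mathbb T^d)$. Let $T>0$, and let $\rho\in L^\infty_tL^\infty_x(\mathbb T^d\times[0,T])$ be a weak solution of $\partial_t\rho+\nabla\cdot(u\rho)=0$ with weak traces $\rho_0,\rho_T\in L^\infty$ at the times $0,T$.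 Let $\phi\in L^\infty_tL^\infty_x$ be a weak solution of the same equation with weak traces $\phi_0,\phi_T\in L^\infty$ at the times $0,T$, where $\|\phi_T\|_{W^{1,\infty}}=\|\phi_T\|_{L^\infty}+\|\nabla\phi_T\|_{L^\infty}\le1$ and $\|\phi\|_{L^\infty_tL^\infty_x}\le\|\phi_T\|_{L^\infty}$. Let $\Lambda,\delta,\epsilon>0$ with $\delta\le\epsilon e^{-\Lambda}$. Put $$\bar M(\bar x)=\frac{(\nabla u*\varphi_{4\epsilon})(\bar x)}{|(\nabla u*\varphi_{4\epsilon})(\bar x)|}\quad(\text{and }\bar M(\bar x)=0\text{ where the denominator vanishes}),$$ and for a matrix $M$ let $$\varphi^{\Lambda,M}(h)=\frac1\Lambda\int_0^\Lambda\varphi\big(\exp(-\lambda M^{\dagger})h\big)\,d\lambda$$ be the Alberti mollifier, where $M^\dagger$ is the transpose, with rescaling $\varphi^{\Lambda,M}_\delta$. Define $$I_1=\int_{\mathbb T^d}\int_{\mathbb R^d}\rho_T(x)\big(\phi_T(x)-(\phi_T*\varphi_\delta^{\Lambda,\bar M(\bar x)})(x)\big)\varphi_\epsilon(\bar x-x)\,d\bar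 x\,dx,$$ $$I_2=\int_{\mathbb T^d}\int_{\mathbb R^d}\rho_0(x)\,(\phi_0*\varphi_\delta^{\Lambda,\bar M(\bar x)})(x)\,\varphi_\epsilon(\bar x-x)\,d\bar x\,dx,$$ $$I_3=-\int_0^T\!\int_{\mathbb T^d}\int_{\mathbb R^d}\rho(x,t)\,(\phi*\varphi_\delta^{\Lambda,\bar M(\bar x)})(x,t)\;u(x)\cdot\nabla\varphi_\epsilon(\bar x-x)\,d\bar x\,dx\,dt,$$ $$I_4=\int_0^T\!\int_{\mathbb T^d}\int_{\mathbb R^d}\int_{\mathbb R^d}\int_0^1\rho(x,t)\phi(x-\delta h,t)\;h\cdot\big(\nabla u(x-s\delta h)-|\nabla u(x-s\delta h)|\bar M(\bar x)\big)\cdot\nabla\varphi^{\Lambda,\bar M(\bar x)}(h)\,\varphi_\epsilon(\bar x-x)\,ds\,dh\,d\bar x\,dx\,dt,$$ $$I_5=\int_0^T\!\int_{\mathbb T^d}\int_{\mathbb R^d}\int_{\mathbb R^d}\int_0^1\rho(x,t)\phi(x-\delta h,t)\;|\nabla u(x-s\delta h)|\;h\cdot\bar M(\bar x)\cdot\nabla\varphi^{\Lambda,\bar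 M(\bar x)}(h)\,\varphi_\epsilon(\bar x-x)\,ds\,dh\,d\bar x\,dx\,dt,$$ where in $I_4$ and $I_5$ the measures $\nabla u$ and $|\nabla u|$ are integrated in the variable $y=x-s\delta h\in\mathbb T^d$. Then $$\int_{\mathbb T^d}\rho_T(x)\phi_T(x)\,dx=I_1+I_2+I_3+I_4+I_5,$$ and $$|I_1|\le C\,\delta e^{(d+1)\Lambda}\|\rho\|_{L^\infty_tL^\infty_x},$$ $$|I_2|\le C\Big(1+\frac{e^\Lambda}{\delta}+\frac1\epsilon\Big)\|\rho_0\|_{W^{-1,1}},\qquad \|\rho_0\|_{W^{-1,1}}=\sup_{\|\psi\|_{W^{1,\infty}}\le1}\int_{\mathbb T^d}\rho_0\psi\,dx,$$ $$|I_3|\le C\,T^{\frac{d-1}d}\frac{e^{d\Lambda}}\epsilon\|\rho\|_{L^\infty_tL^\infty_x}\|\nabla u\|_{L^1}\Big(\|\phi\|^2_{L^2_tL^2_x}-\|\phi*\varphi_{2\delta e^\Lambda}\|^2_{L^2_tL^2_x}\Big)^{\frac1d},$$ $$|I_4|\le C\,Te^{2\Lambda}\|\rho\|_{L^\infty_tL^\infty_x}\|\nabla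 u\|_{L^1}^{\frac12}\Big(\|\nabla u\|_{L^1}-\|\nabla u*\varphi_{4\epsilon}\|_{L^1}\Big)^{\frac12},$$ $$|I_5|\le C\,\frac T\Lambda\|\rho\|_{L^\infty_tL^\infty_x}\|\nabla u\|_{L^1}.$$ -/

import Mathlib

open MeasureTheory Matrix
open scoped ContDiff Topology ENNReal

namespace BVTransport

noncomputable section

/-- Euclidean space `ℝ^d`. -/
abbrev E (d : ℕ) : Type := EuclideanSpace ℝ (Fin d)

/-- The flat torus `𝕋^d = ℝ^d / ℤ^d`, with its Lebesgue (probability) measure `volume`. -/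
abbrev Td (d : ℕ) : Type := UnitAddTorus (Fin d)

/-- The covering projection `ℝ^d → 𝕋^d`. The periodic extension of `f : 𝕋^d → α` is
`fun v => f (proj v)`, and `x + proj v` is the point `x` translated by the vector `v`. -/
def proj {d : ℕ} (v : E d) : Td d := fun i => ((v i : ℝ) : UnitAddCircle)

/-- Smooth functions on the torus. -/
def TorusSmooth {d : ℕ} (ψ : Td d → ℝ) : Prop :=
  ContDiff ℝ ∞ fun v : E d => ψ (proj v)

/-- The (classical) gradient of a function on the torus. -/
def torusGrad {d : ℕ} (ψ : Td d → ℝ) (x : Td d) : E d :=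
  gradient (fun v : E d => ψ (x + proj v)) 0

/-- `g` is the weak gradient of `f` on the torus. -/
def IsWeakGradient {d : ℕ} (f : Td d → ℝ) (g : Td d → E d) : Prop :=
  Integrable f ∧ Integrable g ∧
    ∀ ψ : Td d → ℝ, TorusSmooth ψ → ∀ i : Fin d,
      ∫ x, f x * torusGrad ψ x i = -∫ x, g x i * ψ x

/-- The norm `‖f‖_{W^{1,∞}} = ‖f‖_{L^∞} + ‖∇f‖_{L^∞}`; it is `∞` if `f` has no weak gradient. The
weak gradient is unique almost everywhere, so that the infimum is over equal numbers. -/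
def w1InfNorm {d : ℕ} (f : Td d → ℝ) : ℝ≥0∞ :=
  eLpNorm f ∞ volume + ⨅ (g : Td d → E d) (_ : IsWeakGradient f g), eLpNorm g ∞ volume

/-- The dual norm `‖f‖_{W^{-1,1}} = sup {∫ f ψ : ‖ψ‖_{W^{1,∞}} ≤ 1}`. -/
def wNeg1Norm {d : ℕ} (f : Td d → ℝ) : ℝ :=
  sSup {a : ℝ | ∃ ψ : Td d → ℝ, w1InfNorm ψ ≤ 1 ∧ a = ∫ x, f x * ψ x}

/-- Lebesgue measure on `[0,T] × 𝕋^d`. -/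
def spaceTime (d : ℕ) (T : ℝ) : Measure (ℝ × Td d) :=
  (volume.restrict (Set.Icc 0 T)).prod volume

/-- `u` is divergence-free in the sense of distributions. -/
def DivFree {d : ℕ} (u : Td d → E d) : Prop :=
  ∀ ψ : Td d → ℝ, TorusSmooth ψ → ∫ x, inner ℝ (u x) (torusGrad ψ x) = 0

/-- The Euclidean (Frobenius, `l²`) norm of a matrix. -/
def frob {d : ℕ} (A : Matrix (Fin d) (Fin d) ℝ) : ℝ :=
  Real.sqrt (∑ i, ∑ j, A i j ^ 2)

/-- `u` is a vector field of bounded variation on the torus: `u ∈ L¹`, and the distributional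
gradient `(∇u)_{ij} = ∂_i u_j` is the finite matrix-valued measure with polar decomposition
`∇u = σ |∇u|`, where `|∇u| = μ` is its total variation measure and `|σ| = 1` holds
`μ`-almost everywhere (so `σ` stands for `∇u / |∇u|`). -/
structure IsBVWithGradient {d : ℕ} (u : Td d → E d) (μ : Measure (Td d))
    (σ : Td d → Matrix (Fin d) (Fin d) ℝ) : Prop where
  integrable : Integrable u
  finite : IsFiniteMeasure μ
  measurable : ∀ i j, Measurable fun x => σ x i j
  unit : ∀ᵐ x ∂μ, frob (σ x) = 1
  grad : ∀ ψ : Td d → ℝ, TorusSmooth ψ → ∀ i j : Fin d,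
    ∫ x, u x j * torusGrad ψ x i = -∫ x, ψ x * σ x i j ∂μ

/-- `f ∈ L^∞([0,T] × 𝕋^d)` is a weak solution on `[0,T]` of the transport equation
`∂_t f + ∇ · (u f) = 0` whose weak traces at times `0` and `T` are `f₀, fT ∈ L^∞(𝕋^d)`. -/
structure IsWeakSolution {d : ℕ} (u : Td d → E d) (T : ℝ) (f : ℝ → Td d → ℝ)
    (f₀ fT : Td d → ℝ) : Prop where
  memLp : MemLp (Function.uncurry f) ∞ (spaceTime d T)
  memLp_zero : MemLp f₀ ∞ volume
  memLp_final : MemLp fT ∞ volume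
  weak : ∀ ψ : ℝ → Td d → ℝ, ContDiff ℝ ∞ (fun p : ℝ × E d => ψ p.1 (proj p.2)) →
    (∫ x, fT x * ψ T x) - (∫ x, f₀ x * ψ 0 x) =
      ∫ t in Set.Icc 0 T, ∫ x,
        f t x * (deriv (fun s => ψ s x) t + inner ℝ (u x) (torusGrad (ψ t) x))

/-- The space-time norm `‖f‖_{L_t^∞ L_x^∞}`. -/
def linfNorm {d : ℕ} (T : ℝ) (f : ℝ → Td d → ℝ) : ℝ :=
  (eLpNorm (Function.uncurry f) ∞ (spaceTime d T)).toReal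

/-- The square of the space-time norm `‖f‖_{L_t^2 L_x^2}`. -/
def l2NormSq {d : ℕ} (T : ℝ) (f : ℝ → Td d → ℝ) : ℝ :=
  ∫ t in Set.Icc 0 T, ∫ x, f t x ^ 2

/-- The standard mollifiers used for the regularisation. -/
structure IsMollifier {d : ℕ} (η : E d → ℝ) : Prop where
  smooth : ContDiff ℝ ∞ η
  nonneg : ∀ h, 0 ≤ η h
  even : ∀ h, η (-h) = η h
  support : ∀ h, 1 ≤ ‖h‖ → η h = 0
  pos : ∀ h, ‖h‖ ≤ 1 / 2 → 0 < η h
  integral : ∫ h, η h = 1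

/-- The rescaled kernel `k_r(h) = r^{-d} k(h/r)`. -/
def rescale {d : ℕ} (k : E d → ℝ) (r : ℝ) (h : E d) : ℝ :=
  (r ^ d)⁻¹ * k (r⁻¹ • h)

/-- Convolution `(f * k)(x) = ∫_{ℝ^d} f(x - h) k(h) dh` of a function on the torus, extended
periodically, with a kernel on `ℝ^d`. -/
def conv {d : ℕ} (f : Td d → ℝ) (k : E d → ℝ) (x : Td d) : ℝ :=
  ∫ h, f (x - proj h) * k h

/-- The periodisation `∑_{proj z = y} k(z)` of a kernel of compact support. -/
def periodise {d : ℕ} (k : E d → ℝ) (y : Td d) : ℝ :=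
  ∑' z : {z : E d // proj z = y}, k z

/-- The convolution `(∇u * k)(x)` of the matrix-valued measure `∇u = σ μ` on the torus with a
kernel `k` on `ℝ^d`. -/
def gradConv {d : ℕ} (μ : Measure (Td d)) (σ : Td d → Matrix (Fin d) (Fin d) ℝ)
    (k : E d → ℝ) (x : Td d) : Matrix (Fin d) (Fin d) ℝ :=
  Matrix.of fun i j => ∫ y, periodise k (x - y) * σ y i j ∂μ

/-- The matrix field `M̄ = (∇u * η_{4ε}) / |∇u * η_{4ε}|`, equal to `0` where the denominator
vanishes. -/
def matField {d : ℕ} (η : E d → ℝ) (μ : Measure (Td d))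
    (σ : Td d → Matrix (Fin d) (Fin d) ℝ) (ε : ℝ) (x : Td d) : Matrix (Fin d) (Fin d) ℝ :=
  (frob (gradConv μ σ (rescale η (4 * ε)) x))⁻¹ • gradConv μ σ (rescale η (4 * ε)) x

/-- Alberti's anisotropic mollifier `η^{Λ,M}(h) = Λ⁻¹ ∫_0^Λ η(exp(-l Mᵀ) h) dl`. -/
def alberti {d : ℕ} (η : E d → ℝ) (Λ : ℝ) (M : Matrix (Fin d) (Fin d) ℝ) (h : E d) : ℝ :=
  Λ⁻¹ * ∫ l in (0 : ℝ)..Λ, η (WithLp.toLp 2 (NormedSpace.exp (-(l • Mᵀ)) *ᵥ WithLp.ofLp h))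

/-- The contraction `a · A · b = ∑_{i,j} a_i A_{ij} b_j`. -/
def contract {d : ℕ} (a : E d) (A : Matrix (Fin d) (Fin d) ℝ) (b : E d) : ℝ :=
  ∑ i, ∑ j, a i * A i j * b j

/-! In the five terms below the localisation variable `x̄ ∈ ℝ^d` is written as `x̄ = x + z`,
so that `∫_{ℝ^d} F(x̄) η_ε(x̄ - x) dx̄` becomes `∫_{ℝ^d} F(x + z) η_ε(z) dz`. `M` is a matrix field
on the torus. -/

/-- The error from regularising the final datum. -/
def I1 {d : ℕ} (η : E d → ℝ) (M : Td d → Matrix (Fin d) (Fin d) ℝ) (Λ δ ε : ℝ)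
    (ρT φT : Td d → ℝ) : ℝ :=
  ∫ x, ∫ z : E d, ρT x *
    (φT x - conv φT (rescale (alberti η Λ (M (x + proj z))) δ) x) * rescale η ε z

/-- The regularised pairing at the initial time. -/
def I2 {d : ℕ} (η : E d → ℝ) (M : Td d → Matrix (Fin d) (Fin d) ℝ) (Λ δ ε : ℝ)
    (ρ₀ φ₀ : Td d → ℝ) : ℝ :=
  ∫ x, ∫ z : E d, ρ₀ x *
    conv φ₀ (rescale (alberti η Λ (M (x + proj z))) δ) x * rescale η ε z

/-- The transport error from the localisation. -/
def I3 {d : ℕ} (η : E d → ℝ) (M : Td d → Matrix (Fin d) (Fin d) ℝ) (Λ δ ε T : ℝ)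
    (u : Td d → E d) (ρ φ : ℝ → Td d → ℝ) : ℝ :=
  -∫ t in Set.Icc 0 T, ∫ x, ∫ z : E d, ρ t x *
    conv (φ t) (rescale (alberti η Λ (M (x + proj z))) δ) x *
      inner ℝ (u x) (gradient (rescale η ε) z)

/-- The first part of the commutator,
`∫∫∫∫∫ ρ(x,t) φ(x-δh,t) h·(∇u(x-sδh) - |∇u(x-sδh)| M(x̄))·∇η^{Λ,M(x̄)}(h) η_ε(x̄-x) ds dh dx̄ dx dt`,
where `∇u = σ μ` and `|∇u| = μ` are measures, integrated in the variable `y = x - sδh`. -/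
def I4 {d : ℕ} (η : E d → ℝ) (M : Td d → Matrix (Fin d) (Fin d) ℝ) (Λ δ ε T : ℝ)
    (μ : Measure (Td d)) (σ : Td d → Matrix (Fin d) (Fin d) ℝ) (ρ φ : ℝ → Td d → ℝ) : ℝ :=
  ∫ t in Set.Icc 0 T, ∫ s in Set.Icc (0 : ℝ) 1, ∫ h : E d, ∫ y,
    let x : Td d := y + proj ((s * δ) • h)
    (∫ z : E d, ρ t x * φ t (x - proj (δ • h)) *
      contract h (σ y - M (x + proj z)) (gradient (alberti η Λ (M (x + proj z))) h) *
        rescale η ε z) ∂μ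

/-- The second part of the commutator,
`∫∫∫∫∫ ρ(x,t) φ(x-δh,t) |∇u(x-sδh)| h·M(x̄)·∇η^{Λ,M(x̄)}(h) η_ε(x̄-x) ds dh dx̄ dx dt`,
where `|∇u| = μ` is a measure, integrated in the variable `y = x - sδh`. -/
def I5 {d : ℕ} (η : E d → ℝ) (M : Td d → Matrix (Fin d) (Fin d) ℝ) (Λ δ ε T : ℝ)
    (μ : Measure (Td d)) (ρ φ : ℝ → Td d → ℝ) : ℝ :=
  ∫ t in Set.Icc 0 T, ∫ s in Set.Icc (0 : ℝ) 1, ∫ h : E d, ∫ y,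
    let x : Td d := y + proj ((s * δ) • h)
    (∫ z : E d, ρ t x * φ t (x - proj (δ • h)) *
      contract h (M (x + proj z)) (gradient (alberti η Λ (M (x + proj z))) h) *
        rescale η ε z) ∂μ

end

end BVTransport

open BVTransport

/-! The identity is a doubling of variables. Neither `ρ` nor `φ` can be used as a test function for
the other, so the equation of `ρ` in `x` and that of `φ` in `y` are tested with `ζ(x) P(x - y)`,
where `P` is the periodised Alberti kernel with frozen matrix and `ζ` a cut-off around a centre
`x̄`. Time evolution produces `P u(x)·∇ζ`, which gives `I3`, and the commutator `ζ(x) (u(x) -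
u(y))·∇P(x - y)`. The matrix depends on the centre only, so it is never differentiated; afterwards
one integrates over the centre (`pairing_identity`, `transport_pairing`, `transport_identity`). The
increment of the `BV` field is then written as an integral of `∇u = σ μ` along the segment
(`IsBVWithGradient.increment`), and `σ = (σ - M̄) + M̄` splits the commutator into `I4 + I5`.

`I5`: the function `h·M·∇η^{Λ,M}(h)` is `-Λ⁻¹` times the integral over `l` of the derivative of
`η(exp(-l Mᵀ) h)`, so it telescopes to `Λ⁻¹ (η(h) - η(exp(-Λ Mᵀ) h))`. As `u` is divergence-free,
`M̄` has trace zero, the flow preserves volume and the `L¹` norm is at most `2/Λ`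
(`contract_gradient_alberti`, `det_exp_smul_of_trace_eq_zero`).

`I4`: since `|σ| = 1` and `|M̄| ≤ 1`, one has `|σ - M̄|² ≤ 2 - 2 σ : M̄`. Averaged with `η_{4ε}` the
right-hand side becomes `2 (‖∇u‖ - ‖∇u * η_{4ε}‖)`, because `M̄` is the direction of `∇u * η_{4ε}`;
Cauchy-Schwarz concludes (`IsBVWithGradient.integral_frob_sub_le`). The scale `4ε` dominates `η_ε`
shifted by at most `δ e^Λ ≤ ε` (`IsMollifier.exists_shift_bound`).

`I3`: `∇η_ε` has mean zero, so `φ * η_δ^{Λ,M̄}` may be replaced by its difference from `φ`, which an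
oscillation of `φ` at scale `2δe^Λ` controls. Hölder's inequality pairs `u` in `L^{d/(d-1)}`,
bounded by the Sobolev inequality for `BV` (`exists_sobolev_bv`), with the oscillation in `L^d`. As
`|φ| ≤ 1` and `d ≥ 2`, the `d`-th power is bounded by a square, and the mean square increment by the
`L²` norm lost under mollification (`IsMollifier.lintegral_increment_le`).

`I1` uses the Lipschitz bound of `φ_T` on the support of the kernel, of radius `δ e^Λ`. `I2` pairs
`ρ₀` with a function whose weak gradient is computed explicitly (`isWeakGradient_average`). All of
this is done for bounded Borel representatives, and the last part returns to almost-everywhere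
classes; as `μ` may be singular, this uses the average over the shift `h`. -/

namespace BVTransport

variable {d : ℕ}

/-! ### The covering projection -/

/-- The lattice point with integer coordinates `n`. -/
noncomputable def lat (n : Fin d → ℤ) : E d := WithLp.toLp 2 fun i => (n i : ℝ)

@[simp] lemma lat_apply (n : Fin d → ℤ) (i : Fin d) : lat n i = n i := rfl

/-- The fundamental cell `(0,1]^d`. -/
def cell (d : ℕ) : Set (E d) := {v | ∀ i, v i ∈ Set.Ioc (0 : ℝ) 1}

@[simp] lemma proj_zero : proj (0 : E d) = 0 := by
  funext i; simp [proj]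

lemma proj_add (v w : E d) : proj (v + w) = proj v + proj w := by
  funext i; simp [proj]

lemma proj_neg (v : E d) : proj (-v) = -proj v := by
  funext i; simp [proj]

lemma proj_sub (v w : E d) : proj (v - w) = proj v - proj w := by
  funext i; simp [proj]

@[simp] lemma proj_lat (n : Fin d → ℤ) : proj (lat n) = 0 := by
  funext i
  simp only [proj, lat_apply, Pi.zero_apply]
  rw [AddCircle.coe_eq_zero_iff]
  exact ⟨n i, by simp⟩

lemma proj_add_lat (v : E d) (n : Fin d → ℤ) : proj (v + lat n) = proj v := by
  simp [proj_add]

lemma exists_lat_of_proj_eq {v w : E d} (h : proj v = proj w) : ∃ n, v = w + lat n := by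
  have : ∀ i, ∃ n : ℤ, v i - w i = n := by
    intro i
    have hi : ((v i : ℝ) : UnitAddCircle) = (w i : ℝ) := congrFun h i
    have h0 : ((v i - w i : ℝ) : UnitAddCircle) = 0 := by
      rw [AddCircle.coe_sub, hi, sub_self]
    obtain ⟨n, hn⟩ := (AddCircle.coe_eq_zero_iff (1 : ℝ)).1 h0
    exact ⟨n, by simpa using hn.symm⟩
  choose n hn using this
  refine ⟨n, ?_⟩
  ext i
  simp [← hn i]

@[fun_prop] lemma continuous_proj : Continuous (proj : E d → Td d) := by
  refine continuous_pi fun i => ?_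
  exact (AddCircle.continuous_mk' (1 : ℝ)).comp (by fun_prop)

@[fun_prop] lemma measurable_proj : Measurable (proj : E d → Td d) := continuous_proj.measurable

lemma exists_mem_cell (x : Td d) : ∃ v ∈ cell d, proj v = x := by
  have : ∀ i, ∃ a : ℝ, a ∈ Set.Ioc (0 : ℝ) 1 ∧ (a : UnitAddCircle) = x i := by
    intro i
    refine ⟨(AddCircle.equivIoc 1 0 (x i)).1, ?_, ?_⟩
    · simpa using (AddCircle.equivIoc 1 0 (x i)).2
    · exact (AddCircle.equivIoc 1 0).symm_apply_apply (x i)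
  choose a ha hx using this
  exact ⟨WithLp.toLp 2 a, ha, funext hx⟩

lemma proj_surjective : Function.Surjective (proj : E d → Td d) := fun x =>
  let ⟨v, _, hv⟩ := exists_mem_cell x
  ⟨v, hv⟩

lemma measurableSet_cell : MeasurableSet (cell d) := by
  have : cell d = ⋂ i, (fun v : E d => v i) ⁻¹' Set.Ioc (0 : ℝ) 1 := by
    ext v; simp [cell]
  rw [this]
  refine MeasurableSet.iInter fun i => measurableSet_Ioc.preimage ?_
  fun_prop

/-- The bound `d` is cruder than `√d` but enough wherever only finiteness of a set of cells matters.
-/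
lemma norm_le_of_mem_cell {v : E d} (hv : v ∈ cell d) : ‖v‖ ≤ d := by
  rcases Nat.eq_zero_or_pos d with rfl | hd
  · simp [EuclideanSpace.norm_eq]
  rw [EuclideanSpace.norm_eq]
  refine Real.sqrt_le_iff.2 ⟨by positivity, ?_⟩
  calc ∑ i, ‖v i‖ ^ 2 ≤ ∑ _i : Fin d, (1 : ℝ) := by
        refine Finset.sum_le_sum fun i _ => ?_
        have := hv i
        rw [Real.norm_eq_abs, sq_abs]
        nlinarith [this.1, this.2]
    _ = d := by simp
    _ ≤ (d : ℝ) ^ 2 := by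
        have : (1 : ℝ) ≤ d := by exact_mod_cast hd
        nlinarith

/-- Each circle is the interval `(0,1]` with its Lebesgue measure; products of measure-preserving
maps are measure-preserving, and passing from tuples to `E d` preserves volume. -/
lemma measurePreserving_proj :
    MeasurePreserving (proj : E d → Td d) (volume.restrict (cell d)) volume := by
  have h1 : MeasurePreserving (fun (v : Fin d → ℝ) (i : Fin d) => ((v i : ℝ) : UnitAddCircle))
      (Measure.pi fun _ => volume.restrict (Set.Ioc (0 : ℝ) (0 + 1))) volume :=
    measurePreserving_pi _ _ (fun _ => AddCircle.measurePreserving_mk 1 0)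
  rw [← Measure.restrict_pi_pi] at h1
  have h2 := (PiLp.volume_preserving_ofLp (Fin d)).restrict_preimage
    (s := Set.univ.pi fun _ : Fin d => Set.Ioc (0 : ℝ) (0 + 1))
    (MeasurableSet.univ_pi fun _ => measurableSet_Ioc)
  have h3 := h1.comp h2
  have hc : (WithLp.ofLp : E d → _) ⁻¹' (Set.univ.pi fun _ : Fin d => Set.Ioc (0 : ℝ) (0 + 1)) =
      cell d := by
    ext v; simp [cell]
  rw [hc] at h3
  exact h3

lemma proj_injOn_cell : Set.InjOn (proj : E d → Td d) (cell d) := by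
  intro v hv w hw h
  obtain ⟨n, rfl⟩ := exists_lat_of_proj_eq h
  have : n = 0 := by
    funext i
    have h1 := hv i
    have h2 := hw i
    simp only [PiLp.add_apply, lat_apply] at h1
    have h3 : (n i : ℝ) < 1 := by linarith [h1.2, h2.1]
    have h4 : (-1 : ℝ) < n i := by linarith [h1.1, h2.2]
    have h5 : n i < 1 := by exact_mod_cast h3
    have h6 : -1 < n i := by exact_mod_cast h4
    simp; omega
  subst this
  ext i; simp

/-- The translate of the fundamental cell by a lattice point. -/
def cellAt (n : Fin d → ℤ) : Set (E d) := (fun v => v - lat n) ⁻¹' cell d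

lemma measurableSet_cellAt (n : Fin d → ℤ) : MeasurableSet (cellAt n) :=
  measurableSet_cell.preimage (by fun_prop)

lemma iUnion_cellAt : ⋃ n, cellAt (d := d) n = Set.univ := by
  refine Set.eq_univ_of_forall fun v => ?_
  obtain ⟨w, hw, h⟩ := exists_mem_cell (proj v)
  obtain ⟨n, hn⟩ := exists_lat_of_proj_eq h.symm
  refine Set.mem_iUnion.2 ⟨n, ?_⟩
  simpa [cellAt, hn] using hw

lemma pairwise_disjoint_cellAt : Pairwise (Function.onFun Disjoint (cellAt (d := d))) := by
  intro m n hmn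
  refine Set.disjoint_left.2 fun v hm hn => hmn ?_
  have h := proj_injOn_cell hm hn (by simp [proj_sub])
  funext i
  have := congrArg (fun w : E d => w i) h
  simp at this
  exact this

lemma measurePreserving_sub_lat (n : Fin d → ℤ) :
    MeasurePreserving (fun v : E d => v - lat n) (volume.restrict (cellAt n))
      (volume.restrict (cell d)) :=
  (measurePreserving_sub_right volume (lat n)).restrict_preimage measurableSet_cell

lemma measurePreserving_proj_cellAt (n : Fin d → ℤ) :
    MeasurePreserving (proj : E d → Td d) (volume.restrict (cellAt n)) volume := by
  have h := measurePreserving_proj.comp (measurePreserving_sub_lat n)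
  have : (proj ∘ fun v : E d => v - lat n) = proj := by
    funext v; simp [proj_sub]
  rwa [this] at h

/-- The preimage of a null set is null in each of the countably many cells. -/
lemma quasiMeasurePreserving_proj :
    Measure.QuasiMeasurePreserving (proj : E d → Td d) volume volume := by
  refine ⟨measurable_proj, ?_⟩
  refine Measure.AbsolutelyContinuous.mk fun s hs h0 => ?_
  rw [Measure.map_apply measurable_proj hs]
  have : proj ⁻¹' s = ⋃ n, (proj ⁻¹' s ∩ cellAt (d := d) n) := by
    rw [← Set.inter_iUnion, iUnion_cellAt, Set.inter_univ]
  rw [this]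
  refine measure_iUnion_null fun n => ?_
  have h1 := (measurePreserving_proj_cellAt n).measure_preimage hs.nullMeasurableSet
  rw [Measure.restrict_apply (measurable_proj hs)] at h1
  rw [h1, h0]

/-- A finite set of lattice points containing all those of norm at most `R`. -/
noncomputable def latBall (d : ℕ) (R : ℝ) : Finset (Fin d → ℤ) :=
  Fintype.piFinset fun _ => Finset.Icc (-⌈R⌉) ⌈R⌉

lemma mem_latBall {R : ℝ} {n : Fin d → ℤ} (h : ‖lat n‖ ≤ R) : n ∈ latBall d R := by
  refine Fintype.mem_piFinset.2 fun i => ?_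
  have h1 : |(n i : ℝ)| ≤ R := by
    have := PiLp.norm_apply_le (lat n) i
    simpa using this.trans h
  have h2 : |(n i : ℝ)| ≤ ⌈R⌉ := h1.trans (Int.le_ceil R)
  have h3 := abs_le.1 h2
  rw [Finset.mem_Icc]
  exact ⟨by exact_mod_cast h3.1, by exact_mod_cast h3.2⟩

lemma closedBall_subset_iUnion_cellAt (R : ℝ) :
    Metric.closedBall (0 : E d) R ⊆ ⋃ n ∈ latBall d (R + d), cellAt n := by
  intro v hv
  have : v ∈ ⋃ n, cellAt (d := d) n := by rw [iUnion_cellAt]; trivial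
  obtain ⟨n, hn⟩ := Set.mem_iUnion.1 this
  refine Set.mem_iUnion₂.2 ⟨n, mem_latBall ?_, hn⟩
  have h1 : ‖v - lat n‖ ≤ d := norm_le_of_mem_cell hn
  have h2 : ‖v‖ ≤ R := by simpa using hv
  calc ‖lat n‖ = ‖v - (v - lat n)‖ := by simp
    _ ≤ ‖v‖ + ‖v - lat n‖ := norm_sub_le _ _
    _ ≤ R + d := add_le_add h2 h1

variable {F : Type*} [NormedAddCommGroup F]

lemma locallyIntegrable_comp_proj {f : Td d → F} (hf : Integrable f) :
    LocallyIntegrable (fun v : E d => f (proj v)) := by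
  refine (locallyIntegrable_iff).2 fun K hK => ?_
  obtain ⟨R, hR⟩ := hK.isBounded.subset_closedBall 0
  refine IntegrableOn.mono_set ?_ (hR.trans (closedBall_subset_iUnion_cellAt R))
  refine (integrableOn_finset_iUnion).2 fun n _ => ?_
  exact (measurePreserving_proj_cellAt n).integrable_comp_of_integrable hf

lemma integral_torus_eq_setIntegral_cell [NormedSpace ℝ F] {f : Td d → F} (hf : AEStronglyMeasurable f) :
    ∫ x, f x = ∫ v in cell d, f (proj v) := by
  have h := measurePreserving_proj (d := d)
  rw [← h.map_eq] at hf
  conv_lhs => rw [← h.map_eq]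
  exact integral_map h.measurable.aemeasurable hf

lemma isOpenQuotientMap_proj : IsOpenQuotientMap (proj : E d → Td d) := by
  have h1 : IsOpenQuotientMap
      (Pi.map fun (_ : Fin d) (a : ℝ) => (a : UnitAddCircle)) :=
    IsOpenQuotientMap.piMap fun _ => QuotientAddGroup.isOpenQuotientMap_mk
  exact h1.comp (PiLp.homeomorph 2 (fun _ : Fin d => ℝ)).isOpenQuotientMap

lemma continuous_torus_iff {X : Type*} [TopologicalSpace X] {ψ : Td d → X} :
    Continuous ψ ↔ Continuous fun v : E d => ψ (proj v) :=
  isOpenQuotientMap_proj.isQuotientMap.continuous_iff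

lemma TorusSmooth.continuous {ψ : Td d → ℝ} (hψ : TorusSmooth ψ) : Continuous ψ :=
  continuous_torus_iff.2 (ContDiff.continuous hψ)

/-! ### Kernels and their periodisation -/

/-- The kernel `k` vanishes outside of the closed ball of radius `R`. -/
def SuppBall (k : E d → F) (R : ℝ) : Prop := ∀ h, R < ‖h‖ → k h = 0

lemma SuppBall.hasCompactSupport {k : E d → F} {R : ℝ} (h : SuppBall k R) :
    HasCompactSupport k := by
  refine HasCompactSupport.intro (isCompact_closedBall (0 : E d) R) fun x hx => h x ?_
  simpa using hx

/-- The fibre of `proj` over `proj v` is the coset `v + ℤ^d`. -/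
noncomputable def fibreEquiv (v : E d) : (Fin d → ℤ) ≃ {z : E d // proj z = proj v} :=
  Equiv.ofBijective (fun n => ⟨v + lat n, proj_add_lat v n⟩) <| by
    constructor
    · intro m n h
      have h1 : v + lat m = v + lat n := congrArg Subtype.val h
      funext i
      have := congrArg (fun w : E d => w i) (add_left_cancel h1)
      simpa using this
    · rintro ⟨z, hz⟩
      obtain ⟨n, hn⟩ := exists_lat_of_proj_eq hz
      exact ⟨n, Subtype.ext hn.symm⟩

lemma periodise_proj (k : E d → ℝ) (v : E d) :
    periodise k (proj v) = ∑' n : Fin d → ℤ, k (v + lat n) :=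
  ((fibreEquiv v).tsum_eq (fun z : {z : E d // proj z = proj v} => k z)).symm

lemma eq_zero_of_notMem_latBall {k : E d → F} {R r : ℝ} (hk : SuppBall k R) {v : E d}
    (hv : ‖v‖ ≤ r) {n : Fin d → ℤ} (hn : n ∉ latBall d (R + r)) : k (v + lat n) = 0 := by
  refine hk _ (lt_of_not_ge fun h => hn (mem_latBall ?_))
  calc ‖lat n‖ = ‖(v + lat n) - v‖ := by simp
    _ ≤ ‖v + lat n‖ + ‖v‖ := norm_sub_le _ _
    _ ≤ R + r := add_le_add h hv

lemma periodise_proj_eq_sum {k : E d → ℝ} {R r : ℝ} (hk : SuppBall k R) {v : E d}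
    (hv : ‖v‖ ≤ r) : periodise k (proj v) = ∑ n ∈ latBall d (R + r), k (v + lat n) := by
  rw [periodise_proj]
  exact tsum_eq_sum fun n hn => eq_zero_of_notMem_latBall hk hv hn

lemma SuppBall.integrable_mul {k : E d → ℝ} {R : ℝ} (hk : SuppBall k R) (hc : Continuous k)
    {f : Td d → ℝ} (hf : Integrable f) : Integrable fun h : E d => f (proj h) * k h :=
  (locallyIntegrable_comp_proj hf).integrable_smul_right_of_hasCompactSupport hc
    hk.hasCompactSupport

/-- Near `v` the lattice sum runs over one fixed finite set, so continuity, smoothness and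
differentiation of a periodisation reduce to finite sums. -/
lemma exists_periodise_proj_eq_sum_nhds {k : E d → ℝ} {R : ℝ} (hk : SuppBall k R) (v : E d) :
    ∀ᶠ w in 𝓝 v, periodise k (proj w) = ∑ n ∈ latBall d (R + (‖v‖ + 1)), k (w + lat n) := by
  filter_upwards [Metric.ball_mem_nhds v one_pos] with w hw
  refine periodise_proj_eq_sum hk ?_
  have h1 : ‖w - v‖ < 1 := by simpa [dist_eq_norm] using hw
  calc ‖w‖ = ‖v + (w - v)‖ := by simp
    _ ≤ ‖v‖ + ‖w - v‖ := norm_add_le _ _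
    _ ≤ ‖v‖ + 1 := by gcongr

lemma SuppBall.continuous_periodise {k : E d → ℝ} {R : ℝ} (hk : SuppBall k R)
    (hc : Continuous k) : Continuous (periodise k) := by
  refine continuous_torus_iff.2 (continuous_iff_continuousAt.2 fun v => ?_)
  refine ContinuousAt.congr ?_ (Filter.EventuallyEq.symm (exists_periodise_proj_eq_sum_nhds hk v))
  fun_prop

lemma SuppBall.torusSmooth_periodise {k : E d → ℝ} {R : ℝ} (hk : SuppBall k R)
    (hc : ContDiff ℝ ∞ k) : TorusSmooth (periodise k) := by
  refine contDiff_iff_contDiffAt.2 fun v => ?_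
  refine ContDiffAt.congr_of_eventuallyEq ?_ (exists_periodise_proj_eq_sum_nhds hk v)
  refine ContDiff.contDiffAt ?_
  fun_prop

/-- Unfolding of an integral against a periodised kernel. -/
lemma integral_mul_periodise {k : E d → ℝ} {R : ℝ} (hk : SuppBall k R) (hc : Continuous k)
    {f : Td d → ℝ} (hf : Integrable f) :
    ∫ y, f y * periodise k y = ∫ h : E d, f (proj h) * k h := by
  have hint := hk.integrable_mul hc hf
  have h1 : ∫ h : E d, f (proj h) * k h =
      ∑' n : Fin d → ℤ, ∫ v in cell d, f (proj v) * k (v + lat n) := by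
    rw [← setIntegral_univ, ← iUnion_cellAt (d := d),
      integral_iUnion measurableSet_cellAt pairwise_disjoint_cellAt hint.integrableOn]
    congr 1; funext n
    have := (measurePreserving_sub_lat n).integral_comp
      ((MeasurableEquiv.subRight (lat n)).measurableEmbedding)
      (fun v : E d => f (proj v) * k (v + lat n))
    rw [← this]
    simp [proj_sub]
  have h2 : ∀ n : Fin d → ℤ, IntegrableOn (fun v : E d => f (proj v) * k (v + lat n)) (cell d) := by
    intro n
    have := (measurePreserving_add_right volume (lat n)).integrable_comp_of_integrable hint
    simpa [Function.comp_def, proj_add] using this.integrableOn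
  have h3 : ∀ v ∈ cell d, periodise k (proj v) = ∑ n ∈ latBall d (R + d), k (v + lat n) :=
    fun v hv => periodise_proj_eq_sum hk (norm_le_of_mem_cell hv)
  -- A translate of the cell by a distant lattice point misses the support, so the sum over all
  -- cells is the finite sum that defines the periodisation on the cell.
  have hz : ∀ n ∉ latBall d (R + d), ∫ v in cell d, f (proj v) * k (v + lat n) = 0 := by
    intro n hn
    rw [setIntegral_congr_fun measurableSet_cell (g := fun _ => (0 : ℝ))]
    · simp
    · intro v hv
      simp [eq_zero_of_notMem_latBall hk (norm_le_of_mem_cell hv) hn]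
  have h4 : ∫ v in cell d, f (proj v) * periodise k (proj v) = ∫ h : E d, f (proj h) * k h := by
    rw [h1, tsum_eq_sum hz, ← integral_finsetSum _ fun n _ => h2 n]
    refine setIntegral_congr_fun measurableSet_cell fun v hv => ?_
    simp only [h3 v hv, Finset.mul_sum]
  rw [← h4]
  have hm : AEStronglyMeasurable (fun y => f y * periodise k y) :=
    hf.aestronglyMeasurable.mul (hk.continuous_periodise hc).aestronglyMeasurable
  exact integral_torus_eq_setIntegral_cell hm

end BVTransport

namespace BVTransport

variable {d : ℕ}

/-- Negation invariance of the circle and torus measures is what permits the substitution `y ↦ x -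
y` in convolutions. -/
instance : (volume : Measure UnitAddCircle).IsNegInvariant :=
  Measure.IsAddHaarMeasure.isNegInvariant_of_regular _

instance : (volume : Measure (Td d)).IsNegInvariant :=
  Measure.pi.isNegInvariant _

/-! ### Calculus on the torus -/

/-- The partial derivative `∂_i k`. -/
noncomputable def pd (i : Fin d) (k : E d → ℝ) (h : E d) : ℝ :=
  fderiv ℝ k h (EuclideanSpace.single i 1)

lemma inner_gradient (a : E d) (k : E d → ℝ) (h : E d) :
    inner ℝ a (gradient k h) = fderiv ℝ k h a := by
  rw [real_inner_comm, gradient, InnerProductSpace.toDual_symm_apply]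

lemma gradient_apply (k : E d → ℝ) (h : E d) (i : Fin d) : gradient k h i = pd i k h := by
  rw [pd, ← inner_gradient, EuclideanSpace.inner_single_left]
  simp

lemma fderiv_eq_sum_pd (k : E d → ℝ) (h a : E d) : fderiv ℝ k h a = ∑ i, a i * pd i k h := by
  rw [← inner_gradient, PiLp.inner_apply]
  simp [gradient_apply, mul_comm]

lemma norm_gradient (k : E d → ℝ) (h : E d) : ‖gradient k h‖ = ‖fderiv ℝ k h‖ := by
  simp [gradient]

lemma abs_pd_le (i : Fin d) (k : E d → ℝ) (h : E d) : |pd i k h| ≤ ‖fderiv ℝ k h‖ := by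
  have := (fderiv ℝ k h).le_opNorm (EuclideanSpace.single i 1)
  simpa [pd] using this

lemma contDiff_pd {k : E d → ℝ} (hk : ContDiff ℝ ∞ k) (i : Fin d) : ContDiff ℝ ∞ (pd i k) := by
  have : ContDiff ℝ ∞ (fderiv ℝ k) := hk.fderiv_right (by simp)
  exact this.clm_apply contDiff_const

lemma pd_comm {k : E d → ℝ} (hk : ContDiff ℝ ∞ k) (i j : Fin d) :
    pd i (pd j k) = pd j (pd i k) := by
  have hd : Differentiable ℝ (fderiv ℝ k) :=
    (hk.fderiv_right (m := ∞) (by simp)).differentiable (by simp)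
  have key : ∀ a b : E d, ∀ h, fderiv ℝ (fun h => fderiv ℝ k h a) h b =
      fderiv ℝ (fderiv ℝ k) h b a := by
    intro a b h
    rw [fderiv_clm_apply (hd h) (differentiableAt_const a)]
    simp
  funext h
  have hs : IsSymmSndFDerivAt ℝ k h :=
    hk.contDiffAt.isSymmSndFDerivAt (by simpa using ENat.LEInfty.out)
  unfold pd
  rw [key, key]
  exact hs _ _

lemma SuppBall.fderiv {k : E d → ℝ} {R : ℝ} (hk : SuppBall k R) : SuppBall (fderiv ℝ k) R := by
  intro h hh
  have : k =ᶠ[𝓝 h] fun _ => 0 := by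
    filter_upwards [(isOpen_lt continuous_const continuous_norm).mem_nhds hh] with w hw
    exact hk w hw
  rw [this.fderiv_eq]; simp

lemma SuppBall.pd {k : E d → ℝ} {R : ℝ} (hk : SuppBall k R) (i : Fin d) :
    SuppBall (pd i k) R := by
  intro h hh
  simp [BVTransport.pd, hk.fderiv h hh]

lemma TorusSmooth.translate {ψ : Td d → ℝ} (hψ : TorusSmooth ψ) (x : Td d) :
    ContDiff ℝ ∞ fun v : E d => ψ (x + proj v) := by
  obtain ⟨w, rfl⟩ := proj_surjective x
  have : (fun v : E d => ψ (proj w + proj v)) = (fun v : E d => ψ (proj v)) ∘ fun v => w + v := by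
    funext v; simp [proj_add]
  rw [this]
  exact ContDiff.comp hψ (by fun_prop)

lemma inner_torusGrad (a : E d) (ψ : Td d → ℝ) (x : Td d) :
    inner ℝ a (torusGrad ψ x) = fderiv ℝ (fun v : E d => ψ (x + proj v)) 0 a :=
  inner_gradient _ _ _

lemma torusGrad_apply (ψ : Td d → ℝ) (x : Td d) (i : Fin d) :
    torusGrad ψ x i = pd i (fun v : E d => ψ (x + proj v)) 0 :=
  gradient_apply _ _ _

lemma inner_torusGrad_eq_sum (a : E d) (ψ : Td d → ℝ) (x : Td d) :
    inner ℝ a (torusGrad ψ x) = ∑ i, a i * torusGrad ψ x i := by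
  rw [PiLp.inner_apply]; simp [mul_comm]

/-- Turns the gradient on the torus, defined through a translate at the origin, into an ordinary
gradient of the lifted function at an arbitrary point. -/
lemma torusGrad_proj_add (ψ : Td d → ℝ) (x : Td d) (w : E d) :
    torusGrad ψ (x + proj w) = gradient (fun v : E d => ψ (x + proj v)) w := by
  unfold torusGrad gradient
  congr 1
  have : (fun v : E d => ψ (x + proj w + proj v)) =
      fun v => (fun v : E d => ψ (x + proj v)) (v + w) := by
    funext v; simp only [proj_add]; congr 1; abel
  rw [this]
  exact (fderiv_comp_add_right (f := fun v : E d => ψ (x + proj v)) w).trans (by rw [zero_add])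

lemma TorusSmooth.torusGrad {ψ : Td d → ℝ} (hψ : TorusSmooth ψ) (i : Fin d) :
    TorusSmooth fun x => torusGrad ψ x i := by
  have h : (fun v : E d => BVTransport.torusGrad ψ (proj v) i) =
      BVTransport.pd i fun v : E d => ψ (proj v) := by
    funext v
    have := torusGrad_proj_add ψ 0 v
    simp only [zero_add] at this
    rw [this, gradient_apply]
  unfold TorusSmooth
  rw [h]
  exact contDiff_pd hψ i

lemma TorusSmooth.continuous_torusGrad {ψ : Td d → ℝ} (hψ : TorusSmooth ψ) :
    Continuous (BVTransport.torusGrad ψ) := by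
  have : Continuous fun x => WithLp.ofLp (BVTransport.torusGrad ψ x) :=
    continuous_pi fun i => (hψ.torusGrad i).continuous
  exact (PiLp.continuous_toLp 2 _).comp this

lemma TorusSmooth.mul {ψ χ : Td d → ℝ} (hψ : TorusSmooth ψ) (hχ : TorusSmooth χ) :
    TorusSmooth fun x => ψ x * χ x := ContDiff.mul hψ hχ

lemma TorusSmooth.sum_const_mul {ι : Type*} (s : Finset ι) (a : ι → ℝ) {ψ : ι → Td d → ℝ}
    (hψ : ∀ i, TorusSmooth (ψ i)) : TorusSmooth fun x => ∑ i ∈ s, a i * ψ i x :=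
  ContDiff.sum fun i _ => contDiff_const.mul (hψ i)

lemma TorusSmooth.comp_sub {ψ : Td d → ℝ} (hψ : TorusSmooth ψ) (x : Td d) :
    TorusSmooth fun y => ψ (x - y) := by
  have := (hψ.translate x).comp (contDiff_neg (𝕜 := ℝ) (F := E d))
  simpa [TorusSmooth, Function.comp_def, proj_neg, sub_eq_add_neg] using this

lemma TorusSmooth.comp_sub_right {ψ : Td d → ℝ} (hψ : TorusSmooth ψ) (y : Td d) :
    TorusSmooth fun x => ψ (x - y) := by
  have := hψ.translate (-y)
  unfold TorusSmooth
  simpa [sub_eq_neg_add] using this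

lemma torusGrad_mul {ψ χ : Td d → ℝ} (hψ : TorusSmooth ψ) (hχ : TorusSmooth χ) (x : Td d)
    (i : Fin d) : torusGrad (fun x => ψ x * χ x) x i =
      torusGrad ψ x i * χ x + ψ x * torusGrad χ x i := by
  simp only [torusGrad_apply, pd]
  rw [fderiv_fun_mul ((hψ.translate x).differentiable (by simp) 0)
    ((hχ.translate x).differentiable (by simp) 0)]
  simp; ring

lemma torusGrad_sum_const_mul {ι : Type*} (s : Finset ι) (a : ι → ℝ) {ψ : ι → Td d → ℝ}
    (hψ : ∀ i, TorusSmooth (ψ i)) (x : Td d) (j : Fin d) :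
    torusGrad (fun x => ∑ i ∈ s, a i * ψ i x) x j = ∑ i ∈ s, a i * torusGrad (ψ i) x j := by
  simp only [torusGrad_apply, pd]
  have hd : ∀ i, DifferentiableAt ℝ (fun v : E d => ψ i (x + proj v)) 0 := fun i =>
    ((hψ i).translate x).differentiable (by simp) 0
  rw [fderiv_fun_sum fun i _ => (hd i).const_mul (a i)]
  simp only [_root_.sum_apply]
  refine Finset.sum_congr rfl fun i _ => ?_
  rw [fderiv_const_mul (hd i)]
  simp

lemma torusGrad_comp_sub (ψ : Td d → ℝ) (x y : Td d) (i : Fin d) :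
    torusGrad (fun y => ψ (x - y)) y i = -torusGrad ψ (x - y) i := by
  simp only [torusGrad_apply, pd]
  have : (fun v : E d => ψ (x - (y + proj v))) =
      fun v => (fun v : E d => ψ (x - y + proj v)) (-v) := by
    funext v; simp only [proj_neg]; congr 1; abel
  have h1 := fderiv_comp_smul (𝕜 := ℝ) (-1 : ℝ) (f := fun v : E d => ψ (x - y + proj v)) (x := 0)
  simp only [neg_smul, one_smul, smul_zero] at h1
  rw [this, h1]
  simp

lemma torusGrad_comp_sub_right (ψ : Td d → ℝ) (x y : Td d) :
    torusGrad (fun x => ψ (x - y)) x = torusGrad ψ (x - y) := by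
  unfold torusGrad
  congr 1; funext v; abel_nf

lemma torusGrad_periodise {k : E d → ℝ} {R : ℝ} (hk : SuppBall k R) (hc : ContDiff ℝ ∞ k)
    (y : Td d) (i : Fin d) : torusGrad (periodise k) y i = periodise (pd i k) y := by
  obtain ⟨v, rfl⟩ := proj_surjective y
  have h0 := torusGrad_proj_add (periodise k) 0 v
  simp only [zero_add] at h0
  rw [h0, gradient_apply, pd,
    Filter.EventuallyEq.fderiv_eq (exists_periodise_proj_eq_sum_nhds hk v),
    periodise_proj_eq_sum (hk.pd i) (by linarith : ‖v‖ ≤ ‖v‖ + 1)]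
  have hd : Differentiable ℝ k := hc.differentiable (by simp)
  rw [fderiv_fun_sum fun n _ => by fun_prop]
  simp only [_root_.sum_apply]
  refine Finset.sum_congr rfl fun n _ => ?_
  rw [fderiv_comp_add_right]; rfl

lemma TorusSmooth.hasDerivAt_line {ψ : Td d → ℝ} (hψ : TorusSmooth ψ) (x : Td d) (a : E d)
    (s : ℝ) : HasDerivAt (fun s : ℝ => ψ (x + proj (s • a)))
      (inner ℝ a (BVTransport.torusGrad ψ (x + proj (s • a)))) s := by
  rw [torusGrad_proj_add, inner_gradient]
  have h1 : HasDerivAt (fun s : ℝ => s • a) a s := by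
    simpa using (hasDerivAt_id s).smul_const a
  exact ((hψ.translate x).differentiable (by simp) (s • a)).hasFDerivAt.comp_hasDerivAt s h1

lemma TorusSmooth.sub_eq_integral {ψ : Td d → ℝ} (hψ : TorusSmooth ψ) (x : Td d) (a : E d) :
    ψ (x + proj a) - ψ x =
      ∫ s in Set.Icc (0 : ℝ) 1, inner ℝ a (BVTransport.torusGrad ψ (x + proj (s • a))) := by
  rw [integral_Icc_eq_integral_Ioc, ← intervalIntegral.integral_of_le zero_le_one]
  have := intervalIntegral.integral_eq_sub_of_hasDerivAt (a := 0) (b := 1)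
    (fun s _ => hψ.hasDerivAt_line x a s) (Continuous.intervalIntegrable (by
      have := hψ.continuous_torusGrad; fun_prop) _ _)
  rw [this]; simp

lemma Continuous.integrable_torus {F : Type*} [NormedAddCommGroup F] {ψ : Td d → F}
    (hψ : Continuous ψ) (μ : Measure (Td d)) [IsFiniteMeasure μ] : Integrable ψ μ :=
  hψ.integrable_of_hasCompactSupport (HasCompactSupport.of_compactSpace ψ)

lemma Continuous.exists_bound_torus {F : Type*} [NormedAddCommGroup F] {ψ : Td d → F}
    (hψ : Continuous ψ) : ∃ C, 0 ≤ C ∧ ∀ x, ‖ψ x‖ ≤ C := by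
  obtain ⟨C, hC⟩ := hψ.bounded_above_of_compact_support (HasCompactSupport.of_compactSpace ψ)
  exact ⟨C, (norm_nonneg _).trans (hC 0), hC⟩

/-- Integrals of derivatives vanish on the torus. -/
lemma TorusSmooth.integral_inner_torusGrad {ψ : Td d → ℝ} (hψ : TorusSmooth ψ) (a : E d) :
    ∫ x, inner ℝ a (BVTransport.torusGrad ψ x) = 0 := by
  have hc : Continuous fun p : Td d × ℝ =>
      inner ℝ a (BVTransport.torusGrad ψ (p.1 + proj (p.2 • a))) := by
    have := hψ.continuous_torusGrad; fun_prop
  -- The mean of `ψ(x + a) - ψ(x)` vanishes by translation invariance; by Fubini it is also the mean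
  -- of the derivative along `a`.
  have h1 : ∫ x, ∫ s in Set.Icc (0 : ℝ) 1,
      inner ℝ a (BVTransport.torusGrad ψ (x + proj (s • a))) = 0 := by
    simp_rw [← hψ.sub_eq_integral]
    rw [integral_sub, integral_add_right_eq_self, sub_self]
    · exact Continuous.integrable_torus (hψ.continuous.comp (by fun_prop)) _
    · exact Continuous.integrable_torus hψ.continuous _
  rw [integral_integral_swap] at h1
  · have h2 : ∀ s : ℝ, ∫ x, inner ℝ a (BVTransport.torusGrad ψ (x + proj (s • a))) =
        ∫ x, inner ℝ a (BVTransport.torusGrad ψ x) := fun s =>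
      integral_add_right_eq_self (fun x => inner ℝ a (BVTransport.torusGrad ψ x)) _
    simpa [h2] using h1
  · obtain ⟨C, _, hC⟩ := Continuous.exists_bound_torus
      (ψ := fun x => inner ℝ a (BVTransport.torusGrad ψ x))
      (by have := hψ.continuous_torusGrad; fun_prop)
    exact Integrable.of_bound hc.aestronglyMeasurable C (Filter.Eventually.of_forall fun p => hC _)

lemma TorusSmooth.integral_torusGrad {ψ : Td d → ℝ} (hψ : TorusSmooth ψ) (i : Fin d) :
    ∫ x, BVTransport.torusGrad ψ x i = 0 := by
  have := hψ.integral_inner_torusGrad (EuclideanSpace.single i 1)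
  simpa [EuclideanSpace.inner_single_left] using this

/-! ### Convolutions with smooth kernels -/

/-- Lifted to `ℝ^d` this is an ordinary convolution with a locally integrable function, so the known
smoothness and convergence results apply. -/
lemma conv_proj (f : Td d → ℝ) (k : E d → ℝ) (v : E d) :
    conv f k (proj v) = convolution k (fun w => f (proj w)) (ContinuousLinearMap.lsmul ℝ ℝ)
      volume v := by
  simp only [conv, convolution, ContinuousLinearMap.lsmul_apply, smul_eq_mul]
  refine integral_congr_ae (Filter.Eventually.of_forall fun h => ?_)
  simp only [proj_sub]; ring

lemma SuppBall.torusSmooth_conv {k : E d → ℝ} {R : ℝ} (hk : SuppBall k R) (hc : ContDiff ℝ ∞ k)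
    {f : Td d → ℝ} (hf : Integrable f) : TorusSmooth (conv f k) := by
  unfold TorusSmooth
  simp_rw [conv_proj]
  exact hk.hasCompactSupport.contDiff_convolution_left _ hc (locallyIntegrable_comp_proj hf)

lemma conv_eq_integral_periodise {k : E d → ℝ} {R : ℝ} (hk : SuppBall k R) (hc : Continuous k)
    {f : Td d → ℝ} (hf : Integrable f) (x : Td d) :
    conv f k x = ∫ y, f y * periodise k (x - y) := by
  rw [conv, ← integral_mul_periodise hk hc (f := fun y => f (x - y)) (hf.comp_sub_left x),
    ← integral_sub_left_eq_self _ _ x]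
  simp

lemma torusGrad_conv {k : E d → ℝ} {R : ℝ} (hk : SuppBall k R) (hc : ContDiff ℝ ∞ k)
    {f : Td d → ℝ} (hf : Integrable f) (x : Td d) (i : Fin d) :
    torusGrad (conv f k) x i = conv f (pd i k) x := by
  obtain ⟨v, rfl⟩ := proj_surjective x
  have h0 := torusGrad_proj_add (conv f k) 0 v
  simp only [zero_add] at h0
  rw [h0, gradient_apply, pd]
  have h1 : (fun v : E d => conv f k (proj v)) = convolution k (fun w => f (proj w))
      (ContinuousLinearMap.lsmul ℝ ℝ) volume := funext (conv_proj f k)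
  have h2 := hk.hasCompactSupport.hasFDerivAt_convolution_left (ContinuousLinearMap.lsmul ℝ ℝ)
    (hc.of_le (by simp)) (locallyIntegrable_comp_proj hf) v (μ := volume)
  rw [h1, h2.fderiv, conv_proj]
  simp only [convolution]
  rw [ContinuousLinearMap.integral_apply]
  · rfl
  · exact (hk.fderiv.hasCompactSupport.convolutionExists_left _
      (hc.continuous_fderiv (by simp)) (locallyIntegrable_comp_proj hf)) v

lemma conv_congr_ae {f g : Td d → ℝ} (h : f =ᵐ[volume] g) (k : E d → ℝ) : conv f k = conv g k := by
  funext x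
  refine integral_congr_ae ?_
  have h1 : ∀ᵐ y : Td d, f (x - y) = g (x - y) :=
    (quasiMeasurePreserving_sub_left volume x).ae h
  filter_upwards [quasiMeasurePreserving_proj.ae h1] with v hv
  rw [hv]

lemma periodise_nonneg {k : E d → ℝ} (hk : ∀ h, 0 ≤ k h) (y : Td d) : 0 ≤ periodise k y :=
  tsum_nonneg fun z => hk z

lemma integral_periodise {k : E d → ℝ} {R : ℝ} (hk : SuppBall k R) (hc : Continuous k) :
    ∫ y, periodise k y = ∫ h, k h := by
  simpa using integral_mul_periodise hk hc (f := fun _ => 1) (integrable_const _)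

/-! ### Approximate identities -/

/-- A sequence of bump functions concentrating at the origin. -/
noncomputable def bump (d : ℕ) (n : ℕ) : ContDiffBump (0 : E d) where
  rIn := 1 / (n + 1)
  rOut := 2 / (n + 1)
  rIn_pos := by positivity
  rIn_lt_rOut := by gcongr; norm_num

/-- The normalised bump functions, an approximate identity. -/
noncomputable def approxId (d : ℕ) (n : ℕ) : E d → ℝ := (bump d n).normed volume

lemma contDiff_approxId (n : ℕ) : ContDiff ℝ ∞ (approxId d n) := (bump d n).contDiff_normed

lemma approxId_nonneg (n : ℕ) (h : E d) : 0 ≤ approxId d n h := (bump d n).nonneg_normed h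

lemma integral_approxId (n : ℕ) : ∫ h, approxId d n h = 1 := (bump d n).integral_normed

lemma suppBall_approxId (n : ℕ) : SuppBall (approxId d n) (2 / (n + 1)) := by
  intro h hh
  have : h ∉ Function.support ((bump d n).normed volume) := by
    rw [ContDiffBump.support_normed_eq]
    simpa [bump] using hh.le
  exact Function.notMem_support.1 this

lemma tendsto_bump_rOut : Filter.Tendsto (fun n => (bump d n).rOut) Filter.atTop (𝓝 0) := by
  have := (tendsto_one_div_add_atTop_nhds_zero_nat (𝕜 := ℝ)).const_mul 2
  simpa [bump, div_eq_mul_inv] using this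

/-- Lebesgue differentiation holds on `ℝ^d`. A Borel representative makes the set of convergence
measurable, so that the statement descends through `proj`. -/
lemma ae_tendsto_conv_approxId {f : Td d → ℝ} (hf : Integrable f) :
    ∀ᵐ x, Filter.Tendsto (fun n => conv f (approxId d n) x) Filter.atTop (𝓝 (f x)) := by
  obtain ⟨g, hg, hfg⟩ := hf.1.aemeasurable
  have hgi : Integrable g := hf.congr hfg
  have h1 : ∀ᵐ v : E d, Filter.Tendsto (fun n => conv g (approxId d n) (proj v)) Filter.atTop
      (𝓝 (g (proj v))) := by
    simp_rw [conv_proj]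
    -- The ratio of the outer to the inner radius of `bump` is exactly `2`, the uniform eccentricity
    -- required here.
    refine ContDiffBump.ae_convolution_tendsto_right_of_locallyIntegrable (K := 2)
      tendsto_bump_rOut (Filter.Eventually.of_forall fun n => ?_) (locallyIntegrable_comp_proj hgi)
    simp [bump, div_eq_mul_inv]
  have hms : MeasurableSet {x | Filter.Tendsto (fun n => conv g (approxId d n) x) Filter.atTop
      (𝓝 (g x))} := by
    refine measurableSet_tendsto_fun (fun n => ?_) hg
    exact ((suppBall_approxId n).torusSmooth_conv (contDiff_approxId n) hgi).continuous.measurable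
  have h2 : ∀ᵐ x, Filter.Tendsto (fun n => conv g (approxId d n) x) Filter.atTop (𝓝 (g x)) := by
    rw [← measurePreserving_proj.map_eq, ae_map_iff measurable_proj.aemeasurable hms]
    exact ae_restrict_of_ae h1
  filter_upwards [h2, hfg] with x hx hx'
  rw [hx']
  simpa [conv_congr_ae hfg] using hx

/-- A pointwise a.e. bound from duality with smooth functions. -/
lemma ae_abs_le_of_forall_smooth {f : Td d → ℝ} (hf : Integrable f) {K : ℝ}
    (h : ∀ ψ : Td d → ℝ, TorusSmooth ψ → |∫ x, f x * ψ x| ≤ K * ∫ x, |ψ x|) :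
    ∀ᵐ x, |f x| ≤ K := by
  filter_upwards [ae_tendsto_conv_approxId hf] with x hx
  -- The duality bound is applied to the periodised bump centred at `x`, which is nonnegative of
  -- mass one.
  refine le_of_tendsto hx.abs (Filter.Eventually.of_forall fun n => ?_)
  have hs := (suppBall_approxId (d := d) n).torusSmooth_periodise (contDiff_approxId n)
  have hc := (contDiff_approxId (d := d) n).continuous
  rw [conv_eq_integral_periodise (suppBall_approxId n) hc hf]
  refine (h _ (hs.comp_sub x)).trans (le_of_eq ?_)
  have h1 : ∀ y, |periodise (approxId d n) (x - y)| = periodise (approxId d n) (x - y) := fun y =>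
    abs_of_nonneg (periodise_nonneg (approxId_nonneg n) _)
  simp_rw [h1]
  rw [integral_sub_left_eq_self (periodise (approxId d n)),
    integral_periodise (suppBall_approxId n) hc, integral_approxId, mul_one]

end BVTransport

namespace BVTransport

variable {d : ℕ}

/-! ### One-dimensional weak derivatives -/

/-- The function `b - b₀ - ∫₀ᵗ B` is orthogonal to every `χ'`: integrate by parts with the
absolutely continuous primitive of `B`. As `χ` is not required to vanish at the ends, the weak
formulation also fixes both boundary values. -/
lemma ae_eq_primitive_of_weak {T : ℝ} (hT : 0 < T) {b B : ℝ → ℝ} {b₀ bT : ℝ}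
    (hb : IntegrableOn b (Set.Icc 0 T)) (hB : IntegrableOn B (Set.Icc 0 T))
    (h : ∀ χ : ℝ → ℝ, ContDiff ℝ ∞ χ →
      bT * χ T - b₀ * χ 0 = ∫ t in Set.Icc 0 T, (b t * deriv χ t + B t * χ t)) :
    bT = b₀ + ∫ t in Set.Icc 0 T, B t ∧
      ∀ᵐ t ∂volume.restrict (Set.Icc 0 T), b t = b₀ + ∫ s in (0 : ℝ)..t, B s := by
  have hbT : bT = b₀ + ∫ t in Set.Icc 0 T, B t := by
    -- The test function `1` isolates the total change over `[0,T]`.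
    have := h (fun _ => 1) contDiff_const
    simp at this
    linarith
  refine ⟨hbT, ?_⟩
  have hBi : IntervalIntegrable B volume 0 T := by
    rw [intervalIntegrable_iff_integrableOn_Icc_of_le hT.le]; exact hB
  have hbi : IntervalIntegrable b volume 0 T := by
    rw [intervalIntegrable_iff_integrableOn_Icc_of_le hT.le]; exact hb
  set c : ℝ → ℝ := fun t => ∫ s in (0 : ℝ)..t, B s with hc
  have hcAC : AbsolutelyContinuousOnInterval c 0 T :=
    hBi.absolutelyContinuousOnInterval_intervalIntegral Set.left_mem_uIcc
  have hcc : ContinuousOn c (Set.uIcc 0 T) := hcAC.continuousOn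
  have hbT' : bT = b₀ + c T := by
    rw [hbT, hc, integral_Icc_eq_integral_Ioc, ← intervalIntegral.integral_of_le hT.le]
  have hderiv : ∀ᵐ t, t ∈ Set.uIcc 0 T → deriv c t = B t := by
    filter_upwards [hBi.ae_hasDerivAt_integral] with t ht htm
    exact (ht htm 0 Set.left_mem_uIcc).deriv
  have key : ∀ χ : ℝ → ℝ, ContDiff ℝ ∞ χ →
      ∫ t in (0 : ℝ)..T, (b t - (b₀ + c t)) * deriv χ t = 0 := by
    intro χ hχ
    have hχd : Continuous (deriv χ) := hχ.continuous_deriv (by simp)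
    have hχAC : AbsolutelyContinuousOnInterval χ 0 T :=
      (hχ.of_le (by simp)).contDiffOn.absolutelyContinuousOnInterval
    have h1 := hχAC.integral_mul_deriv_eq_deriv_mul hcAC
    have h2 : ∫ t in (0 : ℝ)..T, χ t * deriv c t = ∫ t in (0 : ℝ)..T, B t * χ t := by
      refine intervalIntegral.integral_congr_ae ?_
      filter_upwards [hderiv] with t ht htm
      rw [ht (Set.uIoc_subset_uIcc htm), mul_comm]
    have h3 := h χ hχ
    rw [integral_Icc_eq_integral_Ioc, ← intervalIntegral.integral_of_le hT.le,
      intervalIntegral.integral_add (hbi.mul_continuousOn hχd.continuousOn)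
        (hBi.mul_continuousOn hχ.continuous.continuousOn), ← h2, h1] at h3
    have h4 : ∫ t in (0 : ℝ)..T, deriv χ t = χ T - χ 0 :=
      intervalIntegral.integral_deriv_eq_sub (fun t _ => hχ.differentiable (by simp) t)
        (hχd.intervalIntegrable _ _)
    have hci : IntervalIntegrable (fun t => deriv χ t * c t) volume 0 T :=
      (hχd.continuousOn.mul hcc).intervalIntegrable
    have h5 : ∫ t in (0 : ℝ)..T, (b t - (b₀ + c t)) * deriv χ t =
        (∫ t in (0 : ℝ)..T, b t * deriv χ t) - b₀ * (χ T - χ 0) -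
          ∫ t in (0 : ℝ)..T, deriv χ t * c t := by
      rw [← h4, ← intervalIntegral.integral_const_mul,
        ← intervalIntegral.integral_sub (hbi.mul_continuousOn hχd.continuousOn)
          ((hχd.intervalIntegrable _ _).const_mul _), ← intervalIntegral.integral_sub _ hci]
      · congr 1; funext t; ring
      · exact (hbi.mul_continuousOn hχd.continuousOn).sub
          ((hχd.intervalIntegrable _ _).const_mul _)
    have h6 : c 0 = 0 := by simp [hc]
    rw [h6, hbT'] at h3
    rw [h5]
    linear_combination -h3
  have hloc : LocallyIntegrableOn (fun t => b t - (b₀ + c t)) (Set.Ioo 0 T) := by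
    refine IntegrableOn.locallyIntegrableOn ?_
    refine IntegrableOn.mono_set ?_ Set.Ioo_subset_Icc_self
    refine hb.sub ((continuousOn_const.add ?_).integrableOn_compact isCompact_Icc)
    rwa [← Set.uIcc_of_le hT.le]
  -- Every smooth `g` supported inside the interval is the derivative of its primitive, and this
  -- primitive is an admissible `χ`.
  have hae := isOpen_Ioo.ae_eq_zero_of_integral_contDiff_smul_eq_zero hloc (by
    intro g hg hgc hgs
    have hprim : ∀ t, HasDerivAt (fun t => ∫ s in (0 : ℝ)..t, g s) (g t) t := fun t =>
      intervalIntegral.integral_hasDerivAt_right (hg.continuous.intervalIntegrable _ _)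
        (hg.continuous.stronglyMeasurableAtFilter _ _) hg.continuous.continuousAt
    have hd : deriv (fun t => ∫ s in (0 : ℝ)..t, g s) = g := funext fun t => (hprim t).deriv
    have hs : ContDiff ℝ ∞ fun t => ∫ s in (0 : ℝ)..t, g s :=
      contDiff_infty_iff_deriv.2 ⟨fun t => (hprim t).differentiableAt, by rw [hd]; exact hg⟩
    have h1 := key _ hs
    rw [hd, intervalIntegral.integral_of_le hT.le] at h1
    rw [← h1, ← setIntegral_eq_integral_of_forall_compl_eq_zero (s := Set.Ioc 0 T)]
    · refine integral_congr_ae (Filter.Eventually.of_forall fun t => ?_)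
      simp [mul_comm]
    · intro t ht
      have : t ∉ tsupport g := fun hh => ht (Set.Ioo_subset_Ioc_self (hgs hh))
      simp [image_eq_zero_of_notMem_tsupport this])
  rw [← restrict_Ioo_eq_restrict_Icc, ae_restrict_iff' measurableSet_Ioo]
  filter_upwards [hae] with t ht htm
  exact sub_eq_zero.1 (ht htm)

/-- The primitive is continuous, so an almost-everywhere bound holds at every time, in particular at
the end points; this is how traces inherit the bound of the solution. -/
lemma abs_le_of_ae_eq_primitive {T : ℝ} (hT : 0 < T) {b B : ℝ → ℝ} {b₀ K : ℝ}
    (hB : IntegrableOn B (Set.Icc 0 T))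
    (h : ∀ᵐ t ∂volume.restrict (Set.Icc 0 T), b t = b₀ + ∫ s in (0 : ℝ)..t, B s)
    (hK : ∀ t, |b t| ≤ K) {t : ℝ} (ht : t ∈ Set.Icc 0 T) :
    |b₀ + ∫ s in (0 : ℝ)..t, B s| ≤ K := by
  have hBi : IntervalIntegrable B volume 0 T := by
    rw [intervalIntegrable_iff_integrableOn_Icc_of_le hT.le]; exact hB
  have hcc : ContinuousOn (fun t => ∫ s in (0 : ℝ)..t, B s) (Set.Icc 0 T) := by
    rw [← Set.uIcc_of_le hT.le]
    exact (hBi.absolutelyContinuousOnInterval_intervalIntegral Set.left_mem_uIcc).continuousOn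
  -- The bound is phrased as the equality `max |·| K = K`, since two continuous functions that agree
  -- almost everywhere agree everywhere.
  have := Measure.eqOn_Icc_of_ae_eq volume hT.ne
    (f := fun t => max |b₀ + ∫ s in (0 : ℝ)..t, B s| K) (g := fun _ => K) ?_ ?_
    continuousOn_const ht
  · exact max_eq_right_iff.1 this
  · filter_upwards [h] with t ht
    rw [← ht]; exact max_eq_right (hK t)
  · exact (continuousOn_const.add hcc).abs.sup continuousOn_const

/-! ### Weak solutions tested with functions of space -/

/-- A weak solution with Borel measurable and everywhere bounded data. -/
structure IsBddSolution (u : Td d → E d) (T K : ℝ) (f : ℝ → Td d → ℝ) (f₀ fT : Td d → ℝ) :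
    Prop extends IsWeakSolution u T f f₀ fT where
  meas : Measurable (Function.uncurry f)
  bound : ∀ t x, |f t x| ≤ K
  meas_zero : Measurable f₀
  meas_final : Measurable fT

lemma integrable_of_bound_mul {X : Type*} [MeasurableSpace X] {m : Measure X} {f w : X → ℝ}
    {K : ℝ} (hf : AEStronglyMeasurable f m) (hw : Integrable w m)
    (h : ∀ x, |f x| ≤ K * w x) : Integrable f m :=
  (hw.const_mul K).mono' hf (Filter.Eventually.of_forall h)

section
variable {u : Td d → E d} {T K : ℝ} {f : ℝ → Td d → ℝ} {f₀ fT : Td d → ℝ}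

/-- The transport term of a weak solution tested with `H`. -/
noncomputable def flux (u : Td d → E d) (f : ℝ → Td d → ℝ) (H : Td d → ℝ) (t : ℝ) : ℝ :=
  ∫ x, f t x * inner ℝ (u x) (torusGrad H x)

lemma measurable_integral_right {X Y : Type*} [MeasurableSpace X] [MeasurableSpace Y]
    {m : Measure Y} [SFinite m] {f : X → Y → ℝ} (hf : Measurable (Function.uncurry f)) :
    Measurable fun x => ∫ y, f x y ∂m :=
  (StronglyMeasurable.integral_prod_right' (ν := m) hf.stronglyMeasurable).measurable

lemma IsBddSolution.bound_nonneg (hf : IsBddSolution u T K f f₀ fT) : 0 ≤ K :=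
  (abs_nonneg _).trans (hf.bound 0 0)

lemma IsBddSolution.integrable_mul (hf : IsBddSolution u T K f f₀ fT) {H : Td d → ℝ}
    (hH : Integrable H) (t : ℝ) : Integrable fun x => f t x * H x := by
  refine hH.bdd_mul (c := K) ?_ (Filter.Eventually.of_forall fun x => hf.bound t x)
  have := hf.meas
  exact Measurable.aestronglyMeasurable (by fun_prop)

lemma IsBddSolution.abs_integral_mul_le (hf : IsBddSolution u T K f f₀ fT) {H : Td d → ℝ}
    (hH : Integrable H) (t : ℝ) : |∫ x, f t x * H x| ≤ K * ∫ x, |H x| := by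
  refine (abs_integral_le_integral_abs).trans ?_
  rw [← integral_const_mul]
  refine integral_mono (hf.integrable_mul hH t).abs (hH.abs.const_mul K) fun x => ?_
  simp only [abs_mul]
  exact mul_le_mul_of_nonneg_right (hf.bound t x) (abs_nonneg _)

lemma integrable_inner_torusGrad (hu : Integrable u) {H : Td d → ℝ} (hH : TorusSmooth H) :
    Integrable fun x => inner ℝ (u x) (torusGrad H x) := by
  obtain ⟨C, hC0, hC⟩ := Continuous.exists_bound_torus hH.continuous_torusGrad
  refine (hu.norm.const_mul C).mono'
    (hu.1.inner hH.continuous_torusGrad.aestronglyMeasurable) (Filter.Eventually.of_forall ?_)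
  intro x
  calc _ ≤ ‖u x‖ * ‖torusGrad H x‖ := norm_inner_le_norm _ _
    _ ≤ C * ‖u x‖ := by rw [mul_comm]; exact mul_le_mul_of_nonneg_right (hC x) (norm_nonneg _)

lemma IsBddSolution.flux_integrable (hf : IsBddSolution u T K f f₀ fT) (hu : Integrable u)
    (hum : Measurable u) {H : Td d → ℝ} (hH : TorusSmooth H) :
    IntegrableOn (flux u f H) (Set.Icc 0 T) := by
  have hm := hf.meas
  have hg := hH.continuous_torusGrad.measurable
  have : Measurable (flux u f H) := by
    refine measurable_integral_right ?_
    simp only [Function.uncurry_def]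
    exact Measurable.mul (by fun_prop) (Measurable.inner (by fun_prop) (by fun_prop))
  exact Integrable.of_bound this.aestronglyMeasurable _ (Filter.Eventually.of_forall fun t =>
    hf.abs_integral_mul_le (integrable_inner_torusGrad hu hH) t)

/-- Test functions `χ(t) H(x)` reduce the equation to the one-dimensional statement for `t ↦ ∫ f t x
* H x`. -/
lemma IsBddSolution.weak_space (hf : IsBddSolution u T K f f₀ fT) (hT : 0 < T)
    (hu : Integrable u) (hum : Measurable u) {H : Td d → ℝ} (hH : TorusSmooth H) :
    ∫ x, fT x * H x = (∫ x, f₀ x * H x) + ∫ t in Set.Icc 0 T, flux u f H t ∧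
      ∀ᵐ t ∂volume.restrict (Set.Icc 0 T),
        ∫ x, f t x * H x = (∫ x, f₀ x * H x) + ∫ s in (0 : ℝ)..t, flux u f H s := by
  have hm := hf.meas
  have hHc := hH.continuous
  have hHi : Integrable H := Continuous.integrable_torus hHc _
  refine ae_eq_primitive_of_weak hT ?_ (hf.flux_integrable hu hum hH) fun χ hχ => ?_
  · have : Measurable fun t => ∫ x, f t x * H x := by
      have := hHc.measurable
      exact measurable_integral_right (by fun_prop)
    exact Integrable.of_bound this.aestronglyMeasurable _ (Filter.Eventually.of_forall fun t =>
      hf.abs_integral_mul_le hHi t)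
  · have h1 := hf.weak (fun t x => χ t * H x) (by
      have h2 : ContDiff ℝ ∞ fun v : E d => H (proj v) := hH
      exact (hχ.comp contDiff_fst).mul (h2.comp contDiff_snd))
    have e1 : ∀ (g : Td d → ℝ) (a : ℝ), ∫ x, g x * (a * H x) = (∫ x, g x * H x) * a := by
      intro g a
      rw [← integral_mul_const]
      congr 1; funext x; ring
    rw [e1, e1] at h1
    rw [h1]
    refine integral_congr_ae (Filter.Eventually.of_forall fun t => ?_)
    have hχt : DifferentiableAt ℝ χ t := hχ.differentiable (by simp) t
    have e2 : ∀ x, deriv (fun s => χ s * H x) t = deriv χ t * H x := fun x =>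
      deriv_mul_const hχt _
    have e3 : ∀ x, inner ℝ (u x) (torusGrad (fun x => χ t * H x) x) =
        χ t * inner ℝ (u x) (torusGrad H x) := by
      intro x
      rw [inner_torusGrad, inner_torusGrad,
        fderiv_const_mul ((hH.translate x).differentiable (by simp) 0)]
      simp
    simp only [e2, e3, flux]
    rw [← integral_mul_const, ← integral_mul_const, ← integral_add]
    · congr 1; funext x; ring
    · exact (hf.integrable_mul hHi t).mul_const _
    · exact (hf.integrable_mul (integrable_inner_torusGrad hu hH) t).mul_const _

/-- The pairing of `f t` with a smooth `ψ` is bounded by `K ‖ψ‖₁` up to the end times, and duality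
turns this into a pointwise bound for the traces. -/
lemma IsBddSolution.ae_abs_le (hf : IsBddSolution u T K f f₀ fT) (hT : 0 < T)
    (hu : Integrable u) (hum : Measurable u) : (∀ᵐ x, |f₀ x| ≤ K) ∧ ∀ᵐ x, |fT x| ≤ K := by
  have h : ∀ ψ : Td d → ℝ, TorusSmooth ψ →
      |∫ x, f₀ x * ψ x| ≤ K * ∫ x, |ψ x| ∧ |∫ x, fT x * ψ x| ≤ K * ∫ x, |ψ x| := by
    intro ψ hψ
    have h1 := hf.weak_space hT hu hum hψ
    have hb := hf.abs_integral_mul_le (Continuous.integrable_torus hψ.continuous _)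
    have h2 := fun t ht => abs_le_of_ae_eq_primitive hT (hf.flux_integrable hu hum hψ) h1.2 hb
      (t := t) ht
    refine ⟨by simpa using h2 0 ⟨le_rfl, hT.le⟩, ?_⟩
    have h3 := h2 T ⟨hT.le, le_rfl⟩
    rwa [intervalIntegral.integral_of_le hT.le, ← integral_Icc_eq_integral_Ioc, ← h1.1] at h3
  exact ⟨ae_abs_le_of_forall_smooth (hf.memLp_zero.integrable (by simp)) fun ψ hψ => (h ψ hψ).1,
    ae_abs_le_of_forall_smooth (hf.memLp_final.integrable (by simp)) fun ψ hψ => (h ψ hψ).2⟩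

end

end BVTransport

namespace BVTransport

variable {d : ℕ}

/-! ### The pairing of two weak solutions -/

section
variable {X : Type*} [MeasurableSpace X] {m : Measure X}

/-- The bilinear pairing `∬ a(x) b(y) H(x,y) dx dy`. -/
noncomputable def pairing (m : Measure X) (H : X → X → ℝ) (a b : X → ℝ) : ℝ :=
  ∫ x, a x * ∫ y, b y * H x y ∂m ∂m

/-- The kernels will contain `u(x)` and `u(y)`, which are integrable but unbounded; domination by a
product `w₁(x) w₂(y)` is the form that survives. -/
lemma integrable_pairing [SFinite m] {H : X → X → ℝ} {a b w₁ w₂ : X → ℝ} {K : ℝ}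
    (hH : Measurable (Function.uncurry H)) (ha : Measurable a) (hb : Measurable b)
    (hw₁ : Integrable w₁ m) (hw₂ : Integrable w₂ m)
    (hHw : ∀ x y, |H x y| ≤ w₁ x * w₂ y) (haK : ∀ x, |a x| ≤ K) (hbK : ∀ x, |b x| ≤ K) :
    Integrable (fun p : X × X => a p.1 * (b p.2 * H p.1 p.2)) (m.prod m) := by
  refine integrable_of_bound_mul (K := K * K)
    (Measurable.aestronglyMeasurable (by fun_prop)) (hw₁.mul_prod hw₂) fun p => ?_
  rw [abs_mul, abs_mul, mul_assoc]
  have hK : 0 ≤ K := (abs_nonneg _).trans (haK p.1)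
  gcongr
  exacts [haK _, hbK _, hHw _ _]

lemma pairing_comm [SFinite m] {H : X → X → ℝ} {a b w₁ w₂ : X → ℝ} {K : ℝ}
    (hH : Measurable (Function.uncurry H)) (ha : Measurable a) (hb : Measurable b)
    (hw₁ : Integrable w₁ m) (hw₂ : Integrable w₂ m)
    (hHw : ∀ x y, |H x y| ≤ w₁ x * w₂ y) (haK : ∀ x, |a x| ≤ K) (hbK : ∀ x, |b x| ≤ K) :
    pairing m H a b = ∫ y, b y * ∫ x, a x * H x y ∂m ∂m := by
  have hi := integrable_pairing hH ha hb hw₁ hw₂ hHw haK hbK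
  unfold pairing
  simp_rw [← integral_const_mul]
  rw [integral_integral_swap hi]
  congr 1; funext y; congr 1; funext x; ring

lemma abs_integral_mul_kernel_le {H : X → X → ℝ} {b w₁ w₂ : X → ℝ} {K : ℝ}
    (hw₂ : Integrable w₂ m) (hHw : ∀ x y, |H x y| ≤ w₁ x * w₂ y) (hbK : ∀ x, |b x| ≤ K) (x : X) :
    |∫ y, b y * H x y ∂m| ≤ (K * ∫ y, w₂ y ∂m) * w₁ x := by
  have h1 : ‖∫ y, b y * H x y ∂m‖ ≤ ∫ y, K * w₁ x * w₂ y ∂m := by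
    refine norm_integral_le_of_norm_le (hw₂.const_mul _) (Filter.Eventually.of_forall fun y => ?_)
    rw [Real.norm_eq_abs, abs_mul, mul_assoc]
    have hK : 0 ≤ K := (abs_nonneg _).trans (hbK y)
    gcongr
    exacts [hbK _, hHw _ _]
  rw [integral_const_mul] at h1
  calc _ ≤ _ := h1
    _ = _ := by ring

lemma abs_pairing_le {H : X → X → ℝ} {a b w₁ w₂ : X → ℝ} {K : ℝ}
    (hw₁ : Integrable w₁ m) (hw₂ : Integrable w₂ m)
    (hHw : ∀ x y, |H x y| ≤ w₁ x * w₂ y) (haK : ∀ x, |a x| ≤ K) (hbK : ∀ x, |b x| ≤ K) :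
    |pairing m H a b| ≤ K * (K * ∫ y, w₂ y ∂m) * ∫ x, w₁ x ∂m := by
  rw [← integral_const_mul, ← Real.norm_eq_abs]
  refine norm_integral_le_of_norm_le (hw₁.const_mul _) (Filter.Eventually.of_forall fun x => ?_)
  rw [Real.norm_eq_abs, abs_mul, mul_assoc]
  have hK : 0 ≤ K := (abs_nonneg _).trans (haK x)
  gcongr
  exacts [haK _, abs_integral_mul_kernel_le hw₂ hHw hbK x]

lemma measurable_pairing [SFinite m] {H : X → X → ℝ} (hH : Measurable (Function.uncurry H)) {Y : Type*}
    [MeasurableSpace Y] {f g : Y → X → ℝ} (hf : Measurable (Function.uncurry f))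
    (hg : Measurable (Function.uncurry g)) : Measurable fun t => pairing m H (f t) (g t) := by
  have h1 : Measurable fun p : Y × X => ∫ y, g p.1 y * H p.2 y ∂m := by
    refine measurable_integral_right (f := fun (p : Y × X) y => g p.1 y * H p.2 y) ?_
    simp only [Function.uncurry_def]
    fun_prop
  refine measurable_integral_right (f := fun t x => f t x * ∫ y, g t y * H x y ∂m) ?_
  simp only [Function.uncurry_def]
  fun_prop

/-- The time evolution of `g` is inserted while `f` stays frozen at time `t`. The hypothesis has an
exceptional set of times for each `x`; Fubini gives a common set of times, for almost every `x`. An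
indicator of `s ≤ t` replaces the interval integral so that double time integrals become integrals
over triangles. -/
lemma ae_pairing_primitive [IsFiniteMeasure m] {l : Measure ℝ} [IsFiniteMeasure l] {f g : ℝ → X → ℝ} {g₀ : X → ℝ}
    {H H' : X → X → ℝ} {K : ℝ} {w₁ w₂ v₂ : X → ℝ}
    (hf : Measurable (Function.uncurry f)) (hg : Measurable (Function.uncurry g))
    (hg₀ : Measurable g₀)
    (hfK : ∀ t x, |f t x| ≤ K) (hgK : ∀ t x, |g t x| ≤ K) (hg₀K : ∀ x, |g₀ x| ≤ K)
    (hH : Measurable (Function.uncurry H)) (hH' : Measurable (Function.uncurry H'))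
    (hw₁ : Integrable w₁ m) (hw₂ : Integrable w₂ m) (hv₂ : Integrable v₂ m)
    (hHw : ∀ x y, |H x y| ≤ w₁ x * v₂ y) (hHw' : ∀ x y, |H' x y| ≤ w₁ x * w₂ y)
    (h : ∀ x, ∀ᵐ t ∂l, ∫ y, g t y * H x y ∂m = (∫ y, g₀ y * H x y ∂m) +
      ∫ s, (Set.Iic t).indicator (fun s => ∫ y, g s y * H' x y ∂m) s ∂l) :
    ∀ᵐ t ∂l, pairing m H (f t) (g t) = pairing m H (f t) g₀ +
      ∫ s, (Set.Iic t).indicator (fun s => pairing m H' (f t) (g s)) s ∂l := by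
  have hQ : Measurable fun p : ℝ × X => ∫ y, g p.1 y * H' p.2 y ∂m := by
    refine measurable_integral_right (f := fun (p : ℝ × X) y => g p.1 y * H' p.2 y) ?_
    simp only [Function.uncurry_def]
    fun_prop
  have hS : MeasurableSet {p : (ℝ × X) × ℝ | p.2 ≤ p.1.1} :=
    measurableSet_le (by fun_prop) (by fun_prop)
  have hind : ∀ (F : ℝ → ℝ) (t s : ℝ), (Set.Iic t).indicator F s = if s ≤ t then F s else 0 :=
    fun F t s => by simp [Set.indicator_apply]
  simp only [hind] at h ⊢
  have hI : Measurable fun p : ℝ × X =>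
      ∫ s, (if s ≤ p.1 then ∫ y, g s y * H' p.2 y ∂m else 0) ∂l := by
    refine measurable_integral_right
      (f := fun (p : ℝ × X) s => if s ≤ p.1 then ∫ y, g s y * H' p.2 y ∂m else 0) ?_
    simp only [Function.uncurry_def]
    exact Measurable.ite hS (hQ.comp (by fun_prop : Measurable fun p : (ℝ × X) × ℝ =>
      (p.2, p.1.2))) measurable_const
  have hq : Measurable fun p : X × ℝ => ∫ y, g p.2 y * H p.1 y ∂m := by
    refine measurable_integral_right (f := fun (p : X × ℝ) y => g p.2 y * H p.1 y) ?_
    simp only [Function.uncurry_def]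
    fun_prop
  have hq0 : Measurable fun x : X => ∫ y, g₀ y * H x y ∂m :=
    measurable_integral_right (by fun_prop)
  have h' : ∀ᵐ t ∂l, ∀ᵐ x ∂m, ∫ y, g t y * H x y ∂m = (∫ y, g₀ y * H x y ∂m) +
      ∫ s, (if s ≤ t then ∫ y, g s y * H' x y ∂m else 0) ∂l := by
    -- Exchanges "for every `x`, almost every `t`" for "for almost every `t`, almost every `x`";
    -- measurability of the identity in `(x,t)` is the only cost.
    refine (Measure.ae_ae_comm (μ := m) (ν := l) ?_).1 (Filter.Eventually.of_forall h)
    exact measurableSet_eq_fun hq ((hq0.comp measurable_fst).add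
      (hI.comp (by fun_prop : Measurable fun p : X × ℝ => (p.2, p.1))))
  have hQb : ∀ {b : X → ℝ}, (∀ y, |b y| ≤ K) → ∀ x,
      |∫ y, b y * H' x y ∂m| ≤ (K * ∫ y, w₂ y ∂m) * w₁ x :=
    fun hb x => abs_integral_mul_kernel_le hw₂ hHw' hb x
  filter_upwards [h'] with t ht
  have e1 : pairing m H (f t) (g t) = ∫ x, (f t x * (∫ y, g₀ y * H x y ∂m) +
      f t x * ∫ s, (if s ≤ t then ∫ y, g s y * H' x y ∂m else 0) ∂l) ∂m := by
    refine integral_congr_ae ?_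
    filter_upwards [ht] with x hx
    rw [hx, mul_add]
  have hfull : Integrable (fun p : X × ℝ => f t p.1 *
      (if p.2 ≤ t then ∫ y, g p.2 y * H' p.1 y ∂m else 0)) (m.prod l) := by
    refine integrable_of_bound_mul (K := K * (K * ∫ y, w₂ y ∂m)) ?_
      (hw₁.mul_prod (integrable_const (1 : ℝ))) fun p => ?_
    · refine Measurable.aestronglyMeasurable (Measurable.mul (by fun_prop) ?_)
      exact Measurable.ite (measurableSet_le (by fun_prop) (by fun_prop))
        (hQ.comp (by fun_prop : Measurable fun p : X × ℝ => (p.2, p.1))) measurable_const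
    · rw [abs_mul, mul_assoc, mul_one]
      have hK : 0 ≤ K := (abs_nonneg _).trans (hfK 0 p.1)
      gcongr
      · exact hfK _ _
      · split_ifs
        · exact hQb (hgK _) p.1
        · rw [abs_zero]; exact (abs_nonneg _).trans (hQb (hgK 0) p.1)
  rw [e1, integral_add]
  · congr 1
    simp_rw [← integral_const_mul]
    rw [integral_integral_swap hfull]
    congr 1; funext s
    split_ifs with hs
    · rfl
    · simp
  · refine integrable_of_bound_mul (K := K * (K * ∫ y, v₂ y ∂m)) ?_ hw₁ fun x => ?_
    · exact Measurable.aestronglyMeasurable (by fun_prop)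
    · rw [abs_mul, mul_assoc]
      have hK : 0 ≤ K := (abs_nonneg _).trans (hfK 0 x)
      gcongr
      exacts [hfK _ _, abs_integral_mul_kernel_le hv₂ hHw hg₀K x]
  · simp_rw [← integral_const_mul]
    exact hfull.integral_prod_left

/-- The product of two functions that solve transport equations weakly. -/
theorem pairing_identity [IsFiniteMeasure m] {l : Measure ℝ} [IsFiniteMeasure l] [NullSingletonClass l]
    {f g : ℝ → X → ℝ} {f₀ fT g₀ gT : X → ℝ} {G G₁ G₂ G₁₂ : X → X → ℝ} {K c : ℝ} {w : X → ℝ}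
    (hf : Measurable (Function.uncurry f)) (hg : Measurable (Function.uncurry g))
    (hf₀ : Measurable f₀) (hfT : Measurable fT) (hg₀ : Measurable g₀) (hgT : Measurable gT)
    (hfK : ∀ t x, |f t x| ≤ K) (hgK : ∀ t x, |g t x| ≤ K) (hf₀K : ∀ x, |f₀ x| ≤ K)
    (hfTK : ∀ x, |fT x| ≤ K) (hg₀K : ∀ x, |g₀ x| ≤ K) (hgTK : ∀ x, |gT x| ≤ K)
    (hG : Measurable (Function.uncurry G)) (hG₁ : Measurable (Function.uncurry G₁))
    (hG₂ : Measurable (Function.uncurry G₂)) (hG₁₂ : Measurable (Function.uncurry G₁₂))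
    (hw : Integrable w m) (hGw : ∀ x y, |G x y| ≤ c) (hG₁w : ∀ x y, |G₁ x y| ≤ w x)
    (hG₂w : ∀ x y, |G₂ x y| ≤ w y) (hG₁₂w : ∀ x y, |G₁₂ x y| ≤ w x * w y)
    (hf1 : ∀ y, ∫ x, fT x * G x y ∂m = (∫ x, f₀ x * G x y ∂m) +
      ∫ t, ∫ x, f t x * G₁ x y ∂m ∂l)
    (hf2 : ∀ y, ∀ᵐ t ∂l, ∫ x, f t x * G₂ x y ∂m = (∫ x, f₀ x * G₂ x y ∂m) +
      ∫ s, (Set.Iic t).indicator (fun s => ∫ x, f s x * G₁₂ x y ∂m) s ∂l)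
    (hg1 : ∀ x, ∫ y, gT y * G₁ x y ∂m = (∫ y, g₀ y * G₁ x y ∂m) +
      ∫ s, ∫ y, g s y * G₁₂ x y ∂m ∂l)
    (hg2 : ∀ x, ∀ᵐ t ∂l, ∫ y, g t y * G₁ x y ∂m = (∫ y, g₀ y * G₁ x y ∂m) +
      ∫ s, (Set.Iic t).indicator (fun s => ∫ y, g s y * G₁₂ x y ∂m) s ∂l)
    (hg3 : ∀ x, ∫ y, gT y * G x y ∂m = (∫ y, g₀ y * G x y ∂m) +
      ∫ t, ∫ y, g t y * G₂ x y ∂m ∂l) :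
    pairing m G fT gT - pairing m G f₀ g₀ =
      ∫ t, (pairing m G₁ (f t) (g t) + pairing m G₂ (f t) (g t)) ∂l := by
  have h1i : Integrable (fun _ : X => (1 : ℝ)) m := integrable_const 1
  have hG₁w' : ∀ x y, |G₁ x y| ≤ w x * 1 := fun x y => by simpa using hG₁w x y
  have hG₂w' : ∀ x y, |G₂ x y| ≤ 1 * w y := fun x y => by simpa using hG₂w x y
  have hGw' : ∀ x y, |G x y| ≤ c * 1 := fun x y => by simpa using hGw x y
  have hswap : ∀ {H : X → X → ℝ}, Measurable (Function.uncurry H) →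
      Measurable (Function.uncurry fun x y => H y x) := fun {H} hH =>
    hH.comp measurable_swap
  -- bounds and integrability in time
  obtain ⟨B, hB⟩ : ∃ B, ∀ t s, |pairing m G₁₂ (f t) (g s)| ≤ B :=
    ⟨_, fun t s => abs_pairing_le hw hw hG₁₂w (hfK t) (hgK s)⟩
  have hEm : Measurable fun p : ℝ × ℝ => pairing m G₁₂ (f p.1) (g p.2) :=
    measurable_pairing (Y := ℝ × ℝ) (f := fun p => f p.1) (g := fun p => g p.2) hG₁₂
      (by simp only [Function.uncurry_def]; fun_prop)
      (by simp only [Function.uncurry_def]; fun_prop)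
  have hB0 : 0 ≤ B := (abs_nonneg _).trans (hB 0 0)
  have hind : ∀ (F : ℝ → ℝ) (t s : ℝ), (Set.Iic t).indicator F s = if s ≤ t then F s else 0 :=
    fun F t s => by simp [Set.indicator_apply]
  -- In the `G₁` term `g` is expanded from its initial value, in the `G₂` term `f` is. Both
  -- remainders contain `G₁₂` paired with `f` at one time and `g` at another, over the triangles `s
  -- ≤ t` and `t ≤ s`, so no product of time derivatives appears.
  have hT1 := ae_pairing_primitive hf hg hg₀ hfK hgK hg₀K hG₁ hG₁₂ hw hw h1i hG₁w' hG₁₂w hg2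
  have hT2 := ae_pairing_primitive (H := fun x y => G₂ y x) (H' := fun x y => G₁₂ y x)
    hg hf hf₀ hgK hfK hf₀K (hswap hG₂) (hswap hG₁₂) hw hw h1i
    (fun x y => by simpa using hG₂w y x) (fun x y => by simpa [mul_comm] using hG₁₂w y x) hf2
  have c2 : ∀ {a b : X → ℝ}, Measurable a → Measurable b → (∀ x, |a x| ≤ K) → (∀ x, |b x| ≤ K) →
      pairing m (fun x y => G₂ y x) b a = pairing m G₂ a b := fun ha hb haK hbK =>
    (pairing_comm hG₂ ha hb h1i hw hG₂w' haK hbK).symm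
  have c12 : ∀ {a b : X → ℝ}, Measurable a → Measurable b → (∀ x, |a x| ≤ K) →
      (∀ x, |b x| ≤ K) → pairing m (fun x y => G₁₂ y x) b a = pairing m G₁₂ a b :=
    fun ha hb haK hbK => (pairing_comm hG₁₂ ha hb hw hw hG₁₂w haK hbK).symm
  have hft : ∀ t, Measurable (f t) := fun t => by fun_prop
  have hgt : ∀ t, Measurable (g t) := fun t => by fun_prop
  simp only [hind] at hT1 hT2
  have bddI : ∀ {F : ℝ → ℝ} {C : ℝ}, Measurable F → (∀ t, |F t| ≤ C) → Integrable F l :=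
    fun {F C} hF hC => Integrable.of_bound hF.aestronglyMeasurable C
      (Filter.Eventually.of_forall hC)
  have hle1 : Measurable fun p : ℝ × ℝ =>
      if p.2 ≤ p.1 then pairing m G₁₂ (f p.1) (g p.2) else 0 :=
    Measurable.ite (measurableSet_le (by fun_prop) (by fun_prop)) hEm measurable_const
  have hle2 : Measurable fun p : ℝ × ℝ =>
      if p.1 ≤ p.2 then pairing m G₁₂ (f p.1) (g p.2) else 0 :=
    Measurable.ite (measurableSet_le (by fun_prop) (by fun_prop)) hEm measurable_const
  have hi1 : Integrable (fun p : ℝ × ℝ =>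
      if p.2 ≤ p.1 then pairing m G₁₂ (f p.1) (g p.2) else 0) (l.prod l) := by
    refine Integrable.of_bound hle1.aestronglyMeasurable B (Filter.Eventually.of_forall fun p => ?_)
    split_ifs
    exacts [hB _ _, by simpa using hB0]
  have hi2 : Integrable (fun p : ℝ × ℝ =>
      if p.1 ≤ p.2 then pairing m G₁₂ (f p.1) (g p.2) else 0) (l.prod l) := by
    refine Integrable.of_bound hle2.aestronglyMeasurable B (Filter.Eventually.of_forall fun p => ?_)
    split_ifs
    exacts [hB _ _, by simpa using hB0]
  have m1 := measurable_pairing (m := m) hG₁ hf hg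
  have m2 := measurable_pairing (m := m) hG₂ hf hg
  have m10 : Measurable fun t => pairing m G₁ (f t) g₀ :=
    measurable_pairing (g := fun _ : ℝ => g₀) hG₁ hf
      (by simp only [Function.uncurry_def]; fun_prop)
  have m1T : Measurable fun t => pairing m G₁ (f t) gT :=
    measurable_pairing (g := fun _ : ℝ => gT) hG₁ hf
      (by simp only [Function.uncurry_def]; fun_prop)
  have m20 : Measurable fun t => pairing m G₂ f₀ (g t) :=
    measurable_pairing (f := fun _ : ℝ => f₀) hG₂
      (by simp only [Function.uncurry_def]; fun_prop) hg
  have i1 := bddI m1 fun t => abs_pairing_le hw h1i hG₁w' (hfK t) (hgK t)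
  have i2 := bddI m2 fun t => abs_pairing_le h1i hw hG₂w' (hfK t) (hgK t)
  have i10 := bddI m10 fun t => abs_pairing_le hw h1i hG₁w' (hfK t) hg₀K
  have i1T := bddI m1T fun t => abs_pairing_le hw h1i hG₁w' (hfK t) hgTK
  have i20 := bddI m20 fun t => abs_pairing_le h1i hw hG₂w' hf₀K (hgK t)
  have t1 : ∫ t, pairing m G₁ (f t) (g t) ∂l = (∫ t, pairing m G₁ (f t) g₀ ∂l) +
      ∫ t, ∫ s, (if s ≤ t then pairing m G₁₂ (f t) (g s) else 0) ∂l ∂l := by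
    rw [integral_congr_ae hT1, integral_add i10 hi1.integral_prod_left]
  have t2 : ∫ t, pairing m G₂ (f t) (g t) ∂l = (∫ t, pairing m G₂ f₀ (g t) ∂l) +
      ∫ t, ∫ s, (if t ≤ s then pairing m G₁₂ (f t) (g s) else 0) ∂l ∂l := by
    rw [integral_integral_swap hi2]
    have h3 : ∀ t, pairing m (fun x y => G₂ y x) (g t) (f t) = pairing m G₂ (f t) (g t) :=
      fun t => c2 (hft t) (hgt t) (hfK t) (hgK t)
    have h4 : ∀ t, pairing m (fun x y => G₂ y x) (g t) f₀ = pairing m G₂ f₀ (g t) :=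
      fun t => c2 hf₀ (hgt t) hf₀K (hgK t)
    have h5 : ∀ t s, pairing m (fun x y => G₁₂ y x) (g t) (f s) = pairing m G₁₂ (f s) (g t) :=
      fun t s => c12 (hft s) (hgt t) (hfK s) (hgK t)
    simp only [h3, h4, h5] at hT2
    rw [integral_congr_ae hT2, integral_add i20 hi2.integral_prod_right]
  -- the two triangles add up to the square
  have sq : (∫ t, ∫ s, (if s ≤ t then pairing m G₁₂ (f t) (g s) else 0) ∂l ∂l) +
      ∫ t, ∫ s, (if t ≤ s then pairing m G₁₂ (f t) (g s) else 0) ∂l ∂l =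
      ∫ t, (pairing m G₁ (f t) gT - pairing m G₁ (f t) g₀) ∂l := by
    rw [← integral_add hi1.integral_prod_left hi2.integral_prod_left]
    congr 1; funext t
    have hEt : Measurable fun s => pairing m G₁₂ (f t) (g s) :=
      hEm.comp (by fun_prop : Measurable fun s : ℝ => (t, s))
    rw [← integral_add]
    · have hne : ∀ᵐ s ∂l, s ≠ t := by
        simp [ae_iff, measure_singleton]
      have h6 : ∫ s, ((if s ≤ t then pairing m G₁₂ (f t) (g s) else 0) +
          if t ≤ s then pairing m G₁₂ (f t) (g s) else 0) ∂l =
          ∫ s, pairing m G₁₂ (f t) (g s) ∂l := by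
        refine integral_congr_ae ?_
        filter_upwards [hne] with s hs
        rcases lt_or_gt_of_ne hs with h | h
        · simp [h.le, not_le.2 h]
        · simp [h.le, not_le.2 h]
      rw [h6]
      have hint : Integrable (fun p : ℝ × X => f t p.2 * ∫ y, g p.1 y * G₁₂ p.2 y ∂m)
          (l.prod m) := by
        have hQ : Measurable fun p : ℝ × X => ∫ y, g p.1 y * G₁₂ p.2 y ∂m := by
          refine measurable_integral_right (f := fun (p : ℝ × X) y => g p.1 y * G₁₂ p.2 y) ?_
          simp only [Function.uncurry_def]
          fun_prop
        refine integrable_of_bound_mul (K := K * (K * ∫ y, w y ∂m)) ?_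
          ((integrable_const (1 : ℝ)).mul_prod hw) fun p => ?_
        · exact Measurable.aestronglyMeasurable (by fun_prop)
        · rw [abs_mul, mul_assoc, one_mul]
          have hK : 0 ≤ K := (abs_nonneg _).trans (hfK 0 p.2)
          gcongr
          exacts [hfK _ _, abs_integral_mul_kernel_le hw hG₁₂w (hgK _) p.2]
      have h7 : ∫ s, pairing m G₁₂ (f t) (g s) ∂l =
          ∫ x, f t x * ((∫ y, gT y * G₁ x y ∂m) - ∫ y, g₀ y * G₁ x y ∂m) ∂m := by
        unfold pairing
        rw [integral_integral_swap hint]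
        congr 1; funext x
        rw [integral_const_mul, hg1 x]
        ring
      rw [h7]
      unfold pairing
      rw [← integral_sub]
      · congr 1; funext x; ring
      · have := (integrable_pairing hG₁ (hft t) hgT hw h1i hG₁w' (hfK t) hgTK).integral_prod_left
        simpa [integral_const_mul] using this
      · have := (integrable_pairing hG₁ (hft t) hg₀ hw h1i hG₁w' (hfK t) hg₀K).integral_prod_left
        simpa [integral_const_mul] using this
    · exact bddI (Measurable.ite measurableSet_Iic hEt measurable_const) (C := B) fun s => by
        split_ifs
        exacts [hB _ _, by simpa using hB0]
    · exact bddI (Measurable.ite measurableSet_Ici hEt measurable_const) (C := B) fun s => by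
        split_ifs
        exacts [hB _ _, by simpa using hB0]
  have e1 : ∫ t, pairing m G₁ (f t) gT ∂l = pairing m G fT gT - pairing m G f₀ gT := by
    have h3 : ∀ t, pairing m G₁ (f t) gT = ∫ y, gT y * ∫ x, f t x * G₁ x y ∂m ∂m := fun t =>
      pairing_comm hG₁ (hft t) hgT hw h1i hG₁w' (hfK t) hgTK
    simp only [h3]
    have hint : Integrable (fun p : ℝ × X => gT p.2 * ∫ x, f p.1 x * G₁ x p.2 ∂m)
        (l.prod m) := by
      have hQ : Measurable fun p : ℝ × X => ∫ x, f p.1 x * G₁ x p.2 ∂m := by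
        refine measurable_integral_right (f := fun (p : ℝ × X) x => f p.1 x * G₁ x p.2) ?_
        simp only [Function.uncurry_def]
        fun_prop
      refine Integrable.of_bound (Measurable.aestronglyMeasurable (by fun_prop))
        (K * (K * ∫ y, w y ∂m)) (Filter.Eventually.of_forall fun p => ?_)
      rw [Real.norm_eq_abs, abs_mul]
      have hK : 0 ≤ K := (abs_nonneg _).trans (hgTK p.2)
      gcongr
      · exact hgTK _
      · have := abs_integral_mul_kernel_le (H := fun y x => G₁ x y) (w₁ := fun _ => 1)
          hw (fun x y => by simpa using hG₁w y x) (hfK p.1) p.2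
        simpa using this
    rw [integral_integral_swap hint, pairing_comm hG hfT hgT (integrable_const c) h1i hGw' hfTK hgTK,
      pairing_comm hG hf₀ hgT (integrable_const c) h1i hGw' hf₀K hgTK, ← integral_sub]
    · congr 1; funext y
      rw [integral_const_mul, hf1 y]; ring
    · have := (integrable_pairing (H := fun x y => G y x) (hswap hG) hgT hfT (integrable_const c)
        h1i (fun x y => hGw' y x) hgTK hfTK).integral_prod_left
      simpa [integral_const_mul] using this
    · have := (integrable_pairing (H := fun x y => G y x) (hswap hG) hgT hf₀ (integrable_const c)
        h1i (fun x y => hGw' y x) hgTK hf₀K).integral_prod_left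
      simpa [integral_const_mul] using this
  have e2 : ∫ t, pairing m G₂ f₀ (g t) ∂l = pairing m G f₀ gT - pairing m G f₀ g₀ := by
    have hint : Integrable (fun p : ℝ × X => f₀ p.2 * ∫ y, g p.1 y * G₂ p.2 y ∂m)
        (l.prod m) := by
      have hQ : Measurable fun p : ℝ × X => ∫ y, g p.1 y * G₂ p.2 y ∂m := by
        refine measurable_integral_right (f := fun (p : ℝ × X) y => g p.1 y * G₂ p.2 y) ?_
        simp only [Function.uncurry_def]
        fun_prop
      refine Integrable.of_bound (Measurable.aestronglyMeasurable (by fun_prop))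
        (K * (K * ∫ y, w y ∂m)) (Filter.Eventually.of_forall fun p => ?_)
      rw [Real.norm_eq_abs, abs_mul]
      have hK : 0 ≤ K := (abs_nonneg _).trans (hf₀K p.2)
      gcongr
      · exact hf₀K _
      · simpa using abs_integral_mul_kernel_le hw hG₂w' (hgK p.1) p.2
    unfold pairing
    rw [integral_integral_swap hint, ← integral_sub]
    · congr 1; funext x
      rw [integral_const_mul, hg3 x]; ring
    · have := (integrable_pairing hG hf₀ hgT (integrable_const c) h1i hGw' hf₀K
        hgTK).integral_prod_left
      simpa [integral_const_mul] using this
    · have := (integrable_pairing hG hf₀ hg₀ (integrable_const c) h1i hGw' hf₀K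
        hg₀K).integral_prod_left
      simpa [integral_const_mul] using this
  -- By `sq` the terms with `g₀` cancel. What remains is the pairing of `G₁` with `gT` and of `G₂`
  -- with `f₀`; `e1` and `e2` evaluate these, and the mixed pairing of `f₀` with `gT` cancels.
  rw [integral_add i1 i2, t1, t2]
  rw [integral_sub i1T i10, e1] at sq
  rw [e2]
  linear_combination -sq

end

end BVTransport

namespace BVTransport

variable {d : ℕ}

/-! ### The commutator identity for a fixed localisation -/

lemma TorusSmooth.add {ψ χ : Td d → ℝ} (hψ : TorusSmooth ψ) (hχ : TorusSmooth χ) :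
    TorusSmooth fun x => ψ x + χ x := ContDiff.add hψ hχ

lemma TorusSmooth.mul_const {ψ : Td d → ℝ} (hψ : TorusSmooth ψ) (a : ℝ) :
    TorusSmooth fun x => ψ x * a := ContDiff.mul hψ contDiff_const

lemma torusGrad_add {ψ χ : Td d → ℝ} (hψ : TorusSmooth ψ) (hχ : TorusSmooth χ) (x : Td d)
    (i : Fin d) : torusGrad (fun x => ψ x + χ x) x i = torusGrad ψ x i + torusGrad χ x i := by
  simp only [torusGrad_apply, pd]
  rw [fderiv_fun_add ((hψ.translate x).differentiable (by simp) 0)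
    ((hχ.translate x).differentiable (by simp) 0)]
  simp

lemma torusGrad_mul_const {ψ : Td d → ℝ} (hψ : TorusSmooth ψ) (a : ℝ) (x : Td d)
    (i : Fin d) : torusGrad (fun x => ψ x * a) x i = torusGrad ψ x i * a := by
  simp only [torusGrad_apply, pd]
  rw [fderiv_mul_const ((hψ.translate x).differentiable (by simp) 0)]
  simp [mul_comm]

lemma intervalIntegral_eq_indicator {T t : ℝ} (ht : t ∈ Set.Icc 0 T) (B : ℝ → ℝ) :
    ∫ s in (0 : ℝ)..t, B s = ∫ s in Set.Icc 0 T, (Set.Iic t).indicator B s := by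
  rw [setIntegral_indicator measurableSet_Iic, intervalIntegral.integral_of_le ht.1,
    ← integral_Icc_eq_integral_Ioc]
  congr 2
  ext s
  simp only [Set.mem_Icc, Set.mem_inter_iff, Set.mem_Iic]
  exact ⟨fun h => ⟨⟨h.1, h.2.trans ht.2⟩, h.2⟩, fun h => ⟨h.1.1, h.2⟩⟩

section
variable {u : Td d → E d} {T K : ℝ} {f g : ℝ → Td d → ℝ} {f₀ fT g₀ gT : Td d → ℝ}

lemma IsBddSolution.weak_kernel (hf : IsBddSolution u T K f f₀ fT) (hT : 0 < T)
    (hu : Integrable u) (hum : Measurable u) {H H' : Td d → ℝ} (hH : TorusSmooth H)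
    (hH' : ∀ x, inner ℝ (u x) (torusGrad H x) = H' x) :
    ∫ x, fT x * H x = (∫ x, f₀ x * H x) + ∫ t in Set.Icc 0 T, ∫ x, f t x * H' x ∧
      ∀ᵐ t ∂volume.restrict (Set.Icc 0 T), ∫ x, f t x * H x = (∫ x, f₀ x * H x) +
        ∫ s in Set.Icc 0 T, (Set.Iic t).indicator (fun s => ∫ x, f s x * H' x) s := by
  have h := hf.weak_space hT hu hum hH
  simp only [flux, hH'] at h
  refine ⟨h.1, ?_⟩
  filter_upwards [h.2, ae_restrict_mem measurableSet_Icc] with t ht htm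
  rw [ht, intervalIntegral_eq_indicator htm]

lemma abs_sum_coord_mul_le (a : E d) {b : Fin d → ℝ} {A : ℝ} (hb : ∀ i, |b i| ≤ A) :
    |∑ i, a i * b i| ≤ d * A * ‖a‖ := by
  calc |∑ i, a i * b i| ≤ ∑ i, |a i * b i| := Finset.abs_sum_le_sum_abs _ _
    _ ≤ ∑ _i : Fin d, ‖a‖ * A := by
        refine Finset.sum_le_sum fun i _ => ?_
        rw [abs_mul]
        have := PiLp.norm_apply_le a i
        rw [Real.norm_eq_abs] at this
        exact mul_le_mul this (hb i) (abs_nonneg _) (norm_nonneg _)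
    _ = d * A * ‖a‖ := by simp; ring

/-- `pairing_identity` for `G(x,y) = ζ(x) P(x - y)`, where `G₁ = u(x)·∇ₓG` and `G₂ = u(y)·∇_yG`. For
fixed `y` the kernel `G₂` is smooth in `x`, and for fixed `x` the kernel `G₁` is smooth in `y`, so
both may be used as test functions and `u` is never differentiated. In `G₁ + G₂` the derivatives of
`P` combine into the commutator. -/
theorem transport_pairing (hf : IsBddSolution u T K f f₀ fT) (hg : IsBddSolution u T K g g₀ gT)
    (hT : 0 < T) (hu : Integrable u) (hum : Measurable u)
    (hf₀K : ∀ x, |f₀ x| ≤ K) (hfTK : ∀ x, |fT x| ≤ K) (hg₀K : ∀ x, |g₀ x| ≤ K)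
    (hgTK : ∀ x, |gT x| ≤ K) {p : E d → ℝ} {R : ℝ} (hp : SuppBall p R) (hpc : ContDiff ℝ ∞ p)
    {ζ : Td d → ℝ} (hζ : TorusSmooth ζ) :
    (∫ x, fT x * (ζ x * conv gT p x)) - ∫ x, f₀ x * (ζ x * conv g₀ p x) =
      ∫ t in Set.Icc 0 T, ∫ x, f t x * (conv (g t) p x * inner ℝ (u x) (torusGrad ζ x) +
        ζ x * ∫ h : E d, g t (x - proj h) * fderiv ℝ p h (u x - u (x - proj h))) := by
  set P := periodise p with hPdef
  have hPs : TorusSmooth P := hp.torusSmooth_periodise hpc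
  set P1 : Fin d → Td d → ℝ := fun i => periodise (pd i p) with hP1def
  have hP1s : ∀ i, TorusSmooth (P1 i) := fun i => (hp.pd i).torusSmooth_periodise (contDiff_pd hpc i)
  set P2 : Fin d → Fin d → Td d → ℝ := fun i j => periodise (pd i (pd j p)) with hP2def
  have hP2s : ∀ i j, TorusSmooth (P2 i j) := fun i j =>
    ((hp.pd j).pd i).torusSmooth_periodise (contDiff_pd (contDiff_pd hpc j) i)
  -- Differentiating `G₁` in `y` and `G₂` in `x` has to give the same kernel `G₁₂`; this is the
  -- symmetry of second derivatives.
  have hP2c : ∀ i j, P2 i j = P2 j i := fun i j => by simp only [hP2def, pd_comm hpc i j]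
  have gP : ∀ y i, torusGrad P y i = P1 i y := fun y i => torusGrad_periodise hp hpc y i
  have gP1 : ∀ j y i, torusGrad (P1 j) y i = P2 i j y := fun j y i =>
    torusGrad_periodise (hp.pd j) (contDiff_pd hpc j) y i
  set ζ1 : Fin d → Td d → ℝ := fun i x => torusGrad ζ x i with hζ1def
  have hζ1s : ∀ i, TorusSmooth (ζ1 i) := fun i => hζ.torusGrad i
  -- uniform bounds
  obtain ⟨A, hA1, bP, bP1, bP2, bζ, bζ1⟩ : ∃ A : ℝ, 1 ≤ A ∧ (∀ x, |P x| ≤ A) ∧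
      (∀ i x, |P1 i x| ≤ A) ∧ (∀ i j x, |P2 i j x| ≤ A) ∧ (∀ x, |ζ x| ≤ A) ∧
      ∀ i x, |ζ1 i x| ≤ A := by
    obtain ⟨a, ha0, ha⟩ := Continuous.exists_bound_torus hPs.continuous
    choose b hb0 hb using fun i => Continuous.exists_bound_torus (hP1s i).continuous
    choose c hc0 hc using fun i j => Continuous.exists_bound_torus (hP2s i j).continuous
    obtain ⟨e, he0, he⟩ := Continuous.exists_bound_torus hζ.continuous
    choose r hr0 hr using fun i => Continuous.exists_bound_torus (hζ1s i).continuous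
    have sb : ∀ i, b i ≤ ∑ i, b i := fun i =>
      Finset.single_le_sum (fun i _ => hb0 i) (Finset.mem_univ i)
    have sr : ∀ i, r i ≤ ∑ i, r i := fun i =>
      Finset.single_le_sum (fun i _ => hr0 i) (Finset.mem_univ i)
    have sc0 : ∀ i, 0 ≤ ∑ j, c i j := fun i => Finset.sum_nonneg fun j _ => hc0 i j
    have sc : ∀ i j, c i j ≤ ∑ i, ∑ j, c i j := fun i j =>
      (Finset.single_le_sum (fun j _ => hc0 i j) (Finset.mem_univ j)).trans
        (Finset.single_le_sum (fun i _ => sc0 i) (Finset.mem_univ i))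
    have nb : 0 ≤ ∑ i, b i := Finset.sum_nonneg fun i _ => hb0 i
    have nr : 0 ≤ ∑ i, r i := Finset.sum_nonneg fun i _ => hr0 i
    have nc : 0 ≤ ∑ i, ∑ j, c i j := Finset.sum_nonneg fun i _ => sc0 i
    refine ⟨1 + a + (∑ i, b i) + (∑ i, ∑ j, c i j) + e + ∑ i, r i, by linarith,
      fun x => ?_, fun i x => ?_, fun i j x => ?_, fun x => ?_, fun i x => ?_⟩
    · have := ha x; rw [Real.norm_eq_abs] at this; linarith
    · have := hb i x; have := sb i; rw [Real.norm_eq_abs] at *; linarith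
    · have := hc i j x; have := sc i j; rw [Real.norm_eq_abs] at *; linarith
    · have := he x; rw [Real.norm_eq_abs] at this; linarith
    · have := hr i x; have := sr i; rw [Real.norm_eq_abs] at *; linarith
  have hA0 : 0 ≤ A := zero_le_one.trans hA1
  have bmul : ∀ {a b : ℝ}, |a| ≤ A → |b| ≤ A → |a * b| ≤ A * A := fun ha hb => by
    rw [abs_mul]; exact mul_le_mul ha hb (abs_nonneg _) hA0
  have badd : ∀ {a b : ℝ}, |a| ≤ A * A → |b| ≤ A * A → |a + b| ≤ 2 * (A * A) := fun ha hb => by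
    refine (abs_add_le _ _).trans ?_
    linarith
  -- the test functions
  set G : Td d → Td d → ℝ := fun x y => ζ x * P (x - y) with hG
  set G1 : Td d → Td d → ℝ := fun x y => ∑ i, u x i * (P1 i (x - y) * ζ x + P (x - y) * ζ1 i x)
    with hG1
  set G2 : Td d → Td d → ℝ := fun x y => ∑ j, (-u y j) * (P1 j (x - y) * ζ x) with hG2
  set G12 : Td d → Td d → ℝ := fun x y => ∑ i, u x i * ∑ j, (-u y j) *
    (P2 i j (x - y) * ζ x + P1 j (x - y) * ζ1 i x) with hG12
  have mP := hPs.continuous.measurable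
  have mP1 := fun i => (hP1s i).continuous.measurable
  have mP2 := fun i j => (hP2s i j).continuous.measurable
  have mζ := hζ.continuous.measurable
  have mζ1 := fun i => (hζ1s i).continuous.measurable
  set w : Td d → ℝ := fun x => d * (2 * (A * A)) * ‖u x‖ with hw
  have dw : ∀ x, d * (A * A) * ‖u x‖ ≤ w x := fun x => by
    have : (0 : ℝ) ≤ d * (A * A) * ‖u x‖ := by positivity
    simp only [hw]; nlinarith
  have key := pairing_identity (m := (volume : Measure (Td d))) (l := volume.restrict (Set.Icc 0 T))
    (f := f) (g := g) (f₀ := f₀) (fT := fT) (g₀ := g₀) (gT := gT) (G := G) (G₁ := G1) (G₂ := G2)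
    (G₁₂ := G12) (K := K) (c := A * A) (w := w) hf.meas hg.meas hf.meas_zero hf.meas_final
    hg.meas_zero hg.meas_final hf.bound hg.bound hf₀K hfTK hg₀K hgTK
    (by simp only [hG, Function.uncurry_def]; fun_prop)
    (by simp only [hG1, Function.uncurry_def]; fun_prop)
    (by simp only [hG2, Function.uncurry_def]; fun_prop)
    (by simp only [hG12, Function.uncurry_def]; fun_prop)
    (hu.norm.const_mul _) (fun x y => bmul (bζ _) (bP _))
    (fun x y => abs_sum_coord_mul_le (u x) fun i =>
      badd (bmul (bP1 _ _) (bζ _)) (bmul (bP _) (bζ1 _ _)))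
    (fun x y => by
      have := abs_sum_coord_mul_le (-u y) fun i => bmul (bP1 i (x - y)) (bζ x)
      rw [norm_neg] at this
      exact this.trans (dw y))
    (fun x y => by
      have := abs_sum_coord_mul_le (u x) fun i => abs_sum_coord_mul_le (-u y) fun j =>
        badd (bmul (bP2 i j (x - y)) (bζ x)) (bmul (bP1 j (x - y)) (bζ1 i x))
      rw [norm_neg] at this
      refine this.trans ?_
      -- The double sum costs one factor `2A²`, whereas `w x * w y` contains two; hence the
      -- normalisation `1 ≤ A`.
      have hAA : 1 ≤ 2 * (A * A) := by nlinarith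
      simp only [hw]
      have h0 : 0 ≤ (d : ℝ) * ‖u x‖ * (d * (2 * (A * A)) * ‖u y‖) := by positivity
      nlinarith)
    (fun y => by
      refine (hf.weak_kernel hT hu hum (hζ.mul (hPs.comp_sub_right y)) fun x => ?_).1
      rw [inner_torusGrad_eq_sum]
      refine Finset.sum_congr rfl fun i _ => ?_
      rw [torusGrad_mul hζ (hPs.comp_sub_right y), torusGrad_comp_sub_right, gP]
      ring)
    (fun y => by
      refine (hf.weak_kernel hT hu hum (TorusSmooth.sum_const_mul Finset.univ (fun j => -u y j)
        fun j => ((hP1s j).comp_sub_right y).mul hζ) fun x => ?_).2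
      rw [inner_torusGrad_eq_sum]
      refine Finset.sum_congr rfl fun i _ => ?_
      rw [torusGrad_sum_const_mul Finset.univ (fun j => -u y j)
        fun j => ((hP1s j).comp_sub_right y).mul hζ]
      congr 1
      refine Finset.sum_congr rfl fun j _ => ?_
      rw [torusGrad_mul ((hP1s j).comp_sub_right y) hζ, torusGrad_comp_sub_right, gP1])
    (fun x => by
      have hs : ∀ i, TorusSmooth fun y => P1 i (x - y) * ζ x + P (x - y) * ζ1 i x := fun i =>
        (((hP1s i).comp_sub x).mul_const _).add ((hPs.comp_sub x).mul_const _)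
      refine (hg.weak_kernel hT hu hum (TorusSmooth.sum_const_mul Finset.univ (fun i => u x i) hs)
        fun y => ?_).1
      rw [inner_torusGrad_eq_sum]
      simp only [torusGrad_sum_const_mul Finset.univ (fun i => u x i) hs, hG12, Finset.mul_sum]
      rw [Finset.sum_comm]
      refine Finset.sum_congr rfl fun i _ => Finset.sum_congr rfl fun j _ => ?_
      rw [torusGrad_add (((hP1s i).comp_sub x).mul_const _) ((hPs.comp_sub x).mul_const _),
        torusGrad_mul_const ((hP1s i).comp_sub x), torusGrad_mul_const (hPs.comp_sub x),
        torusGrad_comp_sub, torusGrad_comp_sub, gP, gP1, hP2c j i]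
      ring)
    (fun x => by
      have hs : ∀ i, TorusSmooth fun y => P1 i (x - y) * ζ x + P (x - y) * ζ1 i x := fun i =>
        (((hP1s i).comp_sub x).mul_const _).add ((hPs.comp_sub x).mul_const _)
      refine (hg.weak_kernel hT hu hum (TorusSmooth.sum_const_mul Finset.univ (fun i => u x i) hs)
        fun y => ?_).2
      rw [inner_torusGrad_eq_sum]
      simp only [torusGrad_sum_const_mul Finset.univ (fun i => u x i) hs, hG12, Finset.mul_sum]
      rw [Finset.sum_comm]
      refine Finset.sum_congr rfl fun i _ => Finset.sum_congr rfl fun j _ => ?_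
      rw [torusGrad_add (((hP1s i).comp_sub x).mul_const _) ((hPs.comp_sub x).mul_const _),
        torusGrad_mul_const ((hP1s i).comp_sub x), torusGrad_mul_const (hPs.comp_sub x),
        torusGrad_comp_sub, torusGrad_comp_sub, gP, gP1, hP2c j i]
      ring)
    (fun x => by
      have hs := (hPs.comp_sub x).mul_const (ζ x)
      have h := (hg.weak_kernel hT hu hum hs (H' := fun y => G2 x y) fun y => by
        rw [inner_torusGrad_eq_sum]
        refine Finset.sum_congr rfl fun i _ => ?_
        rw [torusGrad_mul_const (hPs.comp_sub x), torusGrad_comp_sub, gP]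
        ring).1
      simpa only [hG, mul_comm (ζ x)] using h)
  -- identification of the terms
  have hgi : ∀ t, Integrable (g t) := fun t => by
    simpa using hg.integrable_mul (H := fun _ => 1) (integrable_const 1) t
  have hbi : ∀ {b : Td d → ℝ}, Measurable b → (∀ x, |b x| ≤ K) → Integrable b := fun hm hb =>
    Integrable.of_bound hm.aestronglyMeasurable K (Filter.Eventually.of_forall hb)
  have e0 : ∀ {b : Td d → ℝ}, Integrable b → ∀ x, ∫ y, b y * G x y = ζ x * conv b p x := by
    intro b hb x
    rw [conv_eq_integral_periodise hp hpc.continuous hb, ← integral_const_mul]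
    congr 1; funext y; simp only [hG]; ring
  simp only [pairing] at key
  simp only [e0 (hbi hg.meas_zero hg₀K), e0 (hbi hg.meas_final hgTK)] at key
  rw [key]
  congr 1; funext t
  have hft : Measurable (f t) := by have := hf.meas; fun_prop
  have hgt : Measurable (g t) := by have := hg.meas; fun_prop
  have iu : ∀ i, Integrable fun x => u x i := fun i =>
    hu.norm.mono' (Measurable.aestronglyMeasurable (by fun_prop))
      (Filter.Eventually.of_forall fun x => PiLp.norm_apply_le (u x) i)
  have iF : ∀ x i, Integrable fun y => g t y * (u x i - u y i) := fun x i =>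
    hg.integrable_mul ((integrable_const _).sub (iu i)) t
  -- Each coordinate of the commutator is the convolution of `y ↦ g t y * (u x i - u y i)` with
  -- `∂ᵢp`, evaluated at the same `x` that is frozen inside.
  have e3 : ∀ x, ∫ h : E d, g t (x - proj h) * fderiv ℝ p h (u x - u (x - proj h)) =
      ∑ i, ∫ y, g t y * (u x i - u y i) * P1 i (x - y) := by
    intro x
    have h1 : ∀ i, ∫ y, g t y * (u x i - u y i) * P1 i (x - y) =
        ∫ h : E d, g t (x - proj h) * (u x i - u (x - proj h) i) * pd i p h := fun i =>
      (conv_eq_integral_periodise (hp.pd i) (contDiff_pd hpc i).continuous (iF x i) x).symm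
    simp only [h1]
    rw [← integral_finsetSum]
    · congr 1; funext h
      rw [fderiv_eq_sum_pd, Finset.mul_sum]
      refine Finset.sum_congr rfl fun i _ => ?_
      simp only [PiLp.sub_apply]; ring
    · intro i _
      exact (hp.pd i).integrable_mul (contDiff_pd hpc i).continuous ((iF x i).comp_sub_left x)
  have iP : Integrable fun y => P y := Continuous.integrable_torus hPs.continuous _
  have e4 : ∀ x, (∫ y, g t y * G1 x y) + ∫ y, g t y * G2 x y =
      conv (g t) p x * inner ℝ (u x) (torusGrad ζ x) +
        ζ x * ∫ h : E d, g t (x - proj h) * fderiv ℝ p h (u x - u (x - proj h)) := by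
    intro x
    have iPx : Integrable fun y => P (x - y) := iP.comp_sub_left x
    have iP1x : ∀ i, Integrable fun y => P1 i (x - y) := fun i =>
      (Continuous.integrable_torus (hP1s i).continuous _).comp_sub_left x
    have j1 : Integrable fun y => g t y * G1 x y :=
      hg.integrable_mul (integrable_finsetSum _ fun i _ => (((iP1x i).mul_const _).add
        (iPx.mul_const _)).const_mul _) t
    have j2 : Integrable fun y => g t y * G2 x y := by
      refine hg.integrable_mul (integrable_finsetSum _ fun i _ => ?_) t
      refine Integrable.mul_bdd (c := A * A) (iu i).neg ?_ (Filter.Eventually.of_forall fun y =>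
        bmul (bP1 i (x - y)) (bζ x))
      exact Measurable.aestronglyMeasurable (by fun_prop)
    rw [← integral_add j1 j2, e3 x, inner_torusGrad_eq_sum,
      conv_eq_integral_periodise hp hpc.continuous (hgi t), ← integral_mul_const,
      ← integral_finsetSum, ← integral_const_mul, ← integral_add]
    · congr 1; funext y
      simp only [hG1, hG2, Finset.mul_sum]
      rw [← Finset.sum_add_distrib, ← Finset.sum_add_distrib]
      refine Finset.sum_congr rfl fun i _ => ?_
      simp only [hζ1def]; ring
    · exact (hg.integrable_mul iPx t).mul_const _
    · refine Integrable.const_mul (integrable_finsetSum _ fun i _ => ?_) _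
      exact Integrable.mul_bdd (c := A) (iF x i) (Measurable.aestronglyMeasurable (by fun_prop))
        (Filter.Eventually.of_forall fun y => bP1 i (x - y))
    · intro i _
      exact Integrable.mul_bdd (c := A) (iF x i) (Measurable.aestronglyMeasurable (by fun_prop))
        (Filter.Eventually.of_forall fun y => bP1 i (x - y))
  rw [← integral_add]
  · congr 1; funext x
    rw [← mul_add, e4]
  · have := (integrable_pairing (m := (volume : Measure (Td d))) (H := G1) (w₁ := w)
      (w₂ := fun _ => 1) (K := K)
      (by simp only [hG1, Function.uncurry_def]; fun_prop) hft hgt (hu.norm.const_mul _)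
      (integrable_const 1) (fun x y => by
        rw [mul_one]
        exact abs_sum_coord_mul_le (u x) fun i =>
          badd (bmul (bP1 _ _) (bζ _)) (bmul (bP _) (bζ1 _ _)))
      (hf.bound t) (hg.bound t)).integral_prod_left
    simpa [integral_const_mul] using this
  · have := (integrable_pairing (m := (volume : Measure (Td d))) (H := G2) (w₁ := fun _ => 1)
      (w₂ := w) (K := K)
      (by simp only [hG2, Function.uncurry_def]; fun_prop) hft hgt
      (integrable_const 1) (hu.norm.const_mul _) (fun x y => by
        rw [one_mul]
        have := abs_sum_coord_mul_le (-u y) fun i => bmul (bP1 i (x - y)) (bζ x)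
        rw [norm_neg] at this
        exact this.trans (dw y))
      (hf.bound t) (hg.bound t)).integral_prod_left
    simpa [integral_const_mul] using this

end

end BVTransport

namespace BVTransport

variable {d : ℕ}

/-! ### Increments of functions of bounded variation -/

lemma tendsto_conv_approxId {F : Td d → ℝ} (hF : Continuous F) (x : Td d) :
    Filter.Tendsto (fun n => conv F (approxId d n) x) Filter.atTop (𝓝 (F x)) := by
  obtain ⟨v, rfl⟩ := proj_surjective x
  simp_rw [conv_proj]
  exact ContDiffBump.convolution_tendsto_right_of_continuous tendsto_bump_rOut
    (hF.comp continuous_proj) v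

lemma abs_conv_le {F : Td d → ℝ} {C : ℝ} (hC : ∀ x, |F x| ≤ C) {k : E d → ℝ}
    (hk : Integrable k) (x : Td d) : |conv F k x| ≤ C * ∫ h, |k h| := by
  rw [← integral_const_mul, ← Real.norm_eq_abs]
  refine norm_integral_le_of_norm_le (hk.abs.const_mul C) (Filter.Eventually.of_forall fun h => ?_)
  rw [Real.norm_eq_abs, abs_mul]
  exact mul_le_mul_of_nonneg_right (hC _) (abs_nonneg _)

lemma SuppBall.integrable {k : E d → ℝ} {R : ℝ} (hk : SuppBall k R) (hc : Continuous k) :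
    Integrable k := hc.integrable_of_hasCompactSupport hk.hasCompactSupport

lemma abs_conv_approxId_le {F : Td d → ℝ} {C : ℝ} (hC : ∀ x, |F x| ≤ C) (n : ℕ) (x : Td d) :
    |conv F (approxId d n) x| ≤ C := by
  have := abs_conv_le hC ((suppBall_approxId n).integrable (contDiff_approxId n).continuous) x
  simpa [abs_of_nonneg (approxId_nonneg n _), integral_approxId] using this

lemma integral_withDensity_ofReal {X : Type*} [MeasurableSpace X] {m : Measure X} {r F : X → ℝ}
    (hr : Integrable r m) :
    ∫ x, F x ∂m.withDensity (fun x => ENNReal.ofReal (r x)) = ∫ x, max (r x) 0 * F x ∂m := by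
  rw [integral_withDensity_eq_integral_toReal_smul₀ hr.1.aemeasurable.ennreal_ofReal
    (Filter.Eventually.of_forall fun x => ENNReal.ofReal_lt_top)]
  simp [ENNReal.toReal_ofReal']

lemma integral_mul_eq_sub_withDensity {X : Type*} [MeasurableSpace X] {m : Measure X}
    {r F : X → ℝ} (hr : Integrable r m) (hF : Measurable F) {C : ℝ} (hC : ∀ x, |F x| ≤ C) :
    ∫ x, F x * r x ∂m = (∫ x, F x ∂m.withDensity fun x => ENNReal.ofReal (r x)) -
      ∫ x, F x ∂m.withDensity fun x => ENNReal.ofReal ((-r) x) := by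
  rw [integral_withDensity_ofReal hr, integral_withDensity_ofReal hr.neg, ← integral_sub]
  · congr 1; funext z
    simp only [Pi.neg_apply]
    rcases le_total (r z) 0 with h | h
    · rw [max_eq_right h, max_eq_left (by linarith)]; ring
    · rw [max_eq_left h, max_eq_right (by linarith)]; ring
  · exact hr.pos_part.mul_bdd (c := C) hF.aestronglyMeasurable (Filter.Eventually.of_forall hC)
  · exact hr.neg.pos_part.mul_bdd (c := C) hF.aestronglyMeasurable
      (Filter.Eventually.of_forall hC)

/-- Two signed measures that agree on continuous functions agree on bounded Borel functions. -/
lemma integral_eq_of_forall_continuous {X Y : Type*} [TopologicalSpace X] [MeasurableSpace X]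
    [BorelSpace X] [HasOuterApproxClosed X] [MeasurableSpace Y] {m : Measure X} {m' : Measure Y}
    {Θ : Y → X} (hΘ : Measurable Θ) {r : X → ℝ} {q : Y → ℝ} (hr : Integrable r m)
    (hq : Integrable q m')
    (h : ∀ F : BoundedContinuousFunction X ℝ, ∫ x, F x * r x ∂m = ∫ y, F (Θ y) * q y ∂m')
    {F : X → ℝ} (hF : Measurable F) {C : ℝ} (hC : ∀ x, |F x| ≤ C) :
    ∫ x, F x * r x ∂m = ∫ y, F (Θ y) * q y ∂m' := by
  have f1 := isFiniteMeasure_withDensity_ofReal hr.2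
  have f2 := isFiniteMeasure_withDensity_ofReal hr.neg.2
  have f3 := isFiniteMeasure_withDensity_ofReal hq.2
  have f4 := isFiniteMeasure_withDensity_ofReal hq.neg.2
  set r1 := m.withDensity fun x => ENNReal.ofReal (r x) with hr1
  set r2 := m.withDensity fun x => ENNReal.ofReal ((-r) x) with hr2
  set q1 := (m'.withDensity fun x => ENNReal.ofReal (q x)) with hq1
  set q2 := (m'.withDensity fun x => ENNReal.ofReal ((-q) x)) with hq2
  -- The negative parts are moved to the opposite sides, so that the comparison is between finite
  -- positive measures, which bounded continuous functions determine.
  have key : ∀ {G : X → ℝ} {C : ℝ}, Measurable G → (∀ x, |G x| ≤ C) →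
      (∫ x, G x ∂(r1 + q2.map Θ)) - ∫ x, G x ∂(q1.map Θ + r2) =
        (∫ x, G x * r x ∂m) - ∫ y, G (Θ y) * q y ∂m' := by
    intro G C hG hGC
    have bi : ∀ {n : Measure X} [IsFiniteMeasure n], Integrable G n := fun {n} _ =>
      Integrable.of_bound hG.aestronglyMeasurable C (Filter.Eventually.of_forall hGC)
    rw [integral_add_measure bi bi, integral_add_measure bi bi,
      integral_map hΘ.aemeasurable hG.aestronglyMeasurable,
      integral_map hΘ.aemeasurable hG.aestronglyMeasurable,
      integral_mul_eq_sub_withDensity hr hG hGC,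
      integral_mul_eq_sub_withDensity (F := fun y => G (Θ y)) hq (hG.comp hΘ) fun y => hGC (Θ y)]
    ring
  have heq : r1 + q2.map Θ = q1.map Θ + r2 := by
    refine ext_of_forall_integral_eq_of_IsFiniteMeasure fun G => ?_
    have := key G.continuous.measurable fun x => G.norm_coe_le_norm x
    rw [h G, sub_self] at this
    exact sub_eq_zero.1 this
  have := key hF hC
  rw [heq, sub_self] at this
  exact (sub_eq_zero.1 this.symm)

section
variable {u : Td d → E d} {μ : Measure (Td d)} {σ : Td d → Matrix (Fin d) (Fin d) ℝ}

lemma abs_entry_le_frob (A : Matrix (Fin d) (Fin d) ℝ) (i j : Fin d) : |A i j| ≤ frob A := by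
  refine Real.abs_le_sqrt ?_
  calc A i j ^ 2 ≤ ∑ j, A i j ^ 2 :=
        Finset.single_le_sum (f := fun j => A i j ^ 2) (fun j _ => sq_nonneg _) (Finset.mem_univ j)
    _ ≤ ∑ i, ∑ j, A i j ^ 2 :=
        Finset.single_le_sum (f := fun i => ∑ j, A i j ^ 2)
          (fun i _ => Finset.sum_nonneg fun j _ => sq_nonneg _) (Finset.mem_univ i)

lemma IsBVWithGradient.ae_abs_le (h : IsBVWithGradient u μ σ) (i j : Fin d) :
    ∀ᵐ x ∂μ, |σ x i j| ≤ 1 := by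
  filter_upwards [h.unit] with x hx
  exact (abs_entry_le_frob _ i j).trans hx.le

lemma IsBVWithGradient.integrable_entry (h : IsBVWithGradient u μ σ) (i j : Fin d) :
    Integrable (fun x => σ x i j) μ := by
  have := h.finite
  exact Integrable.of_bound (h.measurable i j).aestronglyMeasurable 1 (h.ae_abs_le i j)

lemma IsBVWithGradient.integrable_coord (h : IsBVWithGradient u μ σ) (j : Fin d) :
    Integrable fun x => u x j :=
  (h.integrable.norm).mono' ((EuclideanSpace.proj (𝕜 := ℝ) j).continuous.comp_aestronglyMeasurable
    h.integrable.1) (Filter.Eventually.of_forall fun x => PiLp.norm_apply_le (u x) j)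

/-- The shift is moved onto `F`, whose increment is an integral of its gradient along the segment;
the definition of `∇u` is then applied to each translate of `F`. -/
lemma IsBVWithGradient.increment_smooth (h : IsBVWithGradient u μ σ) {F : Td d → ℝ}
    (hF : TorusSmooth F) (a : E d) (j : Fin d) :
    ∫ x, F x * (u x j - u (x - proj a) j) =
      ∫ s in Set.Icc (0 : ℝ) 1, ∫ y, F (y + proj (s • a)) * ∑ i, a i * σ y i j ∂μ := by
  have := h.finite
  have huj := h.integrable_coord j
  obtain ⟨C, hC0, hC⟩ := Continuous.exists_bound_torus hF.continuous
  have mF := hF.continuous.measurable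
  have e1 : ∫ x, F x * (u x j - u (x - proj a) j) =
      -∫ x, u x j * (F (x + proj a) - F x) := by
    have i1 : Integrable fun x => F x * u x j :=
      huj.bdd_mul (c := C) mF.aestronglyMeasurable (Filter.Eventually.of_forall hC)
    have i2 : Integrable fun x => F (x + proj a) * u x j :=
      huj.bdd_mul (c := C) (Measurable.aestronglyMeasurable (by fun_prop))
        (Filter.Eventually.of_forall fun x => hC _)
    have i3 : Integrable fun x => F x * u (x - proj a) j := by
      simpa using i2.comp_sub_right (proj a)
    have i4 : ∫ x, F x * u (x - proj a) j = ∫ x, F (x + proj a) * u x j := by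
      have := integral_sub_right_eq_self (μ := (volume : Measure (Td d)))
        (fun x => F (x + proj a) * u x j) (proj a)
      simpa using this
    simp_rw [mul_sub]
    rw [integral_sub i1 i3, i4, integral_sub]
    · simp_rw [mul_comm (u _ j)]; ring
    · simpa only [mul_comm] using i2
    · simpa only [mul_comm] using i1
  have hs : ∀ s : ℝ, TorusSmooth fun x => F (x + proj (s • a)) := by
    intro s
    have := hF.comp_sub_right (-proj (s • a))
    simpa using this
  have hsg : ∀ (s : ℝ) x, torusGrad (fun x => F (x + proj (s • a))) x =
      torusGrad F (x + proj (s • a)) := by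
    intro s x
    have := torusGrad_comp_sub_right F x (-proj (s • a))
    simpa using this
  have cg := hF.continuous_torusGrad
  obtain ⟨C', hC'0, hC'⟩ := Continuous.exists_bound_torus
    (ψ := fun x => inner ℝ a (torusGrad F x)) (by fun_prop)
  have hint : Integrable (Function.uncurry fun (x : Td d) (s : ℝ) =>
      u x j * inner ℝ a (torusGrad F (x + proj (s • a))))
      (volume.prod (volume.restrict (Set.Icc (0 : ℝ) 1))) := by
    have hu' := huj.comp_fst (volume.restrict (Set.Icc (0 : ℝ) 1))
    refine hu'.mul_bdd (c := C') ?_ (Filter.Eventually.of_forall fun p => hC' _)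
    exact Continuous.aestronglyMeasurable (by fun_prop)
  rw [e1]
  simp_rw [hF.sub_eq_integral, ← integral_const_mul]
  rw [integral_integral_swap hint, ← integral_neg]
  congr 1; funext s
  have e2 : ∀ i, ∫ x, u x j * torusGrad F (x + proj (s • a)) i =
      -∫ x, F (x + proj (s • a)) * σ x i j ∂μ := fun i => by
    rw [← h.grad _ (hs s) i j]; simp only [hsg]
  have iu : ∀ i, Integrable fun x => u x j * torusGrad F (x + proj (s • a)) i := by
    intro i
    obtain ⟨D, _, hD⟩ := Continuous.exists_bound_torus (hF.torusGrad i).continuous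
    have := (hF.torusGrad i).continuous.measurable
    exact huj.mul_bdd (c := D) (Measurable.aestronglyMeasurable (by fun_prop))
      (Filter.Eventually.of_forall fun x => hD _)
  have iσ : ∀ i, Integrable (fun x => F (x + proj (s • a)) * σ x i j) μ := fun i =>
    (h.integrable_entry i j).bdd_mul (c := C) (Measurable.aestronglyMeasurable (by fun_prop))
      (Filter.Eventually.of_forall fun x => hC _)
  simp_rw [inner_torusGrad_eq_sum, Finset.mul_sum]
  rw [integral_finsetSum, integral_finsetSum, ← Finset.sum_neg_distrib]
  · refine Finset.sum_congr rfl fun i _ => ?_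
    have e3 : ∀ x, u x j * (a i * torusGrad F (x + proj (s • a)) i) =
      a i * (u x j * torusGrad F (x + proj (s • a)) i) := fun x => by ring
    have e4 : ∀ x, F (x + proj (s • a)) * (a i * σ x i j) =
      a i * (F (x + proj (s • a)) * σ x i j) := fun x => by ring
    simp_rw [e3, e4, integral_const_mul, e2]
    ring
  · intro i _
    have := (iσ i).const_mul (a i)
    refine this.congr (Filter.Eventually.of_forall fun x => ?_)
    ring
  · intro i _
    have := (iu i).const_mul (a i)
    refine this.congr (Filter.Eventually.of_forall fun x => ?_)
    ring

/-- Increments of a function of bounded variation, tested with a bounded Borel function. -/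
theorem IsBVWithGradient.increment (h : IsBVWithGradient u μ σ) {F : Td d → ℝ}
    (hF : Measurable F) {C : ℝ} (hC : ∀ x, |F x| ≤ C) (a : E d) (j : Fin d) :
    ∫ x, F x * (u x j - u (x - proj a) j) =
      ∫ s in Set.Icc (0 : ℝ) 1, ∫ y, F (y + proj (s • a)) * ∑ i, a i * σ y i j ∂μ := by
  have := h.finite
  have huj := h.integrable_coord j
  have hr : Integrable fun x => u x j - u (x - proj a) j := huj.sub (huj.comp_sub_right (proj a))
  have hq' : Integrable (fun y => ∑ i, a i * σ y i j) μ :=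
    integrable_finsetSum _ fun i _ => (h.integrable_entry i j).const_mul _
  have hq : Integrable (fun p : ℝ × Td d => ∑ i, a i * σ p.2 i j)
      ((volume.restrict (Set.Icc (0 : ℝ) 1)).prod μ) := hq'.comp_snd _
  have hΘ : Measurable fun p : ℝ × Td d => p.2 + proj (p.1 • a) := by fun_prop
  have fub : ∀ {G : Td d → ℝ} {C : ℝ}, Measurable G → (∀ x, |G x| ≤ C) →
      ∫ p : ℝ × Td d, G (p.2 + proj (p.1 • a)) * ∑ i, a i * σ p.2 i j
        ∂((volume.restrict (Set.Icc (0 : ℝ) 1)).prod μ) =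
      ∫ s in Set.Icc (0 : ℝ) 1, ∫ y, G (y + proj (s • a)) * ∑ i, a i * σ y i j ∂μ := by
    intro G C hG hGC
    rw [integral_prod]
    exact hq.bdd_mul (c := C) (hG.comp hΘ).aestronglyMeasurable
      (Filter.Eventually.of_forall fun p => hGC _)
  rw [← fub hF hC]
  -- Both sides are signed measures tested with `F`, the right one an image under `(s, y) ↦ y + s
  -- a`. They agree on mollified, hence on continuous `F`. An almost-everywhere approximation of a
  -- Borel `F` would not do, since `μ` may be singular.
  refine integral_eq_of_forall_continuous (m' := (volume.restrict (Set.Icc (0 : ℝ) 1)).prod μ)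
    hΘ hr hq (fun G => ?_) hF hC
  have hGi : Integrable (fun x => G x) := Continuous.integrable_torus G.continuous volume
  have hb := fun x => G.norm_coe_le_norm x
  have hs := fun n => (suppBall_approxId n).torusSmooth_conv (contDiff_approxId n) hGi
  have hbn := fun n x => abs_conv_approxId_le hb n x
  have l1 : Filter.Tendsto (fun n => ∫ x, conv G (approxId d n) x * (u x j - u (x - proj a) j))
      Filter.atTop (𝓝 (∫ x, G x * (u x j - u (x - proj a) j))) := by
    refine tendsto_integral_of_dominated_convergence
      (fun x => ‖G‖ * |u x j - u (x - proj a) j|)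
      (fun n => (hs n).continuous.aestronglyMeasurable.mul hr.1)
      (hr.abs.const_mul _) (fun n => Filter.Eventually.of_forall fun x => ?_)
      (Filter.Eventually.of_forall fun x => ?_)
    · rw [Real.norm_eq_abs, abs_mul]
      exact mul_le_mul_of_nonneg_right (hbn n x) (abs_nonneg _)
    · exact (tendsto_conv_approxId G.continuous x).mul_const _
  have l2 : Filter.Tendsto (fun n => ∫ p : ℝ × Td d, conv G (approxId d n)
      (p.2 + proj (p.1 • a)) * ∑ i, a i * σ p.2 i j ∂((volume.restrict (Set.Icc (0 : ℝ) 1)).prod μ))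
      Filter.atTop (𝓝 (∫ p : ℝ × Td d, G (p.2 + proj (p.1 • a)) * ∑ i, a i * σ p.2 i j
        ∂((volume.restrict (Set.Icc (0 : ℝ) 1)).prod μ))) := by
    refine tendsto_integral_of_dominated_convergence
      (fun p => ‖G‖ * |∑ i, a i * σ p.2 i j|)
      (fun n => ((hs n).continuous.measurable.comp hΘ).aestronglyMeasurable.mul hq.1)
      (hq.abs.const_mul _) (fun n => Filter.Eventually.of_forall fun x => ?_)
      (Filter.Eventually.of_forall fun x => ?_)
    · rw [Real.norm_eq_abs, abs_mul]
      exact mul_le_mul_of_nonneg_right (hbn n _) (abs_nonneg _)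
    · exact (tendsto_conv_approxId G.continuous _).mul_const _
  refine tendsto_nhds_unique l1 (l2.congr fun n => ?_)
  rw [h.increment_smooth (hs n), fub (hs n).continuous.measurable (hbn n)]

end

end BVTransport

namespace BVTransport

variable {d : ℕ}

/-! ### The exponential flow of a matrix -/

/-- The linear map `h ↦ Mᵀ h`. -/
noncomputable def opT (M : Matrix (Fin d) (Fin d) ℝ) : E d →L[ℝ] E d := toEuclideanCLM (𝕜 := ℝ) Mᵀ

/-- The flow `exp(-l L)`. -/
noncomputable def flow (L : E d →L[ℝ] E d) (l : ℝ) : E d →L[ℝ] E d := NormedSpace.exp (-(l • L))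

lemma continuous_flow : Continuous fun p : (E d →L[ℝ] E d) × ℝ => flow p.1 p.2 := by
  let _ : NormedAlgebra ℚ (E d →L[ℝ] E d) := NormedAlgebra.restrictScalars ℚ ℝ _
  exact NormedSpace.exp_continuous.comp (by fun_prop)

@[simp] lemma flow_zero (L : E d →L[ℝ] E d) : flow L 0 = 1 := by
  have : (0 : ℝ) • L = 0 := by ext; simp
  rw [flow, this, neg_zero, NormedSpace.exp_zero]

lemma flow_add (L : E d →L[ℝ] E d) (a b : ℝ) : flow L (a + b) = flow L a * flow L b := by
  let _ : NormedAlgebra ℚ (E d →L[ℝ] E d) := NormedAlgebra.restrictScalars ℚ ℝ _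
  unfold flow
  rw [← NormedSpace.exp_add_of_commute]
  · congr 1; module
  · have : Commute (a • L) (b • L) := by
      ext h : 1
      simp [smul_comm a b]
    exact this.neg_left.neg_right

lemma hasDerivAt_flow (L : E d →L[ℝ] E d) (l : ℝ) :
    HasDerivAt (flow L) (-(flow L l * L)) l := by
  have := hasDerivAt_exp_smul_const (𝕂 := ℝ) (-L) l
  simp only [smul_neg] at this
  refine (show HasDerivAt (flow L) (flow L l * -L) l from this).congr_deriv ?_
  ext h
  simp

lemma norm_exp_clm_le (L : E d →L[ℝ] E d) : ‖NormedSpace.exp L‖ ≤ Real.exp ‖L‖ := by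
  rw [NormedSpace.exp_eq_tsum ℝ, Real.exp_eq_exp_ℝ]
  refine tsum_of_norm_bounded (NormedSpace.exp_series_hasSum_exp' (𝕂 := ℝ) ‖L‖) fun n => ?_
  rw [norm_smul, smul_eq_mul, Real.norm_of_nonneg (by positivity)]
  gcongr
  -- The power `0` is separate: the identity has norm at most `1`, with equality only in positive
  -- dimension.
  rcases Nat.eq_zero_or_pos n with rfl | hn
  · rw [pow_zero, pow_zero]
    exact ContinuousLinearMap.norm_id_le
  · exact norm_pow_le' L hn

lemma norm_flow_le {L : E d →L[ℝ] E d} (hL : ‖L‖ ≤ 1) (l : ℝ) : ‖flow L l‖ ≤ Real.exp |l| := by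
  refine (norm_exp_clm_le _).trans (Real.exp_le_exp.2 ?_)
  rw [norm_neg, norm_smul, Real.norm_eq_abs]
  exact mul_le_of_le_one_right (abs_nonneg _) hL

/-- The backward flow inverts the forward one and has norm at most `e^Λ`. This lower bound confines
the support of the Alberti kernel. -/
lemma norm_le_exp_mul_norm_flow {L : E d →L[ℝ] E d} (hL : ‖L‖ ≤ 1) {l Λ : ℝ} (hl : 0 ≤ l)
    (hlΛ : l ≤ Λ) (h : E d) : ‖h‖ ≤ Real.exp Λ * ‖flow L l h‖ := by
  have h1 : h = flow L (-l) (flow L l h) := by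
    have := flow_add L (-l) l
    rw [neg_add_cancel, flow_zero] at this
    have := congrArg (fun A : E d →L[ℝ] E d => A h) this
    simpa using this
  calc ‖h‖ = ‖flow L (-l) (flow L l h)‖ := by rw [← h1]
    _ ≤ ‖flow L (-l)‖ * ‖flow L l h‖ := (flow L (-l)).le_opNorm _
    _ ≤ Real.exp Λ * ‖flow L l h‖ := by
        gcongr
        refine (norm_flow_le hL _).trans (Real.exp_le_exp.2 ?_)
        rwa [abs_neg, abs_of_nonneg hl]

lemma continuous_opT : Continuous (opT (d := d)) := by
  have : Continuous fun M : Matrix (Fin d) (Fin d) ℝ => toEuclideanCLM (𝕜 := ℝ) M :=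
    LinearMap.continuous_of_finiteDimensional
      (toEuclideanCLM (n := Fin d) (𝕜 := ℝ)).toAlgEquiv.toLinearMap
  exact this.comp (by fun_prop)

/-- Passing from matrices to operators is a continuous ring homomorphism, hence commutes with the
exponential; the operator form gives access to the Euclidean operator norm. -/
lemma flow_opT_apply (M : Matrix (Fin d) (Fin d) ℝ) (l : ℝ) (h : E d) :
    flow (opT M) l h = WithLp.toLp 2 (NormedSpace.exp (-(l • Mᵀ)) *ᵥ WithLp.ofLp h) := by
  have h1 : toEuclideanCLM (𝕜 := ℝ) (NormedSpace.exp (-(l • Mᵀ))) = flow (opT M) l := by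
    let _ : SeminormedRing (Matrix (Fin d) (Fin d) ℝ) := Matrix.linftyOpSemiNormedRing
    let _ : NormedRing (Matrix (Fin d) (Fin d) ℝ) := Matrix.linftyOpNormedRing
    let _ : NormedAlgebra ℝ (Matrix (Fin d) (Fin d) ℝ) := Matrix.linftyOpNormedAlgebra
    let _ : NormedAlgebra ℚ (Matrix (Fin d) (Fin d) ℝ) := Matrix.linftyOpNormedAlgebra
    let φ : Matrix (Fin d) (Fin d) ℝ →+* (E d →L[ℝ] E d) :=
      (toEuclideanCLM (n := Fin d) (𝕜 := ℝ)).toAlgEquiv.toAlgHom.toRingHom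
    have hφ : Continuous φ := LinearMap.continuous_of_finiteDimensional
      (toEuclideanCLM (n := Fin d) (𝕜 := ℝ)).toAlgEquiv.toLinearMap
    have := NormedSpace.map_exp φ hφ (-(l • Mᵀ))
    refine this.trans ?_
    unfold flow opT
    congr 1
    change toEuclideanCLM (𝕜 := ℝ) (-(l • Mᵀ)) = _
    rw [map_neg, map_smul]
  rw [← h1]
  rfl

lemma norm_opT_le (M : Matrix (Fin d) (Fin d) ℝ) : ‖opT M‖ ≤ frob M := by
  refine ContinuousLinearMap.opNorm_le_bound _ (Real.sqrt_nonneg _) fun h => ?_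
  have h1 : ∀ j, (opT M h) j = ∑ i, M i j * h i := fun j => rfl
  rw [EuclideanSpace.norm_eq, EuclideanSpace.norm_eq, frob, ← Real.sqrt_mul (by positivity)]
  refine Real.sqrt_le_sqrt ?_
  simp only [h1, Real.norm_eq_abs, sq_abs]
  rw [Finset.sum_comm, Finset.sum_mul]
  exact Finset.sum_le_sum fun j _ => Finset.sum_mul_sq_le_sq_mul_sq _ _ _

lemma contract_eq (a : E d) (A : Matrix (Fin d) (Fin d) ℝ) (b : E d) :
    contract a A b = inner ℝ (opT A a) b := by
  have h1 : ∀ j, (opT A a) j = ∑ i, A i j * a i := fun j => rfl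
  rw [PiLp.inner_apply, contract, Finset.sum_comm]
  refine Finset.sum_congr rfl fun j _ => ?_
  simp only [h1, RCLike.inner_apply, conj_trivial, Finset.mul_sum]
  refine Finset.sum_congr rfl fun i _ => ?_
  ring

/-! ### Determinant of the flow -/

/-- The curves `exp(l A)` and `1 + l A` have the same tangent at `l = 0`, and `det(1 + l A) = 1 + l
tr A + O(l²)`. So `det exp(l A)` has derivative zero at `0`, and by multiplicativity at every `l`.
-/
lemma det_exp_smul_of_trace_eq_zero (A : Matrix (Fin d) (Fin d) ℝ) (hA : A.trace = 0) (l : ℝ) :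
    (NormedSpace.exp (l • A)).det = 1 := by
  let _ : SeminormedRing (Matrix (Fin d) (Fin d) ℝ) := Matrix.linftyOpSemiNormedRing
  let _ : NormedRing (Matrix (Fin d) (Fin d) ℝ) := Matrix.linftyOpNormedRing
  let _ : NormedAlgebra ℝ (Matrix (Fin d) (Fin d) ℝ) := Matrix.linftyOpNormedAlgebra
  let _ : NormedAlgebra ℚ (Matrix (Fin d) (Fin d) ℝ) := Matrix.linftyOpNormedAlgebra
  have hcurve := hasDerivAt_exp_smul_const (𝕂 := ℝ) A 0
  simp only [zero_smul, NormedSpace.exp_zero, one_mul] at hcurve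
  -- The Leibniz formula exhibits the determinant as a polynomial in the entries, so it is
  -- differentiable and only the tangent of a curve matters.
  let D : (Fin d → Fin d → ℝ) → ℝ := fun m => ∑ τ : Equiv.Perm (Fin d),
    ((Equiv.Perm.sign τ : ℤ) : ℝ) * ∏ i, m (τ i) i
  have hD : ∀ m : Matrix (Fin d) (Fin d) ℝ, m.det = D fun i j => m i j := fun m =>
    Matrix.det_apply' m
  have hDd : Differentiable ℝ D := by
    intro m
    refine DifferentiableAt.fun_sum fun τ _ => ?_
    refine DifferentiableAt.const_mul ?_ _
    have : ContDiff ℝ 1 fun m : Fin d → Fin d → ℝ => ∏ i, m (τ i) i :=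
      contDiff_prod fun i _ => by fun_prop
    exact this.differentiable one_ne_zero m
  have hent : HasDerivAt (fun (l : ℝ) (i j : Fin d) => NormedSpace.exp (l • A) i j)
      (fun i j => A i j) 0 := by
    refine hasDerivAt_pi.2 fun i => hasDerivAt_pi.2 fun j => ?_
    let e : Matrix (Fin d) (Fin d) ℝ →L[ℝ] ℝ := LinearMap.toContinuousLinearMap
      (Matrix.entryLinearMap ℝ ℝ i j)
    exact e.hasFDerivAt.comp_hasDerivAt 0 hcurve
  have hlin : HasDerivAt (fun (l : ℝ) (i j : Fin d) => (1 + l • A) i j)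
      (fun i j => A i j) 0 := by
    refine hasDerivAt_pi.2 fun i => hasDerivAt_pi.2 fun j => ?_
    simpa using ((hasDerivAt_id (0 : ℝ)).mul_const (A i j)).const_add ((1 : Matrix _ _ ℝ) i j)
  have h1 : HasDerivAt (fun l : ℝ => (1 + l • A).det) 0 0 := by
    rw [show (fun l : ℝ => (1 + l • A).det) = _ from
      funext fun l => Matrix.det_one_add_smul l A]
    simp only [hA]
    have hp := (Polynomial.differentiable
      (Matrix.det (1 + (Polynomial.X : Polynomial ℝ) • A.map Polynomial.C)).divX.divX
      (0 : ℝ)).hasDerivAt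
    have := (hp.mul ((hasDerivAt_id (0 : ℝ)).pow 2)).const_add (1 + 0 : ℝ)
    simpa using this
  have z1 : (fun i j => NormedSpace.exp ((0 : ℝ) • A) i j) = fun i j => (1 : Matrix _ _ ℝ) i j := by
    simp
  have z2 : (fun i j => (1 + (0 : ℝ) • A) i j) = fun i j => (1 : Matrix _ _ ℝ) i j := by
    simp
  have h2 : HasDerivAt (fun l : ℝ => (1 + l • A).det)
      (fderiv ℝ D (fun i j => (1 : Matrix _ _ ℝ) i j) fun i j => A i j) 0 := by
    simp_rw [hD]
    have := (hDd fun i j => (1 + (0 : ℝ) • A) i j).hasFDerivAt.comp_hasDerivAt 0 hlin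
    rw [z2] at this
    exact this
  -- By `h1` and `h2` the derivative of `D` at the identity in the direction `A` is zero, which the
  -- chain rule transfers to the exponential curve.
  have h3 : HasDerivAt (fun l : ℝ => (NormedSpace.exp (l • A)).det) 0 0 := by
    have := (hDd fun i j => NormedSpace.exp ((0 : ℝ) • A) i j).hasFDerivAt.comp_hasDerivAt 0 hent
    rw [z1, h2.unique h1] at this
    simp_rw [hD]
    exact this
  have hmul : ∀ a b : ℝ, (NormedSpace.exp ((a + b) • A)).det =
      (NormedSpace.exp (a • A)).det * (NormedSpace.exp (b • A)).det := by
    intro a b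
    rw [add_smul, Matrix.exp_add_of_commute _ _
      (((Commute.refl A).smul_left a).smul_right b), Matrix.det_mul]
  have h4 : ∀ a : ℝ, HasDerivAt (fun l : ℝ => (NormedSpace.exp (l • A)).det) 0 a := by
    intro a
    have h5 : HasDerivAt (fun l : ℝ => (NormedSpace.exp ((l - a) • A)).det) 0 a := by
      have h3' : HasDerivAt (fun l : ℝ => (NormedSpace.exp (l • A)).det) 0 (a - a) := by
        rwa [sub_self]
      exact h3'.comp_sub_const a a
    have h6 := h5.const_mul (NormedSpace.exp (a • A)).det
    rw [mul_zero] at h6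
    refine h6.congr_of_eventuallyEq (Filter.Eventually.of_forall fun l => ?_)
    simp only [← hmul, add_sub_cancel]
  have h7 := is_const_of_deriv_eq_zero (fun a => (h4 a).differentiableAt)
    (fun a => (h4 a).deriv) l 0
  simpa using h7

lemma det_flow_opT {M : Matrix (Fin d) (Fin d) ℝ} (hM : M.trace = 0) (l : ℝ) :
    LinearMap.det (flow (opT M) l : E d →ₗ[ℝ] E d) = 1 := by
  have h1 : (flow (opT M) l : E d →ₗ[ℝ] E d) =
      Matrix.toLpLin 2 2 (NormedSpace.exp (-(l • Mᵀ))) := by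
    ext h : 1
    exact flow_opT_apply M l h
  have h2 := det_exp_smul_of_trace_eq_zero Mᵀ (by simpa using hM) (-l)
  rw [neg_smul] at h2
  rw [h1, ← h2, Matrix.toLpLin_eq_toLin, LinearMap.det_toLin]

lemma measurePreserving_flow {M : Matrix (Fin d) (Fin d) ℝ} (hM : M.trace = 0) (l : ℝ) :
    MeasurePreserving (flow (opT M) l) (volume : Measure (E d)) volume := by
  have hdet := det_flow_opT hM l
  have hmap := Measure.map_linearMap_addHaar_eq_smul_addHaar (volume : Measure (E d))
    (f := (flow (opT M) l : E d →ₗ[ℝ] E d)) (by rw [hdet]; exact one_ne_zero)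
  rw [hdet] at hmap
  simp only [inv_one, abs_one, ENNReal.ofReal_one, one_smul] at hmap
  exact ⟨(flow (opT M) l).continuous.measurable, hmap⟩

lemma measurableEmbedding_flow (M : Matrix (Fin d) (Fin d) ℝ) (l : ℝ) :
    MeasurableEmbedding (flow (opT M) l) := by
  have hinj : Function.LeftInverse (flow (opT M) (-l)) (flow (opT M) l) := fun h => by
    have := flow_add (opT M) (-l) l
    rw [neg_add_cancel, flow_zero] at this
    exact (congrArg (fun A : E d →L[ℝ] E d => A h) this).symm
  exact (flow (opT M) l).continuous.measurableEmbedding hinj.injective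

lemma integral_comp_flow {M : Matrix (Fin d) (Fin d) ℝ} (hM : M.trace = 0) (l : ℝ) (f : E d → ℝ) :
    ∫ h, f (flow (opT M) l h) = ∫ h, f h :=
  (measurePreserving_flow hM l).integral_comp (measurableEmbedding_flow M l) f

end BVTransport

namespace BVTransport

variable {d : ℕ}

/-! ### Smoothness of parametric integrals -/

lemma hasFDerivAt_intervalIntegral_of_contDiff {F : Type} [NormedAddCommGroup F] [NormedSpace ℝ F]
    [CompleteSpace F] {g : E d → ℝ → F} (hg : ContDiff ℝ 1 (Function.uncurry g)) (a b : ℝ) (x : E d) :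
    HasFDerivAt (fun x => ∫ l in a..b, g x l)
      (∫ l in a..b, (fderiv ℝ (Function.uncurry g) (x, l)).comp (ContinuousLinearMap.inl ℝ (E d) ℝ)) x := by
  have hc : Continuous fun p : E d × ℝ =>
      (fderiv ℝ (Function.uncurry g) p).comp (ContinuousLinearMap.inl ℝ (E d) ℝ) :=
    (hg.continuous_fderiv one_ne_zero).clm_comp continuous_const
  obtain ⟨B, hB⟩ := ((isCompact_closedBall x 1).prod (isCompact_uIcc (a := a) (b := b))).exists_bound_of_continuousOn
    hc.continuousOn
  refine intervalIntegral.hasFDerivAt_integral_of_dominated_of_fderiv_le (bound := fun _ => B)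
    (F' := fun x l => (fderiv ℝ (Function.uncurry g) (x, l)).comp (ContinuousLinearMap.inl ℝ (E d) ℝ))
    (Metric.closedBall_mem_nhds x one_pos) ?_ ?_ ?_ ?_ ?_ ?_
  · refine Filter.Eventually.of_forall fun y => Continuous.aestronglyMeasurable ?_
    exact hg.continuous.comp (by fun_prop : Continuous fun l : ℝ => (y, l))
  · exact (hg.continuous.comp (by fun_prop : Continuous fun l : ℝ => (x, l))).intervalIntegrable _ _
  · exact (hc.comp (by fun_prop : Continuous fun l : ℝ => (x, l))).aestronglyMeasurable
  · exact Filter.Eventually.of_forall fun l hl y hy => hB (y, l) ⟨hy, Set.uIoc_subset_uIcc hl⟩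
  · exact intervalIntegrable_const
  · refine Filter.Eventually.of_forall fun l _ y _ => ?_
    have h1 := (hg.differentiable one_ne_zero (y, l)).hasFDerivAt
    have h2 : HasFDerivAt (fun y : E d => (y, l)) (ContinuousLinearMap.inl ℝ (E d) ℝ) y :=
      hasFDerivAt_prodMk_left y l
    exact h1.comp y h2

/-- The derivative is again a parametric integral, with values in a space of linear maps, so the
induction has to range over all target spaces. -/
lemma contDiff_intervalIntegral_of_contDiff (n : ℕ) : ∀ {F : Type} [NormedAddCommGroup F]
    [NormedSpace ℝ F] [CompleteSpace F] {g : E d → ℝ → F},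
    ContDiff ℝ ∞ (Function.uncurry g) → ∀ a b : ℝ, ContDiff ℝ n fun x => ∫ l in a..b, g x l := by
  induction n with
  | zero =>
    intro F _ _ _ g hg a b
    exact contDiff_zero.2 (intervalIntegral.continuous_parametric_intervalIntegral_of_continuous'
      hg.continuous a b)
  | succ n ih =>
    intro F _ _ _ g hg a b
    have hd := hasFDerivAt_intervalIntegral_of_contDiff (hg.of_le (by simp)) a b
    rw [Nat.cast_add, Nat.cast_one, contDiff_succ_iff_fderiv]
    refine ⟨fun x => (hd x).differentiableAt, by simp, ?_⟩
    rw [funext fun x => (hd x).fderiv]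
    refine ih (g := fun x l => (fderiv ℝ (Function.uncurry g) (x, l)).comp
      (ContinuousLinearMap.inl ℝ (E d) ℝ)) ?_ a b
    exact (hg.fderiv_right (m := ∞) (by simp)).clm_comp contDiff_const

/-! ### The Alberti kernel -/

lemma contDiff_flow (L : E d →L[ℝ] E d) : ContDiff ℝ ∞ (flow L) := by
  let _ : NormedAlgebra ℚ (E d →L[ℝ] E d) := NormedAlgebra.restrictScalars ℚ ℝ _
  have h : ContDiff ℝ ∞ (NormedSpace.exp : (E d →L[ℝ] E d) → (E d →L[ℝ] E d)) :=
    AnalyticOnNhd.contDiff fun x _ => NormedSpace.exp_analytic x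
  exact h.comp (by fun_prop)

lemma alberti_eq (η : E d → ℝ) (Λ : ℝ) (M : Matrix (Fin d) (Fin d) ℝ) (h : E d) :
    alberti η Λ M h = Λ⁻¹ * ∫ l in (0 : ℝ)..Λ, η (flow (opT M) l h) := by
  simp only [alberti, flow_opT_apply]

lemma contDiff_comp_flow {η : E d → ℝ} (hη : ContDiff ℝ ∞ η) (L : E d →L[ℝ] E d) :
    ContDiff ℝ ∞ (Function.uncurry fun (h : E d) (l : ℝ) => η (flow L l h)) :=
  hη.comp (((contDiff_flow L).comp contDiff_snd).clm_apply contDiff_fst)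

lemma contDiff_alberti {η : E d → ℝ} (hη : ContDiff ℝ ∞ η) (Λ : ℝ)
    (M : Matrix (Fin d) (Fin d) ℝ) : ContDiff ℝ ∞ (alberti η Λ M) := by
  rw [funext (alberti_eq η Λ M)]
  refine contDiff_const.mul (contDiff_infty.2 fun n => ?_)
  exact contDiff_intervalIntegral_of_contDiff n (contDiff_comp_flow hη _) 0 Λ

lemma fderiv_alberti {η : E d → ℝ} (hη : ContDiff ℝ ∞ η) (Λ : ℝ)
    (M : Matrix (Fin d) (Fin d) ℝ) (h a : E d) : fderiv ℝ (alberti η Λ M) h a =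
      Λ⁻¹ * ∫ l in (0 : ℝ)..Λ, fderiv ℝ η (flow (opT M) l h) (flow (opT M) l a) := by
  have hg := contDiff_comp_flow hη (opT M)
  have h1 := (hasFDerivAt_intervalIntegral_of_contDiff (hg.of_le (by simp)) 0 Λ h).const_mul Λ⁻¹
  rw [funext (alberti_eq η Λ M), h1.fderiv]
  rw [_root_.smul_apply, smul_eq_mul, ContinuousLinearMap.intervalIntegral_apply]
  · congr 1
    refine intervalIntegral.integral_congr fun l _ => ?_
    have e1 := ((hg.differentiable (by simp)) (h, l)).hasFDerivAt.comp h
      (hasFDerivAt_prodMk_left (𝕜 := ℝ) h l)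
    have e2 := ((hη.differentiable (by simp)) (flow (opT M) l h)).hasFDerivAt.comp h
      (flow (opT M) l).hasFDerivAt
    exact congrArg (fun A : E d →L[ℝ] ℝ => A a) (e1.unique e2)
  · refine Continuous.intervalIntegrable ?_ _ _
    exact ((hg.continuous_fderiv (by simp)).comp (by fun_prop : Continuous fun l : ℝ => (h, l))).clm_comp
      continuous_const

lemma continuous_flow_opT_apply {X : Type*} [TopologicalSpace X]
    {M : X → Matrix (Fin d) (Fin d) ℝ} {l : X → ℝ} {h : X → E d} (hM : Continuous M)
    (hl : Continuous l) (hh : Continuous h) : Continuous fun x => flow (opT (M x)) (l x) (h x) :=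
  (continuous_flow.comp ((continuous_opT.comp hM).prodMk hl)).clm_apply hh

lemma continuous_alberti {η : E d → ℝ} (hη : Continuous η) (Λ : ℝ) :
    Continuous fun p : Matrix (Fin d) (Fin d) ℝ × E d => alberti η Λ p.1 p.2 := by
  simp only [alberti_eq]
  refine continuous_const.mul
    (intervalIntegral.continuous_parametric_intervalIntegral_of_continuous' ?_ 0 Λ)
  exact hη.comp (continuous_flow_opT_apply (by fun_prop) (by fun_prop) (by fun_prop))

section
variable {η : E d → ℝ} {Λ : ℝ} {M : Matrix (Fin d) (Fin d) ℝ}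

lemma abs_inv_mul_intervalIntegral_le (hΛ : 0 < Λ) {f : ℝ → ℝ} {B : ℝ}
    (hf : ∀ l ∈ Set.Icc 0 Λ, |f l| ≤ B) : |Λ⁻¹ * ∫ l in (0 : ℝ)..Λ, f l| ≤ B := by
  rw [abs_mul, abs_of_pos (inv_pos.2 hΛ)]
  have := intervalIntegral.norm_integral_le_of_norm_le_const (a := 0) (b := Λ) (f := f) (C := B)
    fun l hl => hf l (by rw [Set.uIoc_of_le hΛ.le] at hl; exact ⟨hl.1.le, hl.2⟩)
  rw [sub_zero, abs_of_pos hΛ, Real.norm_eq_abs] at this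
  rw [inv_mul_le_iff₀ hΛ]
  linarith

/-- Contraction by the flow is at most by the factor `e^{-Λ}`, so beyond radius `e^Λ` every `flow
(opT M) l h` lies outside the unit ball. -/
lemma suppBall_alberti (hη : SuppBall η 1) (hΛ : 0 < Λ) (hM : frob M ≤ 1) :
    SuppBall (alberti η Λ M) (Real.exp Λ) := by
  intro h hh
  rw [alberti_eq, intervalIntegral.integral_congr (g := fun _ => 0) ?_]
  · simp
  · intro l hl
    rw [Set.uIcc_of_le hΛ.le] at hl
    refine hη _ ?_
    have := norm_le_exp_mul_norm_flow ((norm_opT_le M).trans hM) hl.1 hl.2 h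
    by_contra hc
    push Not at hc
    have : Real.exp Λ * ‖flow (opT M) l h‖ ≤ Real.exp Λ * 1 := by gcongr
    linarith

lemma abs_alberti_le (hΛ : 0 < Λ) {B : ℝ} (hB : ∀ h, |η h| ≤ B) (h : E d) :
    |alberti η Λ M h| ≤ B := by
  rw [alberti_eq]
  exact abs_inv_mul_intervalIntegral_le hΛ fun l _ => hB _

lemma alberti_nonneg (hΛ : 0 < Λ) (hη : ∀ h, 0 ≤ η h) (h : E d) : 0 ≤ alberti η Λ M h := by
  rw [alberti_eq]
  exact mul_nonneg (inv_nonneg.2 hΛ.le) (intervalIntegral.integral_nonneg hΛ.le fun l _ => hη _)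

lemma norm_fderiv_alberti_le (hη : ContDiff ℝ ∞ η) (hΛ : 0 < Λ) (hM : frob M ≤ 1) {B : ℝ}
    (hB : ∀ h, ‖fderiv ℝ η h‖ ≤ B) (h : E d) :
    ‖fderiv ℝ (alberti η Λ M) h‖ ≤ Real.exp Λ * B := by
  have hB0 : 0 ≤ B := (norm_nonneg _).trans (hB 0)
  refine ContinuousLinearMap.opNorm_le_bound _ (by positivity) fun a => ?_
  rw [fderiv_alberti hη, Real.norm_eq_abs]
  refine abs_inv_mul_intervalIntegral_le hΛ fun l hl => ?_
  have h1 : ‖flow (opT M) l a‖ ≤ Real.exp Λ * ‖a‖ := by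
    refine ((flow (opT M) l).le_opNorm a).trans ?_
    gcongr
    refine (norm_flow_le ((norm_opT_le M).trans hM) l).trans (Real.exp_le_exp.2 ?_)
    rw [abs_of_nonneg hl.1]; exact hl.2
  calc |fderiv ℝ η (flow (opT M) l h) (flow (opT M) l a)|
      ≤ ‖fderiv ℝ η (flow (opT M) l h)‖ * ‖flow (opT M) l a‖ :=
        (fderiv ℝ η (flow (opT M) l h)).le_opNorm _
    _ ≤ B * (Real.exp Λ * ‖a‖) := by gcongr; exact hB _
    _ = _ := by ring

/-- The point of averaging over the flow: `M` commutes with its exponential, so the integrand is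
minus the `l`-derivative of `η (flow (opT M) l h)` and only the end values survive, with the gain
`Λ⁻¹`. -/
lemma contract_gradient_alberti (hη : ContDiff ℝ ∞ η) (h : E d) :
    contract h M (gradient (alberti η Λ M) h) = Λ⁻¹ * (η h - η (flow (opT M) Λ h)) := by
  rw [contract_eq, inner_gradient, fderiv_alberti hη]
  congr 1
  have hd : ∀ l : ℝ, HasDerivAt (fun l => η (flow (opT M) l h))
      (-fderiv ℝ η (flow (opT M) l h) (flow (opT M) l (opT M h))) l := by
    intro l
    have h1 : HasDerivAt (fun l => flow (opT M) l h) (-(flow (opT M) l (opT M h))) l :=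
      (hasDerivAt_flow (opT M) l).clm_apply (hasDerivAt_const l h) |>.congr_deriv (by simp)
    have := ((hη.differentiable (by simp)) (flow (opT M) l h)).hasFDerivAt.comp_hasDerivAt l h1
    exact this.congr_deriv (by simp)
  have hi := intervalIntegral.integral_eq_sub_of_hasDerivAt (a := 0) (b := Λ)
    (fun l _ => hd l) (Continuous.intervalIntegrable ?_ _ _)
  · rw [intervalIntegral.integral_neg] at hi
    simp only [flow_zero, one_apply_eq_self] at hi
    linarith
  · exact (((hη.continuous_fderiv (by simp)).comp (continuous_flow_opT_apply continuous_const
      continuous_id continuous_const)).clm_apply (continuous_flow_opT_apply continuous_const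
      continuous_id continuous_const)).neg

lemma integrable_comp_flow (hc : Continuous η) (hs : SuppBall η 1) (hM : frob M ≤ 1) :
    Integrable (Function.uncurry fun (l : ℝ) (h : E d) => η (flow (opT M) l h))
      ((volume.restrict (Set.Ioc 0 Λ)).prod volume) := by
  have hcont : Continuous (Function.uncurry fun (l : ℝ) (h : E d) => η (flow (opT M) l h)) :=
    hc.comp (continuous_flow_opT_apply continuous_const continuous_fst continuous_snd)
  rw [← Measure.restrict_univ (μ := (volume : Measure (E d))), Measure.prod_restrict]
  have hk : IsCompact (Set.Icc 0 Λ ×ˢ Metric.closedBall (0 : E d) (Real.exp Λ)) :=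
    isCompact_Icc.prod (isCompact_closedBall _ _)
  have h1 := hcont.continuousOn.integrableOn_compact (μ := volume.prod volume) hk
  refine IntegrableOn.of_forall_sdiff_eq_zero (s := Set.Icc 0 Λ ×ˢ Metric.closedBall (0 : E d) (Real.exp Λ))
    h1 (measurableSet_Ioc.prod MeasurableSet.univ) ?_
  rintro ⟨l, h⟩ ⟨⟨hl, _⟩, hn⟩
  refine hs _ ?_
  have hh : Real.exp Λ < ‖h‖ := by
    by_contra hc
    push Not at hc
    exact hn ⟨⟨hl.1.le, hl.2⟩, by simpa using hc⟩
  have := norm_le_exp_mul_norm_flow ((norm_opT_le M).trans hM) hl.1.le hl.2 h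
  by_contra hc
  push Not at hc
  have : Real.exp Λ * ‖flow (opT M) l h‖ ≤ Real.exp Λ * 1 := by gcongr
  linarith

/-- Trace zero makes the flow volume-preserving, so each composition with it keeps the mass. -/
lemma integral_alberti (hc : Continuous η) (hs : SuppBall η 1) (hΛ : 0 < Λ) (hM : frob M ≤ 1)
    (htr : M.trace = 0) : ∫ h, alberti η Λ M h = ∫ h, η h := by
  simp only [alberti_eq, intervalIntegral.integral_of_le hΛ.le]
  rw [integral_const_mul, ← integral_integral_swap (integrable_comp_flow hc hs hM)]
  simp only [integral_comp_flow htr]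
  rw [setIntegral_const]
  simp [hΛ.le, hΛ.ne']

/-- Pointwise, the gradient is at most `e^Λ` times the Alberti average of `|∇η|`, whose integral is
that of `|∇η|`. A supremum bound times the volume of the support would cost a further `e^{dΛ}`. -/
lemma integral_norm_fderiv_alberti_le (hη : ContDiff ℝ ∞ η) (hs : SuppBall η 1) (hΛ : 0 < Λ)
    (hM : frob M ≤ 1) (htr : M.trace = 0) :
    ∫ h, ‖fderiv ℝ (alberti η Λ M) h‖ ≤ Real.exp Λ * ∫ h, ‖fderiv ℝ η h‖ := by
  have hc : Continuous fun h => ‖fderiv ℝ η h‖ := (hη.continuous_fderiv (by simp)).norm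
  have hs' : SuppBall (fun h => ‖fderiv ℝ η h‖) 1 := fun h hh => by
    simp only [hs.fderiv h hh, norm_zero]
  rw [← integral_alberti hc hs' hΛ hM htr, ← integral_const_mul]
  refine integral_mono ?_ ?_ fun h => ?_
  · exact (((contDiff_alberti hη Λ M).continuous_fderiv (by simp)).integrable_of_hasCompactSupport
      (suppBall_alberti hs hΛ hM).fderiv.hasCompactSupport).norm
  · refine (((continuous_alberti hc Λ).comp
      (by fun_prop : Continuous fun h : E d => (M, h))).integrable_of_hasCompactSupport
        (suppBall_alberti hs' hΛ hM).hasCompactSupport).const_mul _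
  refine ContinuousLinearMap.opNorm_le_bound _
    (mul_nonneg (Real.exp_pos _).le (alberti_nonneg hΛ (fun h => norm_nonneg _) h)) fun a => ?_
  rw [fderiv_alberti hη, Real.norm_eq_abs, abs_mul, abs_of_pos (inv_pos.2 hΛ), alberti_eq]
  have h2 : ‖∫ l in (0 : ℝ)..Λ, fderiv ℝ η (flow (opT M) l h) (flow (opT M) l a)‖ ≤
      ∫ l in (0 : ℝ)..Λ, ‖fderiv ℝ η (flow (opT M) l h)‖ * (Real.exp Λ * ‖a‖) := by
    refine intervalIntegral.norm_integral_le_of_norm_le hΛ.le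
      (Filter.Eventually.of_forall fun l hl => ?_) (Continuous.intervalIntegrable ?_ _ _)
    · refine ((fderiv ℝ η (flow (opT M) l h)).le_opNorm _).trans ?_
      gcongr
      refine ((flow (opT M) l).le_opNorm a).trans ?_
      gcongr
      refine (norm_flow_le ((norm_opT_le M).trans hM) l).trans (Real.exp_le_exp.2 ?_)
      rw [abs_of_pos hl.1]; exact hl.2
    · exact (hc.comp (continuous_flow_opT_apply continuous_const
        continuous_id continuous_const)).mul continuous_const
  rw [intervalIntegral.integral_mul_const, Real.norm_eq_abs] at h2
  calc _ ≤ Λ⁻¹ * ((∫ l in (0 : ℝ)..Λ, ‖fderiv ℝ η (flow (opT M) l h)‖) * (Real.exp Λ * ‖a‖)) := by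
        gcongr
    _ = _ := by ring

lemma integral_abs_contract_alberti_le (hη : ContDiff ℝ ∞ η) (hs : SuppBall η 1)
    (hn : ∀ h, 0 ≤ η h) (hΛ : 0 < Λ) (htr : M.trace = 0) :
    ∫ h, |contract h M (gradient (alberti η Λ M) h)| ≤ 2 / Λ * ∫ h, η h := by
  simp only [contract_gradient_alberti hη]
  have hi : Integrable η := hs.integrable hη.continuous
  have hi2 : Integrable fun h => η (flow (opT M) Λ h) := 
    (measurePreserving_flow htr Λ).integrable_comp_of_integrable hi
  calc ∫ h, |Λ⁻¹ * (η h - η (flow (opT M) Λ h))|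
      ≤ ∫ h, Λ⁻¹ * (η h + η (flow (opT M) Λ h)) := by
        refine integral_mono ((hi.sub hi2).const_mul _).abs ((hi.add hi2).const_mul _) fun h => ?_
        simp only [abs_mul, abs_of_pos (inv_pos.2 hΛ)]
        gcongr
        have h1 := hn h
        have h2 := hn (flow (opT M) Λ h)
        rw [abs_le]; constructor <;> linarith
    _ = 2 / Λ * ∫ h, η h := by
        rw [integral_const_mul, integral_add hi hi2, integral_comp_flow htr]
        ring

end

end BVTransport

namespace BVTransport

variable {d : ℕ}

/-! ### Iterated integrals -/

section
variable {X Y Z : Type*} [MeasurableSpace X] [MeasurableSpace Y] [MeasurableSpace Z]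
  {a : Measure X} {b : Measure Y} {c : Measure Z} [SFinite a] [SFinite b] [SFinite c]

lemma integral_triple {F : X → Y → Z → ℝ}
    (hF : Integrable (fun q : X × (Y × Z) => F q.1 q.2.1 q.2.2) (a.prod (b.prod c))) :
    ∫ x, ∫ y, ∫ z, F x y z ∂c ∂b ∂a = ∫ q, F q.1 q.2.1 q.2.2 ∂(a.prod (b.prod c)) := by
  rw [integral_prod _ hF]
  refine integral_congr_ae ?_
  filter_upwards [hF.prod_right_ae] with x hx
  rw [integral_prod _ hx]

lemma integral_rotate {F : X → Y → Z → ℝ}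
    (hF : Integrable (fun q : X × (Y × Z) => F q.1 q.2.1 q.2.2) (a.prod (b.prod c))) :
    ∫ x, ∫ y, ∫ z, F x y z ∂c ∂b ∂a = ∫ y, ∫ z, ∫ x, F x y z ∂a ∂c ∂b := by
  rw [integral_triple hF, integral_prod_symm _ hF, integral_prod _ hF.integral_prod_right]

end

/-! ### Families of kernels -/

/-- A Borel family of smooth kernels, uniformly bounded in `C¹` and supported in a fixed ball. -/
structure IsKernelFamily (p : Td d → E d → ℝ) (R B : ℝ) : Prop where
  smooth : ∀ x, ContDiff ℝ ∞ (p x)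
  supp : ∀ x, SuppBall (p x) R
  meas : Measurable (Function.uncurry p)
  meas_pd : ∀ j, Measurable fun q : Td d × E d => pd j (p q.1) q.2
  bound : ∀ x h, |p x h| ≤ B
  bound_pd : ∀ j x h, |pd j (p x) h| ≤ B

lemma measurable_conv {X : Type*} [MeasurableSpace X] {g : X → Td d → ℝ} {k : X → E d → ℝ}
    {x : X → Td d} (hg : Measurable (Function.uncurry g)) (hk : Measurable (Function.uncurry k))
    (hx : Measurable x) : Measurable fun q => conv (g q) (k q) (x q) := by
  refine measurable_integral_right (f := fun q h => g q (x q - proj h) * k q h) ?_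
  simp only [Function.uncurry_def]
  have h1 : Measurable fun p : X × E d => g p.1 (x p.1 - proj p.2) :=
    hg.comp (f := fun p : X × E d => (p.1, x p.1 - proj p.2)) (by fun_prop)
  exact h1.mul hk

lemma SuppBall.integral_abs_le {k : E d → ℝ} {R B : ℝ} (hk : SuppBall k R) (hB : ∀ h, |k h| ≤ B) :
    ∫ h, |k h| ≤ B * volume.real (Metric.closedBall (0 : E d) R) := by
  have h1 : ∫ h, |k h| = ∫ h in Metric.closedBall (0 : E d) R, |k h| := by
    refine (setIntegral_eq_integral_of_forall_compl_eq_zero fun h hh => ?_).symm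
    rw [hk h (by simpa using hh), abs_zero]
  rw [h1]
  refine (Real.le_norm_self _).trans (norm_setIntegral_le_of_norm_le_const
    measure_closedBall_lt_top fun h _ => ?_)
  simpa using hB h

lemma integral_mul_periodise_sub {k : E d → ℝ} {R : ℝ} (hk : SuppBall k R) (hc : Continuous k)
    {F : Td d → ℝ} (hF : Integrable F) (x : Td d) :
    ∫ y, F y * periodise k (y - x) = ∫ z, F (x + proj z) * k z := by
  rw [← integral_mul_periodise hk hc (hF.comp_add_left x),
    ← integral_sub_right_eq_self (fun y => F (x + y) * periodise k y) x]
  simp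

section
variable {p : Td d → E d → ℝ} {R B : ℝ}

lemma IsKernelFamily.abs_conv_le (hp : IsKernelFamily p R B) {g : Td d → ℝ} {K : ℝ}
    (hg : ∀ x, |g x| ≤ K) (y x : Td d) :
    |conv g (p y) x| ≤ K * (B * volume.real (Metric.closedBall (0 : E d) R)) := by
  have hK : 0 ≤ K := (abs_nonneg _).trans (hg 0)
  refine (BVTransport.abs_conv_le hg ((hp.supp y).integrable (hp.smooth y).continuous) x).trans ?_
  gcongr
  exact (hp.supp y).integral_abs_le (hp.bound y)

lemma IsKernelFamily.bound_nonneg (hp : IsKernelFamily p R B) : 0 ≤ B :=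
  (abs_nonneg _).trans (hp.bound 0 0)

lemma IsKernelFamily.abs_fderiv_le (hp : IsKernelFamily p R B) (x : Td d) (h a : E d) :
    |fderiv ℝ (p x) h a| ≤ d * B * ‖a‖ := by
  rw [fderiv_eq_sum_pd]
  exact abs_sum_coord_mul_le a fun i => hp.bound_pd i x h

/-- The centre of the cut-off is integrated over the torus; unfolding the periodisation replaces it
by `x + proj z` with `z ∈ ℝ^d`, the form in which the five terms are written. -/
lemma integral_localise {κ : E d → ℝ} {r : ℝ} (hκ : SuppBall κ r) (hκc : Continuous κ)
    {w : Td d → ℝ} (hw : Integrable w) {G : Td d → Td d → ℝ}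
    (hG : Measurable (Function.uncurry G)) {A : ℝ} (hA : ∀ x y, |G x y| ≤ A) :
    Integrable (fun y => ∫ x, w x * (periodise κ (y - x) * G x y)) ∧
    ∫ y, ∫ x, w x * (periodise κ (y - x) * G x y) =
      ∫ x, ∫ z, w x * G x (x + proj z) * κ z := by
  have hN := hκ.continuous_periodise hκc
  obtain ⟨C, hC0, hC⟩ := Continuous.exists_bound_torus hN
  have hi : Integrable (fun q : Td d × Td d => w q.2 * (periodise κ (q.1 - q.2) * G q.2 q.1))
      (volume.prod volume) := by
    refine (hw.comp_snd (μ := (volume : Measure (Td d)))).mul_bdd (c := C * A) ?_ ?_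
    · have := hN.measurable
      refine Measurable.aestronglyMeasurable (Measurable.mul (by fun_prop) ?_)
      exact hG.comp measurable_swap
    · refine Filter.Eventually.of_forall fun q => ?_
      rw [norm_mul]
      exact mul_le_mul (hC _) (hA _ _) (norm_nonneg _) hC0
  refine ⟨hi.integral_prod_left, ?_⟩
  rw [integral_integral_swap hi]
  congr 1; funext x
  have hGx : Integrable fun y => G x y :=
    Integrable.of_bound (hG.comp measurable_prodMk_left).aestronglyMeasurable A
      (Filter.Eventually.of_forall fun y => hA x y)
  simp only [integral_const_mul, mul_assoc]
  rw [← integral_mul_periodise_sub hκ hκc hGx]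
  congr 2; funext y; ring

end

section
variable {u : Td d → E d} {μ : Measure (Td d)} {σ : Td d → Matrix (Fin d) (Fin d) ℝ} {T K : ℝ}
  {f g : ℝ → Td d → ℝ} {f₀ fT g₀ gT : Td d → ℝ} {p : Td d → E d → ℝ} {R B : ℝ} {κ : E d → ℝ} {r : ℝ}

/-- The localisation term: integrability, and the integral over the localisation variable. -/
lemma integral_localisation_term (hf : IsBddSolution u T K f f₀ fT)
    (hg : IsBddSolution u T K g g₀ gT) (hu : Integrable u) (hum : Measurable u)
    (hp : IsKernelFamily p R B) (hκ : SuppBall κ r) (hκc : ContDiff ℝ ∞ κ) :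
    Integrable (fun q : Td d × (ℝ × Td d) => f q.2.1 q.2.2 * (conv (g q.2.1) (p q.1) q.2.2 *
      inner ℝ (u q.2.2) (torusGrad (fun x => periodise κ (q.1 - x)) q.2.2)))
      (volume.prod ((volume.restrict (Set.Icc 0 T)).prod volume)) ∧
    ∀ t x, ∫ y, f t x * (conv (g t) (p y) x *
      inner ℝ (u x) (torusGrad (fun x => periodise κ (y - x)) x)) =
      -∫ z, f t x * conv (g t) (p (x + proj z)) x * inner ℝ (u x) (gradient κ z) := by
  have hN := hκ.torusSmooth_periodise hκc
  have hin : ∀ y x, inner ℝ (u x) (torusGrad (fun x => periodise κ (y - x)) x) =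
      -∑ i, u x i * periodise (pd i κ) (y - x) := by
    intro y x
    rw [inner_torusGrad_eq_sum, ← Finset.sum_neg_distrib]
    refine Finset.sum_congr rfl fun i _ => ?_
    rw [torusGrad_comp_sub, torusGrad_periodise hκ hκc]; ring
  have hNi : ∀ i, Continuous (periodise (pd i κ)) := fun i =>
    (hκ.pd i).continuous_periodise (contDiff_pd hκc i).continuous
  choose C hC0 hC using fun i => Continuous.exists_bound_torus (hNi i)
  have hCs : ∀ i x, |periodise (pd i κ) x| ≤ ∑ i, C i := fun i x =>
    (hC i x).trans (Finset.single_le_sum (fun i _ => hC0 i) (Finset.mem_univ i))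
  have hK := hf.bound_nonneg
  have hfm := hf.meas
  have hgm := hg.meas
  have hcm : Measurable fun q : Td d × (ℝ × Td d) => conv (g q.2.1) (p q.1) q.2.2 := by
    have h1 := hp.meas
    refine measurable_conv (g := fun q : Td d × (ℝ × Td d) => g q.2.1) (k := fun q => p q.1)
      (x := fun q => q.2.2) ?_ ?_ (by fun_prop)
    · simp only [Function.uncurry_def]; fun_prop
    · exact hp.meas.comp (f := fun q : (Td d × (ℝ × Td d)) × E d => (q.1.1, q.2)) (by fun_prop)
  have hcb := fun t y x => hp.abs_conv_le (hg.bound t) y x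
  have hNm := fun i => (hNi i).measurable
  simp only [hin]
  constructor
  · have hw : Integrable (fun q : Td d × (ℝ × Td d) => ‖u q.2.2‖)
        (volume.prod ((volume.restrict (Set.Icc 0 T)).prod volume)) :=
      (hu.norm.comp_snd (μ := volume.restrict (Set.Icc 0 T))).comp_snd volume
    refine integrable_of_bound_mul
      (K := K * (K * (B * volume.real (Metric.closedBall (0 : E d) R)) * (d * ∑ i, C i))) ?_ hw ?_
    · refine Measurable.aestronglyMeasurable (Measurable.mul (by fun_prop) (hcm.mul ?_))
      refine (Finset.measurable_sum _ fun i _ => ?_).neg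
      have := hNm i
      fun_prop
    · rintro ⟨y, t, x⟩
      simp only [abs_mul, abs_neg]
      have := abs_sum_coord_mul_le (u x) fun i => hCs i (y - x)
      calc _ ≤ K * (K * (B * volume.real (Metric.closedBall (0 : E d) R)) *
            (d * (∑ i, C i) * ‖u x‖)) := by
            have h1 := hcb t y x
            have h2 := hf.bound t x
            have h3 := (abs_nonneg _).trans h1
            gcongr
        _ = _ := by ring
  · intro t x
    have hci : ∀ i, Integrable fun y => conv (g t) (p y) x * periodise (pd i κ) (y - x) := by
      intro i
      have h1 : Measurable fun y => conv (g t) (p y) x :=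
        hcm.comp (by fun_prop : Measurable fun y : Td d => (y, (t, x)))
      have := hNm i
      refine Integrable.of_bound (h1.mul (by fun_prop)).aestronglyMeasurable
        (K * (B * volume.real (Metric.closedBall (0 : E d) R)) * C i)
        (Filter.Eventually.of_forall fun y => ?_)
      rw [norm_mul]
      exact mul_le_mul (hcb t y x) (hC i _) (norm_nonneg _) ((abs_nonneg _).trans (hcb t y x))
    have hcx : Integrable fun y => conv (g t) (p y) x :=
      Integrable.of_bound (hcm.comp (by fun_prop : Measurable fun y : Td d => (y, (t, x)))).aestronglyMeasurable
        (K * (B * volume.real (Metric.closedBall (0 : E d) R)))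
        (Filter.Eventually.of_forall fun y => hcb t y x)
    have e1 : ∀ y, f t x * (conv (g t) (p y) x * -∑ i, u x i * periodise (pd i κ) (y - x)) =
        ∑ i, -(f t x * u x i) * (conv (g t) (p y) x * periodise (pd i κ) (y - x)) := by
      intro y
      rw [← Finset.sum_neg_distrib, Finset.mul_sum, Finset.mul_sum]
      exact Finset.sum_congr rfl fun i _ => by ring
    have e2 : ∀ z, f t x * conv (g t) (p (x + proj z)) x * inner ℝ (u x) (gradient κ z) =
        ∑ i, (f t x * u x i) * (conv (g t) (p (x + proj z)) x * pd i κ z) := by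
      intro z
      rw [inner_gradient, fderiv_eq_sum_pd, Finset.mul_sum]
      exact Finset.sum_congr rfl fun i _ => by ring
    simp only [e1, e2]
    rw [integral_finsetSum _ fun i _ => (hci i).const_mul _, integral_finsetSum _ fun i _ => ?_,
      ← Finset.sum_neg_distrib]
    · refine Finset.sum_congr rfl fun i _ => ?_
      rw [integral_const_mul, integral_const_mul,
        integral_mul_periodise_sub (hκ.pd i) (contDiff_pd hκc i).continuous hcx]
      ring
    · exact ((hκ.pd i).integrable_mul (contDiff_pd hκc i).continuous
        (hcx.comp_add_left x)).const_mul _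

end

end BVTransport

/-! ### The commutator, and the identity integrated over the localisation variable. -/

namespace BVTransport

variable {d : ℕ}

section
variable {u : Td d → E d} {μ : Measure (Td d)} {σ : Td d → Matrix (Fin d) (Fin d) ℝ} {T K : ℝ}
  {f g : ℝ → Td d → ℝ} {f₀ fT g₀ gT : Td d → ℝ} {p : Td d → E d → ℝ} {R B : ℝ} {κ : E d → ℝ} {r : ℝ}

/-- Dominated by `|u(x)| + |u(x - h)|` on `|h| ≤ R`. By translation invariance the integral of this
over `x` does not depend on `h`, so integrability of `u` suffices for all later uses of Fubini. -/
lemma integrable_commutator (hf : IsBddSolution u T K f f₀ fT)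
    (hg : IsBddSolution u T K g g₀ gT) (hu : Integrable u) (hum : Measurable u)
    (hp : IsKernelFamily p R B) (hκ : SuppBall κ r) (hκc : ContDiff ℝ ∞ κ) :
    Integrable (fun q : (Td d × (ℝ × Td d)) × E d => f q.1.2.1 q.1.2.2 *
      (periodise κ (q.1.1 - q.1.2.2) * (g q.1.2.1 (q.1.2.2 - proj q.2) *
        fderiv ℝ (p q.1.1) q.2 (u q.1.2.2 - u (q.1.2.2 - proj q.2)))))
      ((volume.prod ((volume.restrict (Set.Icc 0 T)).prod volume)).prod volume) := by
  have hN := hκ.continuous_periodise hκc.continuous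
  obtain ⟨C, hC0, hC⟩ := Continuous.exists_bound_torus hN
  have hNm := hN.measurable
  have hfm := hf.meas
  have hgm := hg.meas
  have hpm := hp.meas_pd
  have hK := hf.bound_nonneg
  set w : (Td d × (ℝ × Td d)) × E d → ℝ := fun q =>
    (‖u q.1.2.2‖ + ‖u (q.1.2.2 - proj q.2)‖) *
      (Metric.closedBall (0 : E d) R).indicator (fun _ => (1 : ℝ)) q.2 with hw
  have hwm : Measurable w := by
    refine Measurable.mul (by fun_prop) ?_
    exact (measurable_const.indicator measurableSet_closedBall).comp measurable_snd
  have hwi : Integrable w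
      ((volume.prod ((volume.restrict (Set.Icc 0 T)).prod volume)).prod volume) := by
    have hslice : ∀ h : E d, Integrable (fun q : Td d × (ℝ × Td d) => w (q, h))
        (volume.prod ((volume.restrict (Set.Icc 0 T)).prod volume)) := by
      intro h
      have : Integrable fun x => (‖u x‖ + ‖u (x - proj h)‖) *
          (Metric.closedBall (0 : E d) R).indicator (fun _ => (1 : ℝ)) h :=
        (hu.norm.add (hu.comp_sub_right (proj h)).norm).mul_const _
      exact (this.comp_snd (volume.restrict (Set.Icc 0 T))).comp_snd volume
    rw [integrable_prod_iff' hwm.aestronglyMeasurable]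
    refine ⟨Filter.Eventually.of_forall hslice, ?_⟩
    have e : ∀ h : E d, ∫ q, ‖w (q, h)‖ ∂(volume.prod ((volume.restrict (Set.Icc 0 T)).prod volume)) =
        (Metric.closedBall (0 : E d) R).indicator
          (fun _ => volume.real (Set.univ : Set (Td d)) * (volume.real (Set.Icc 0 T) *
            (2 * ∫ x, ‖u x‖))) h := by
      intro h
      have e1 : ∀ q : Td d × (ℝ × Td d), ‖w (q, h)‖ = w (q, h) := fun q =>
        Real.norm_of_nonneg (mul_nonneg (by positivity)
          (Set.indicator_nonneg (fun _ _ => zero_le_one) _))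
      simp only [e1]
      rw [integral_prod _ (hslice h)]
      simp only [hw]
      rw [integral_prod]
      · simp only [integral_const, smul_eq_mul, integral_mul_const]
        rw [integral_add hu.norm (hu.comp_sub_right (proj h)).norm,
          integral_sub_right_eq_self (fun x => ‖u x‖)]
        by_cases hh : h ∈ Metric.closedBall (0 : E d) R
        · simp only [Set.indicator_of_mem hh, measureReal_restrict_apply_univ]; ring
        · simp [Set.indicator_of_notMem hh]
      · exact ((hu.norm.add (hu.comp_sub_right (proj h)).norm).mul_const _).comp_snd
          (volume.restrict (Set.Icc 0 T))
    simp only [e]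
    exact (integrable_indicator_iff measurableSet_closedBall).2
      (integrableOn_const measure_closedBall_lt_top.ne)
  refine integrable_of_bound_mul (K := K * (C * (K * (d * B)))) ?_ hwi ?_
  · refine Measurable.aestronglyMeasurable (Measurable.mul (by fun_prop) (Measurable.mul
      (by fun_prop) (Measurable.mul (by fun_prop) ?_)))
    simp only [fderiv_eq_sum_pd]
    refine Finset.measurable_sum _ fun i _ => Measurable.mul (by fun_prop) ?_
    exact (hpm i).comp (f := fun q : (Td d × (ℝ × Td d)) × E d => (q.1.1, q.2)) (by fun_prop)
  · rintro ⟨⟨y, t, x⟩, h⟩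
    simp only [hw]
    by_cases hh : h ∈ Metric.closedBall (0 : E d) R
    · rw [Set.indicator_of_mem hh, mul_one]
      simp only [abs_mul]
      have h1 := hf.bound t x
      have h2 := hC (y - x)
      have h3 := hg.bound t (x - proj h)
      have h4 := hp.abs_fderiv_le y h (u x - u (x - proj h))
      have h5 := norm_sub_le (u x) (u (x - proj h))
      have hB := hp.bound_nonneg
      rw [Real.norm_eq_abs] at h2
      calc _ ≤ K * (C * (K * (d * B * (‖u x‖ + ‖u (x - proj h)‖)))) := by
            gcongr
            exact h4.trans (by gcongr)
        _ = _ := by ring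
    · rw [Set.indicator_of_notMem hh]
      rw [(hp.supp y).fderiv h (by simpa using hh)]
      simp

lemma measurable_kernel_average (hp : IsKernelFamily p R B) (hκc : Continuous κ) (j : Fin d) :
    Measurable fun q : Td d × E d => ∫ z, pd j (p (q.1 + proj z)) q.2 * κ z := by
  refine measurable_integral_right (f := fun (q : Td d × E d) z => pd j (p (q.1 + proj z)) q.2 * κ z) ?_
  have := hκc.measurable
  refine Measurable.mul ?_ (by fun_prop)
  exact (hp.meas_pd j).comp
    (f := fun q : (Td d × E d) × E d => (q.1.1 + proj q.2, q.1.2)) (by fun_prop)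

lemma IsKernelFamily.integrable_pd_mul (hp : IsKernelFamily p R B) (hκ : SuppBall κ r)
    (hκc : Continuous κ) (j : Fin d) (x : Td d) (h : E d) :
    Integrable fun z => pd j (p (x + proj z)) h * κ z := by
  refine (hκ.integrable hκc).bdd_mul (c := B) ?_ (Filter.Eventually.of_forall fun z => hp.bound_pd _ _ _)
  exact ((hp.meas_pd j).comp (f := fun z : E d => (x + proj z, h)) (by fun_prop)).aestronglyMeasurable

lemma abs_kernel_average_le (hp : IsKernelFamily p R B) (hκ : SuppBall κ r) (hκc : Continuous κ)
    (j : Fin d) (x : Td d) (h : E d) :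
    |∫ z, pd j (p (x + proj z)) h * κ z| ≤ B * ∫ z, |κ z| := by
  rw [← integral_const_mul, ← Real.norm_eq_abs]
  refine norm_integral_le_of_norm_le ((hκ.integrable hκc).abs.const_mul B)
    (Filter.Eventually.of_forall fun z => ?_)
  rw [Real.norm_eq_abs, abs_mul]
  exact mul_le_mul_of_nonneg_right (hp.bound_pd _ _ _) (abs_nonneg _)

lemma contract_gradient (h : E d) (A : Matrix (Fin d) (Fin d) ℝ) (k : E d → ℝ) :
    contract h A (gradient k h) = ∑ j, (∑ i, h i * A i j) * pd j k h := by
  simp only [contract, gradient_apply, Finset.sum_mul]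
  exact Finset.sum_comm

lemma integral_contract_kernel (hp : IsKernelFamily p R B) (hκ : SuppBall κ r)
    (hκc : Continuous κ) (c : ℝ) (A : Matrix (Fin d) (Fin d) ℝ) (x : Td d) (h : E d) :
    ∫ z, c * contract h A (gradient (p (x + proj z)) h) * κ z =
      c * ∑ j, (∑ i, h i * A i j) * ∫ z, pd j (p (x + proj z)) h * κ z := by
  have e : ∀ z, c * contract h A (gradient (p (x + proj z)) h) * κ z =
      ∑ j, (c * (∑ i, h i * A i j)) * (pd j (p (x + proj z)) h * κ z) := by
    intro z
    rw [contract_gradient, Finset.mul_sum, Finset.sum_mul]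
    exact Finset.sum_congr rfl fun i _ => by ring
  simp only [e]
  rw [integral_finsetSum _ fun j _ => (hp.integrable_pd_mul hκ hκc j x h).const_mul _, Finset.mul_sum]
  refine Finset.sum_congr rfl fun j _ => ?_
  rw [integral_const_mul, mul_assoc]

/-- The commutator for a fixed shift, in terms of the derivative of the vector field. -/
lemma commutator_eq (hf : IsBddSolution u T K f f₀ fT) (hg : IsBddSolution u T K g g₀ gT)
    (h : IsBVWithGradient u μ σ)
    (hp : IsKernelFamily p R B) (hκ : SuppBall κ r) (hκc : ContDiff ℝ ∞ κ) (a : E d) (t : ℝ) :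
    ∫ x, ∫ y, f t x * (periodise κ (y - x) * (g t (x - proj a) *
        fderiv ℝ (p y) a (u x - u (x - proj a)))) =
      ∫ s in Set.Icc (0 : ℝ) 1, ∫ y, (∫ z, f t (y + proj (s • a)) *
        g t (y + proj (s • a) - proj a) *
        contract a (σ y) (gradient (p (y + proj (s • a) + proj z)) a) * κ z) ∂μ := by
  have := h.finite
  have hfm := hf.meas
  have hgm := hg.meas
  -- Once the localisation variable is integrated out, everything that multiplies `u x j - u (x -
  -- proj a) j` is a bounded Borel function of `x`, as `IsBVWithGradient.increment` requires.
  set F : Fin d → Td d → ℝ := fun j x => f t x * g t (x - proj a) *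
    ∫ z, pd j (p (x + proj z)) a * κ z with hF
  have hFm : ∀ j, Measurable (F j) := fun j => Measurable.mul (by fun_prop)
    ((measurable_kernel_average hp hκc.continuous j).comp (by fun_prop : Measurable fun x : Td d => (x, a)))
  have hFb : ∀ j x, |F j x| ≤ K * K * (B * ∫ z, |κ z|) := by
    intro j x
    simp only [hF, abs_mul]
    have h1 := hf.bound t x
    have h2 := hg.bound t (x - proj a)
    have h3 := abs_kernel_average_le hp hκ hκc.continuous j x a
    have := (abs_nonneg _).trans h1
    gcongr
  have huj : ∀ j, Integrable fun x => u x j - u (x - proj a) j := fun j =>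
    (h.integrable_coord j).sub ((h.integrable_coord j).comp_sub_right (proj a))
  have e1 : ∀ x, ∫ y, f t x * (periodise κ (y - x) * (g t (x - proj a) *
        fderiv ℝ (p y) a (u x - u (x - proj a)))) = ∑ j, F j x * (u x j - u (x - proj a) j) := by
    intro x
    have hpi : ∀ j, Integrable fun y => pd j (p y) a := fun j =>
      Integrable.of_bound ((hp.meas_pd j).comp
        (by fun_prop : Measurable fun x : Td d => (x, a))).aestronglyMeasurable B
        (Filter.Eventually.of_forall fun y => hp.bound_pd j y a)
    have hN := hκ.continuous_periodise hκc.continuous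
    obtain ⟨C, hC0, hC⟩ := Continuous.exists_bound_torus hN
    have hNm := hN.measurable
    have e2 : ∀ y, f t x * (periodise κ (y - x) * (g t (x - proj a) *
        fderiv ℝ (p y) a (u x - u (x - proj a)))) =
        ∑ j, (f t x * g t (x - proj a) * (u x j - u (x - proj a) j)) *
          (pd j (p y) a * periodise κ (y - x)) := by
      intro y
      rw [fderiv_eq_sum_pd, Finset.mul_sum, Finset.mul_sum, Finset.mul_sum]
      refine Finset.sum_congr rfl fun j _ => ?_
      simp only [PiLp.sub_apply]
      ring
    simp only [e2]
    rw [integral_finsetSum]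
    · refine Finset.sum_congr rfl fun j _ => ?_
      rw [integral_const_mul, integral_mul_periodise_sub hκ hκc.continuous (hpi j)]
      simp only [hF]; ring
    · intro j _
      exact ((hpi j).mul_bdd (c := C) (Measurable.aestronglyMeasurable (by fun_prop))
        (Filter.Eventually.of_forall fun y => hC _)).const_mul _
  simp only [e1]
  rw [integral_finsetSum _ fun j _ => (huj j).bdd_mul (c := K * K * (B * ∫ z, |κ z|))
    (hFm j).aestronglyMeasurable (Filter.Eventually.of_forall (hFb j))]
  simp only [fun j => h.increment (hFm j) (hFb j) a j]
  have hq : ∀ j, Integrable (fun y => ∑ i, a i * σ y i j) μ := fun j =>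
    integrable_finsetSum _ fun i _ => (h.integrable_entry i j).const_mul _
  have hprod : ∀ j, Integrable (fun q : ℝ × Td d => F j (q.2 + proj (q.1 • a)) * ∑ i, a i * σ q.2 i j)
      ((volume.restrict (Set.Icc (0 : ℝ) 1)).prod μ) := fun j =>
    ((hq j).comp_snd _).bdd_mul (c := K * K * (B * ∫ z, |κ z|))
      ((hFm j).comp (by fun_prop)).aestronglyMeasurable (Filter.Eventually.of_forall fun q => hFb j _)
  rw [← integral_finsetSum _ fun j _ => (hprod j).integral_prod_left]
  congr 1; funext s
  rw [← integral_finsetSum]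
  · congr 1; funext y
    rw [integral_contract_kernel hp hκ hκc.continuous, Finset.mul_sum]
    refine Finset.sum_congr rfl fun j _ => ?_
    simp only [hF]; ring
  · intro j _
    exact (hq j).bdd_mul (c := K * K * (B * ∫ z, |κ z|))
      ((hFm j).comp (by fun_prop)).aestronglyMeasurable (Filter.Eventually.of_forall fun q => hFb j _)

/-- The integrand of the commutator as a function of shift, time and interpolation parameter. -/
lemma integrable_commutator_density (hf : IsBddSolution u T K f f₀ fT)
    (hg : IsBddSolution u T K g g₀ gT) [IsFiniteMeasure μ] 
    (hAm : ∀ i j, Measurable fun y => σ y i j) (hA : ∀ᵐ y ∂μ, ∀ i j, |σ y i j| ≤ 1)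
    (hp : IsKernelFamily p R B) (hκ : SuppBall κ r) (hκc : ContDiff ℝ ∞ κ) :
    Integrable (fun q : E d × (ℝ × ℝ) => ∫ y, (∫ z, f q.2.1 (y + proj (q.2.2 • q.1)) *
        g q.2.1 (y + proj (q.2.2 • q.1) - proj q.1) *
        contract q.1 (σ y) (gradient (p (y + proj (q.2.2 • q.1) + proj z)) q.1) * κ z) ∂μ)
      (volume.prod ((volume.restrict (Set.Icc 0 T)).prod (volume.restrict (Set.Icc (0 : ℝ) 1)))) := by
  have hfm := hf.meas
  have hgm := hg.meas
  simp only [integral_contract_kernel hp hκ hκc.continuous]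
  set C := K * K * (∑ _j : Fin d, d * 1 * R * (B * ∫ z, |κ z|)) with hC
  have hind : Integrable (fun q : E d × (ℝ × ℝ) =>
      (Metric.closedBall (0 : E d) R).indicator (fun _ => C * μ.real Set.univ) q.1)
      (volume.prod ((volume.restrict (Set.Icc 0 T)).prod (volume.restrict (Set.Icc (0 : ℝ) 1)))) :=
    ((integrable_indicator_iff measurableSet_closedBall).2
      (integrableOn_const measure_closedBall_lt_top.ne)).comp_fst _
  refine hind.mono' ?_ (Filter.Eventually.of_forall fun q => ?_)
  · refine (measurable_integral_right (f := fun (q : E d × (ℝ × ℝ)) y =>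
      f q.2.1 (y + proj (q.2.2 • q.1)) * g q.2.1 (y + proj (q.2.2 • q.1) - proj q.1) *
      ∑ j, (∑ i, q.1 i * σ y i j) * ∫ z, pd j (p (y + proj (q.2.2 • q.1) + proj z)) q.1 * κ z)
      ?_).aestronglyMeasurable
    simp only [Function.uncurry_def]
    refine Measurable.mul (by fun_prop) (Finset.measurable_sum _ fun j _ => Measurable.mul ?_ ?_)
    · exact Finset.measurable_sum _ fun i _ => Measurable.mul (by fun_prop)
        ((hAm i j).comp measurable_snd)
    · exact (measurable_kernel_average hp hκc.continuous j).comp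
        (f := fun q : (E d × (ℝ × ℝ)) × Td d => (q.2 + proj (q.1.2.2 • q.1.1), q.1.1)) (by fun_prop)
  · obtain ⟨a, t, s⟩ := q
    by_cases ha : a ∈ Metric.closedBall (0 : E d) R
    · rw [Set.indicator_of_mem ha]
      refine norm_integral_le_of_norm_le_const ?_
      filter_upwards [hA] with y hy
      have haR : ‖a‖ ≤ R := by simpa using ha
      have hK := hf.bound_nonneg
      rw [Real.norm_eq_abs, abs_mul, abs_mul, hC]
      gcongr
      · exact hf.bound _ _
      · exact hg.bound _ _
      refine (Finset.abs_sum_le_sum_abs _ _).trans (Finset.sum_le_sum fun j _ => ?_)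
      rw [abs_mul]
      have h1 := abs_sum_coord_mul_le a fun i => hy i j
      have h2 := abs_kernel_average_le hp hκ hκc.continuous j (y + proj (s • a)) a
      have hR : 0 ≤ R := (norm_nonneg _).trans haR
      refine mul_le_mul (h1.trans (by gcongr)) h2 (abs_nonneg _) (by positivity)
    · rw [Set.indicator_of_notMem ha]
      have hz : ∀ x j, pd j (p x) a = 0 := fun x j => ((hp.supp x).pd j) a (by simpa using ha)
      simp [hz]

/-- For each centre `y`, `transport_pairing` is applied with the kernel `p y` and the cut-off
centred at `y`, and the result is integrated over `y`. The kernel is fixed in each application, so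
only measurability in `y` is needed. -/
theorem transport_identity (hT : 0 < T) (hf : IsBddSolution u T K f f₀ fT)
    (hg : IsBddSolution u T K g g₀ gT) (h : IsBVWithGradient u μ σ) (hum : Measurable u)
    (hf₀K : ∀ x, |f₀ x| ≤ K) (hfTK : ∀ x, |fT x| ≤ K) (hg₀K : ∀ x, |g₀ x| ≤ K)
    (hgTK : ∀ x, |gT x| ≤ K)
    (hp : IsKernelFamily p R B) (hκ : SuppBall κ r) (hκc : ContDiff ℝ ∞ κ) :
    (∫ x, ∫ z, fT x * conv gT (p (x + proj z)) x * κ z) -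
      (∫ x, ∫ z, f₀ x * conv g₀ (p (x + proj z)) x * κ z) =
    -(∫ t in Set.Icc 0 T, ∫ x, ∫ z, f t x * conv (g t) (p (x + proj z)) x *
        inner ℝ (u x) (gradient κ z)) +
      ∫ t in Set.Icc 0 T, ∫ s in Set.Icc (0 : ℝ) 1, ∫ a, ∫ y,
        (∫ z, f t (y + proj (s • a)) * g t (y + proj (s • a) - proj a) *
        contract a (σ y) (gradient (p (y + proj (s • a) + proj z)) a) * κ z) ∂μ := by
  have := h.finite
  have hu := h.integrable
  have endpoint : ∀ {w v : Td d → ℝ}, Measurable w → (∀ x, |w x| ≤ K) → Measurable v →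
      (∀ x, |v x| ≤ K) → Integrable (fun y => ∫ x, w x * (periodise κ (y - x) * conv v (p y) x)) ∧
      ∫ y, ∫ x, w x * (periodise κ (y - x) * conv v (p y) x) =
        ∫ x, ∫ z, w x * conv v (p (x + proj z)) x * κ z := by
    intro w v hw hwK hv hvK
    have hcm : Measurable fun q : Td d × Td d => conv v (p q.2) q.1 :=
      measurable_conv (g := fun _ : Td d × Td d => v) (k := fun q => p q.2) (x := fun q => q.1)
        (hv.comp measurable_snd)
        (hp.meas.comp (f := fun q : (Td d × Td d) × E d => (q.1.2, q.2)) (by fun_prop)) (by fun_prop)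
    exact integral_localise hκ hκc.continuous (w := w) (G := fun x y => conv v (p y) x)
      (Integrable.of_bound hw.aestronglyMeasurable K (Filter.Eventually.of_forall hwK)) hcm
      (fun x y => hp.abs_conv_le hvK y x)
  obtain ⟨iT, eT⟩ := endpoint hf.meas_final hfTK hg.meas_final hgTK
  obtain ⟨i0, e0⟩ := endpoint hf.meas_zero hf₀K hg.meas_zero hg₀K
  obtain ⟨iL, eL⟩ := integral_localisation_term hf hg hu hum hp hκ hκc
  have iC := integrable_commutator hf hg hu hum hp hκ hκc
  rw [← eT, ← e0, ← integral_sub iT i0]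
  have key : ∀ y, (∫ x, fT x * (periodise κ (y - x) * conv gT (p y) x)) -
      ∫ x, f₀ x * (periodise κ (y - x) * conv g₀ (p y) x) =
      ∫ t in Set.Icc 0 T, ∫ x, (f t x * (conv (g t) (p y) x *
        inner ℝ (u x) (torusGrad (fun x => periodise κ (y - x)) x)) +
        ∫ a : E d, f t x * (periodise κ (y - x) *
          (g t (x - proj a) * fderiv ℝ (p y) a (u x - u (x - proj a))))) := by
    intro y
    rw [transport_pairing hf hg hT hu hum hf₀K hfTK hg₀K hgTK (hp.supp y) (hp.smooth y)
      ((hκ.torusSmooth_periodise hκc).comp_sub y)]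
    simp only [mul_add, integral_const_mul]
  simp only [key]
  have iC' := iC.integral_prod_left
  have e1 := integral_triple (F := fun y t x => f t x * (conv (g t) (p y) x *
        inner ℝ (u x) (torusGrad (fun x => periodise κ (y - x)) x)) +
        ∫ a : E d, f t x * (periodise κ (y - x) *
          (g t (x - proj a) * fderiv ℝ (p y) a (u x - u (x - proj a))))) (iL.add iC')
  have e3 := integral_triple (F := fun y t x => f t x * (conv (g t) (p y) x *
        inner ℝ (u x) (torusGrad (fun x => periodise κ (y - x)) x))) iL
  have e4 := integral_rotate (F := fun y t x => f t x * (conv (g t) (p y) x *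
        inner ℝ (u x) (torusGrad (fun x => periodise κ (y - x)) x))) iL
  rw [e1, integral_add iL iC', ← e3, e4]
  simp only [eL, integral_neg]
  congr 1
  -- The shift goes outermost: the representation of the increment by `∇u` is available for one
  -- fixed shift at a time.
  rw [integral_integral_swap iC]
  have e2 : ∀ᵐ a : E d, ∫ q : Td d × (ℝ × Td d), f q.2.1 q.2.2 *
      (periodise κ (q.1 - q.2.2) * (g q.2.1 (q.2.2 - proj a) *
        fderiv ℝ (p q.1) a (u q.2.2 - u (q.2.2 - proj a))))
      ∂(volume.prod ((volume.restrict (Set.Icc 0 T)).prod volume)) =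
      ∫ t in Set.Icc 0 T, ∫ s in Set.Icc (0 : ℝ) 1, ∫ y, (∫ z, f t (y + proj (s • a)) *
        g t (y + proj (s • a) - proj a) *
        contract a (σ y) (gradient (p (y + proj (s • a) + proj z)) a) * κ z) ∂μ := by
    filter_upwards [iC.prod_left_ae] with a ha
    have e5 := integral_triple (F := fun y t x => f t x * (periodise κ (y - x) *
      (g t (x - proj a) * fderiv ℝ (p y) a (u x - u (x - proj a))))) ha
    have e6 := integral_rotate (F := fun y t x => f t x * (periodise κ (y - x) *
      (g t (x - proj a) * fderiv ℝ (p y) a (u x - u (x - proj a))))) ha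
    rw [← e5, e6]
    simp only [commutator_eq hf hg h hp hκ hκc a]
  rw [integral_congr_ae e2]
  refine integral_rotate (integrable_commutator_density hf hg h.measurable ?_ hp hκ hκc)
  exact eventually_countable_forall.2 fun i => eventually_countable_forall.2 fun j => h.ae_abs_le i j

end

end BVTransport

namespace BVTransport

variable {d : ℕ}

/-! ### Rescaled kernels -/

lemma contDiff_rescale {k : E d → ℝ} (hk : ContDiff ℝ ∞ k) (r : ℝ) : ContDiff ℝ ∞ (rescale k r) :=
  contDiff_const.mul (hk.comp (contDiff_const_smul r⁻¹))

lemma continuous_rescale {k : E d → ℝ} (hk : Continuous k) (r : ℝ) : Continuous (rescale k r) :=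
  continuous_const.mul (hk.comp (by fun_prop))

lemma SuppBall.rescale {k : E d → ℝ} {R r : ℝ} (hk : SuppBall k R) (hr : 0 < r) :
    SuppBall (rescale k r) (r * R) := by
  intro h hh
  rw [BVTransport.rescale, hk, mul_zero]
  rw [norm_smul, norm_inv, Real.norm_of_nonneg hr.le, ← div_eq_inv_mul, lt_div_iff₀ hr]
  linarith

lemma rescale_smul (k : E d → ℝ) {r : ℝ} (hr : 0 < r) (h : E d) :
    rescale k r (r • h) = (r ^ d)⁻¹ * k h := by
  rw [rescale, inv_smul_smul₀ hr.ne']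

lemma integral_eq_pow_mul_integral_smul {r : ℝ} (hr : 0 < r) (f : E d → ℝ) :
    ∫ h, f h = r ^ d * ∫ h, f (r • h) := by
  rw [Measure.integral_comp_smul, finrank_euclideanSpace_fin, smul_eq_mul,
    abs_of_pos (by positivity)]
  field_simp

lemma integral_mul_rescale (k : E d → ℝ) {r : ℝ} (hr : 0 < r) (f : E d → ℝ) :
    ∫ h, f h * rescale k r h = ∫ h, f (r • h) * k h := by
  rw [integral_eq_pow_mul_integral_smul hr, ← integral_const_mul]
  congr 1; funext h
  rw [rescale_smul k hr]
  field_simp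

lemma integral_rescale (k : E d → ℝ) {r : ℝ} (hr : 0 < r) : ∫ h, rescale k r h = ∫ h, k h := by
  simpa using integral_mul_rescale k hr fun _ => 1

lemma conv_rescale (f : Td d → ℝ) (k : E d → ℝ) {r : ℝ} (hr : 0 < r) (x : Td d) :
    conv f (rescale k r) x = ∫ h, f (x - proj (r • h)) * k h :=
  integral_mul_rescale k hr fun h => f (x - proj h)

lemma pd_rescale {k : E d → ℝ} (r : ℝ) (j : Fin d) (h : E d) :
    pd j (rescale k r) h = r⁻¹ * rescale (pd j k) r h := by
  have h1 : rescale k r = (r ^ d)⁻¹ • (fun h => k (r⁻¹ • h)) := rfl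
  rw [pd, h1, fderiv_const_smul_field, Pi.smul_apply, fderiv_comp_smul, rescale, pd]
  simp only [_root_.smul_apply, smul_eq_mul]
  ring

lemma pd_rescale_smul {k : E d → ℝ} {r : ℝ} (hr : 0 < r) (j : Fin d) (h : E d) :
    pd j (rescale k r) (r • h) = (r ^ (d + 1))⁻¹ * pd j k h := by
  rw [pd_rescale, rescale_smul _ hr, pow_succ, mul_inv]; ring

/-- The factor `r` from the increment cancels the `r⁻¹` from the gradient; hence no negative power
of `δ` survives in `I4` and `I5`. -/
lemma contract_gradient_rescale_smul (k : E d → ℝ) {r : ℝ} (hr : 0 < r) (h : E d)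
    (A : Matrix (Fin d) (Fin d) ℝ) :
    contract (r • h) A (gradient (rescale k r) (r • h)) =
      (r ^ d)⁻¹ * contract h A (gradient k h) := by
  simp only [contract_gradient, pd_rescale_smul hr, Finset.mul_sum, Finset.sum_mul, PiLp.smul_apply,
    smul_eq_mul]
  refine Finset.sum_congr rfl fun j _ => Finset.sum_congr rfl fun i _ => ?_
  field_simp
  ring

/-! ### Mollifiers and the family of Alberti kernels -/

lemma IsMollifier.suppBall {η : E d → ℝ} (hη : IsMollifier η) : SuppBall η 1 :=
  fun h hh => hη.support h hh.le

lemma IsMollifier.exists_bound {η : E d → ℝ} (hη : IsMollifier η) :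
    ∃ B, 1 ≤ B ∧ (∀ h, |η h| ≤ B) ∧ ∀ h, ‖fderiv ℝ η h‖ ≤ B := by
  obtain ⟨B₁, h₁⟩ := hη.suppBall.hasCompactSupport.exists_bound_of_continuous hη.smooth.continuous
  obtain ⟨B₂, h₂⟩ := hη.suppBall.fderiv.hasCompactSupport.exists_bound_of_continuous
    (hη.smooth.continuous_fderiv (by simp))
  exact ⟨max 1 (max B₁ B₂), le_max_left _ _,
    fun h => (h₁ h).trans ((le_max_left _ _).trans (le_max_right _ _)),
    fun h => (h₂ h).trans ((le_max_right _ _).trans (le_max_right _ _))⟩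

section
variable {η : E d → ℝ} {Λ δ ε : ℝ} {M : Td d → Matrix (Fin d) (Fin d) ℝ}

lemma measurable_comp_matrix {X : Type*} [MeasurableSpace X] {F : Matrix (Fin d) (Fin d) ℝ × E d → ℝ}
    (hF : Continuous F) {A : X → Matrix (Fin d) (Fin d) ℝ} (hA : ∀ i j, Measurable fun x => A x i j)
    {h : X → E d} (hh : Measurable h) : Measurable fun x => F (A x, h x) := by
  have h1 : Continuous fun q : (Fin d → Fin d → ℝ) × E d => F (Matrix.of q.1, q.2) :=
    hF.comp (by fun_prop)
  have h2 : Measurable fun x => ((fun i j => A x i j : Fin d → Fin d → ℝ), h x) :=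
    (measurable_pi_lambda _ fun i => measurable_pi_lambda _ fun j => hA i j).prodMk hh
  exact h1.measurable.comp h2

lemma continuous_pd_alberti (hη : ContDiff ℝ ∞ η) (j : Fin d) :
    Continuous fun q : Matrix (Fin d) (Fin d) ℝ × E d => pd j (alberti η Λ q.1) q.2 := by
  simp only [pd, fderiv_alberti hη]
  refine continuous_const.mul
    (intervalIntegral.continuous_parametric_intervalIntegral_of_continuous' ?_ 0 Λ)
  exact ((hη.continuous_fderiv (by simp)).comp (continuous_flow_opT_apply (by fun_prop) (by fun_prop)
    (by fun_prop))).clm_apply (continuous_flow_opT_apply (by fun_prop) (by fun_prop) (by fun_prop))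

lemma measurable_pd_alberti (hη : ContDiff ℝ ∞ η) {X : Type*} [MeasurableSpace X]
    {A : X → Matrix (Fin d) (Fin d) ℝ} (hA : ∀ i j, Measurable fun x => A x i j)
    {h : X → E d} (hh : Measurable h) (j : Fin d) :
    Measurable fun x => pd j (alberti η Λ (A x)) (h x) :=
  measurable_comp_matrix (continuous_pd_alberti hη j) hA hh

lemma measurable_alberti (hη : Continuous η) {X : Type*} [MeasurableSpace X]
    {A : X → Matrix (Fin d) (Fin d) ℝ} (hA : ∀ i j, Measurable fun x => A x i j)
    {h : X → E d} (hh : Measurable h) : Measurable fun x => alberti η Λ (A x) (h x) :=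
  measurable_comp_matrix (continuous_alberti hη Λ) hA hh

lemma exists_isKernelFamily_alberti (hη : IsMollifier η) (hΛ : 0 < Λ) (hδ : 0 < δ)
    (hMm : ∀ i j, Measurable fun x => M x i j) (hM : ∀ x, frob (M x) ≤ 1) :
    ∃ B, IsKernelFamily (fun x => rescale (alberti η Λ (M x)) δ) (δ * Real.exp Λ) B := by
  obtain ⟨B, hB1, hB, hB'⟩ := hη.exists_bound
  have hB0 : 0 ≤ B := zero_le_one.trans hB1
  -- The two entries bound the kernel and its derivatives: `δ^{-d}` from the normalisation, a
  -- further `δ⁻¹ e^Λ` for a derivative along the flow.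
  refine ⟨max ((δ ^ d)⁻¹ * B) (δ⁻¹ * ((δ ^ d)⁻¹ * (Real.exp Λ * B))), ?_, ?_, ?_, ?_, ?_, ?_⟩
  · exact fun x => contDiff_rescale (contDiff_alberti hη.smooth Λ _) δ
  · exact fun x => (suppBall_alberti hη.suppBall hΛ (hM x)).rescale hδ
  · exact measurable_const.mul (measurable_alberti (A := fun q : Td d × E d => M q.1)
      hη.smooth.continuous (fun i j => (hMm i j).comp measurable_fst) (by fun_prop))
  · intro j
    simp only [pd_rescale]
    exact measurable_const.mul (measurable_const.mul (measurable_pd_alberti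
      (A := fun q : Td d × E d => M q.1)
      hη.smooth (fun i j => (hMm i j).comp measurable_fst) (by fun_prop) j))
  · intro x h
    refine le_max_of_le_left ?_
    rw [rescale, abs_mul, abs_of_pos (by positivity)]
    gcongr
    exact abs_alberti_le hΛ hB _
  · intro j x h
    refine le_max_of_le_right ?_
    rw [pd_rescale, abs_mul, abs_of_pos (by positivity), rescale, abs_mul, abs_of_pos (by positivity)]
    gcongr
    exact (abs_pd_le _ _ _).trans (norm_fderiv_alberti_le hη.smooth hΛ (hM x) hB' _)

end

/-! ### The identity for Borel data -/

section
variable {X Y Z W : Type*} [MeasurableSpace X] [MeasurableSpace Y] [MeasurableSpace Z]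
  [MeasurableSpace W]
  {a : Measure X} {b : Measure Y} {c : Measure Z} {e : Measure W} [SFinite a] [SFinite b] [SFinite c]
  [SFinite e]

lemma integral_quadruple {F : X → Y → Z → W → ℝ}
    (hF : Integrable (fun q : X × (Y × (Z × W)) => F q.1 q.2.1 q.2.2.1 q.2.2.2)
      (a.prod (b.prod (c.prod e)))) :
    ∫ x, ∫ y, ∫ z, ∫ w, F x y z w ∂e ∂c ∂b ∂a =
      ∫ q, F q.1 q.2.1 q.2.2.1 q.2.2.2 ∂(a.prod (b.prod (c.prod e))) := by
  rw [integral_prod _ hF]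
  refine integral_congr_ae ?_
  filter_upwards [hF.prod_right_ae] with x hx
  exact integral_triple (F := F x) hx

end

section
variable {u : Td d → E d} {μ : Measure (Td d)} {σ : Td d → Matrix (Fin d) (Fin d) ℝ} {T K : ℝ}
  {f g : ℝ → Td d → ℝ} {f₀ fT g₀ gT : Td d → ℝ} {η κ : E d → ℝ} {Λ δ r : ℝ}
  {M : Td d → Matrix (Fin d) (Fin d) ℝ}

lemma abs_contract_le (h : E d) (A : Matrix (Fin d) (Fin d) ℝ) (b : E d) :
    |contract h A b| ≤ frob A * ‖h‖ * ‖b‖ := by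
  rw [contract_eq]
  refine (abs_real_inner_le_norm _ _).trans ?_
  gcongr
  exact ((opT A).le_opNorm h).trans (by gcongr; exact norm_opT_le A)

lemma frob_nonneg (A : Matrix (Fin d) (Fin d) ℝ) : 0 ≤ frob A := Real.sqrt_nonneg _

lemma measurable_frob {X : Type*} [MeasurableSpace X] {A : X → Matrix (Fin d) (Fin d) ℝ}
    (hA : ∀ i j, Measurable fun x => A x i j) : Measurable fun x => frob (A x) := by
  unfold frob
  refine Measurable.sqrt (Finset.measurable_sum _ fun i _ => Finset.measurable_sum _ fun j _ => ?_)
  exact (hA i j).pow_const 2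

lemma measurable_contract_alberti (hη : ContDiff ℝ ∞ η) {X : Type*} [MeasurableSpace X]
    {A A' : X → Matrix (Fin d) (Fin d) ℝ} (hA : ∀ i j, Measurable fun x => A x i j)
    (hA' : ∀ i j, Measurable fun x => A' x i j) {h : X → E d} (hh : Measurable h) :
    Measurable fun x => contract (h x) (A x) (gradient (alberti η Λ (A' x)) (h x)) := by
  simp only [contract_gradient]
  refine Finset.measurable_sum _ fun j _ => Measurable.mul
    (Finset.measurable_sum _ fun i _ => Measurable.mul (by fun_prop) (hA i j))
    (measurable_pd_alberti hη hA' hh j)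

/-- The densities of the commutator terms, for a matrix field depending on both variables. -/
lemma integrable_density (hη : IsMollifier η) (hΛ : 0 < Λ)
    (hMm : ∀ i j, Measurable fun x => M x i j) (hM : ∀ x, frob (M x) ≤ 1) [IsFiniteMeasure μ]
    (hfm : Measurable (Function.uncurry f)) (hgm : Measurable (Function.uncurry g))
    (hfK : ∀ t x, |f t x| ≤ K) (hgK : ∀ t x, |g t x| ≤ K)
    (hκ : Integrable κ) (hκm : Measurable κ)
    {A : Td d → Td d → Matrix (Fin d) (Fin d) ℝ}
    (hAm : ∀ i j, Measurable fun q : Td d × Td d => A q.1 q.2 i j) {a : ℝ}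
    (hA : ∀ᵐ y ∂μ, ∀ x, frob (A y x) ≤ a) :
    (∀ᵐ y ∂μ, ∀ t x x' h, Integrable fun z => f t x * g t x' *
      contract h (A y (x + proj z)) (gradient (alberti η Λ (M (x + proj z))) h) * κ z) ∧
    Integrable (fun q : ℝ × (ℝ × (E d × Td d)) => ∫ z, f q.1 (q.2.2.2 + proj ((q.2.1 * δ) • q.2.2.1)) *
        g q.1 (q.2.2.2 + proj ((q.2.1 * δ) • q.2.2.1) - proj (δ • q.2.2.1)) *
        contract q.2.2.1 (A q.2.2.2 (q.2.2.2 + proj ((q.2.1 * δ) • q.2.2.1) + proj z))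
          (gradient (alberti η Λ (M (q.2.2.2 + proj ((q.2.1 * δ) • q.2.2.1) + proj z))) q.2.2.1) * κ z)
      ((volume.restrict (Set.Icc 0 T)).prod ((volume.restrict (Set.Icc (0 : ℝ) 1)).prod
        (volume.prod μ))) := by
  obtain ⟨B, hB1, hB, hB'⟩ := hη.exists_bound
  have hB0 : 0 ≤ B := zero_le_one.trans hB1
  have hK : 0 ≤ K := (abs_nonneg _).trans (hfK 0 0)
  -- `K * K` bounds the two solutions, `a * e^Λ` the matrix times `|h|` on the support, and `e^Λ *
  -- B` the gradient of the kernel.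
  set D : ℝ := K * K * (a * Real.exp Λ * (Real.exp Λ * B)) with hD
  have hcon : ∀ᵐ y ∂μ, ∀ t x x' (w : Td d) (h : E d),
      |f t x * g t x' * contract h (A y w) (gradient (alberti η Λ (M w)) h)| ≤
        (Metric.closedBall (0 : E d) (Real.exp Λ)).indicator (fun _ => D) h := by
    filter_upwards [hA] with y hy t x x' w h
    by_cases hh : h ∈ Metric.closedBall (0 : E d) (Real.exp Λ)
    · rw [Set.indicator_of_mem hh, abs_mul, abs_mul, hD]
      have h1 := abs_contract_le h (A y w) (gradient (alberti η Λ (M w)) h)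
      rw [norm_gradient] at h1
      have h2 := norm_fderiv_alberti_le hη.smooth hΛ (hM w) hB' h
      have h3 : ‖h‖ ≤ Real.exp Λ := by simpa using hh
      have h4 := frob_nonneg (A y w)
      have h5 := h4.trans (hy w)
      have h6 := hfK t x
      have h7 := hgK t x'
      gcongr
      exact h1.trans (by gcongr; exact hy w)
    · rw [Set.indicator_of_notMem hh]
      have : gradient (alberti η Λ (M w)) h = 0 := by
        rw [← norm_eq_zero, norm_gradient, (suppBall_alberti hη.suppBall hΛ (hM w)).fderiv h
          (by simpa using hh), norm_zero]
      simp [this, contract]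
  constructor
  · filter_upwards [hcon] with y hy t x x' h
    refine hκ.bdd_mul (c := (Metric.closedBall (0 : E d) (Real.exp Λ)).indicator (fun _ => D) h) ?_
      (Filter.Eventually.of_forall fun z => hy t x x' _ h)
    refine (measurable_const.mul (measurable_contract_alberti hη.smooth (fun i j => ?_)
      (fun i j => ?_) measurable_const)).aestronglyMeasurable
    · exact (hAm i j).comp (f := fun z : E d => (y, x + proj z)) (by fun_prop)
    · exact (hMm i j).comp (f := fun z : E d => x + proj z) (by fun_prop)
  · have hind : Integrable (fun q : ℝ × (ℝ × (E d × Td d)) =>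
        (Metric.closedBall (0 : E d) (Real.exp Λ)).indicator (fun _ => D * ∫ z, |κ z|) q.2.2.1)
        ((volume.restrict (Set.Icc 0 T)).prod ((volume.restrict (Set.Icc (0 : ℝ) 1)).prod
        (volume.prod μ))) := by
      have h1 : Integrable (fun h : E d =>
          (Metric.closedBall (0 : E d) (Real.exp Λ)).indicator (fun _ => D * ∫ z, |κ z|) h) :=
        (integrable_indicator_iff measurableSet_closedBall).2
          (integrableOn_const measure_closedBall_lt_top.ne)
      exact ((h1.comp_fst μ).comp_snd (volume.restrict (Set.Icc (0 : ℝ) 1))).comp_snd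
        (volume.restrict (Set.Icc 0 T))
    refine hind.mono' ?_ ?_
    · refine (measurable_integral_right (f := fun (q : ℝ × (ℝ × (E d × Td d))) z =>
        f q.1 (q.2.2.2 + proj ((q.2.1 * δ) • q.2.2.1)) *
        g q.1 (q.2.2.2 + proj ((q.2.1 * δ) • q.2.2.1) - proj (δ • q.2.2.1)) *
        contract q.2.2.1 (A q.2.2.2 (q.2.2.2 + proj ((q.2.1 * δ) • q.2.2.1) + proj z))
          (gradient (alberti η Λ (M (q.2.2.2 + proj ((q.2.1 * δ) • q.2.2.1) + proj z))) q.2.2.1) * κ z)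
        ?_).aestronglyMeasurable
      simp only [Function.uncurry_def]
      refine Measurable.mul (Measurable.mul (by fun_prop) ?_) (by fun_prop)
      refine measurable_contract_alberti hη.smooth (fun i j => ?_) (fun i j => ?_) (by fun_prop)
      · exact (hAm i j).comp (f := fun q : (ℝ × (ℝ × (E d × Td d))) × E d =>
          (q.1.2.2.2, q.1.2.2.2 + proj ((q.1.2.1 * δ) • q.1.2.2.1) + proj q.2)) (by fun_prop)
      · exact (hMm i j).comp (f := fun q : (ℝ × (ℝ × (E d × Td d))) × E d =>
          q.1.2.2.2 + proj ((q.1.2.1 * δ) • q.1.2.2.1) + proj q.2) (by fun_prop)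
    · have hae : ∀ᵐ q : ℝ × (ℝ × (E d × Td d)) ∂((volume.restrict (Set.Icc 0 T)).prod
          ((volume.restrict (Set.Icc (0 : ℝ) 1)).prod (volume.prod μ))),
          ∀ t x x' (w : Td d) (h : E d), |f t x * g t x' *
            contract h (A q.2.2.2 w) (gradient (alberti η Λ (M w)) h)| ≤
            (Metric.closedBall (0 : E d) (Real.exp Λ)).indicator (fun _ => D) h :=
        Measure.quasiMeasurePreserving_snd.ae (Measure.quasiMeasurePreserving_snd.ae
          (Measure.quasiMeasurePreserving_snd.ae hcon))
      filter_upwards [hae] with q hq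
      have e : (Metric.closedBall (0 : E d) (Real.exp Λ)).indicator (fun _ => D * ∫ z, |κ z|) q.2.2.1 =
          ∫ z, (Metric.closedBall (0 : E d) (Real.exp Λ)).indicator (fun _ => D) q.2.2.1 * |κ z| := by
        rw [integral_const_mul]
        by_cases hh : q.2.2.1 ∈ Metric.closedBall (0 : E d) (Real.exp Λ)
        · simp only [Set.indicator_of_mem hh]
        · simp only [Set.indicator_of_notMem hh, zero_mul]
      rw [e]
      refine norm_integral_le_of_norm_le (hκ.abs.const_mul _) (Filter.Eventually.of_forall fun z => ?_)
      rw [norm_mul, Real.norm_eq_abs, Real.norm_eq_abs]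
      exact mul_le_mul_of_nonneg_right (hq _ _ _ _ _) (abs_nonneg _)

end

end BVTransport

namespace BVTransport

variable {d : ℕ}

/-! ### The Frobenius norm -/

/-- A matrix as a vector of the Euclidean space of its entries. -/
noncomputable def matVec (A : Matrix (Fin d) (Fin d) ℝ) : EuclideanSpace ℝ (Fin d × Fin d) :=
  WithLp.toLp 2 fun q => A q.1 q.2

lemma frob_eq_norm (A : Matrix (Fin d) (Fin d) ℝ) : frob A = ‖matVec A‖ := by
  rw [EuclideanSpace.norm_eq, frob, Fintype.sum_prod_type]
  simp [matVec]

lemma frob_sub_le (A A' : Matrix (Fin d) (Fin d) ℝ) : frob (A - A') ≤ frob A + frob A' := by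
  simp only [frob_eq_norm]
  exact norm_sub_le (matVec A) (matVec A')

lemma frob_smul (c : ℝ) (A : Matrix (Fin d) (Fin d) ℝ) : frob (c • A) = |c| * frob A := by
  simp only [frob_eq_norm]
  exact norm_smul c (matVec A)

lemma contract_add (h : E d) (A A' : Matrix (Fin d) (Fin d) ℝ) (b : E d) :
    contract h (A + A') b = contract h A b + contract h A' b := by
  simp only [contract, Matrix.add_apply, mul_add, add_mul, Finset.sum_add_distrib]

/-! ### The identity with the five terms. -/

section
variable {u : Td d → E d} {μ : Measure (Td d)} {σ : Td d → Matrix (Fin d) (Fin d) ℝ} {T K : ℝ}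
  {f g : ℝ → Td d → ℝ} {f₀ fT g₀ gT : Td d → ℝ} {η κ : E d → ℝ} {Λ δ ε : ℝ}
  {M : Td d → Matrix (Fin d) (Fin d) ℝ}

lemma IsBVWithGradient.ae_frob_sub_le (h : IsBVWithGradient u μ σ) (hM : ∀ x, frob (M x) ≤ 1) :
    ∀ᵐ y ∂μ, ∀ x, frob (σ y - M x) ≤ 2 := by
  filter_upwards [h.unit] with y hy x
  linarith [frob_sub_le (σ y) (M x), hM x]

lemma measurable_conv_alberti (hη : IsMollifier η) (hΛ : 0 < Λ) (hδ : 0 < δ)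
    (hMm : ∀ i j, Measurable fun x => M x i j) (hM : ∀ x, frob (M x) ≤ 1)
    {X : Type*} [MeasurableSpace X] {v : X → Td d → ℝ} (hv : Measurable (Function.uncurry v))
    {x y : X → Td d} (hx : Measurable x) (hy : Measurable y) :
    Measurable fun q => conv (v q) (rescale (alberti η Λ (M (y q))) δ) (x q) := by
  obtain ⟨B, hp⟩ := exists_isKernelFamily_alberti hη hΛ hδ hMm hM
  exact measurable_conv hv
    (hp.meas.comp (f := fun q : X × E d => (y q.1, q.2)) (by fun_prop)) hx

lemma integrable_conv_alberti (hη : IsMollifier η) (hΛ : 0 < Λ) (hδ : 0 < δ)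
    (hMm : ∀ i j, Measurable fun x => M x i j) (hM : ∀ x, frob (M x) ≤ 1) {v : Td d → ℝ}
    (hv : Measurable v) (hvK : ∀ x, |v x| ≤ K) (hκ : Integrable κ) (x : Td d) :
    Integrable fun z => conv v (rescale (alberti η Λ (M (x + proj z))) δ) x * κ z := by
  obtain ⟨B, hp⟩ := exists_isKernelFamily_alberti hη hΛ hδ hMm hM
  refine hκ.bdd_mul (c := _) ?_ (Filter.Eventually.of_forall fun z => hp.abs_conv_le hvK (x + proj z) x)
  exact (measurable_conv_alberti hη hΛ hδ hMm hM (v := fun _ : E d => v) (hv.comp measurable_snd)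
    measurable_const (by fun_prop)).aestronglyMeasurable

/-- Since `η_ε` has mass one, the unregularised pairing splits off. -/
lemma I1_eq (hη : IsMollifier η) (hΛ : 0 < Λ) (hδ : 0 < δ) (hε : 0 < ε)
    (hMm : ∀ i j, Measurable fun x => M x i j) (hM : ∀ x, frob (M x) ≤ 1)
    (hfT : Measurable fT) (hfTK : ∀ x, |fT x| ≤ K) (hgT : Measurable gT) (hgTK : ∀ x, |gT x| ≤ K) :
    I1 η M Λ δ ε fT gT = (∫ x, fT x * gT x) -
      ∫ x, ∫ z, fT x * conv gT (rescale (alberti η Λ (M (x + proj z))) δ) x * rescale η ε z := by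
  have hκi : Integrable (rescale η ε) :=
    (hη.suppBall.rescale hε).integrable (continuous_rescale hη.smooth.continuous ε)
  have hκm : Measurable (rescale η ε) := (continuous_rescale hη.smooth.continuous ε).measurable
  have hκ1 : ∫ z, rescale η ε z = 1 := by rw [integral_rescale η hε, hη.integral]
  have hK : 0 ≤ K := (abs_nonneg _).trans (hfTK 0)
  have hi := integrable_conv_alberti hη hΛ hδ hMm hM hgT hgTK hκi
  obtain ⟨B, hp⟩ := exists_isKernelFamily_alberti hη hΛ hδ hMm hM
  rw [I1, ← integral_sub]
  · congr 1; funext x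
    have e : ∀ z, fT x * (gT x - conv gT (rescale (alberti η Λ (M (x + proj z))) δ) x) *
        rescale η ε z = fT x * gT x * rescale η ε z -
        fT x * conv gT (rescale (alberti η Λ (M (x + proj z))) δ) x * rescale η ε z := fun z => by ring
    simp only [e]
    rw [integral_sub (hκi.const_mul _), integral_const_mul, hκ1, mul_one]
    simpa only [mul_assoc] using (hi x).const_mul (fT x)
  · exact Integrable.of_bound (by fun_prop) (K * K) (Filter.Eventually.of_forall fun x => by
      rw [norm_mul]; exact mul_le_mul (hfTK x) (hgTK x) (norm_nonneg _) hK)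
  · simp only [mul_assoc, integral_const_mul]
    refine Integrable.of_bound ?_ (K * ∫ z, K * (B * volume.real (Metric.closedBall (0 : E d)
      (δ * Real.exp Λ))) * |rescale η ε z|) (Filter.Eventually.of_forall fun x => ?_)
    · refine (hfT.mul (measurable_integral_right (f := fun (x : Td d) z =>
        conv gT (rescale (alberti η Λ (M (x + proj z))) δ) x * rescale η ε z) ?_)).aestronglyMeasurable
      simp only [Function.uncurry_def]
      exact (measurable_conv_alberti hη hΛ hδ hMm hM (v := fun _ : Td d × E d => gT)
        (hgT.comp measurable_snd) measurable_fst (by fun_prop)).mul (by fun_prop)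
    · rw [norm_mul]
      refine mul_le_mul (hfTK x) ?_ (norm_nonneg _) hK
      refine norm_integral_le_of_norm_le (hκi.abs.const_mul _) (Filter.Eventually.of_forall fun z => ?_)
      rw [norm_mul]
      exact mul_le_mul_of_nonneg_right (hp.abs_conv_le hgTK _ x) (abs_nonneg _)

/-- The substitution `a = δ h` brings the commutator to unit scale, and `σ = (σ - M) + M` is
inserted under all integrals. -/
lemma commutator_eq_I4_add_I5 (hη : IsMollifier η) (hΛ : 0 < Λ) (hδ : 0 < δ) (hε : 0 < ε)
    (hMm : ∀ i j, Measurable fun x => M x i j) (hM : ∀ x, frob (M x) ≤ 1)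
    (h : IsBVWithGradient u μ σ)
    (hfm : Measurable (Function.uncurry f)) (hgm : Measurable (Function.uncurry g))
    (hfK : ∀ t x, |f t x| ≤ K) (hgK : ∀ t x, |g t x| ≤ K) :
    ∫ t in Set.Icc 0 T, ∫ s in Set.Icc (0 : ℝ) 1, ∫ a, ∫ y,
        (∫ z, f t (y + proj (s • a)) * g t (y + proj (s • a) - proj a) *
        contract a (σ y) (gradient (rescale (alberti η Λ (M (y + proj (s • a) + proj z))) δ) a) *
          rescale η ε z) ∂μ =
      I4 η M Λ δ ε T μ σ f g + I5 η M Λ δ ε T μ f g := by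
  have := h.finite
  have hκi : Integrable (rescale η ε) :=
    (hη.suppBall.rescale hε).integrable (continuous_rescale hη.smooth.continuous ε)
  have hκm : Measurable (rescale η ε) := (continuous_rescale hη.smooth.continuous ε).measurable
  have hσm := h.measurable
  have i4 := integrable_density (μ := μ) (T := T) (δ := δ) hη hΛ hMm hM hfm hgm hfK hgK hκi hκm
    (A := fun y x => σ y - M x)
    (fun i j => ((hσm i j).comp measurable_fst).sub ((hMm i j).comp measurable_snd))
    (h.ae_frob_sub_le hM)
  have i5 := integrable_density (μ := μ) (T := T) (δ := δ) hη hΛ hMm hM hfm hgm hfK hgK hκi hκm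
    (A := fun y x => M x) (fun i j => (hMm i j).comp measurable_snd)
    (Filter.Eventually.of_forall fun _ => hM)
  have iJ := integrable_density (μ := μ) (T := T) (δ := δ) hη hΛ hMm hM hfm hgm hfK hgK hκi hκm
    (A := fun y x => σ y) (fun i j => (hσm i j).comp measurable_fst)
    (a := 1) (h.unit.mono fun y hy _ => hy.le)
  have e : ∀ t s : ℝ, ∫ a, ∫ y,
        (∫ z, f t (y + proj (s • a)) * g t (y + proj (s • a) - proj a) *
        contract a (σ y) (gradient (rescale (alberti η Λ (M (y + proj (s • a) + proj z))) δ) a) *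
          rescale η ε z) ∂μ = ∫ h, ∫ y, (∫ z, f t (y + proj ((s * δ) • h)) *
        g t (y + proj ((s * δ) • h) - proj (δ • h)) *
        contract h (σ y) (gradient (alberti η Λ (M (y + proj ((s * δ) • h) + proj z))) h) *
          rescale η ε z) ∂μ := by
    intro t s
    -- The Jacobian `δ^d` cancels the normalisation of the rescaled kernel.
    rw [integral_eq_pow_mul_integral_smul hδ, ← integral_const_mul]
    congr 1; funext h
    rw [← integral_const_mul]
    congr 1; funext y
    rw [← integral_const_mul]
    congr 1; funext z
    rw [smul_smul, contract_gradient_rescale_smul _ hδ]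
    field_simp
  simp only [e]
  have q4 := integral_quadruple (F := fun t s h y => ∫ z, f t (y + proj ((s * δ) • h)) *
        g t (y + proj ((s * δ) • h) - proj (δ • h)) *
        contract h (σ y - M (y + proj ((s * δ) • h) + proj z))
          (gradient (alberti η Λ (M (y + proj ((s * δ) • h) + proj z))) h) *
          rescale η ε z) i4.2
  have q5 := integral_quadruple (F := fun t s h y => ∫ z, f t (y + proj ((s * δ) • h)) *
        g t (y + proj ((s * δ) • h) - proj (δ • h)) *
        contract h (M (y + proj ((s * δ) • h) + proj z))
          (gradient (alberti η Λ (M (y + proj ((s * δ) • h) + proj z))) h) *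
          rescale η ε z) i5.2
  have qJ := integral_quadruple (F := fun t s h y => ∫ z, f t (y + proj ((s * δ) • h)) *
        g t (y + proj ((s * δ) • h) - proj (δ • h)) *
        contract h (σ y)
          (gradient (alberti η Λ (M (y + proj ((s * δ) • h) + proj z))) h) *
          rescale η ε z) iJ.2
  rw [I4, I5, qJ]
  refine Eq.trans ?_ (congrArg₂ (· + ·) q4 q5).symm
  rw [← integral_add i4.2 i5.2]
  refine integral_congr_ae ?_
  have h4 := i4.1
  have h5 := i5.1
  have hae : ∀ᵐ q : ℝ × (ℝ × (E d × Td d)) ∂((volume.restrict (Set.Icc 0 T)).prod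
          ((volume.restrict (Set.Icc (0 : ℝ) 1)).prod (volume.prod μ))), _ :=
    Measure.quasiMeasurePreserving_snd.ae (Measure.quasiMeasurePreserving_snd.ae
      (Measure.quasiMeasurePreserving_snd.ae (h4.and h5)))
  filter_upwards [hae] with q hq
  rw [← integral_add (hq.1 _ _ _ _) (hq.2 _ _ _ _)]
  congr 1; funext z
  rw [← add_mul, ← mul_add, ← contract_add, sub_add_cancel]

theorem transport_identity_alberti (hη : IsMollifier η) (hΛ : 0 < Λ) (hδ : 0 < δ) (hε : 0 < ε)
    (hMm : ∀ i j, Measurable fun x => M x i j) (hM : ∀ x, frob (M x) ≤ 1)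
    (hT : 0 < T) (hf : IsBddSolution u T K f f₀ fT)
    (hg : IsBddSolution u T K g g₀ gT) (h : IsBVWithGradient u μ σ) (hum : Measurable u)
    (hf₀K : ∀ x, |f₀ x| ≤ K) (hfTK : ∀ x, |fT x| ≤ K) (hg₀K : ∀ x, |g₀ x| ≤ K)
    (hgTK : ∀ x, |gT x| ≤ K) :
    ∫ x, fT x * gT x = I1 η M Λ δ ε fT gT + I2 η M Λ δ ε f₀ g₀ + I3 η M Λ δ ε T u f g +
      I4 η M Λ δ ε T μ σ f g + I5 η M Λ δ ε T μ f g := by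
  obtain ⟨B, hp⟩ := exists_isKernelFamily_alberti hη hΛ hδ hMm hM
  have key := transport_identity hT hf hg h hum hf₀K hfTK hg₀K hgTK hp (hη.suppBall.rescale hε)
    (contDiff_rescale hη.smooth ε)
  have e1 := I1_eq hη hΛ hδ hε hMm hM hf.meas_final hfTK hg.meas_final hgTK
  have e2 := commutator_eq_I4_add_I5 (T := T) hη hΛ hδ hε hMm hM h hf.meas hg.meas hf.bound hg.bound
  rw [e2] at key
  have e3 : I2 η M Λ δ ε f₀ g₀ = ∫ x, ∫ z, f₀ x *
    conv g₀ (rescale (alberti η Λ (M (x + proj z))) δ) x * rescale η ε z := rfl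
  have e4 : I3 η M Λ δ ε T u f g = -∫ t in Set.Icc 0 T, ∫ x, ∫ z : E d, f t x *
    conv (g t) (rescale (alberti η Λ (M (x + proj z))) δ) x *
      inner ℝ (u x) (gradient (rescale η ε) z) := rfl
  rw [← e3, ← e4] at key
  linarith

end

end BVTransport

namespace BVTransport

variable {d : ℕ}

/-! ### The mollified gradient and the matrix field -/

section
variable {u : Td d → E d} {μ : Measure (Td d)} {σ : Td d → Matrix (Fin d) (Fin d) ℝ}
  {η k : E d → ℝ} {R ε : ℝ} {M : Td d → Matrix (Fin d) (Fin d) ℝ}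

lemma IsBVWithGradient.continuous_gradConv (h : IsBVWithGradient u μ σ) (hk : SuppBall k R)
    (hc : Continuous k) (i j : Fin d) : Continuous fun x => gradConv μ σ k x i j := by
  have hN := hk.continuous_periodise hc
  obtain ⟨C, hC0, hC⟩ := Continuous.exists_bound_torus hN
  simp only [gradConv, Matrix.of_apply]
  have hi := h.integrable_entry i j
  refine continuous_of_dominated (bound := fun y => C * |σ y i j|) (fun x => ?_) (fun x => ?_)
    (hi.abs.const_mul C) (Filter.Eventually.of_forall fun y => by fun_prop)
  · have := hN.measurable
    exact (Measurable.aestronglyMeasurable (by fun_prop)).mul hi.1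
  · refine Filter.Eventually.of_forall fun y => ?_
    rw [norm_mul]
    exact mul_le_mul_of_nonneg_right (hC _) (norm_nonneg _)

/-- The trace is the mollified divergence: test `DivFree` with the translated periodised kernel. -/
lemma IsBVWithGradient.trace_gradConv (h : IsBVWithGradient u μ σ) (hdiv : DivFree u)
    (hk : SuppBall k R) (hc : ContDiff ℝ ∞ k) (x : Td d) : (gradConv μ σ k x).trace = 0 := by
  have hs := (hk.torusSmooth_periodise hc).comp_sub x
  have h1 := hdiv _ hs
  simp only [inner_torusGrad_eq_sum] at h1
  have hg := fun i => (hs.torusGrad i).continuous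
  rw [integral_finsetSum] at h1
  · simp only [fun i => h.grad _ hs i i, Finset.sum_neg_distrib, neg_eq_zero] at h1
    simpa [Matrix.trace, gradConv] using h1
  · intro i _
    obtain ⟨C, hC0, hC⟩ := Continuous.exists_bound_torus (hg i)
    exact (h.integrable_coord i).mul_bdd (c := C) (hg i).aestronglyMeasurable
      (Filter.Eventually.of_forall hC)

/-- Where the denominator vanishes, `0⁻¹ = 0` makes the field zero, so the bound holds at every
point. -/
lemma frob_matField_le (x : Td d) : frob (matField η μ σ ε x) ≤ 1 := by
  rw [matField, frob_smul, abs_inv, abs_of_nonneg (frob_nonneg _)]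
  exact inv_mul_le_one

lemma IsBVWithGradient.trace_matField (h : IsBVWithGradient u μ σ) (hdiv : DivFree u)
    (hη : IsMollifier η) (hε : 0 < ε) (x : Td d) : (matField η μ σ ε x).trace = 0 := by
  rw [matField, Matrix.trace_smul, h.trace_gradConv hdiv
    (hη.suppBall.rescale (by linarith : 0 < 4 * ε)) (contDiff_rescale hη.smooth _), smul_zero]

lemma IsBVWithGradient.measurable_matField (h : IsBVWithGradient u μ σ)
    (hη : IsMollifier η) (hε : 0 < ε) (i j : Fin d) : Measurable fun x => matField η μ σ ε x i j := by
  have hc : ∀ i j, Measurable fun x => gradConv μ σ (rescale η (4 * ε)) x i j := fun i j =>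
    (h.continuous_gradConv (hη.suppBall.rescale (by linarith : 0 < 4 * ε))
      (continuous_rescale hη.smooth.continuous _) i j).measurable
  exact (measurable_frob hc).inv.mul (hc i j)

/-- Because `M̄` is aligned with the mollified gradient, their contraction is its norm; this
produces `‖∇u * η_{4ε}‖` in the bound of `I4`. -/
lemma sum_matField_mul_gradConv (x : Td d) :
    ∑ i, ∑ j, matField η μ σ ε x i j * gradConv μ σ (rescale η (4 * ε)) x i j =
      frob (gradConv μ σ (rescale η (4 * ε)) x) := by
  set G := gradConv μ σ (rescale η (4 * ε)) x
  have h1 : ∑ i, ∑ j, G i j ^ 2 = frob G ^ 2 := by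
    rw [frob, Real.sq_sqrt (by positivity)]
  have h2 : ∀ i j, matField η μ σ ε x i j * G i j = (frob G)⁻¹ * G i j ^ 2 := fun i j => by
    change (frob G)⁻¹ * G i j * G i j = _
    ring
  simp only [h2, ← Finset.mul_sum, h1]
  rcases eq_or_ne (frob G) 0 with h0 | h0
  · simp [h0]
  · field_simp

/-- Fubini moves the mollifier from `M` to the measure `∇u`. -/
lemma IsBVWithGradient.integral_sum_mul (h : IsBVWithGradient u μ σ) (hk : SuppBall k R)
    (hc : Continuous k) (hMm : ∀ i j, Measurable fun x => M x i j) (hM : ∀ x, frob (M x) ≤ 1) :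
    ∫ y, (∫ z, (∑ i, ∑ j, σ y i j * M (y + proj z) i j) * k z) ∂μ =
      ∫ x, ∑ i, ∑ j, M x i j * gradConv μ σ k x i j := by
  have := h.finite
  have hMi : ∀ i j, Integrable fun x => M x i j := fun i j =>
    Integrable.of_bound (hMm i j).aestronglyMeasurable 1 (Filter.Eventually.of_forall fun x =>
      (abs_entry_le_frob (M x) i j).trans (hM x))
  have hN := hk.continuous_periodise hc
  obtain ⟨C, hC0, hC⟩ := Continuous.exists_bound_torus hN
  have hNm := hN.measurable
  have hprod : ∀ i j, Integrable (fun q : Td d × Td d =>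
      M q.2 i j * (periodise k (q.2 - q.1) * σ q.1 i j)) (μ.prod volume) := by
    intro i j
    have h1 := ((h.integrable_entry i j).mul_prod (hMi i j)).bdd_mul (c := C)
      (f := fun q : Td d × Td d => periodise k (q.2 - q.1))
      (Measurable.aestronglyMeasurable (by fun_prop)) (Filter.Eventually.of_forall fun q => hC _)
    exact h1.congr (Filter.Eventually.of_forall fun q => by ring)
  have hMG : ∀ i j, Integrable fun x => M x i j * gradConv μ σ k x i j := fun i j => by
    have hG := h.continuous_gradConv hk hc i j
    obtain ⟨C, hC0, hC⟩ := Continuous.exists_bound_torus hG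
    exact (hMi i j).mul_bdd (c := C) hG.aestronglyMeasurable (Filter.Eventually.of_forall hC)
  have e1 : ∀ y, ∫ z, (∑ i, ∑ j, σ y i j * M (y + proj z) i j) * k z =
      ∑ i, ∑ j, ∫ x, M x i j * (periodise k (x - y) * σ y i j) := by
    intro y
    simp only [Finset.sum_mul]
    have hi : ∀ i j, Integrable fun z => σ y i j * M (y + proj z) i j * k z := fun i j => by
      simpa only [mul_assoc] using
        (hk.integrable_mul hc ((hMi i j).comp_add_left y)).const_mul (σ y i j)
    rw [integral_finsetSum _ fun i _ => integrable_finsetSum _ fun j _ => hi i j]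
    refine Finset.sum_congr rfl fun i _ => ?_
    rw [integral_finsetSum _ fun j _ => hi i j]
    refine Finset.sum_congr rfl fun j _ => ?_
    simp only [mul_assoc, integral_const_mul]
    rw [← integral_mul_periodise_sub hk hc (hMi i j), ← integral_const_mul]
    congr 1; funext x; ring
  simp only [e1]
  rw [integral_finsetSum _ fun i _ => integrable_finsetSum _ fun j _ => (hprod i j).integral_prod_left,
    integral_finsetSum]
  · refine Finset.sum_congr rfl fun i _ => ?_
    rw [integral_finsetSum _ fun j _ => (hprod i j).integral_prod_left, integral_finsetSum]
    · refine Finset.sum_congr rfl fun j _ => ?_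
      rw [integral_integral_swap (hprod i j)]
      simp only [integral_const_mul, gradConv, Matrix.of_apply]
    · intro j _
      exact hMG i j
  · intro i _
    exact integrable_finsetSum _ fun j _ => hMG i j

end

end BVTransport

namespace BVTransport

variable {d : ℕ}

/-! ### Bounds for the commutator terms -/

/-- A ratio bound comparing a shifted mollifier with the mollifier at a larger scale. -/
lemma IsMollifier.exists_shift_bound {η : E d → ℝ} (hη : IsMollifier η) :
    ∃ C, 0 < C ∧ ∀ (ε : ℝ) (v z : E d), 0 < ε → ‖v‖ ≤ ε →
      rescale η ε (z - v) ≤ C * rescale η (4 * ε) z := by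
  obtain ⟨B, hB1, hB, -⟩ := hη.exists_bound
  obtain ⟨w, hw, hmin⟩ := (isCompact_closedBall (0 : E d) (1 / 2)).exists_isMinOn
    ⟨0, by simp⟩ hη.smooth.continuous.continuousOn
  have hm : 0 < η w := hη.pos w (by simpa using hw)
  -- `B` bounds `η` from above and `η w` is its minimum on the half ball; `4^d` compares the
  -- normalisations. If `|z - v| ≤ ε` and `|v| ≤ ε`, then `|z| ≤ 2ε`, half the radius of the larger
  -- kernel, where it is bounded below.
  refine ⟨4 ^ d * B / η w, by positivity, fun ε v z hε hv => ?_⟩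
  have hRn : 0 ≤ rescale η (4 * ε) z := mul_nonneg (by positivity) (hη.nonneg _)
  by_cases hz : ‖z - v‖ ≤ ε
  · have hz2 : ‖z‖ ≤ 2 * ε := by
      calc ‖z‖ = ‖(z - v) + v‖ := by rw [sub_add_cancel]
        _ ≤ ‖z - v‖ + ‖v‖ := norm_add_le _ _
        _ ≤ _ := by linarith
    have h1 : η w ≤ η ((4 * ε)⁻¹ • z) := by
      refine hmin ?_
      rw [mem_closedBall_zero_iff, norm_smul, norm_inv, Real.norm_of_nonneg (by positivity),
        ← div_eq_inv_mul, div_le_iff₀ (by positivity)]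
      linarith
    have h2 : η (ε⁻¹ • (z - v)) ≤ B := (le_abs_self _).trans (hB _)
    calc rescale η ε (z - v) ≤ (ε ^ d)⁻¹ * B := by
          unfold rescale; gcongr
      _ = 4 ^ d * B / η w * (((4 * ε) ^ d)⁻¹ * η w) := by
          rw [mul_pow]; field_simp
      _ ≤ _ := by unfold rescale; gcongr
  · have : rescale η ε (z - v) = 0 := by
      have := hη.suppBall.rescale hε (z - v) (by simpa using hz)
      exact this
    rw [this]
    have : 0 ≤ 4 ^ d * B / η w := by positivity
    positivity

section
variable {η : E d → ℝ} {Λ δ ε T Kf Kg : ℝ} {μ : Measure (Td d)} {f g : ℝ → Td d → ℝ}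
  {M : Td d → Matrix (Fin d) (Fin d) ℝ} {A : Td d → Td d → Matrix (Fin d) (Fin d) ℝ}

/-- Common to `I4` and `I5`. The solutions are replaced by their bounds, and the localisation is
recentred at `y`, where `∇u` is evaluated, at the price of `η_{4ε}` for `η_ε`. Then `t` and `s` no
longer occur. Extended nonnegative integrals make Tonelli free of integrability conditions. -/
lemma enorm_commutator_le (hη : IsMollifier η) (hΛ : 0 < Λ) (hδ : 0 < δ) (hε : 0 < ε)
    (hδε : δ ≤ ε * Real.exp (-Λ)) {C₀ : ℝ} (hC₀ : 0 < C₀)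
    (hshift : ∀ (ε : ℝ) (v z : E d), 0 < ε → ‖v‖ ≤ ε →
      rescale η ε (z - v) ≤ C₀ * rescale η (4 * ε) z) [SFinite μ]
    (hMm : ∀ i j, Measurable fun x => M x i j) (hM : ∀ x, frob (M x) ≤ 1)
    (hf : ∀ t x, |f t x| ≤ Kf) (hg : ∀ t x, |g t x| ≤ Kg)
    (hAm : ∀ i j, Measurable fun q : Td d × Td d => A q.1 q.2 i j) :
    ‖∫ t in Set.Icc 0 T, ∫ s in Set.Icc (0 : ℝ) 1, ∫ h : E d, ∫ y,
      (∫ z : E d, f t (y + proj ((s * δ) • h)) * g t (y + proj ((s * δ) • h) - proj (δ • h)) *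
        contract h (A y (y + proj ((s * δ) • h) + proj z))
          (gradient (alberti η Λ (M (y + proj ((s * δ) • h) + proj z))) h) *
        rescale η ε z) ∂μ‖ₑ ≤
      ENNReal.ofReal (Kf * Kg * C₀ * T) * ∫⁻ y, (∫⁻ z : E d, ‖rescale η (4 * ε) z‖ₑ *
        ∫⁻ h, ‖contract h (A y (y + proj z)) (gradient (alberti η Λ (M (y + proj z))) h)‖ₑ) ∂μ := by
  have hKf : 0 ≤ Kf := (abs_nonneg _).trans (hf 0 0)
  have hKg : 0 ≤ Kg := (abs_nonneg _).trans (hg 0 0)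
  have hκ4 : Measurable fun z => rescale η (4 * ε) z :=
    (continuous_rescale hη.smooth.continuous _).measurable
  set c : Td d → Td d → E d → ℝ≥0∞ := fun y w h =>
    ‖contract h (A y w) (gradient (alberti η Λ (M w)) h)‖ₑ with hc
  have hcm : Measurable fun q : (Td d × Td d) × E d => c q.1.1 q.1.2 q.2 := by
    refine (measurable_contract_alberti hη.smooth (fun i j => ?_) (fun i j => ?_) (by fun_prop)).enorm
    · exact (hAm i j).comp measurable_fst
    · exact (hMm i j).comp (by fun_prop)
  have hc0 : ∀ y w h, Real.exp Λ < ‖h‖ → c y w h = 0 := by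
    intro y w h hh
    have : gradient (alberti η Λ (M w)) h = 0 := by
      rw [← norm_eq_zero, norm_gradient, (suppBall_alberti hη.suppBall hΛ (hM w)).fderiv h hh, norm_zero]
    simp [hc, this, contract]
  have step : ∀ s ∈ Set.Icc (0 : ℝ) 1, ∀ h y, ∫⁻ z : E d, c y (y + proj ((s * δ) • h) + proj z) h *
      ‖rescale η ε z‖ₑ ≤ ENNReal.ofReal C₀ * ∫⁻ z : E d, ‖rescale η (4 * ε) z‖ₑ * c y (y + proj z) h := by
    intro s hs h y
    by_cases hh : Real.exp Λ < ‖h‖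
    · simp [hc0 _ _ h hh]
    push Not at hh
    have hv : ‖(s * δ) • h‖ ≤ ε := by
      rw [norm_smul, Real.norm_of_nonneg (mul_nonneg hs.1 hδ.le)]
      calc s * δ * ‖h‖ ≤ 1 * (ε * Real.exp (-Λ)) * Real.exp Λ := by
            gcongr
            exact hs.2
        _ = ε := by rw [one_mul, mul_assoc, ← Real.exp_add]; simp
    -- The substitution `z ↦ z - sδh` turns `x̄ = y + sδh + z` into `y + z`; the shift is at most `δ
    -- e^Λ ≤ ε`.
    rw [← lintegral_sub_right_eq_self _ ((s * δ) • h), ← lintegral_const_mul' _ _ ENNReal.ofReal_ne_top]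
    refine lintegral_mono fun z => ?_
    have e : y + proj ((s * δ) • h) + proj (z - (s * δ) • h) = y + proj z := by
      rw [proj_sub]; abel
    rw [e, mul_comm, ← mul_assoc]
    gcongr
    have h1 := hshift ε _ z hε hv
    have h2 : 0 ≤ rescale η ε (z - (s * δ) • h) := mul_nonneg (by positivity) (hη.nonneg _)
    have h3 : 0 ≤ rescale η (4 * ε) z := mul_nonneg (by positivity) (hη.nonneg _)
    rw [Real.enorm_of_nonneg h2, Real.enorm_of_nonneg h3, ← ENNReal.ofReal_mul hC₀.le]
    exact ENNReal.ofReal_le_ofReal h1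
  set S := ∫⁻ y, (∫⁻ z : E d, ‖rescale η (4 * ε) z‖ₑ * ∫⁻ h, c y (y + proj z) h) ∂μ with hS
  have swap : ∫⁻ h : E d, ∫⁻ y, (∫⁻ z : E d, ‖rescale η (4 * ε) z‖ₑ * c y (y + proj z) h) ∂μ = S := by
    have hm3 : Measurable fun q : (E d × Td d) × E d => ‖rescale η (4 * ε) q.2‖ₑ *
        c q.1.2 (q.1.2 + proj q.2) q.1.1 := by
      refine Measurable.mul (hκ4.comp measurable_snd).enorm ?_
      exact hcm.comp (f := fun q : (E d × Td d) × E d => ((q.1.2, q.1.2 + proj q.2), q.1.1)) (by fun_prop)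
    rw [lintegral_lintegral_swap hm3.lintegral_prod_right'.aemeasurable, hS]
    refine lintegral_congr fun y => ?_
    rw [lintegral_lintegral_swap]
    · refine lintegral_congr fun z => ?_
      rw [lintegral_const_mul' _ _ enorm_ne_top]
    · exact (hm3.comp (f := fun q : E d × E d => ((q.1, y), q.2)) (by fun_prop)).aemeasurable
  have inner : ∀ t, ∀ s ∈ Set.Icc (0 : ℝ) 1, ‖∫ h : E d, ∫ y,
      (∫ z : E d, f t (y + proj ((s * δ) • h)) * g t (y + proj ((s * δ) • h) - proj (δ • h)) *
        contract h (A y (y + proj ((s * δ) • h) + proj z))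
          (gradient (alberti η Λ (M (y + proj ((s * δ) • h) + proj z))) h) *
        rescale η ε z) ∂μ‖ₑ ≤ ENNReal.ofReal (Kf * Kg * C₀) * S := by
    intro t s hs
    rw [← swap, ← lintegral_const_mul' _ _ ENNReal.ofReal_ne_top]
    refine (enorm_integral_le_lintegral_enorm _).trans (lintegral_mono fun h => ?_)
    rw [← lintegral_const_mul' _ _ ENNReal.ofReal_ne_top]
    refine (enorm_integral_le_lintegral_enorm _).trans (lintegral_mono fun y => ?_)
    refine (enorm_integral_le_lintegral_enorm _).trans ?_
    rw [ENNReal.ofReal_mul (by positivity), mul_assoc]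
    refine le_trans ?_ (mul_le_mul_right (step s hs h y) _)
    rw [← lintegral_const_mul' _ _ ENNReal.ofReal_ne_top]
    refine lintegral_mono fun z => ?_
    rw [enorm_mul, enorm_mul, mul_assoc]
    refine mul_le_mul_left ?_ _
    rw [← ofReal_norm]
    refine ENNReal.ofReal_le_ofReal ?_
    rw [norm_mul]
    exact mul_le_mul (hf _ _) (hg _ _) (norm_nonneg _) hKf
  refine (enorm_integral_le_lintegral_enorm _).trans ?_
  have : ∀ t, ‖∫ s in Set.Icc (0 : ℝ) 1, ∫ h : E d, ∫ y,
      (∫ z : E d, f t (y + proj ((s * δ) • h)) * g t (y + proj ((s * δ) • h) - proj (δ • h)) *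
        contract h (A y (y + proj ((s * δ) • h) + proj z))
          (gradient (alberti η Λ (M (y + proj ((s * δ) • h) + proj z))) h) *
        rescale η ε z) ∂μ‖ₑ ≤ ENNReal.ofReal (Kf * Kg * C₀) * S := by
    intro t
    refine (enorm_integral_le_lintegral_enorm _).trans ?_
    calc _ ≤ ∫⁻ s in Set.Icc (0 : ℝ) 1, ENNReal.ofReal (Kf * Kg * C₀) * S :=
          setLIntegral_mono' measurableSet_Icc fun s hs => inner t s hs
      _ = _ := by simp
  calc _ ≤ ∫⁻ t in Set.Icc 0 T, ENNReal.ofReal (Kf * Kg * C₀) * S := lintegral_mono fun t => this t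
    _ = _ := by
      rw [lintegral_const, Measure.restrict_apply_univ, Real.volume_Icc, sub_zero,
        ENNReal.ofReal_mul (p := Kf * Kg * C₀) (by positivity)]
      ring

lemma integrable_contract_alberti (hη : IsMollifier η) (hΛ : 0 < Λ) {M A : Matrix (Fin d) (Fin d) ℝ}
    (hM : frob M ≤ 1) : Integrable fun h => contract h A (gradient (alberti η Λ M) h) := by
  have hs : SuppBall (fun h => contract h A (gradient (alberti η Λ M) h)) (Real.exp Λ) := by
    intro h hh
    have : gradient (alberti η Λ M) h = 0 := by
      rw [← norm_eq_zero, norm_gradient, (suppBall_alberti hη.suppBall hΛ hM).fderiv h hh, norm_zero]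
    simp [this, contract]
  refine hs.integrable ?_
  simp only [contract_gradient]
  have := fun j => (contDiff_pd (contDiff_alberti hη.smooth Λ M) j).continuous
  fun_prop

/-- For every centre the `h`-integral is at most `2/Λ`; the remaining integrals over `z` and `y`
contribute mass one and `‖∇u‖`. -/
theorem abs_I5_le (hη : IsMollifier η) (hΛ : 0 < Λ) (hδ : 0 < δ) (hε : 0 < ε) (hT : 0 < T)
    (hδε : δ ≤ ε * Real.exp (-Λ)) {C₀ : ℝ} (hC₀ : 0 < C₀)
    (hshift : ∀ (ε : ℝ) (v z : E d), 0 < ε → ‖v‖ ≤ ε →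
      rescale η ε (z - v) ≤ C₀ * rescale η (4 * ε) z) [IsFiniteMeasure μ]
    (hMm : ∀ i j, Measurable fun x => M x i j) (hM : ∀ x, frob (M x) ≤ 1)
    (htr : ∀ x, (M x).trace = 0)
    (hf : ∀ t x, |f t x| ≤ Kf) (hg : ∀ t x, |g t x| ≤ Kg) :
    |I5 η M Λ δ ε T μ f g| ≤ Kf * Kg * C₀ * T * (2 / Λ) * μ.real Set.univ := by
  have hKf : 0 ≤ Kf := (abs_nonneg _).trans (hf 0 0)
  have hKg : 0 ≤ Kg := (abs_nonneg _).trans (hg 0 0)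
  have h1 := enorm_commutator_le (T := T) (μ := μ) (A := fun _ w => M w) hη hΛ hδ hε hδε hC₀ hshift hMm hM hf hg
    (fun i j => (hMm i j).comp measurable_snd)
  have hin : ∀ w, ∫⁻ h, ‖contract h (M w) (gradient (alberti η Λ (M w)) h)‖ₑ ≤
      ENNReal.ofReal (2 / Λ) := by
    intro w
    have hi := integrable_contract_alberti hη hΛ (A := M w) (hM w)
    rw [← ofReal_integral_norm_eq_lintegral_enorm hi]
    refine ENNReal.ofReal_le_ofReal ?_
    have := integral_abs_contract_alberti_le hη.smooth hη.suppBall hη.nonneg hΛ (htr w)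
    rwa [hη.integral, mul_one] at this
  have hκi : Integrable (rescale η (4 * ε)) := (hη.suppBall.rescale (by linarith : 0 < 4 * ε)).integrable
    (continuous_rescale hη.smooth.continuous _)
  have hκ1 : ∫⁻ z : E d, ‖rescale η (4 * ε) z‖ₑ = 1 := by
    have hn : ∀ z, ‖rescale η (4 * ε) z‖ = rescale η (4 * ε) z := fun z =>
      Real.norm_of_nonneg (mul_nonneg (by positivity) (hη.nonneg _))
    rw [← ofReal_integral_norm_eq_lintegral_enorm hκi]
    simp only [hn]
    rw [integral_rescale η (by linarith : 0 < 4 * ε), hη.integral, ENNReal.ofReal_one]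
  have h2 : ∫⁻ y, (∫⁻ z : E d, ‖rescale η (4 * ε) z‖ₑ *
        ∫⁻ h, ‖contract h (M (y + proj z)) (gradient (alberti η Λ (M (y + proj z))) h)‖ₑ) ∂μ ≤
      ENNReal.ofReal (2 / Λ * μ.real Set.univ) := by
    calc _ ≤ ∫⁻ y, (∫⁻ z : E d, ‖rescale η (4 * ε) z‖ₑ * ENNReal.ofReal (2 / Λ)) ∂μ := by
          gcongr with y z
          exact hin _
      _ = ENNReal.ofReal (2 / Λ) * μ Set.univ := by
          simp only [lintegral_mul_const' _ _ ENNReal.ofReal_ne_top, hκ1, one_mul, lintegral_const]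
      _ = _ := by
          rw [ENNReal.ofReal_mul (by positivity), ofReal_measureReal]
  have h3 := h1.trans (mul_le_mul_right h2 _)
  rw [← ENNReal.ofReal_mul (by positivity), ← ofReal_norm,
    ENNReal.ofReal_le_ofReal_iff (by positivity), Real.norm_eq_abs] at h3
  refine h3.trans (le_of_eq ?_)
  ring

lemma sq_frob_sub (A A' : Matrix (Fin d) (Fin d) ℝ) :
    frob (A - A') ^ 2 = frob A ^ 2 - 2 * (∑ i, ∑ j, A i j * A' i j) + frob A' ^ 2 := by
  simp only [frob_eq_norm]
  have h1 : matVec (A - A') = matVec A - matVec A' := rfl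
  rw [h1, norm_sub_sq_real]
  congr 3
  simp [PiLp.inner_apply, matVec, Fintype.sum_prod_type, mul_comm]

variable {u : Td d → E d} {σ : Td d → Matrix (Fin d) (Fin d) ℝ} {k : E d → ℝ} {R : ℝ}

/-- As `|σ| = 1` and `|M| ≤ 1`, expanding the square gives `|σ - M|² ≤ 2 - 2 σ : M`, whose average
is twice the defect between `‖∇u‖` and the contraction of `M` with `∇u * k`. Cauchy-Schwarz passes
to the first power. -/
lemma IsBVWithGradient.integral_frob_sub_le (h : IsBVWithGradient u μ σ) (hk : SuppBall k R)
    (hc : Continuous k) (hk0 : ∀ z, 0 ≤ k z) (hk1 : ∫ z, k z = 1)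
    (hMm : ∀ i j, Measurable fun x => M x i j) (hM : ∀ x, frob (M x) ≤ 1) :
    Integrable (fun q : Td d × E d => frob (σ q.1 - M (q.1 + proj q.2)) * k q.2) (μ.prod volume) ∧
    0 ≤ μ.real Set.univ - ∫ x, ∑ i, ∑ j, M x i j * gradConv μ σ k x i j ∧
    ∫ q : Td d × E d, frob (σ q.1 - M (q.1 + proj q.2)) * k q.2 ∂(μ.prod volume) ≤
      Real.sqrt (2 * (μ.real Set.univ * (μ.real Set.univ -
        ∫ x, ∑ i, ∑ j, M x i j * gradConv μ σ k x i j))) := by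
  have := h.finite
  have hki := hk.integrable hc
  have hkP : Integrable (fun q : Td d × E d => k q.2) (μ.prod volume) := hki.comp_snd μ
  set W : Td d × E d → ℝ := fun q => frob (σ q.1 - M (q.1 + proj q.2)) with hW
  have hMm' : ∀ i j, Measurable fun q : Td d × E d => M (q.1 + proj q.2) i j := fun i j =>
    (hMm i j).comp (f := fun q : Td d × E d => q.1 + proj q.2) (by fun_prop)
  have hσm' : ∀ i j, Measurable fun q : Td d × E d => σ q.1 i j := fun i j =>
    (h.measurable i j).comp measurable_fst
  have hWm : Measurable W := measurable_frob fun i j => (hσm' i j).sub (hMm' i j)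
  have hWb : ∀ᵐ q ∂(μ.prod (volume : Measure (E d))), ‖W q‖ ≤ 2 := by
    have := Measure.quasiMeasurePreserving_fst (μ := μ) (ν := (volume : Measure (E d))) |>.ae
      (h.ae_frob_sub_le hM)
    filter_upwards [this] with q hq
    rw [Real.norm_of_nonneg (frob_nonneg _)]
    exact hq _
  have i1 : Integrable (fun q => W q * k q.2) (μ.prod volume) :=
    hkP.bdd_mul (c := 2) hWm.aestronglyMeasurable hWb
  have i2 : Integrable (fun q => W q * (W q * k q.2)) (μ.prod volume) :=
    i1.bdd_mul (c := 2) hWm.aestronglyMeasurable hWb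
  set P : Td d × E d → ℝ := fun q => ∑ i, ∑ j, σ q.1 i j * M (q.1 + proj q.2) i j with hP
  have hPm : Measurable P := Finset.measurable_sum _ fun i _ => Finset.measurable_sum _ fun j _ =>
    (hσm' i j).mul (hMm' i j)
  have hunit := Measure.quasiMeasurePreserving_fst (μ := μ) (ν := (volume : Measure (E d))) |>.ae h.unit
  have hPb : ∀ᵐ q ∂(μ.prod (volume : Measure (E d))), ‖P q‖ ≤ 1 := by
    filter_upwards [hunit] with q hq
    have e : P q = inner ℝ (matVec (σ q.1)) (matVec (M (q.1 + proj q.2))) := by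
      simp [PiLp.inner_apply, matVec, Fintype.sum_prod_type, hP, mul_comm]
    rw [e]
    refine (norm_inner_le_norm _ _).trans ?_
    rw [← frob_eq_norm, ← frob_eq_norm, hq, one_mul]
    exact hM _
  have i3 : Integrable (fun q => P q * k q.2) (μ.prod volume) :=
    hkP.bdd_mul (c := 1) hPm.aestronglyMeasurable hPb
  have em : ∫ q : Td d × E d, k q.2 ∂(μ.prod volume) = μ.real Set.univ := by
    rw [integral_prod _ hkP]
    simp [hk1]
  have eP : ∫ q, P q * k q.2 ∂(μ.prod volume) = ∫ x, ∑ i, ∑ j, M x i j * gradConv μ σ k x i j := by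
    rw [integral_prod _ i3, ← h.integral_sum_mul hk hc hMm hM]
  set m := μ.real Set.univ
  set G := ∫ x, ∑ i, ∑ j, M x i j * gradConv μ σ k x i j
  have hGm : G ≤ m := by
    rw [← eP, ← em]
    refine integral_mono_ae i3 hkP ?_
    filter_upwards [hPb] with q hq
    exact mul_le_of_le_one_left (hk0 _) ((le_abs_self _).trans hq)
  have hS : ∫ q, W q * (W q * k q.2) ∂(μ.prod volume) ≤ 2 * (m - G) := by
    calc _ ≤ ∫ q, (2 * k q.2 - 2 * (P q * k q.2)) ∂(μ.prod volume) := by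
          refine integral_mono_ae i2 ((hkP.const_mul 2).sub (i3.const_mul 2)) ?_
          filter_upwards [hunit] with q hq
          have h1 := sq_frob_sub (σ q.1) (M (q.1 + proj q.2))
          have h2 : frob (M (q.1 + proj q.2)) ^ 2 ≤ 1 :=
            pow_le_one₀ (frob_nonneg _) (hM _)
          have h3 : W q ^ 2 ≤ 2 - 2 * P q := by
            simp only [hW, hP]
            rw [h1, hq]; linarith
          calc W q * (W q * k q.2) = W q ^ 2 * k q.2 := by ring
            _ ≤ (2 - 2 * P q) * k q.2 := mul_le_mul_of_nonneg_right h3 (hk0 _)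
            _ = _ := by ring
      _ = _ := by
          rw [integral_sub (hkP.const_mul 2) (i3.const_mul 2), integral_const_mul,
            integral_const_mul, em, eP]; ring
  refine ⟨i1, by linarith, Real.le_sqrt_of_sq_le ?_⟩
  set J := ∫ q, W q * k q.2 ∂(μ.prod volume) with hJ
  -- Cauchy-Schwarz through the discriminant of the nonnegative quadratic `a ↦ ∫ (a - W)² k`, up to
  -- the bound already found for `∫ W² k`.
  have hquad : ∀ a : ℝ, 0 ≤ m * (a * a) + (-2 * J) * a + 2 * (m - G) := by
    intro a
    have h0 : 0 ≤ ∫ q, (a * a * k q.2 - 2 * a * (W q * k q.2) + W q * (W q * k q.2)) ∂(μ.prod volume) := by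
      refine integral_nonneg fun q => ?_
      have : a * a * k q.2 - 2 * a * (W q * k q.2) + W q * (W q * k q.2) = (a - W q) ^ 2 * k q.2 := by ring
      rw [Pi.zero_apply, this]
      exact mul_nonneg (sq_nonneg _) (hk0 _)
    have j1 : Integrable (fun q : Td d × E d => a * a * k q.2 - 2 * a * (W q * k q.2))
      (μ.prod volume) := (hkP.const_mul _).sub (i1.const_mul _)
    rw [integral_add j1 i2,
      integral_sub (hkP.const_mul _) (i1.const_mul _), integral_const_mul, integral_const_mul, em] at h0
    linarith
  have hd := discrim_le_zero hquad
  unfold discrim at hd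
  nlinarith

/-- One factor `e^Λ` bounds `|h|` on the support of the kernel, the other comes from the `L¹` norm
of its gradient. -/
theorem IsBVWithGradient.abs_I4_le (h : IsBVWithGradient u μ σ) (hη : IsMollifier η) (hΛ : 0 < Λ)
    (hδ : 0 < δ) (hε : 0 < ε) (hT : 0 < T)
    (hδε : δ ≤ ε * Real.exp (-Λ)) {C₀ : ℝ} (hC₀ : 0 < C₀)
    (hshift : ∀ (ε : ℝ) (v z : E d), 0 < ε → ‖v‖ ≤ ε →
      rescale η ε (z - v) ≤ C₀ * rescale η (4 * ε) z)
    (hMm : ∀ i j, Measurable fun x => M x i j) (hM : ∀ x, frob (M x) ≤ 1)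
    (htr : ∀ x, (M x).trace = 0)
    (hf : ∀ t x, |f t x| ≤ Kf) (hg : ∀ t x, |g t x| ≤ Kg) :
    |I4 η M Λ δ ε T μ σ f g| ≤ Kf * Kg * C₀ * T * (Real.exp (2 * Λ) * ∫ h, ‖fderiv ℝ η h‖) *
      Real.sqrt (2 * (μ.real Set.univ * (μ.real Set.univ -
        ∫ x, ∑ i, ∑ j, M x i j * gradConv μ σ (rescale η (4 * ε)) x i j))) := by
  have := h.finite
  have hKf : 0 ≤ Kf := (abs_nonneg _).trans (hf 0 0)
  have hKg : 0 ≤ Kg := (abs_nonneg _).trans (hg 0 0)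
  have h1 := enorm_commutator_le (T := T) (μ := μ) (A := fun y w => σ y - M w) hη hΛ hδ hε hδε hC₀ hshift
    hMm hM hf hg
    (fun i j => ((h.measurable i j).comp measurable_fst).sub ((hMm i j).comp measurable_snd))
  set D := Real.exp (2 * Λ) * ∫ h, ‖fderiv ℝ η h‖ with hD
  have hD0 : 0 ≤ D := mul_nonneg (Real.exp_pos _).le (integral_nonneg fun _ => norm_nonneg _)
  have hin : ∀ y w, ∫⁻ h, ‖contract h (σ y - M w) (gradient (alberti η Λ (M w)) h)‖ₑ ≤
      ENNReal.ofReal (D * frob (σ y - M w)) := by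
    intro y w
    have hi := integrable_contract_alberti hη hΛ (A := σ y - M w) (hM w)
    have hs := (suppBall_alberti hη.suppBall hΛ (hM w)).fderiv
    have hfi : Integrable fun h => ‖fderiv ℝ (alberti η Λ (M w)) h‖ :=
      (((contDiff_alberti hη.smooth Λ (M w)).continuous_fderiv (by simp)).integrable_of_hasCompactSupport
        hs.hasCompactSupport).norm
    rw [← ofReal_integral_norm_eq_lintegral_enorm hi]
    refine ENNReal.ofReal_le_ofReal ?_
    calc _ ≤ ∫ h, frob (σ y - M w) * Real.exp Λ * ‖fderiv ℝ (alberti η Λ (M w)) h‖ := by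
          refine integral_mono hi.norm (hfi.const_mul _) fun h => ?_
          have h2 := abs_contract_le h (σ y - M w) (gradient (alberti η Λ (M w)) h)
          rw [norm_gradient] at h2
          refine h2.trans ?_
          by_cases hh : Real.exp Λ < ‖h‖
          · simp [hs h hh]
          · push Not at hh
            have := frob_nonneg (σ y - M w)
            gcongr
      _ ≤ frob (σ y - M w) * Real.exp Λ * (Real.exp Λ * ∫ h, ‖fderiv ℝ η h‖) := by
          rw [integral_const_mul]
          have := frob_nonneg (σ y - M w)
          gcongr
          exact integral_norm_fderiv_alberti_le hη.smooth hη.suppBall hΛ (hM w) (htr w)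
      _ = _ := by
          rw [hD, two_mul, Real.exp_add]; ring
  have h4 : 0 < 4 * ε := by linarith
  have hk0 : ∀ z, 0 ≤ rescale η (4 * ε) z := fun z => mul_nonneg (by positivity) (hη.nonneg _)
  obtain ⟨i1, hG, hJ⟩ := h.integral_frob_sub_le (hη.suppBall.rescale h4)
    (continuous_rescale hη.smooth.continuous _) hk0
    (by rw [integral_rescale η h4, hη.integral]) hMm hM
  have h2 : ∫⁻ y, (∫⁻ z : E d, ‖rescale η (4 * ε) z‖ₑ *
        ∫⁻ h, ‖contract h (σ y - M (y + proj z)) (gradient (alberti η Λ (M (y + proj z))) h)‖ₑ) ∂μ ≤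
      ENNReal.ofReal (D * ∫ q : Td d × E d, frob (σ q.1 - M (q.1 + proj q.2)) *
        rescale η (4 * ε) q.2 ∂(μ.prod volume)) := by
    calc _ ≤ ∫⁻ y, (∫⁻ z : E d, ENNReal.ofReal (D * (frob (σ y - M (y + proj z)) *
            rescale η (4 * ε) z))) ∂μ := by
          gcongr with y z
          rw [← mul_assoc, ENNReal.ofReal_mul' (hk0 z), mul_comm, Real.enorm_of_nonneg (hk0 z)]
          gcongr
          exact hin _ _
      _ = ENNReal.ofReal (∫ q : Td d × E d, D * (frob (σ q.1 - M (q.1 + proj q.2)) *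
            rescale η (4 * ε) q.2) ∂(μ.prod volume)) := by
          rw [ofReal_integral_eq_lintegral_ofReal (i1.const_mul D), lintegral_prod]
          · exact (i1.const_mul D).1.aemeasurable.ennreal_ofReal
          · exact Filter.Eventually.of_forall fun q =>
              mul_nonneg hD0 (mul_nonneg (frob_nonneg _) (hk0 _))
      _ = _ := by rw [integral_const_mul]
  have h3 := h1.trans (mul_le_mul_right (h2.trans
    (ENNReal.ofReal_le_ofReal (mul_le_mul_of_nonneg_left hJ hD0))) _)
  rw [← ENNReal.ofReal_mul (by positivity), ← ofReal_norm,
    ENNReal.ofReal_le_ofReal_iff (by positivity), Real.norm_eq_abs] at h3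
  refine h3.trans (le_of_eq ?_)
  ring

end

end BVTransport

namespace BVTransport

variable {d : ℕ}

/-! ### Weak gradients and the terms at the end points -/

instance : IsProbabilityMeasure (volume : Measure UnitAddCircle) :=
  ⟨by rw [AddCircle.measure_univ, ENNReal.ofReal_one]⟩

instance : IsProbabilityMeasure (volume : Measure (Td d)) :=
  inferInstanceAs (IsProbabilityMeasure (Measure.pi fun _ : Fin d => (volume : Measure UnitAddCircle)))

/-- A function with bounded weak gradient is Lipschitz along every shift, almost everywhere. -/
lemma IsWeakGradient.ae_abs_sub_le {f : Td d → ℝ} {g : Td d → E d} (h : IsWeakGradient f g) {L : ℝ}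
    (hL : ∀ᵐ x, ‖g x‖ ≤ L) (v : E d) : ∀ᵐ x, |f x - f (x - proj v)| ≤ L * ‖v‖ := by
  obtain ⟨hf, hg, hw⟩ := h
  -- By duality the increment is moved to the test function, written as a line integral of its
  -- gradient, and the weak gradient of `f` is inserted.
  refine ae_abs_le_of_forall_smooth (hf.sub (hf.comp_sub_right (proj v))) fun ψ hψ => ?_
  have hψc := hψ.continuous
  have hgc := hψ.continuous_torusGrad
  obtain ⟨C, hC0, hC⟩ := Continuous.exists_bound_torus hψc
  obtain ⟨C', hC0', hC'⟩ := Continuous.exists_bound_torus hgc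
  have hfψ : Integrable fun x => f x * ψ x :=
    hf.mul_bdd (c := C) hψc.aestronglyMeasurable (Filter.Eventually.of_forall hC)
  have hfψ' : Integrable fun x => f x * ψ (x + proj v) :=
    hf.mul_bdd (c := C) (hψc.comp (by fun_prop)).aestronglyMeasurable
      (Filter.Eventually.of_forall fun x => hC _)
  have hfψ'' : Integrable fun x => f (x - proj v) * ψ x :=
    (hf.comp_sub_right (proj v)).mul_bdd (c := C) hψc.aestronglyMeasurable (Filter.Eventually.of_forall hC)
  have e1 : ∫ x, (f x - f (x - proj v)) * ψ x = -∫ x, f x * (ψ (x + proj v) - ψ x) := by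
    have e2 : ∫ x, f (x - proj v) * ψ x = ∫ x, f x * ψ (x + proj v) := by
      rw [← integral_sub_right_eq_self (fun x => f x * ψ (x + proj v)) (proj v)]
      simp
    simp only [sub_mul, mul_sub]
    rw [integral_sub hfψ hfψ'', integral_sub hfψ' hfψ, e2]; ring
  have hi : Integrable (fun q : Td d × ℝ => f q.1 * inner ℝ v (torusGrad ψ (q.1 + proj (q.2 • v))))
      (volume.prod (volume.restrict (Set.Icc (0 : ℝ) 1))) := by
    refine (hf.comp_fst _).mul_bdd (c := ‖v‖ * C') (Continuous.aestronglyMeasurable (by fun_prop))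
      (Filter.Eventually.of_forall fun q => (norm_inner_le_norm _ _).trans ?_)
    gcongr
    exact hC' _
  have e3 : ∀ s : ℝ, ∫ x, f x * inner ℝ v (torusGrad ψ (x + proj (s • v))) =
      -∫ x, inner ℝ v (g x) * ψ (x + proj (s • v)) := by
    intro s
    have hs : TorusSmooth fun x => ψ (x + proj (s • v)) := by
      simpa using hψ.comp_sub_right (-proj (s • v))
    have hgs : ∀ x, torusGrad ψ (x + proj (s • v)) = torusGrad (fun x => ψ (x + proj (s • v))) x := by
      intro x
      have := torusGrad_comp_sub_right ψ x (-proj (s • v))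
      simpa using this.symm
    have hi1 : ∀ i, Integrable fun x => v i * (f x * torusGrad (fun x => ψ (x + proj (s • v))) x i) := by
      intro i
      obtain ⟨A, _, hA⟩ := Continuous.exists_bound_torus (hs.torusGrad i).continuous
      exact (hf.mul_bdd (c := A) (hs.torusGrad i).continuous.aestronglyMeasurable
        (Filter.Eventually.of_forall hA)).const_mul _
    have hgi : ∀ i, Integrable fun x => g x i := fun i =>
      (EuclideanSpace.proj (𝕜 := ℝ) i : E d →L[ℝ] ℝ).integrable_comp hg
    have hi2 : ∀ i, Integrable fun x => v i * (g x i * ψ (x + proj (s • v))) := by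
      intro i
      exact ((hgi i).mul_bdd (c := C) hs.continuous.aestronglyMeasurable
        (Filter.Eventually.of_forall fun x => hC _)).const_mul _
    have e4 : ∀ x, f x * inner ℝ v (torusGrad ψ (x + proj (s • v))) =
        ∑ i, v i * (f x * torusGrad (fun x => ψ (x + proj (s • v))) x i) := by
      intro x
      rw [hgs, inner_torusGrad_eq_sum, Finset.mul_sum]
      exact Finset.sum_congr rfl fun i _ => by ring
    have e5 : ∀ x, inner ℝ v (g x) * ψ (x + proj (s • v)) =
        ∑ i, v i * (g x i * ψ (x + proj (s • v))) := by
      intro x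
      rw [PiLp.inner_apply, Finset.sum_mul]
      refine Finset.sum_congr rfl fun i _ => ?_
      simp; ring
    simp only [e4, e5]
    rw [integral_finsetSum _ fun i _ => hi1 i, integral_finsetSum _ fun i _ => hi2 i,
      ← Finset.sum_neg_distrib]
    refine Finset.sum_congr rfl fun i _ => ?_
    rw [integral_const_mul, integral_const_mul, hw _ hs i]; ring
  change |∫ x, (f x - f (x - proj v)) * ψ x| ≤ _
  rw [e1, abs_neg]
  simp only [hψ.sub_eq_integral, ← integral_const_mul]
  rw [integral_integral_swap hi]
  simp only [e3]
  have h6 : ∀ s : ℝ, ‖-∫ x, inner ℝ v (g x) * ψ (x + proj (s • v))‖ ≤ L * ‖v‖ * ∫ x, |ψ x| := by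
    intro s
    rw [norm_neg, ← integral_add_right_eq_self (fun x => |ψ x|) (proj (s • v)), ← integral_const_mul]
    refine norm_integral_le_of_norm_le ?_ ?_
    · exact ((Continuous.integrable_torus (hψc.comp (by fun_prop)) _).abs).const_mul _
    · filter_upwards [hL] with x hx
      rw [norm_mul]
      refine mul_le_mul_of_nonneg_right ((norm_inner_le_norm _ _).trans ?_) (norm_nonneg _)
      rw [mul_comm]; gcongr
  have h7 := norm_setIntegral_le_of_norm_le_const (μ := volume) (s := Set.Icc (0 : ℝ) 1)
    (f := fun s : ℝ => -∫ x, inner ℝ v (g x) * ψ (x + proj (s • v))) (by simp) (fun s _ => h6 s)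
  simpa [integral_const_mul] using h7

/-- The infimum over weak gradients is at most `1`, hence some weak gradient has norm below `2`. The
constant `2` avoids showing that the infimum is attained. -/
lemma exists_lipschitz_of_w1InfNorm_le {f : Td d → ℝ} (h : w1InfNorm f ≤ 1) (v : E d) :
    ∀ᵐ x, |f x - f (x - proj v)| ≤ 2 * ‖v‖ := by
  have h1 : (⨅ (g : Td d → E d) (_ : IsWeakGradient f g), eLpNorm g ∞ volume) < 2 :=
    (le_add_self.trans h).trans_lt (by norm_num)
  simp only [iInf_lt_iff] at h1
  obtain ⟨g, hg, hlt⟩ := h1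
  refine hg.ae_abs_sub_le (L := 2) ?_ v
  have h2 := ae_le_eLpNormEssSup (f := g) (μ := volume)
  rw [← eLpNorm_exponent_top] at h2
  filter_upwards [h2] with x hx
  have h3 := hx.trans hlt.le
  have h4 : ENNReal.ofReal ‖g x‖ ≤ ENNReal.ofReal 2 := by
    rw [ofReal_norm]; simpa using h3
  exact (ENNReal.ofReal_le_ofReal_iff (by norm_num)).1 h4

section
variable {η : E d → ℝ} {Λ δ ε K : ℝ} {M : Td d → Matrix (Fin d) (Fin d) ℝ}

lemma integral_rescale_mollifier {η : E d → ℝ} (hη : IsMollifier η) (hε : 0 < ε) :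
    (∀ z, 0 ≤ rescale η ε z) ∧ ∫ z, rescale η ε z = 1 ∧ Integrable (rescale η ε) :=
  ⟨fun _ => mul_nonneg (by positivity) (hη.nonneg _), by rw [integral_rescale η hε, hη.integral],
    (hη.suppBall.rescale hε).integrable (continuous_rescale hη.smooth.continuous ε)⟩

/-- The kernel is nonnegative, has mass one and lives in radius `δ e^Λ`, so averaging moves a
Lipschitz function by at most a multiple of `δ e^Λ`. -/
theorem abs_I1_le (hη : IsMollifier η) (hΛ : 0 < Λ) (hδ : 0 < δ) (hε : 0 < ε)
    (hM : ∀ x, frob (M x) ≤ 1) (htr : ∀ x, (M x).trace = 0)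
    {f g : Td d → ℝ} (hfK : ∀ x, |f x| ≤ K) (hg : Measurable g) {G : ℝ} (hgG : ∀ x, |g x| ≤ G)
    (hlip : ∀ v, ∀ᵐ x, |g x - g (x - proj v)| ≤ 2 * ‖v‖) :
    |I1 η M Λ δ ε f g| ≤ K * (2 * δ * Real.exp Λ) := by
  obtain ⟨hκ0, hκ1, hκi⟩ := integral_rescale_mollifier hη hε
  have hK : 0 ≤ K := (abs_nonneg _).trans (hfK 0)
  -- The Lipschitz bound has a null set for every shift; Fubini gives almost every `x` a bound for
  -- almost all shifts.
  have hlip' : ∀ᵐ x, ∀ᵐ h : E d, |g x - g (x - proj (δ • h))| ≤ 2 * ‖δ • h‖ := by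
    refine (Measure.ae_ae_comm (p := fun x (h : E d) => |g x - g (x - proj (δ • h))| ≤ 2 * ‖δ • h‖) ?_).2
      (Filter.Eventually.of_forall fun h => hlip (δ • h))
    exact measurableSet_le (by fun_prop) (by fun_prop)
  have key : ∀ᵐ x, ∀ y, |g x - conv g (rescale (alberti η Λ (M y)) δ) x| ≤ 2 * δ * Real.exp Λ := by
    filter_upwards [hlip'] with x hx y
    have hk := suppBall_alberti hη.suppBall hΛ (hM y)
    have hkc := (contDiff_alberti hη.smooth Λ (M y)).continuous
    have hki := hk.integrable hkc
    have hk1 : ∫ h, alberti η Λ (M y) h = 1 := by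
      rw [integral_alberti hη.smooth.continuous hη.suppBall hΛ (hM y) (htr y), hη.integral]
    have hk0 := alberti_nonneg (M := M y) hΛ hη.nonneg
    have e1 : g x - conv g (rescale (alberti η Λ (M y)) δ) x =
        ∫ h, (g x - g (x - proj (δ • h))) * alberti η Λ (M y) h := by
      rw [conv_rescale _ _ hδ]
      simp only [sub_mul]
      rw [integral_sub (hki.const_mul _), integral_const_mul, hk1, mul_one]
      exact hki.bdd_mul (c := G) (Measurable.aestronglyMeasurable (by fun_prop))
        (Filter.Eventually.of_forall fun h => hgG _)
    rw [e1, ← Real.norm_eq_abs]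
    calc _ ≤ ∫ h, 2 * δ * Real.exp Λ * alberti η Λ (M y) h := by
          refine norm_integral_le_of_norm_le (hki.const_mul _) ?_
          filter_upwards [hx] with h hh
          rw [norm_mul, Real.norm_of_nonneg (hk0 h)]
          by_cases hR : Real.exp Λ < ‖h‖
          · simp [hk h hR]
          · push Not at hR
            refine mul_le_mul_of_nonneg_right (hh.trans ?_) (hk0 h)
            rw [norm_smul, Real.norm_of_nonneg hδ.le, mul_assoc]
            gcongr
      _ = _ := by rw [integral_const_mul, hk1, mul_one]
  have h2 : |I1 η M Λ δ ε f g| ≤ K * (2 * δ * Real.exp Λ) * volume.real (Set.univ : Set (Td d)) := by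
    rw [I1, ← Real.norm_eq_abs]
    refine norm_integral_le_of_norm_le_const ?_
    filter_upwards [key] with x hx
    calc _ ≤ ∫ z, K * (2 * δ * Real.exp Λ) * rescale η ε z := by
          refine norm_integral_le_of_norm_le (hκi.const_mul _) (Filter.Eventually.of_forall fun z => ?_)
          rw [norm_mul, norm_mul, Real.norm_of_nonneg (hκ0 z)]
          exact mul_le_mul_of_nonneg_right (mul_le_mul (hfK x) (hx _) (norm_nonneg _) hK) (hκ0 z)
      _ = _ := by rw [integral_const_mul, hκ1, mul_one]
  simpa using h2

lemma w1InfNorm_const_mul_le {ψ : Td d → ℝ} {g : Td d → E d} (h : IsWeakGradient ψ g) {A B : ℝ}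
    (hψ : ∀ x, |ψ x| ≤ A) (hg : ∀ x, ‖g x‖ ≤ B) (c : ℝ) :
    w1InfNorm (fun x => c * ψ x) ≤ ENNReal.ofReal (|c| * (A + B)) := by
  have hw : IsWeakGradient (fun x => c * ψ x) (fun x => c • g x) := by
    refine ⟨h.1.const_mul c, h.2.1.smul c, fun χ hχ i => ?_⟩
    simp only [mul_assoc, integral_const_mul, PiLp.smul_apply, smul_eq_mul, h.2.2 χ hχ i]
    ring
  have hA : 0 ≤ A := (abs_nonneg _).trans (hψ 0)
  have hB : 0 ≤ B := (norm_nonneg _).trans (hg 0)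
  rw [mul_add, ENNReal.ofReal_add (by positivity) (by positivity), w1InfNorm]
  refine add_le_add ?_ ((iInf₂_le _ hw).trans ?_)
  · rw [eLpNorm_exponent_top]
    refine eLpNormEssSup_le_of_ae_bound (Filter.Eventually.of_forall fun x => ?_)
    rw [norm_mul]
    exact mul_le_mul_of_nonneg_left (hψ x) (abs_nonneg _)
  · rw [eLpNorm_exponent_top]
    refine eLpNormEssSup_le_of_ae_bound (Filter.Eventually.of_forall fun x => ?_)
    rw [norm_smul]
    exact mul_le_mul_of_nonneg_left (hg x) (abs_nonneg _)

/-- Needed because `sSup` of an unbounded set of reals is `0`. -/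
lemma bddAbove_wNeg1 {f : Td d → ℝ} (hf : Integrable f) :
    BddAbove {a : ℝ | ∃ ψ : Td d → ℝ, w1InfNorm ψ ≤ 1 ∧ a = ∫ x, f x * ψ x} := by
  refine ⟨∫ x, |f x|, ?_⟩
  rintro a ⟨ψ, hψ, rfl⟩
  have h1 : eLpNorm ψ ∞ volume ≤ 1 := le_self_add.trans hψ
  have h2 := ae_le_eLpNormEssSup (f := ψ) (μ := volume)
  rw [← eLpNorm_exponent_top] at h2
  refine (Real.le_norm_self _).trans (norm_integral_le_of_norm_le hf.abs ?_)
  filter_upwards [h2] with x hx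
  have h3 := hx.trans h1
  rw [← ofReal_norm, ← ENNReal.ofReal_one] at h3
  rw [norm_mul]
  exact mul_le_of_le_one_right (norm_nonneg _) ((ENNReal.ofReal_le_ofReal_iff zero_le_one).1 h3)

/-- Both `±(A + B)⁻¹ ψ` are admissible in the supremum. -/
lemma abs_integral_mul_le_wNeg1Norm {f ψ : Td d → ℝ} {g : Td d → E d} (hf : Integrable f)
    (h : IsWeakGradient ψ g) {A B : ℝ} (hψ : ∀ x, |ψ x| ≤ A) (hg : ∀ x, ‖g x‖ ≤ B)
    (hAB : 0 < A + B) : |∫ x, f x * ψ x| ≤ (A + B) * wNeg1Norm f := by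
  have h1 : ∀ c : ℝ, |c| = (A + B)⁻¹ → c * ∫ x, f x * ψ x ≤ wNeg1Norm f := by
    intro c hc
    refine le_csSup (bddAbove_wNeg1 hf) ⟨fun x => c * ψ x, ?_, ?_⟩
    · refine (w1InfNorm_const_mul_le h hψ hg c).trans ?_
      rw [hc, inv_mul_cancel₀ hAB.ne', ENNReal.ofReal_one]
    · rw [← integral_const_mul]
      congr 1; funext x; ring
  have h2 := h1 (A + B)⁻¹ (abs_of_pos (inv_pos.2 hAB))
  have h3 := h1 (-(A + B)⁻¹) (by rw [abs_neg, abs_of_pos (inv_pos.2 hAB)])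
  rw [inv_mul_le_iff₀ hAB] at h2
  rw [neg_mul, neg_le, ← sub_nonneg] at h3
  have h4 : -((A + B) * wNeg1Norm f) ≤ ∫ x, f x * ψ x := by
    have := mul_le_mul_of_nonneg_left (sub_nonneg.1 h3) hAB.le
    rw [mul_inv_cancel_left₀ hAB.ne'] at this
    linarith
  exact abs_le.2 ⟨h4, h2⟩

end

end BVTransport

namespace BVTransport

variable {d : ℕ}

/-! ### The term at the initial time -/

section
variable {p : Td d → E d → ℝ} {R B K r : ℝ} {κ : E d → ℝ} {g : Td d → ℝ}

/-- For a fixed centre `y` the integrand is smooth in `x`, so the product rule integrates to zero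
against `ψ`; Fubini in `y` gives the weak gradient of the average, although the kernel depends on
`y` only measurably. -/
lemma isWeakGradient_average (hp : IsKernelFamily p R B) (hκ : SuppBall κ r)
    (hκc : ContDiff ℝ ∞ κ) (hgm : Measurable g) (hgK : ∀ x, |g x| ≤ K) :
    IsWeakGradient (fun x => ∫ y, periodise κ (y - x) * conv g (p y) x)
      (fun x => WithLp.toLp 2 fun i => ∫ y, (-periodise (pd i κ) (y - x) * conv g (p y) x +
        periodise κ (y - x) * conv g (pd i (p y)) x)) := by
  have hgi : Integrable g := Integrable.of_bound hgm.aestronglyMeasurable K (Filter.Eventually.of_forall hgK)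
  have hK : 0 ≤ K := (abs_nonneg _).trans (hgK 0)
  have hN := hκ.continuous_periodise hκc.continuous
  have hNi := fun i => (hκ.pd i).continuous_periodise (contDiff_pd hκc i).continuous
  obtain ⟨C, hC0, hC⟩ := Continuous.exists_bound_torus hN
  choose Ci hCi0 hCi using fun i => Continuous.exists_bound_torus (hNi i)
  have hNm := hN.measurable
  have hNim := fun i => (hNi i).measurable
  set V := volume.real (Metric.closedBall (0 : E d) R)
  have hcm : Measurable fun q : Td d × Td d => conv g (p q.2) q.1 :=
    measurable_conv (g := fun _ : Td d × Td d => g) (k := fun q => p q.2) (x := fun q => q.1)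
      (hgm.comp measurable_snd)
      (hp.meas.comp (f := fun q : (Td d × Td d) × E d => (q.1.2, q.2)) (by fun_prop)) (by fun_prop)
  have hcim : ∀ i, Measurable fun q : Td d × Td d => conv g (pd i (p q.2)) q.1 := fun i =>
    measurable_conv (g := fun _ : Td d × Td d => g) (k := fun q => pd i (p q.2)) (x := fun q => q.1)
      (hgm.comp measurable_snd)
      ((hp.meas_pd i).comp (f := fun q : (Td d × Td d) × E d => (q.1.2, q.2)) (by fun_prop)) (by fun_prop)
  have hcb : ∀ y x, |conv g (p y) x| ≤ K * (B * V) := fun y x => hp.abs_conv_le hgK y x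
  have hcib : ∀ i y x, |conv g (pd i (p y)) x| ≤ K * (B * V) := by
    intro i y x
    refine (abs_conv_le hgK (((hp.supp y).pd i).integrable (contDiff_pd (hp.smooth y) i).continuous) x).trans ?_
    gcongr
    exact ((hp.supp y).pd i).integral_abs_le (hp.bound_pd i y)
  have hm1 : Measurable fun q : Td d × Td d => periodise κ (q.2 - q.1) * conv g (p q.2) q.1 :=
    Measurable.mul (by fun_prop) hcm
  have hb1 : ∀ q : Td d × Td d, ‖periodise κ (q.2 - q.1) * conv g (p q.2) q.1‖ ≤ C * (K * (B * V)) := by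
    intro q
    rw [norm_mul]
    exact mul_le_mul (hC _) (hcb _ _) (norm_nonneg _) hC0
  have hm2 : ∀ i, Measurable fun q : Td d × Td d => -periodise (pd i κ) (q.2 - q.1) * conv g (p q.2) q.1 +
        periodise κ (q.2 - q.1) * conv g (pd i (p q.2)) q.1 := fun i => by
    have := hNim i
    exact (Measurable.mul (by fun_prop) hcm).add (Measurable.mul (by fun_prop) (hcim i))
  have hb2 : ∀ i, ∀ q : Td d × Td d, ‖-periodise (pd i κ) (q.2 - q.1) * conv g (p q.2) q.1 +
        periodise κ (q.2 - q.1) * conv g (pd i (p q.2)) q.1‖ ≤ Ci i * (K * (B * V)) + C * (K * (B * V)) := by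
    intro i q
    refine (norm_add_le _ _).trans (add_le_add ?_ ?_)
    · rw [norm_mul, norm_neg]
      exact mul_le_mul (hCi i _) (hcb _ _) (norm_nonneg _) (hCi0 i)
    · rw [norm_mul]
      exact mul_le_mul (hC _) (hcib _ _ _) (norm_nonneg _) hC0
  have i1 : Integrable (fun q : Td d × Td d => periodise κ (q.2 - q.1) * conv g (p q.2) q.1)
      (volume.prod volume) :=
    Integrable.of_bound hm1.aestronglyMeasurable _ (Filter.Eventually.of_forall hb1)
  have i2 : ∀ i, Integrable (fun q : Td d × Td d => -periodise (pd i κ) (q.2 - q.1) * conv g (p q.2) q.1 +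
        periodise κ (q.2 - q.1) * conv g (pd i (p q.2)) q.1) (volume.prod volume) := fun i =>
    Integrable.of_bound (hm2 i).aestronglyMeasurable _ (Filter.Eventually.of_forall (hb2 i))
  refine ⟨i1.integral_prod_left, ?_, fun ψ hψ i => ?_⟩
  · exact Integrable.of_eval_piLp fun i => (i2 i).integral_prod_left
  · obtain ⟨A, hA0, hA⟩ := Continuous.exists_bound_torus hψ.continuous
    obtain ⟨A', hA0', hA'⟩ := Continuous.exists_bound_torus (hψ.torusGrad i).continuous
    have j1 : Integrable (fun q : Td d × Td d => periodise κ (q.2 - q.1) * conv g (p q.2) q.1 *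
        torusGrad ψ q.1 i) (volume.prod volume) :=
      i1.mul_bdd (c := A') ((hψ.torusGrad i).continuous.comp continuous_fst).aestronglyMeasurable
        (Filter.Eventually.of_forall fun q => hA' _)
    have j2 : Integrable (fun q : Td d × Td d => (-periodise (pd i κ) (q.2 - q.1) * conv g (p q.2) q.1 +
        periodise κ (q.2 - q.1) * conv g (pd i (p q.2)) q.1) * ψ q.1) (volume.prod volume) :=
      (i2 i).mul_bdd (c := A) (hψ.continuous.comp continuous_fst).aestronglyMeasurable
        (Filter.Eventually.of_forall fun q => hA _)
    simp only [← integral_mul_const]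
    refine (integral_integral_swap j1).trans
      (Eq.trans ?_ (congrArg Neg.neg (integral_integral_swap j2)).symm)
    rw [← integral_neg]
    congr 1; funext y
    have s1 : TorusSmooth fun x => periodise κ (y - x) := (hκ.torusSmooth_periodise hκc).comp_sub y
    have s2 : TorusSmooth (conv g (p y)) := (hp.supp y).torusSmooth_conv (hp.smooth y) hgi
    have s12 := s1.mul s2
    have h0 := (s12.mul hψ).integral_torusGrad i
    simp only [torusGrad_mul s12 hψ, torusGrad_mul s1 s2, torusGrad_comp_sub,
      torusGrad_periodise hκ hκc, torusGrad_conv (hp.supp y) (hp.smooth y) hgi] at h0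
    rw [integral_add] at h0
    · linarith
    · have := ((s12.torusGrad i).mul hψ).continuous
      simp only [torusGrad_mul s1 s2, torusGrad_comp_sub,
        torusGrad_periodise hκ hκc, torusGrad_conv (hp.supp y) (hp.smooth y) hgi] at this
      exact Continuous.integrable_torus this _
    · exact Continuous.integrable_torus (s12.mul (hψ.torusGrad i)).continuous _

end

section
variable {η : E d → ℝ} {Λ δ ε K : ℝ} {M : Td d → Matrix (Fin d) (Fin d) ℝ}

lemma norm_le_sum_abs (v : E d) : ‖v‖ ≤ ∑ i, |v i| := by
  rw [EuclideanSpace.norm_eq]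
  refine Real.sqrt_le_iff.2 ⟨Finset.sum_nonneg fun i _ => abs_nonneg _, ?_⟩
  exact Finset.sum_sq_le_sq_sum_of_nonneg fun i _ => abs_nonneg _

lemma integral_abs_pd_rescale_le {k : E d → ℝ} {R : ℝ} (hk : SuppBall k R) (hc : ContDiff ℝ ∞ k)
    (hδ : 0 < δ) (i : Fin d) : ∫ h, |pd i (rescale k δ) h| ≤ δ⁻¹ * ∫ h, ‖fderiv ℝ k h‖ := by
  have e : ∀ h, |pd i (rescale k δ) h| = δ⁻¹ * rescale (fun h => |pd i k h|) δ h := by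
    intro h
    rw [pd_rescale, abs_mul, abs_of_pos (inv_pos.2 hδ), rescale, rescale, abs_mul,
      abs_of_pos (by positivity)]
  simp only [e, integral_const_mul, integral_rescale _ hδ]
  have h1 := hk.pd i
  have h2 := (contDiff_pd hc i).continuous
  gcongr
  · exact (h1.integrable h2).abs
  · exact ((hc.continuous_fderiv (by simp)).integrable_of_hasCompactSupport hk.fderiv.hasCompactSupport).norm
  · exact fun h => abs_pd_le _ _ h

/-- The function paired with `f` is an average of averages of `g`, hence bounded by `1`.
Differentiating the kernel costs `e^Λ/δ`, differentiating the localisation `1/ε`; the factor `d`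
sums the coordinates. -/
theorem abs_I2_le (hη : IsMollifier η) (hΛ : 0 < Λ) (hδ : 0 < δ) (hε : 0 < ε)
    (hMm : ∀ i j, Measurable fun x => M x i j) (hM : ∀ x, frob (M x) ≤ 1)
    (htr : ∀ x, (M x).trace = 0) {f g : Td d → ℝ} (hf : Integrable f)
    (hg : Measurable g) (hg1 : ∀ x, |g x| ≤ 1) :
    |I2 η M Λ δ ε f g| ≤ (1 + d * (∫ h, ‖fderiv ℝ η h‖) * (Real.exp Λ / δ + 1 / ε)) * wNeg1Norm f := by
  obtain ⟨hκ0, hκ1, hκi⟩ := integral_rescale_mollifier hη hε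
  obtain ⟨B, hp⟩ := exists_isKernelFamily_alberti hη hΛ hδ hMm hM
  have hκ := hη.suppBall.rescale hε
  have hκc := contDiff_rescale hη.smooth ε
  set D := ∫ h, ‖fderiv ℝ η h‖ with hD
  have hD0 : 0 ≤ D := integral_nonneg fun _ => norm_nonneg _
  have hw := isWeakGradient_average hp hκ hκc hg hg1
  have hconv1 : ∀ y x, |conv g (rescale (alberti η Λ (M y)) δ) x| ≤ 1 := by
    intro y x
    refine (abs_conv_le hg1 ((hp.supp y).integrable (hp.smooth y).continuous) x).trans ?_
    have hn : ∀ h, |rescale (alberti η Λ (M y)) δ h| = rescale (alberti η Λ (M y)) δ h := fun h =>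
      abs_of_nonneg (mul_nonneg (by positivity) (alberti_nonneg hΛ hη.nonneg _))
    simp only [hn]
    rw [one_mul, integral_rescale _ hδ, integral_alberti hη.smooth.continuous hη.suppBall hΛ (hM y)
      (htr y), hη.integral]
  have hconv2 : ∀ i y x, |conv g (pd i (rescale (alberti η Λ (M y)) δ)) x| ≤ Real.exp Λ / δ * D := by
    intro i y x
    refine (abs_conv_le hg1 (((hp.supp y).pd i).integrable (contDiff_pd (hp.smooth y) i).continuous) x).trans ?_
    rw [one_mul]
    refine (integral_abs_pd_rescale_le (suppBall_alberti hη.suppBall hΛ (hM y))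
      (contDiff_alberti hη.smooth Λ (M y)) hδ i).trans ?_
    calc _ ≤ δ⁻¹ * (Real.exp Λ * D) := by
          gcongr
          exact integral_norm_fderiv_alberti_le hη.smooth hη.suppBall hΛ (hM y) (htr y)
      _ = _ := by ring
  have hcm : ∀ x, Measurable fun y => conv g (rescale (alberti η Λ (M y)) δ) x := fun x =>
    measurable_conv_alberti hη hΛ hδ hMm hM (v := fun _ : Td d => g) (hg.comp measurable_snd)
      measurable_const measurable_id
  have hci : ∀ x, Integrable fun y => conv g (rescale (alberti η Λ (M y)) δ) x := fun x =>
    Integrable.of_bound (hcm x).aestronglyMeasurable 1 (Filter.Eventually.of_forall fun y => hconv1 y x)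
  have hcpi : ∀ i x, Integrable fun y => conv g (pd i (rescale (alberti η Λ (M y)) δ)) x := by
    intro i x
    refine Integrable.of_bound (Measurable.aestronglyMeasurable ?_) _
      (Filter.Eventually.of_forall fun y => hconv2 i y x)
    exact measurable_conv (g := fun _ : Td d => g) (x := fun _ : Td d => x) (hg.comp measurable_snd)
      (hp.meas_pd i) measurable_const
  have e1 : I2 η M Λ δ ε f g =
      ∫ x, f x * ∫ y, periodise (rescale η ε) (y - x) * conv g (rescale (alberti η Λ (M y)) δ) x := by
    rw [I2]
    congr 1; funext x
    simp only [mul_assoc, integral_const_mul]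
    rw [← integral_mul_periodise_sub hκ hκc.continuous (hci x)]
    congr 2; funext y; ring
  rw [e1]
  have hN := hκ.continuous_periodise hκc.continuous
  have hNi := fun i => (hκ.pd i).continuous_periodise (contDiff_pd hκc i).continuous
  have havg : ∀ {F : Td d → ℝ} {A : ℝ}, Integrable F → (∀ y, |F y| ≤ A) → ∀ x,
      |∫ y, periodise (rescale η ε) (y - x) * F y| ≤ A := by
    intro F A hF hA x
    have : ∫ y, periodise (rescale η ε) (y - x) * F y = ∫ z, F (x + proj z) * rescale η ε z := by
      rw [← integral_mul_periodise_sub hκ hκc.continuous hF]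
      congr 1; funext y; ring
    rw [this, ← Real.norm_eq_abs]
    calc _ ≤ ∫ z, A * rescale η ε z := by
          refine norm_integral_le_of_norm_le (hκi.const_mul _) (Filter.Eventually.of_forall fun z => ?_)
          rw [norm_mul, Real.norm_of_nonneg (hκ0 z)]
          exact mul_le_mul_of_nonneg_right (hA _) (hκ0 z)
      _ = A := by rw [integral_const_mul, hκ1, mul_one]
  have hgrad : ∀ i x, |∫ y, (-periodise (pd i (rescale η ε)) (y - x) *
      conv g (rescale (alberti η Λ (M y)) δ) x +
        periodise (rescale η ε) (y - x) * conv g (pd i (rescale (alberti η Λ (M y)) δ)) x)| ≤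
      D * (Real.exp Λ / δ + 1 / ε) := by
    intro i x
    obtain ⟨C, hC0, hC⟩ := Continuous.exists_bound_torus hN
    obtain ⟨C', hC0', hC'⟩ := Continuous.exists_bound_torus (hNi i)
    have k1 : Integrable fun y => -periodise (pd i (rescale η ε)) (y - x) *
        conv g (rescale (alberti η Λ (M y)) δ) x := by
      refine (hci x).bdd_mul (c := C') ((hNi i).comp (continuous_sub_right x)).neg.aestronglyMeasurable
        (Filter.Eventually.of_forall fun y => ?_)
      rw [norm_neg]; exact hC' _
    have k2 : Integrable fun y => periodise (rescale η ε) (y - x) *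
        conv g (pd i (rescale (alberti η Λ (M y)) δ)) x :=
      (hcpi i x).bdd_mul (c := C) (hN.comp (continuous_sub_right x)).aestronglyMeasurable
        (Filter.Eventually.of_forall fun y => hC _)
    rw [integral_add k1 k2]
    refine (abs_add_le _ _).trans ?_
    have h2 := havg (hcpi i x) (fun y => hconv2 i y x) x
    have h1 : |∫ y, -periodise (pd i (rescale η ε)) (y - x) *
        conv g (rescale (alberti η Λ (M y)) δ) x| ≤ 1 / ε * D := by
      have : ∫ y, -periodise (pd i (rescale η ε)) (y - x) *
          conv g (rescale (alberti η Λ (M y)) δ) x = -∫ z, conv g (rescale (alberti η Λ (M (x + proj z))) δ) x *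
            pd i (rescale η ε) z := by
        rw [← integral_mul_periodise_sub (hκ.pd i) (contDiff_pd hκc i).continuous (hci x), ← integral_neg]
        congr 1; funext y; ring
      rw [this, abs_neg]
      refine le_trans ?_ ((integral_abs_pd_rescale_le hη.suppBall hη.smooth hε i).trans_eq
        (by rw [one_div]))
      rw [← Real.norm_eq_abs]
      refine norm_integral_le_of_norm_le ((hκ.pd i).integrable (contDiff_pd hκc i).continuous).abs
        (Filter.Eventually.of_forall fun z => ?_)
      rw [norm_mul]
      exact mul_le_of_le_one_left (norm_nonneg _) (hconv1 _ _)
    calc _ ≤ 1 / ε * D + Real.exp Λ / δ * D := add_le_add h1 h2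
      _ = _ := by ring
  have h := abs_integral_mul_le_wNeg1Norm hf hw (A := 1) (B := d * D * (Real.exp Λ / δ + 1 / ε))
    (fun x => havg (hci x) (fun y => hconv1 y x) x) (fun x => ?_) (by positivity)
  · exact h
  · refine (norm_le_sum_abs _).trans ((Finset.sum_le_sum fun i _ => hgrad i x).trans_eq ?_)
    simp only [Finset.sum_const, Finset.card_univ, Fintype.card_fin, nsmul_eq_mul]
    ring

end

end BVTransport

namespace BVTransport

variable {d : ℕ}

/-! ### The Sobolev inequality on the torus -/

/-- The ball lies in finitely many cells, each carrying one copy of the torus integral. -/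
lemma lintegral_comp_proj_closedBall_le (R : ℝ) {F : Td d → ℝ≥0∞} (hF : Measurable F) :
    ∫⁻ v in Metric.closedBall (0 : E d) R, F (proj v) ≤ (latBall d (R + d)).card * ∫⁻ x, F x := by
  refine (lintegral_mono_set (closedBall_subset_iUnion_cellAt R)).trans ?_
  rw [lintegral_biUnion_finset (fun m _ n _ hmn => pairwise_disjoint_cellAt hmn)
    fun n _ => measurableSet_cellAt n]
  simp_rw [(measurePreserving_proj_cellAt (d := d) _).lintegral_comp hF]
  simp

lemma TorusSmooth.lintegral_enorm_sub_le {v : Td d → ℝ} (hv : TorusSmooth v) (a : E d) :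
    ∫⁻ x, ‖v (x + proj a) - v x‖ₑ ≤ ‖a‖ₑ * ∫⁻ x, ‖BVTransport.torusGrad v x‖ₑ := by
  have hg := hv.continuous_torusGrad
  calc ∫⁻ x, ‖v (x + proj a) - v x‖ₑ
      ≤ ∫⁻ x, ∫⁻ s in Set.Icc (0 : ℝ) 1, ‖a‖ₑ * ‖BVTransport.torusGrad v (x + proj (s • a))‖ₑ := by
        refine lintegral_mono fun x => ?_
        rw [hv.sub_eq_integral x a]
        refine (enorm_integral_le_lintegral_enorm _).trans (lintegral_mono fun s => ?_)
        simp only [← ofReal_norm]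
        rw [← ENNReal.ofReal_mul (norm_nonneg _)]
        exact ENNReal.ofReal_le_ofReal (norm_inner_le_norm _ _)
    _ = ∫⁻ s in Set.Icc (0 : ℝ) 1, ∫⁻ x, ‖a‖ₑ * ‖BVTransport.torusGrad v (x + proj (s • a))‖ₑ := by
        refine lintegral_lintegral_swap (Measurable.aemeasurable ?_)
        have h1 : Measurable fun q : Td d × ℝ => BVTransport.torusGrad v (q.1 + proj (q.2 • a)) :=
          hg.measurable.comp (f := fun q : Td d × ℝ => q.1 + proj (q.2 • a)) (by fun_prop)
        exact h1.enorm.const_mul _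
    _ = ∫⁻ s in Set.Icc (0 : ℝ) 1, ‖a‖ₑ * ∫⁻ x, ‖BVTransport.torusGrad v x‖ₑ := by
        refine lintegral_congr fun s => ?_
        rw [lintegral_const_mul' _ _ enorm_ne_top,
          lintegral_add_right_eq_self (fun x => ‖BVTransport.torusGrad v x‖ₑ)]
    _ = _ := by simp

/-- A Poincaré inequality: with mean zero, `v(x)` is minus the mean of `v(x + y) - v(x)`, and every
`y` is represented by a vector of the cell, of length at most `d`. -/
lemma TorusSmooth.lintegral_enorm_le {v : Td d → ℝ} (hv : TorusSmooth v) (h0 : ∫ x, v x = 0) :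
    ∫⁻ x, ‖v x‖ₑ ≤ d * ∫⁻ x, ‖BVTransport.torusGrad v x‖ₑ := by
  have hc := hv.continuous
  calc ∫⁻ x, ‖v x‖ₑ ≤ ∫⁻ x, ∫⁻ a in cell d, ‖v (x + proj a) - v x‖ₑ := by
        refine lintegral_mono fun x => ?_
        have h1 : v x = -∫ y, (v (x + y) - v x) := by
          rw [integral_sub (Continuous.integrable_torus (by fun_prop) _) (integrable_const _),
            integral_add_left_eq_self, h0]
          simp
        have h2 : ∫⁻ a in cell d, ‖v (x + proj a) - v x‖ₑ = ∫⁻ y, ‖v (x + y) - v x‖ₑ :=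
          measurePreserving_proj.lintegral_comp (f := fun y => ‖v (x + y) - v x‖ₑ)
            (Continuous.measurable (by fun_prop))
        rw [h2]
        conv_lhs => rw [h1, enorm_neg]
        exact enorm_integral_le_lintegral_enorm _
    _ = ∫⁻ a in cell d, ∫⁻ x, ‖v (x + proj a) - v x‖ₑ :=
        lintegral_lintegral_swap (by fun_prop)
    _ ≤ ∫⁻ _ in cell d, d * ∫⁻ x, ‖BVTransport.torusGrad v x‖ₑ := by
        refine setLIntegral_mono' measurableSet_cell fun a ha => ?_
        refine (hv.lintegral_enorm_sub_le a).trans ?_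
        gcongr
        rw [← ofReal_norm, ← ENNReal.ofReal_natCast]
        exact ENNReal.ofReal_le_ofReal (norm_le_of_mem_cell ha)
    _ = _ := by
        have : volume (cell d) = 1 := by
          have := (measurePreserving_proj (d := d)).measure_preimage (s := Set.univ) (by simp)
          simpa using this
        simp [this]

/-- The Sobolev inequality for smooth functions of mean zero on the torus. -/
theorem exists_sobolev_smooth {p : NNReal} (hp : NNReal.HolderConjugate d p) :
    ∃ C : NNReal, ∀ v : Td d → ℝ, TorusSmooth v → ∫ x, v x = 0 →
      eLpNorm v p volume ≤ C * ∫⁻ x, ‖torusGrad v x‖ₑ := by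
  -- A cut-off equal to `1` on the fundamental cell. The Gagliardo-Nirenberg-Sobolev inequality on
  -- `ℝ^d` is applied to `χ v`, and the Poincaré inequality absorbs the term `v ∇χ`.
  let χ : ContDiffBump (0 : E d) := ⟨d + 1, d + 2, by positivity, by linarith⟩
  have hχs : ContDiff ℝ ∞ χ := χ.contDiff
  have hχ0 : SuppBall χ (d + 2) := fun h hh => by
    have : h ∉ Function.support χ := by
      rw [χ.support_eq]; simpa using hh.le
    simpa using this
  have hχ1 : ∀ h ∈ cell d, χ h = 1 := fun h hh => χ.one_of_mem_closedBall (by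
    have := norm_le_of_mem_cell hh
    simp only [mem_closedBall_zero_iff]
    exact this.trans (by simp [χ]))
  obtain ⟨D, hD⟩ := hχ0.fderiv.hasCompactSupport.exists_bound_of_continuous
    (hχs.continuous_fderiv (by simp))
  have hD0 : 0 ≤ D := (norm_nonneg _).trans (hD 0)
  let G := eLpNormLESNormFDerivOneConst (volume : Measure (E d)) p
  let L : NNReal := (latBall d (d + 2 + d)).card
  -- `G` is the constant on `ℝ^d`, `L` counts cells that cover the support of `χ`, `D` bounds `|∇χ|`
  -- and `d` is the Poincaré constant.
  refine ⟨G * (L * (1 + D.toNNReal * d)), fun v hv h0 => ?_⟩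
  have hvs : ContDiff ℝ ∞ fun h : E d => v (proj h) := hv
  have hfd : ∀ h, ‖fderiv ℝ (fun h => v (proj h)) h‖ₑ = ‖torusGrad v (proj h)‖ₑ := by
    intro h
    have := torusGrad_proj_add v 0 h
    simp only [zero_add] at this
    rw [this, ← ofReal_norm, ← ofReal_norm, norm_gradient]
  let w : E d → ℝ := fun h => χ h * v (proj h)
  have hws : ContDiff ℝ ∞ w := hχs.mul hvs
  have hwS : SuppBall w (d + 2) := fun h hh => by simp [w, hχ0 h hh]
  have h1 : eLpNorm v p volume ≤ eLpNorm w p volume := by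
    rw [← measurePreserving_proj.map_eq, eLpNorm_map_measure
      hv.continuous.aestronglyMeasurable (by fun_prop)]
    rw [eLpNorm_congr_ae (g := w)]
    · exact eLpNorm_mono_measure _ Measure.restrict_le_self
    · filter_upwards [ae_restrict_mem measurableSet_cell] with h hh
      simp [w, hχ1 h hh]
  have h2 : eLpNorm w p volume ≤ G * eLpNorm (fderiv ℝ w) 1 volume :=
    eLpNorm_le_eLpNorm_fderiv_one volume (hws.of_le (by simp)) hwS.hasCompactSupport (by simpa using hp)
  have h3 : eLpNorm (fderiv ℝ w) 1 volume ≤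
      L * ∫⁻ x, (‖torusGrad v x‖ₑ + ENNReal.ofReal D * ‖v x‖ₑ) := by
    have hm : Measurable fun x => ‖torusGrad v x‖ₑ + ENNReal.ofReal D * ‖v x‖ₑ := by
      have := hv.continuous; have := hv.continuous_torusGrad; fun_prop
    rw [eLpNorm_one_eq_lintegral_enorm]
    refine le_trans ?_ (lintegral_comp_proj_closedBall_le (d + 2) hm)
    rw [← lintegral_indicator measurableSet_closedBall]
    refine lintegral_mono fun h => ?_
    by_cases hh : h ∈ Metric.closedBall (0 : E d) (d + 2)
    · simp only [Set.indicator_of_mem hh]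
      have : fderiv ℝ w h = χ h • fderiv ℝ (fun h => v (proj h)) h + v (proj h) • fderiv ℝ χ h :=
        fderiv_fun_mul (hχs.differentiable (by simp) h) (hvs.differentiable (by simp) h)
      rw [this]
      have hadd : ∀ A B : E d →L[ℝ] ℝ, ‖A + B‖ₑ ≤ ‖A‖ₑ + ‖B‖ₑ := fun A B => enorm_add_le A B
      refine (hadd _ _).trans ?_
      rw [enorm_smul, enorm_smul, hfd, mul_comm (‖v (proj h)‖ₑ)]
      gcongr
      · refine mul_le_of_le_one_left' ?_
        rw [Real.enorm_of_nonneg χ.nonneg]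
        exact ENNReal.ofReal_le_one.2 χ.le_one
      · rw [← ofReal_norm]; exact ENNReal.ofReal_le_ofReal (hD h)
    · have : d + 2 < ‖h‖ := by simpa using hh
      have h0' : ‖fderiv ℝ w h‖ₑ = 0 := by
        rw [← ofReal_norm, hwS.fderiv h this, norm_zero, ENNReal.ofReal_zero]
      rw [h0']
      exact zero_le
  have h4 : ∫⁻ x, (‖torusGrad v x‖ₑ + ENNReal.ofReal D * ‖v x‖ₑ) ≤
      (1 + ENNReal.ofReal D * d) * ∫⁻ x, ‖torusGrad v x‖ₑ := by
    have := hv.continuous; have := hv.continuous_torusGrad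
    rw [lintegral_add_left (by fun_prop), lintegral_const_mul' _ _ ENNReal.ofReal_ne_top, add_mul,
      one_mul, mul_assoc]
    gcongr
    exact hv.lintegral_enorm_le h0
  refine h1.trans (h2.trans ?_)
  push_cast
  rw [mul_assoc, mul_assoc]
  gcongr
  refine h3.trans ?_
  gcongr
  exact h4

/-! ### The Sobolev inequality for fields of bounded variation -/

/-- Mollification keeps the mean zero, so the smooth Sobolev inequality applies to mollified
coordinates. -/
lemma integral_conv {k : E d → ℝ} {R : ℝ} (hk : SuppBall k R) (hc : Continuous k)
    {f : Td d → ℝ} (hf : Integrable f) : ∫ x, conv f k x = (∫ x, f x) * ∫ h, k h := by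
  simp_rw [conv_eq_integral_periodise hk hc hf]
  have hN := hk.continuous_periodise hc
  obtain ⟨C, hC0, hC⟩ := Continuous.exists_bound_torus hN
  rw [integral_integral_swap]
  · simp_rw [integral_const_mul, integral_sub_right_eq_self (fun x => periodise k x),
      integral_periodise hk hc, integral_mul_const]
  · have h1 : Integrable (fun q : Td d × Td d => f q.2) := hf.comp_snd volume
    exact h1.mul_bdd (c := C) (by fun_prop) (Filter.Eventually.of_forall fun q => hC _)

section
variable {u : Td d → E d} {μ : Measure (Td d)} {σ : Td d → Matrix (Fin d) (Fin d) ℝ}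

lemma IsBVWithGradient.torusGrad_conv_coord (h : IsBVWithGradient u μ σ) {k : E d → ℝ} {R : ℝ}
    (hk : SuppBall k R) (hc : ContDiff ℝ ∞ k) (i j : Fin d) (x : Td d) :
    torusGrad (conv (fun y => u y j) k) x i = ∫ y, periodise k (x - y) * σ y i j ∂μ := by
  have h1 := h.grad (fun y => periodise k (x - y)) ((hk.torusSmooth_periodise hc).comp_sub x) i j
  simp_rw [torusGrad_comp_sub, torusGrad_periodise hk hc, mul_neg, integral_neg] at h1
  rw [torusGrad_conv hk hc (h.integrable_coord j), conv_eq_integral_periodise (hk.pd i)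
    (contDiff_pd hc i).continuous (h.integrable_coord j)]
  linarith

/-- Each entry of the mollified gradient has `L¹` norm at most the total variation, since `|σ i j| ≤
1` and the kernel has mass one; `d` entries are summed. -/
lemma IsBVWithGradient.lintegral_torusGrad_conv_le (h : IsBVWithGradient u μ σ) {k : E d → ℝ}
    {R : ℝ} (hk : SuppBall k R) (hc : ContDiff ℝ ∞ k) (hk0 : ∀ z, 0 ≤ k z) (hk1 : ∫ z, k z = 1)
    (j : Fin d) :
    ∫⁻ x, ‖torusGrad (conv (fun y => u y j) k) x‖ₑ ≤ d * μ Set.univ := by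
  have := h.finite
  have hN := hk.continuous_periodise hc.continuous
  have hNi : ∫⁻ x, ‖periodise k x‖ₑ = 1 := by
    have := ofReal_integral_norm_eq_lintegral_enorm (Continuous.integrable_torus hN volume)
    rw [← this]
    simp_rw [Real.norm_of_nonneg (periodise_nonneg hk0 _)]
    rw [integral_periodise hk hc.continuous, hk1, ENNReal.ofReal_one]
  have h1 : ∀ i, ∫⁻ x, ‖torusGrad (conv (fun y => u y j) k) x i‖ₑ ≤ μ Set.univ := by
    intro i
    calc ∫⁻ x, ‖torusGrad (conv (fun y => u y j) k) x i‖ₑ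
        ≤ ∫⁻ x, ∫⁻ y, ‖periodise k (x - y)‖ₑ ∂μ := by
          refine lintegral_mono fun x => ?_
          rw [h.torusGrad_conv_coord hk hc]
          refine (enorm_integral_le_lintegral_enorm _).trans (lintegral_mono_ae ?_)
          filter_upwards [h.ae_abs_le i j] with y hy
          rw [enorm_mul]
          refine mul_le_of_le_one_right' ?_
          rw [← ofReal_norm]
          exact ENNReal.ofReal_le_one.2 hy
      _ = ∫⁻ y, (∫⁻ x, ‖periodise k (x - y)‖ₑ) ∂μ := lintegral_lintegral_swap (by fun_prop)
      _ = μ Set.univ := by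
          simp_rw [lintegral_sub_right_eq_self (fun x => ‖periodise k x‖ₑ), hNi]
          simp
  have hs := (hk.torusSmooth_conv hc (h.integrable_coord j)).continuous_torusGrad
  calc ∫⁻ x, ‖torusGrad (conv (fun y => u y j) k) x‖ₑ
      ≤ ∫⁻ x, ∑ i, ‖torusGrad (conv (fun y => u y j) k) x i‖ₑ := by
        refine lintegral_mono fun x => ?_
        rw [← ofReal_norm]
        refine (ENNReal.ofReal_le_ofReal (norm_le_sum_abs _)).trans ?_
        rw [ENNReal.ofReal_sum_of_nonneg fun i _ => abs_nonneg _]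
        simp_rw [← Real.norm_eq_abs, ofReal_norm]
        rfl
    _ = ∑ i, ∫⁻ x, ‖torusGrad (conv (fun y => u y j) k) x i‖ₑ :=
        lintegral_finsetSum _ fun i _ => by fun_prop
    _ ≤ ∑ i : Fin d, μ Set.univ := Finset.sum_le_sum fun i _ => h1 i
    _ = _ := by simp

end

/-- The Sobolev inequality for fields of bounded variation and mean zero on the torus. -/
theorem exists_sobolev_bv {p : NNReal} (hp : NNReal.HolderConjugate d p) :
    ∃ C : NNReal, ∀ (u : Td d → E d) (μ : Measure (Td d)) (σ : Td d → Matrix (Fin d) (Fin d) ℝ),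
      IsBVWithGradient u μ σ → ∫ x, u x = 0 → eLpNorm u p volume ≤ C * μ Set.univ := by
  obtain ⟨C, hC⟩ := exists_sobolev_smooth hp
  refine ⟨d * (C * d), fun u μ σ h h0 => ?_⟩
  have hp1 : (1 : ℝ≥0∞) ≤ p := by exact_mod_cast hp.symm.lt.le
  have hj : ∀ j, eLpNorm (fun x => u x j) p volume ≤ C * (d * μ Set.univ) := by
    intro j
    have hi := h.integrable_coord j
    have hm : ∫ x, u x j = 0 := by
      have := (EuclideanSpace.proj (𝕜 := ℝ) j).integral_comp_comm h.integrable
      rw [h0] at this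
      simpa using this
    have hs := fun n => (suppBall_approxId (d := d) n).torusSmooth_conv (contDiff_approxId n) hi
    -- Lower semicontinuity of the `L^p` norm along the mollifications, whose bound is uniform.
    refine Lp.eLpNorm_le_of_ae_tendsto (u := Filter.atTop)
      (f := fun n => conv (fun x => u x j) (approxId d n))
      (Filter.Eventually.of_forall fun n => ?_)
      (fun n => (hs n).continuous.aestronglyMeasurable) (ae_tendsto_conv_approxId hi)
    refine (hC _ (hs n) ?_).trans ?_
    · rw [integral_conv (suppBall_approxId n) (contDiff_approxId n).continuous hi, hm, zero_mul]
    · gcongr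
      exact h.lintegral_torusGrad_conv_le (suppBall_approxId n) (contDiff_approxId n)
        (approxId_nonneg n) (integral_approxId n) j
  calc eLpNorm u p volume ≤ eLpNorm (∑ j, fun x => |u x j|) p volume := by
        refine eLpNorm_mono_real fun x => ?_
        simpa using norm_le_sum_abs (u x)
    _ ≤ ∑ j, eLpNorm (fun x => |u x j|) p volume :=
        eLpNorm_sum_le (fun j _ => (h.integrable_coord j).abs.aestronglyMeasurable) hp1
    _ ≤ ∑ j : Fin d, C * (d * μ Set.univ) := by
        refine Finset.sum_le_sum fun j _ => le_trans (le_of_eq ?_) (hj j)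
        exact eLpNorm_norm (fun x => u x j)
    _ = _ := by simp; ring

end BVTransport

namespace BVTransport

variable {d : ℕ}

/-! ### Loss of the `L²` norm under mollification -/

section
variable {η : E d → ℝ} {Λ δ ε r : ℝ}

/-- For `|w| ≤ 1/2`, if `h` lies in the ball of radius `1/4` around `-w/2`, then `h` and `h + w`
both lie in the half ball, where `η` is bounded below. -/
lemma IsMollifier.exists_autocorrelation_bound (hη : IsMollifier η) :
    ∃ c : ℝ, 0 < c ∧ ∀ w, ‖w‖ ≤ 1 / 2 →
      ENNReal.ofReal c ≤ ∫⁻ h, ENNReal.ofReal (η h * η (h + w)) := by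
  obtain ⟨h₀, hh₀, hmin⟩ := (isCompact_closedBall (0 : E d) (1 / 2)).exists_isMinOn
    ⟨0, by simp⟩ hη.smooth.continuous.continuousOn
  have hm : 0 < η h₀ := hη.pos _ (by simpa using hh₀)
  have hV : 0 < volume.real (Metric.closedBall (0 : E d) (1 / 4)) :=
    ENNReal.toReal_pos (Metric.measure_closedBall_pos _ _ (by norm_num)).ne'
      measure_closedBall_lt_top.ne
  refine ⟨η h₀ ^ 2 * volume.real (Metric.closedBall (0 : E d) (1 / 4)), by positivity,
    fun w hw => ?_⟩
  rw [ENNReal.ofReal_mul (by positivity), ofReal_measureReal measure_closedBall_lt_top.ne,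
    ← Measure.addHaar_closedBall_center volume (-((1 / 2 : ℝ) • w)), ← setLIntegral_const]
  refine (setLIntegral_mono' measurableSet_closedBall fun h hh => ?_).trans
    (setLIntegral_le_lintegral _ _)
  rw [mem_closedBall_iff_norm, sub_neg_eq_add] at hh
  have hw2 : ‖(1 / 2 : ℝ) • w‖ ≤ 1 / 4 := by
    rw [norm_smul]; norm_num; linarith
  have h1 : ‖h‖ ≤ 1 / 2 := by
    have := norm_sub_le (h + (1 / 2 : ℝ) • w) ((1 / 2 : ℝ) • w)
    rw [add_sub_cancel_right] at this
    linarith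
  have h2 : ‖h + w‖ ≤ 1 / 2 := by
    have := norm_add_le (h + (1 / 2 : ℝ) • w) ((1 / 2 : ℝ) • w)
    have e : h + (1 / 2 : ℝ) • w + (1 / 2 : ℝ) • w = h + w := by
      rw [add_assoc, ← add_smul]; norm_num
    rw [e] at this
    linarith
  refine ENNReal.ofReal_le_ofReal ?_
  rw [sq]
  exact mul_le_mul (hmin (by simpa using h1)) (hmin (by simpa using h2)) hm.le (hη.nonneg _)

/-- `η` is a probability density; the mean of `(a - a')²` over two independent copies is twice the
variance. -/
lemma IsMollifier.variance (hη : IsMollifier η) {a : E d → ℝ} (ha : Measurable a) {A : ℝ}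
    (hA : ∀ h, |a h| ≤ A) :
    0 ≤ (∫ h, a h ^ 2 * η h) - (∫ h, a h * η h) ^ 2 ∧
    ∫⁻ h, ∫⁻ h', ENNReal.ofReal (η h * η h' * (a h - a h') ^ 2) =
      ENNReal.ofReal (2 * ((∫ h, a h ^ 2 * η h) - (∫ h, a h * η h) ^ 2)) := by
  have hηi : Integrable η := hη.suppBall.integrable hη.smooth.continuous
  have hηm := hη.smooth.continuous.measurable
  have i1 : Integrable fun h => a h * η h :=
    hηi.bdd_mul (c := A) ha.aestronglyMeasurable (Filter.Eventually.of_forall hA)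
  have i2 : Integrable fun h => a h ^ 2 * η h := by
    refine hηi.bdd_mul (c := A ^ 2) (ha.pow_const 2).aestronglyMeasurable
      (Filter.Eventually.of_forall fun h => ?_)
    rw [norm_pow]
    exact pow_le_pow_left₀ (norm_nonneg _) (hA h) 2
  set m₁ := ∫ h, a h * η h
  set m₂ := ∫ h, a h ^ 2 * η h
  have hlin : ∀ c₁ c₂ c₃ : ℝ,
      Integrable (fun h => c₁ * (a h ^ 2 * η h) - c₂ * (a h * η h) + c₃ * η h) ∧
      ∫ h, (c₁ * (a h ^ 2 * η h) - c₂ * (a h * η h) + c₃ * η h) = c₁ * m₂ - c₂ * m₁ + c₃ := by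
    intro c₁ c₂ c₃
    have k₁ := i2.const_mul c₁
    have k₂ := i1.const_mul c₂
    have k₃ := hηi.const_mul c₃
    have k₁₂ : Integrable fun h => c₁ * (a h ^ 2 * η h) - c₂ * (a h * η h) := k₁.sub k₂
    refine ⟨k₁₂.add k₃, ?_⟩
    rw [integral_add k₁₂ k₃, integral_sub k₁ k₂]
    simp only [integral_const_mul, hη.integral, mul_one, m₁, m₂]
  have inner : ∀ h, (fun h' => η h * η h' * (a h - a h') ^ 2) = fun h' =>
      η h * (a h' ^ 2 * η h') - 2 * (η h * a h) * (a h' * η h') + η h * a h ^ 2 * η h' :=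
    fun h => by funext h'; ring
  have j1 : ∀ h, Integrable fun h' => η h * η h' * (a h - a h') ^ 2 := fun h => by
    rw [inner]; exact (hlin _ _ _).1
  have e1 : ∀ h, ∫ h', η h * η h' * (a h - a h') ^ 2 =
      1 * (a h ^ 2 * η h) - 2 * m₁ * (a h * η h) + m₂ * η h := fun h => by
    rw [inner, (hlin _ _ _).2]; ring
  have j2 := (hlin 1 (2 * m₁) m₂).1
  have e2 : ∫ h, (1 * (a h ^ 2 * η h) - 2 * m₁ * (a h * η h) + m₂ * η h) = 2 * (m₂ - m₁ ^ 2) := by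
    rw [(hlin _ _ _).2]; ring
  have n1 : ∀ h h', 0 ≤ η h * η h' * (a h - a h') ^ 2 := fun h h' =>
    mul_nonneg (mul_nonneg (hη.nonneg _) (hη.nonneg _)) (sq_nonneg _)
  have n2 : ∀ h, 0 ≤ 1 * (a h ^ 2 * η h) - 2 * m₁ * (a h * η h) + m₂ * η h := fun h => by
    rw [← e1]; exact integral_nonneg (n1 h)
  refine ⟨?_, ?_⟩
  · have : 0 ≤ 2 * (m₂ - m₁ ^ 2) := by
      rw [← e2]; exact integral_nonneg n2
    linarith
  · rw [← e2, ofReal_integral_eq_lintegral_ofReal j2 (Filter.Eventually.of_forall n2)]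
    refine lintegral_congr fun h => ?_
    rw [← e1, ofReal_integral_eq_lintegral_ofReal (j1 h) (Filter.Eventually.of_forall (n1 h))]

lemma IsMollifier.abs_conv_le (hη : IsMollifier η) (hr : 0 < r) {g : Td d → ℝ} {G : ℝ}
    (hg : ∀ x, |g x| ≤ G) (x : Td d) : |conv g (rescale η r) x| ≤ G := by
  obtain ⟨h0, h1, hi⟩ := integral_rescale_mollifier hη hr
  refine (BVTransport.abs_conv_le hg hi x).trans ?_
  simp_rw [abs_of_nonneg (h0 _)]
  rw [h1, mul_one]

/-- The `L²` norm lost under mollification is the mean over `x` of the variance of `h ↦ g(x - rh)`,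
hence half of a double integral of squared increments. With `h' = h + w` and `x` translated, the
weight becomes the autocorrelation of `η`, bounded below for `|w| ≤ 1/2`. -/
lemma IsMollifier.lintegral_increment_le (hη : IsMollifier η) {c : ℝ}
    (hc : ∀ w, ‖w‖ ≤ 1 / 2 → ENNReal.ofReal c ≤ ∫⁻ h, ENNReal.ofReal (η h * η (h + w)))
    (hr : 0 < r) {g : Td d → ℝ} (hg : Measurable g) {G : ℝ} (hgG : ∀ x, |g x| ≤ G) :
    0 ≤ (∫ x, g x ^ 2) - ∫ x, conv g (rescale η r) x ^ 2 ∧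
    ENNReal.ofReal c * ∫⁻ w in Metric.closedBall (0 : E d) (1 / 2), ∫⁻ x,
        ENNReal.ofReal ((g x - g (x - proj (r • w))) ^ 2) ≤
      ENNReal.ofReal (2 * ((∫ x, g x ^ 2) - ∫ x, conv g (rescale η r) x ^ 2)) := by
  have hηm := hη.smooth.continuous.measurable
  have hηi : Integrable η := hη.suppBall.integrable hη.smooth.continuous
  have hcm : Measurable (conv g (rescale η r)) :=
    measurable_conv (g := fun _ => g) (k := fun _ => rescale η r) (x := fun x => x)
      (hg.comp measurable_snd)
      ((continuous_rescale hη.smooth.continuous r).measurable.comp measurable_snd) measurable_id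
  have hG2 : ∀ {y : ℝ}, |y| ≤ G → ‖y ^ 2‖ ≤ G ^ 2 := fun hy => by
    rw [norm_pow]; exact pow_le_pow_left₀ (norm_nonneg _) hy 2
  have ic : Integrable fun x => conv g (rescale η r) x ^ 2 :=
    Integrable.of_bound (hcm.pow_const 2).aestronglyMeasurable (G ^ 2)
      (Filter.Eventually.of_forall fun x => hG2 (hη.abs_conv_le hr hgG x))
  have ig : Integrable fun q : Td d × E d => g (q.1 - proj (r • q.2)) ^ 2 * η q.2 := by
    refine (hηi.comp_snd (volume : Measure (Td d))).bdd_mul (c := G ^ 2)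
      (Measurable.aestronglyMeasurable (by fun_prop)) (Filter.Eventually.of_forall fun q => hG2 (hgG _))
  have eg : ∫ x, ∫ h, g (x - proj (r • h)) ^ 2 * η h = ∫ x, g x ^ 2 := by
    rw [integral_integral_swap ig]
    simp_rw [integral_mul_const, integral_sub_right_eq_self (fun x => g x ^ 2), integral_const_mul,
      hη.integral, mul_one]
  have ig' : Integrable fun x => ∫ h, g (x - proj (r • h)) ^ 2 * η h := ig.integral_prod_left
  have hvar := fun x => hη.variance (a := fun h => g (x - proj (r • h))) (by fun_prop)
    (fun h => hgG _)
  have ediff : ∫ x, 2 * ((∫ h, g (x - proj (r • h)) ^ 2 * η h) - conv g (rescale η r) x ^ 2) =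
      2 * ((∫ x, g x ^ 2) - ∫ x, conv g (rescale η r) x ^ 2) := by
    rw [integral_const_mul, integral_sub ig' ic, eg]
  have idiff : Integrable fun x =>
      2 * ((∫ h, g (x - proj (r • h)) ^ 2 * η h) - conv g (rescale η r) x ^ 2) :=
    (ig'.sub ic).const_mul 2
  have n1 : ∀ x, 0 ≤ 2 * ((∫ h, g (x - proj (r • h)) ^ 2 * η h) - conv g (rescale η r) x ^ 2) :=
    fun x => by
      rw [conv_rescale _ _ hr]
      exact mul_nonneg (by norm_num) (hvar x).1
  refine ⟨?_, ?_⟩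
  · have : 0 ≤ 2 * ((∫ x, g x ^ 2) - ∫ x, conv g (rescale η r) x ^ 2) := by
      rw [← ediff]; exact integral_nonneg n1
    linarith
  let F : Td d → E d → E d → ℝ≥0∞ := fun x h h' =>
    ENNReal.ofReal (η h * η h' * (g (x - proj (r • h)) - g (x - proj (r • h'))) ^ 2)
  have hF : Measurable fun q : Td d × E d × E d => F q.1 q.2.1 (q.2.1 + q.2.2) := by
    simp only [F]; fun_prop
  calc ENNReal.ofReal c * ∫⁻ w in Metric.closedBall (0 : E d) (1 / 2), ∫⁻ x,
        ENNReal.ofReal ((g x - g (x - proj (r • w))) ^ 2)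
      = ∫⁻ w in Metric.closedBall (0 : E d) (1 / 2), ENNReal.ofReal c * ∫⁻ x,
        ENNReal.ofReal ((g x - g (x - proj (r • w))) ^ 2) :=
        (lintegral_const_mul' _ _ ENNReal.ofReal_ne_top).symm
    _ ≤ ∫⁻ w in Metric.closedBall (0 : E d) (1 / 2), (∫⁻ h, ENNReal.ofReal (η h * η (h + w))) *
        ∫⁻ x, ENNReal.ofReal ((g x - g (x - proj (r • w))) ^ 2) := by
        refine setLIntegral_mono' measurableSet_closedBall fun w hw => ?_
        gcongr
        exact hc w (by simpa using hw)
    _ ≤ ∫⁻ w, (∫⁻ h, ENNReal.ofReal (η h * η (h + w))) *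
        ∫⁻ x, ENNReal.ofReal ((g x - g (x - proj (r • w))) ^ 2) := setLIntegral_le_lintegral _ _
    _ = ∫⁻ w, ∫⁻ h, ∫⁻ x, F x h (h + w) := by
        refine lintegral_congr fun w => ?_
        rw [← lintegral_mul_const _ (by fun_prop)]
        refine lintegral_congr fun h => ?_
        -- Translating `x` by `r h` makes the increment depend on `h` and `h + w` instead of `w`
        -- alone.
        rw [← lintegral_const_mul _ (by fun_prop),
          ← lintegral_sub_right_eq_self _ (proj (r • h))]
        refine lintegral_congr fun x => ?_
        rw [← ENNReal.ofReal_mul (mul_nonneg (hη.nonneg _) (hη.nonneg _))]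
        simp only [F, smul_add, proj_add]
        rw [sub_sub]
    _ = ∫⁻ h, ∫⁻ w, ∫⁻ x, F x h (h + w) := by
        refine lintegral_lintegral_swap (Measurable.aemeasurable ?_)
        exact Measurable.lintegral_prod_left' (f := fun q : Td d × E d × E d => F q.1 q.2.2 (q.2.2 + q.2.1))
          (hF.comp (f := fun q : Td d × E d × E d => (q.1, q.2.2, q.2.1)) (by fun_prop))
    _ = ∫⁻ h, ∫⁻ x, ∫⁻ w, F x h (h + w) := by
        refine lintegral_congr fun h => lintegral_lintegral_swap (Measurable.aemeasurable ?_)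
        exact hF.comp (f := fun q : E d × Td d => (q.2, h, q.1)) (by fun_prop)
    _ = ∫⁻ h, ∫⁻ x, ∫⁻ h', F x h h' := by
        refine lintegral_congr fun h => lintegral_congr fun x => ?_
        exact lintegral_add_left_eq_self (fun h' => F x h h') h
    _ = ∫⁻ x, ∫⁻ h, ∫⁻ h', F x h h' := by
        refine lintegral_lintegral_swap (Measurable.aemeasurable ?_)
        refine Measurable.lintegral_prod_right' (f := fun q : (E d × Td d) × E d => F q.1.2 q.1.1 q.2) ?_
        simp only [F]; fun_prop
    _ = ∫⁻ x, ENNReal.ofReal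
          (2 * ((∫ h, g (x - proj (r • h)) ^ 2 * η h) - conv g (rescale η r) x ^ 2)) := by
        refine lintegral_congr fun x => ?_
        rw [conv_rescale _ _ hr]
        exact (hvar x).2
    _ = _ := by
        rw [← ediff, ofReal_integral_eq_lintegral_ofReal idiff
          (Filter.Eventually.of_forall n1)]

end

end BVTransport

namespace BVTransport

variable {d : ℕ}

/-! ### The localisation term -/

/-- The oscillation of `g` at `x` at scale `r`. -/
noncomputable def osc (g : Td d → ℝ) (r : ℝ) (x : Td d) : ℝ≥0∞ :=
  ∫⁻ w in Metric.closedBall (0 : E d) (1 / 2), ‖g x - g (x - proj (r • w))‖ₑ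

/-- Dilating by `2R` carries the support radius `R` to `1/2`. This fixes the oscillation scale
`2δR`, and the Jacobian `(2R)^d` is the source of `e^{dΛ}` in the bound of `I3`. -/
lemma enorm_conv_sub_le {k : E d → ℝ} {R B δ : ℝ} (hR : 0 < R) (hk : SuppBall k R)
    (hc : Continuous k) (hB : ∀ h, |k h| ≤ B) (h1 : ∫ h, k h = 1) (hδ : 0 < δ) {g : Td d → ℝ}
    (hg : Measurable g) {G : ℝ} (hgG : ∀ x, |g x| ≤ G) (x : Td d) :
    ‖conv g (rescale k δ) x - g x‖ₑ ≤ ENNReal.ofReal ((2 * R) ^ d * B) * osc g (2 * δ * R) x := by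
  have hki := hk.integrable hc
  have hB0 : 0 ≤ B := (abs_nonneg _).trans (hB 0)
  have hR2 : 0 < 2 * R := by positivity
  have e1 : conv g (rescale k δ) x - g x = (2 * R) ^ d *
      ∫ w, (g (x - proj ((2 * δ * R) • w)) - g x) * k ((2 * R) • w) := by
    have := integral_eq_pow_mul_integral_smul hR2 fun h => (g (x - proj (δ • h)) - g x) * k h
    simp only [smul_smul, show δ * (2 * R) = 2 * δ * R by ring] at this
    rw [← this, conv_rescale _ _ hδ]
    simp only [sub_mul]
    have hi : Integrable fun h => g (x - proj (δ • h)) * k h :=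
      hki.bdd_mul (c := G) (Measurable.aestronglyMeasurable (by fun_prop))
        (Filter.Eventually.of_forall fun h => hgG _)
    rw [integral_sub hi (hki.const_mul _), integral_const_mul, h1, mul_one]
  rw [e1, enorm_mul, Real.enorm_of_nonneg (by positivity), ENNReal.ofReal_mul (by positivity),
    mul_assoc (ENNReal.ofReal _)]
  refine mul_le_mul' le_rfl ?_
  refine (enorm_integral_le_lintegral_enorm _).trans ?_
  rw [osc, ← lintegral_const_mul' _ _ ENNReal.ofReal_ne_top,
    ← lintegral_indicator measurableSet_closedBall]
  refine lintegral_mono fun w => ?_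
  by_cases hw : w ∈ Metric.closedBall (0 : E d) (1 / 2)
  · rw [Set.indicator_of_mem hw, enorm_mul, mul_comm, enorm_sub_rev]
    gcongr
    rw [← ofReal_norm]
    exact ENNReal.ofReal_le_ofReal (hB _)
  · have h2 : R < ‖(2 * R) • w‖ := by
      rw [norm_smul, Real.norm_of_nonneg hR2.le]
      have : 1 / 2 < ‖w‖ := by simpa using hw
      nlinarith
    simp [hk _ h2]

section
variable {g : Td d → ℝ} {r : ℝ}

lemma osc_sq_le (hg : Measurable g) (x : Td d) :
    osc g r x ^ 2 ≤ volume (Metric.closedBall (0 : E d) (1 / 2)) *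
      ∫⁻ w in Metric.closedBall (0 : E d) (1 / 2),
        ENNReal.ofReal ((g x - g (x - proj (r • w))) ^ 2) := by
  have h := ENNReal.lintegral_mul_le_Lp_mul_Lq
    (volume.restrict (Metric.closedBall (0 : E d) (1 / 2))) Real.HolderConjugate.two_two
    (f := fun _ => 1) (g := fun w => ‖g x - g (x - proj (r • w))‖ₑ)
    (by fun_prop) (by fun_prop)
  simp only [Pi.mul_apply, one_mul, ENNReal.one_rpow, lintegral_const, Measure.restrict_apply_univ]
    at h
  refine (pow_le_pow_left' h 2).trans (le_of_eq ?_)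
  rw [mul_pow, ← ENNReal.rpow_natCast, ← ENNReal.rpow_natCast, ← ENNReal.rpow_mul,
    ← ENNReal.rpow_mul]
  norm_num
  congr 1
  refine lintegral_congr fun w => ?_
  rw [← sq_abs (g x - _), ENNReal.ofReal_pow (abs_nonneg _), ← Real.norm_eq_abs, ofReal_norm]

/-- Since `|g| ≤ 1`, all but two of the `d` factors are bounded by a constant, and Cauchy-Schwarz
bounds the remaining square. -/
lemma osc_pow_le (hd : 2 ≤ d) (hg : Measurable g) (hg1 : ∀ x, |g x| ≤ 1) (x : Td d) :
    osc g r x ^ d ≤ (2 * volume (Metric.closedBall (0 : E d) (1 / 2))) ^ (d - 2) *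
      volume (Metric.closedBall (0 : E d) (1 / 2)) *
      ∫⁻ w in Metric.closedBall (0 : E d) (1 / 2),
        ENNReal.ofReal ((g x - g (x - proj (r • w))) ^ 2) := by
  have h1 : osc g r x ≤ 2 * volume (Metric.closedBall (0 : E d) (1 / 2)) := by
    rw [osc, ← setLIntegral_const]
    refine lintegral_mono fun w => ?_
    have h2 : ‖g x - g (x - proj (r • w))‖ ≤ 2 := by
      have := hg1 x; have := hg1 (x - proj (r • w))
      refine (norm_sub_le _ _).trans ?_
      simp only [Real.norm_eq_abs]; linarith
    rw [← ofReal_norm]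
    simpa using ENNReal.ofReal_le_ofReal h2
  rw [mul_assoc]
  calc osc g r x ^ d = osc g r x ^ (d - 2) * osc g r x ^ 2 := by
        rw [← pow_add, Nat.sub_add_cancel hd]
    _ ≤ _ := mul_le_mul' (pow_le_pow_left' h1 _) (osc_sq_le hg x)

end

lemma norm_fderiv_rescale (k : E d → ℝ) {r : ℝ} (hr : 0 < r) (h : E d) :
    ‖fderiv ℝ (rescale k r) h‖ = r⁻¹ * rescale (fun h => ‖fderiv ℝ k h‖) r h := by
  have h1 : rescale k r = (r ^ d)⁻¹ • (fun h => k (r⁻¹ • h)) := rfl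
  rw [h1, fderiv_const_smul_field, Pi.smul_apply, fderiv_comp_smul, rescale, norm_smul, norm_smul,
    Real.norm_of_nonneg (by positivity), Real.norm_of_nonneg (by positivity)]
  ring

section
variable {η : E d → ℝ} {Λ δ ε K T : ℝ} {M : Td d → Matrix (Fin d) (Fin d) ℝ} {u : Td d → E d}
  {f g : ℝ → Td d → ℝ}

lemma lintegral_enorm_gradient_rescale (hη : IsMollifier η) (hε : 0 < ε) :
    ∫⁻ z, ‖gradient (rescale η ε) z‖ₑ = ENNReal.ofReal (ε⁻¹ * ∫ h, ‖fderiv ℝ η h‖) := by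
  have hc := hη.smooth.continuous_fderiv (by simp)
  have hi : Integrable fun h => ‖fderiv ℝ η h‖ :=
    (hc.integrable_of_hasCompactSupport hη.suppBall.fderiv.hasCompactSupport).norm
  have hS : SuppBall (fun h => ‖fderiv ℝ η h‖) 1 := fun h hh => by
    simp only [hη.suppBall.fderiv h hh, norm_zero]
  have hir : Integrable (rescale (fun h => ‖fderiv ℝ η h‖) ε) :=
    (hS.rescale hε).integrable (continuous_rescale hc.norm ε)
  rw [← integral_rescale _ hε, ← integral_const_mul,
    ofReal_integral_eq_lintegral_ofReal (hir.const_mul _)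
      (Filter.Eventually.of_forall fun z => by
        simp only [← norm_fderiv_rescale η hε]; exact norm_nonneg _)]
  refine lintegral_congr fun z => ?_
  rw [← norm_fderiv_rescale η hε, ← norm_gradient, ofReal_norm]

/-- The vanishing mean lets `g t x` be subtracted from the convolution in `I3`. -/
lemma integral_inner_gradient {k : E d → ℝ} {R : ℝ} (hk : SuppBall k R) (hc : ContDiff ℝ ∞ k)
    (a : E d) : Integrable (fun z => inner ℝ a (gradient k z)) ∧
      ∫ z, inner ℝ a (gradient k z) = 0 := by
  have e : (fun z => inner ℝ a (gradient k z)) = fun z => ∑ i, a i * pd i k z := by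
    funext z
    rw [inner_gradient, fderiv_eq_sum_pd]
  have hi : ∀ i, Integrable fun z => a i * pd i k z := fun i =>
    ((hk.pd i).integrable (contDiff_pd hc i).continuous).const_mul _
  rw [e]
  refine ⟨integrable_finsetSum _ fun i _ => hi i, ?_⟩
  rw [integral_finsetSum _ fun i _ => hi i]
  refine Finset.sum_eq_zero fun i _ => ?_
  rw [integral_const_mul, ← integral_periodise (hk.pd i) (contDiff_pd hc i).continuous]
  simp_rw [← torusGrad_periodise hk hc]
  rw [(hk.torusSmooth_periodise hc).integral_torusGrad, mul_zero]

/-- After subtraction of `g t x` the convolution is an oscillation that no longer depends on `z`, so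
the `z`-integral contributes only `‖∇η_ε‖₁`, of order `1/ε`. -/
lemma enorm_I3_le (hη : IsMollifier η) (hΛ : 0 < Λ) (hδ : 0 < δ) (hε : 0 < ε)
    (hMm : ∀ i j, Measurable fun x => M x i j) (hM : ∀ x, frob (M x) ≤ 1)
    (htr : ∀ x, (M x).trace = 0) {B : ℝ} (hB : ∀ h, |η h| ≤ B)
    (hfK : ∀ t x, |f t x| ≤ K) (hg : Measurable (Function.uncurry g)) {G : ℝ}
    (hgG : ∀ t x, |g t x| ≤ G) :
    ‖I3 η M Λ δ ε T u f g‖ₑ ≤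
      ENNReal.ofReal (K * ((2 * Real.exp Λ) ^ d * B) * (ε⁻¹ * ∫ h, ‖fderiv ℝ η h‖)) *
        ∫⁻ t in Set.Icc 0 T, ∫⁻ x, ‖u x‖ₑ * osc (g t) (2 * δ * Real.exp Λ) x := by
  have hK : 0 ≤ K := (abs_nonneg _).trans (hfK 0 0)
  have hB0 : 0 ≤ B := (abs_nonneg _).trans (hB 0)
  have hgt : ∀ t, Measurable (g t) := fun t => hg.comp (f := fun x => (t, x)) (by fun_prop)
  rw [I3, enorm_neg, ← lintegral_const_mul' _ _ ENNReal.ofReal_ne_top]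
  refine (enorm_integral_le_lintegral_enorm _).trans (lintegral_mono fun t => ?_)
  dsimp only
  rw [← lintegral_const_mul' _ _ ENNReal.ofReal_ne_top]
  refine (enorm_integral_le_lintegral_enorm _).trans (lintegral_mono fun x => ?_)
  dsimp only
  obtain ⟨hi, hi0⟩ := integral_inner_gradient (hη.suppBall.rescale hε)
    (contDiff_rescale hη.smooth ε) (u x)
  have e1 : ∫ z, f t x * conv (g t) (rescale (alberti η Λ (M (x + proj z))) δ) x *
      inner ℝ (u x) (gradient (rescale η ε) z) =
      ∫ z, f t x * (conv (g t) (rescale (alberti η Λ (M (x + proj z))) δ) x - g t x) *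
      inner ℝ (u x) (gradient (rescale η ε) z) := by
    simp only [mul_assoc, sub_mul, integral_const_mul]
    rw [integral_sub (integrable_conv_alberti hη hΛ hδ hMm hM (hgt t) (hgG t) hi x)
      (hi.const_mul _), integral_const_mul, hi0, mul_zero, sub_zero]
  rw [e1]
  refine (enorm_integral_le_lintegral_enorm _).trans ?_
  calc _ ≤ ∫⁻ z, ENNReal.ofReal (K * ((2 * Real.exp Λ) ^ d * B)) *
        (‖u x‖ₑ * osc (g t) (2 * δ * Real.exp Λ) x) * ‖gradient (rescale η ε) z‖ₑ := by
        refine lintegral_mono fun z => ?_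
        have h1 : ‖f t x‖ₑ ≤ ENNReal.ofReal K := by
          rw [← ofReal_norm]; exact ENNReal.ofReal_le_ofReal (hfK t x)
        have h2 := enorm_conv_sub_le (Real.exp_pos Λ)
          (suppBall_alberti hη.suppBall hΛ (hM (x + proj z)))
          (contDiff_alberti hη.smooth Λ (M (x + proj z))).continuous
          (abs_alberti_le hΛ hB) (by
            rw [integral_alberti hη.smooth.continuous hη.suppBall hΛ (hM _) (htr _), hη.integral])
          hδ (hgt t) (hgG t) x
        have h3 : ‖inner ℝ (u x) (gradient (rescale η ε) z)‖ₑ ≤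
            ‖u x‖ₑ * ‖gradient (rescale η ε) z‖ₑ := by
          simp only [← ofReal_norm]
          rw [← ENNReal.ofReal_mul (norm_nonneg _)]
          exact ENNReal.ofReal_le_ofReal (norm_inner_le_norm _ _)
        rw [enorm_mul, enorm_mul]
        refine (mul_le_mul' (mul_le_mul' h1 h2) h3).trans (le_of_eq ?_)
        rw [ENNReal.ofReal_mul hK]
        ring
    _ = _ := by
        have hgm : Measurable fun z => ‖gradient (rescale η ε) z‖ₑ := by
          simp only [← ofReal_norm, norm_gradient]
          have := (contDiff_rescale hη.smooth ε).continuous_fderiv (by simp)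
          fun_prop
        rw [lintegral_const_mul _ hgm, lintegral_enorm_gradient_rescale hη hε,
          ENNReal.ofReal_mul (p := K * _) (by positivity)]
        ring

/-- Hölder's inequality in space-time; `u` does not depend on time, which yields the power `1/p` of
`T`. -/
lemma lintegral_mul_osc_le {p : NNReal} (hp : NNReal.HolderConjugate d p) {r : ℝ}
    (hum : Measurable u) (hg : Measurable (Function.uncurry g)) :
    ∫⁻ t in Set.Icc 0 T, ∫⁻ x, ‖u x‖ₑ * osc (g t) r x ≤
      ENNReal.ofReal T ^ (1 / (p : ℝ)) * eLpNorm u p volume *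
        (∫⁻ t in Set.Icc 0 T, ∫⁻ x, osc (g t) r x ^ d) ^ (1 / (d : ℝ)) := by
  have hp0 : p ≠ 0 := hp.symm.pos.ne'
  have hpr : (p : ℝ).HolderConjugate d := by exact_mod_cast hp.symm
  have hom : Measurable fun q : ℝ × Td d => osc (g q.1) r q.2 := by
    refine Measurable.lintegral_prod_right'
      (f := fun q : (ℝ × Td d) × E d => ‖g q.1.1 q.1.2 - g q.1.1 (q.1.2 - proj (r • q.2))‖ₑ) ?_
    have h1 : Measurable fun q : (ℝ × Td d) × E d => g q.1.1 q.1.2 :=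
      hg.comp (f := fun q : (ℝ × Td d) × E d => (q.1.1, q.1.2)) (by fun_prop)
    have h2 : Measurable fun q : (ℝ × Td d) × E d => g q.1.1 (q.1.2 - proj (r • q.2)) :=
      hg.comp (f := fun q : (ℝ × Td d) × E d => (q.1.1, q.1.2 - proj (r • q.2))) (by fun_prop)
    exact (h1.sub h2).enorm
  have hu2 : Measurable fun q : ℝ × Td d => ‖u q.2‖ₑ := (hum.comp measurable_snd).enorm
  have h := ENNReal.lintegral_mul_le_Lp_mul_Lq ((volume.restrict (Set.Icc 0 T)).prod volume) hpr
    (f := fun q : ℝ × Td d => ‖u q.2‖ₑ) (g := fun q : ℝ × Td d => osc (g q.1) r q.2)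
    hu2.aemeasurable hom.aemeasurable
  simp only [Pi.mul_apply] at h
  have huo : Measurable fun q : ℝ × Td d => ‖u q.2‖ₑ * osc (g q.1) r q.2 := hu2.mul hom
  rw [lintegral_prod _ huo.aemeasurable, lintegral_prod _ (hu2.pow_const _).aemeasurable,
    lintegral_prod _ (hom.pow_const _).aemeasurable] at h
  refine h.trans (le_of_eq ?_)
  simp only [lintegral_const, Measure.restrict_apply_univ, Real.volume_Icc, sub_zero,
    ENNReal.rpow_natCast]
  rw [ENNReal.mul_rpow_of_nonneg _ _ (by positivity), eLpNorm_nnreal_eq_lintegral hp0,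
    mul_comm (ENNReal.ofReal T ^ _)]

/-- The estimate of the localisation term. -/
theorem exists_abs_I3_le (hd : 2 ≤ d) (hη : IsMollifier η) :
    ∃ C : ℝ, 0 < C ∧ ∀ (u : Td d → E d) (μ : Measure (Td d)) (σ M : Td d → Matrix (Fin d) (Fin d) ℝ)
      (f g : ℝ → Td d → ℝ) (T K Λ δ ε : ℝ), IsBVWithGradient u μ σ → ∫ x, u x = 0 →
      Measurable u → 0 < T → 0 < Λ → 0 < δ → 0 < ε →
      (∀ i j, Measurable fun x => M x i j) → (∀ x, frob (M x) ≤ 1) → (∀ x, (M x).trace = 0) →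
      (∀ t x, |f t x| ≤ K) → Measurable (Function.uncurry g) → (∀ t x, |g t x| ≤ 1) →
      |I3 η M Λ δ ε T u f g| ≤ C * (T ^ (((d : ℝ) - 1) / d) * (Real.exp (d * Λ) / ε) * K *
        μ.real Set.univ * (l2NormSq T g -
          l2NormSq T fun t => conv (g t) (rescale η (2 * δ * Real.exp Λ))) ^ (1 / (d : ℝ))) := by
  have hd0 : (0 : ℝ) < d := by positivity
  have hd1 : (1 : NNReal) < d := by exact_mod_cast hd
  obtain ⟨B, -, hB, -⟩ := hη.exists_bound
  have hB0 : 0 ≤ B := (abs_nonneg _).trans (hB 0)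
  obtain ⟨c, hc0, hc⟩ := hη.exists_autocorrelation_bound
  have hp := NNReal.HolderConjugate.conjExponent hd1
  set p := NNReal.conjExponent d
  have hpd : 1 / (p : ℝ) = ((d : ℝ) - 1) / d := by
    have := hp.coe.symm.inv_add_inv_eq_one
    have h2 : 1 / (p : ℝ) = 1 - (d : ℝ)⁻¹ := by
      rw [one_div]; simp only [NNReal.coe_natCast] at this; linarith
    rw [h2]; field_simp
  obtain ⟨S, hS⟩ := exists_sobolev_bv hp
  set V := volume.real (Metric.closedBall (0 : E d) (1 / 2))
  set L := ∫ h, ‖fderiv ℝ η h‖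
  have hL : 0 ≤ L := integral_nonneg fun h => norm_nonneg _
  -- The first factors come from `osc_pow_le`, and `2/c` from `IsMollifier.lintegral_increment_le`.
  set D := (2 * V) ^ (d - 2) * V * (c⁻¹ * 2)
  have hD : 0 ≤ D := by positivity
  -- The added `1` makes the constant positive without a lower bound for the factors.
  refine ⟨2 ^ d * B * L * S * D ^ (1 / (d : ℝ)) + 1, by positivity, ?_⟩
  intro u μ σ M f g T K Λ δ ε h h0 hum hT hΛ hδ hε hMm hM htr hfK hg hg1
  have := h.finite
  have hK : 0 ≤ K := (abs_nonneg _).trans (hfK 0 0)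
  set r := 2 * δ * Real.exp Λ
  have hr : 0 < r := by positivity
  have hgt : ∀ t, Measurable (g t) := fun t => hg.comp (f := fun x => (t, x)) (by fun_prop)
  have hinc := fun t => hη.lintegral_increment_le hc hr (hgt t) (hg1 t)
  set Q := l2NormSq T g - l2NormSq T fun t => conv (g t) (rescale η r)
  have hcm : Measurable fun q : ℝ × Td d => conv (g q.1) (rescale η r) q.2 :=
    measurable_conv (g := fun q : ℝ × Td d => g q.1) (k := fun _ => rescale η r)
      (x := fun q => q.2) (hg.comp (f := fun q : (ℝ × Td d) × Td d => (q.1.1, q.2)) (by fun_prop))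
      ((continuous_rescale hη.smooth.continuous r).measurable.comp measurable_snd) measurable_snd
  have hI : ∀ {w : ℝ → Td d → ℝ}, Measurable (Function.uncurry w) → (∀ t x, |w t x| ≤ 1) →
      Integrable (fun t => ∫ x, w t x ^ 2) (volume.restrict (Set.Icc 0 T)) := by
    intro w hw hw1
    refine Integrable.of_bound (measurable_integral_right (f := fun t x => w t x ^ 2)
      (hw.pow_const 2)).aestronglyMeasurable 1 (Filter.Eventually.of_forall fun t => ?_)
    refine (norm_integral_le_of_norm_le_const (C := 1) (Filter.Eventually.of_forall fun x => ?_)).trans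
      (by simp)
    rw [norm_pow]
    exact pow_le_one₀ (norm_nonneg _) (hw1 t x)
  have hIg := hI hg hg1
  have hIc := hI (w := fun t => conv (g t) (rescale η r)) hcm fun t x => hη.abs_conv_le hr (hg1 t) x
  have hQ : Q = ∫ t in Set.Icc 0 T, ((∫ x, g t x ^ 2) - ∫ x, conv (g t) (rescale η r) x ^ 2) :=
    (integral_sub hIg hIc).symm
  have hQ0 : 0 ≤ Q := by rw [hQ]; exact integral_nonneg fun t => (hinc t).1
  have hosc : ∫⁻ t in Set.Icc 0 T, ∫⁻ x, osc (g t) r x ^ d ≤ ENNReal.ofReal (D * Q) := by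
    have hVe : volume (Metric.closedBall (0 : E d) (1 / 2)) = ENNReal.ofReal V :=
      (ofReal_measureReal measure_closedBall_lt_top.ne).symm
    have hV0 : 0 ≤ V := measureReal_nonneg
    have ht : ∀ t, ∫⁻ x, osc (g t) r x ^ d ≤ ENNReal.ofReal (D *
        ((∫ x, g t x ^ 2) - ∫ x, conv (g t) (rescale η r) x ^ 2)) := by
      intro t
      have hgm := hgt t
      have h1 : ENNReal.ofReal c * ∫⁻ x, ∫⁻ w in Metric.closedBall (0 : E d) (1 / 2),
          ENNReal.ofReal ((g t x - g t (x - proj (r • w))) ^ 2) ≤ ENNReal.ofReal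
          (2 * ((∫ x, g t x ^ 2) - ∫ x, conv (g t) (rescale η r) x ^ 2)) := by
        rw [lintegral_lintegral_swap (by fun_prop)]
        exact (hinc t).2
      have h2 : ∫⁻ x, ∫⁻ w in Metric.closedBall (0 : E d) (1 / 2),
          ENNReal.ofReal ((g t x - g t (x - proj (r • w))) ^ 2) ≤ ENNReal.ofReal
          (c⁻¹ * (2 * ((∫ x, g t x ^ 2) - ∫ x, conv (g t) (rescale η r) x ^ 2))) := by
        rw [ENNReal.ofReal_mul (by positivity), ENNReal.ofReal_inv_of_pos hc0,
          ← ENNReal.mul_le_iff_le_inv (by simpa using hc0) ENNReal.ofReal_ne_top]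
        exact h1
      refine (lintegral_mono fun x => osc_pow_le hd hgm (hg1 t) x).trans ?_
      rw [lintegral_const_mul' _ _ (by
        rw [hVe]
        exact ENNReal.mul_ne_top (ENNReal.pow_ne_top (ENNReal.mul_ne_top (by simp)
          ENNReal.ofReal_ne_top)) ENNReal.ofReal_ne_top)]
      refine (mul_le_mul_right h2 _).trans (le_of_eq ?_)
      rw [hVe, ← ENNReal.ofReal_ofNat, ← ENNReal.ofReal_mul (by norm_num),
        ← ENNReal.ofReal_pow (by positivity), ← ENNReal.ofReal_mul (by positivity),
        ← ENNReal.ofReal_mul (by positivity)]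
      congr 1
      simp only [D]; ring
    refine (lintegral_mono fun t => ht t).trans (le_of_eq ?_)
    have hID : Integrable (fun t => D * ((∫ x, g t x ^ 2) - ∫ x, conv (g t) (rescale η r) x ^ 2))
      (volume.restrict (Set.Icc 0 T)) := (hIg.sub hIc).const_mul D
    rw [hQ, ← integral_const_mul, ofReal_integral_eq_lintegral_ofReal hID
      (Filter.Eventually.of_forall fun t => mul_nonneg hD (hinc t).1)]
  have hfin : ‖I3 η M Λ δ ε T u f g‖ₑ ≤ ENNReal.ofReal
      (K * ((2 * Real.exp Λ) ^ d * B) * (ε⁻¹ * L) * (T ^ (1 / (p : ℝ)) * (S * μ.real Set.univ) *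
        (D * Q) ^ (1 / (d : ℝ)))) := by
    refine (enorm_I3_le hη hΛ hδ hε hMm hM htr hB hfK hg hg1).trans ?_
    rw [ENNReal.ofReal_mul (p := K * _ * _) (by positivity)]
    gcongr
    refine (lintegral_mul_osc_le hp hum hg).trans ?_
    rw [ENNReal.ofReal_mul (p := T ^ _ * _) (by positivity),
      ENNReal.ofReal_mul (p := T ^ _) (by positivity), ENNReal.ofReal_mul (p := (S : ℝ)) (by positivity),
      ofReal_measureReal (measure_ne_top _ _), ENNReal.ofReal_coe_nnreal,
      ← ENNReal.ofReal_rpow_of_nonneg hT.le (by positivity),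
      ← ENNReal.ofReal_rpow_of_nonneg (mul_nonneg hD hQ0) (by positivity)]
    gcongr
    exact hS u μ σ h h0
  rw [← ofReal_norm, ENNReal.ofReal_le_ofReal_iff (by positivity)] at hfin
  rw [← Real.norm_eq_abs]
  refine hfin.trans (le_trans (le_of_eq ?_)
    (mul_le_mul_of_nonneg_right (le_add_of_nonneg_right zero_le_one) (by positivity)))
  rw [hpd, Real.mul_rpow hD hQ0, mul_pow, ← Real.exp_nat_mul]
  field_simp

end

end BVTransport

namespace BVTransport

variable {d : ℕ}

/-! ### Borel representatives -/

/-- A Borel representative truncated at `±K` is unchanged almost everywhere and bounded everywhere.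
-/
lemma exists_measurable_bdd {X : Type*} [MeasurableSpace X] {m : Measure X} {f : X → ℝ} {K : ℝ}
    (hf : AEStronglyMeasurable f m) (hK : 0 ≤ K) (h : ∀ᵐ x ∂m, |f x| ≤ K) :
    ∃ f', Measurable f' ∧ (∀ x, |f' x| ≤ K) ∧ f =ᵐ[m] f' := by
  refine ⟨fun x => max (-K) (min K (hf.mk f x)),
    measurable_const.max (measurable_const.min hf.stronglyMeasurable_mk.measurable),
    fun x => abs_le.2 ⟨le_max_left _ _, max_le (by linarith) (min_le_left _ _)⟩, ?_⟩
  filter_upwards [h, hf.ae_eq_mk] with x hx hm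
  rw [← hm, min_eq_right (abs_le.1 hx).2, max_eq_right (abs_le.1 hx).1]

/-- A Lebesgue null set may be charged by `μ`, so a single shift proves nothing. For each `y`,
however, almost every `h` moves `y` off the null set, and Fubini exchanges the quantifiers. -/
lemma ae_ae_add_proj {c : ℝ} (hc : c ≠ 0) {p : Td d → Prop} (hp : ∀ᵐ x, p x) (μ : Measure (Td d))
    [SFinite μ] : ∀ᵐ h : E d, ∀ᵐ y ∂μ, p (y + proj (c • h)) := by
  set N := toMeasurable volume {x | ¬ p x}
  have hN : volume N = 0 := by rw [measure_toMeasurable]; exact hp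
  have hpN : ∀ x, x ∉ N → p x := fun x hx => by
    by_contra h; exact hx (subset_toMeasurable _ _ h)
  have hm : MeasurableSet {q : E d × Td d | q.2 + proj (c • q.1) ∉ N} :=
    ((measurableSet_toMeasurable _ _).preimage (by fun_prop)).compl
  have h1 : ∀ᵐ h : E d, ∀ᵐ y ∂μ, y + proj (c • h) ∉ N := by
    refine (Measure.ae_ae_comm (p := fun (h : E d) y => y + proj (c • h) ∉ N) hm).2
      (Filter.Eventually.of_forall fun y => ?_)
    have h2 : ∀ᵐ x : Td d, y + x ∉ N :=
      (quasiMeasurePreserving_add_left volume y).ae (measure_eq_zero_iff_ae_notMem.1 hN)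
    have h3 : Measure.QuasiMeasurePreserving (fun h : E d => c • h) volume volume := by
      refine ⟨by fun_prop, ?_⟩
      rw [Measure.map_addHaar_smul _ hc]
      exact Measure.smul_absolutelyContinuous
    exact h3.ae (quasiMeasurePreserving_proj.ae h2)
  filter_upwards [h1] with h hh
  filter_upwards [hh] with y hy using hpN _ hy

section
variable {u u' : Td d → E d} {T K : ℝ} {f f' g g' : ℝ → Td d → ℝ} {f₀ f₀' fT fT' g₀ g₀' : Td d → ℝ}
  {η : E d → ℝ} {M : Td d → Matrix (Fin d) (Fin d) ℝ} {Λ δ ε : ℝ} {μ : Measure (Td d)}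
  {σ : Td d → Matrix (Fin d) (Fin d) ℝ}

lemma ae_ae_eq_of_spaceTime (h : Function.uncurry f =ᵐ[spaceTime d T] Function.uncurry f') :
    ∀ᵐ t ∂volume.restrict (Set.Icc 0 T), f t =ᵐ[volume] f' t :=
  Measure.ae_ae_of_ae_prod h

lemma IsBVWithGradient.congr (h : IsBVWithGradient u μ σ) (hu : u =ᵐ[volume] u') :
    IsBVWithGradient u' μ σ where
  integrable := h.integrable.congr hu
  finite := h.finite
  measurable := h.measurable
  unit := h.unit
  grad ψ hψ i j := by
    rw [← h.grad ψ hψ i j]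
    exact integral_congr_ae (hu.mono fun x hx => by simp only [hx])

lemma IsWeakSolution.congr (h : IsWeakSolution u T f f₀ fT) (hu : u =ᵐ[volume] u')
    (hf : Function.uncurry f =ᵐ[spaceTime d T] Function.uncurry f') (hf₀ : f₀ =ᵐ[volume] f₀')
    (hfT : fT =ᵐ[volume] fT') : IsWeakSolution u' T f' f₀' fT' where
  memLp := (memLp_congr_ae hf).1 h.memLp
  memLp_zero := (memLp_congr_ae hf₀).1 h.memLp_zero
  memLp_final := (memLp_congr_ae hfT).1 h.memLp_final
  weak ψ hψ := by
    have e₀ : ∫ x, f₀' x * ψ 0 x = ∫ x, f₀ x * ψ 0 x :=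
      integral_congr_ae (hf₀.mono fun x hx => by simp only [hx])
    have eT : ∫ x, fT' x * ψ T x = ∫ x, fT x * ψ T x :=
      integral_congr_ae (hfT.mono fun x hx => by simp only [hx])
    rw [e₀, eT, h.weak ψ hψ]
    refine integral_congr_ae ?_
    filter_upwards [ae_ae_eq_of_spaceTime hf] with t ht
    refine integral_congr_ae ?_
    filter_upwards [ht, hu] with x hx hux
    rw [hx, hux]

/-- Done in two stages: a bound on the traces follows only once the solution has a bounded Borel
representative, and then the traces are truncated too. -/
lemma IsWeakSolution.exists_isBddSolution (h : IsWeakSolution u T f f₀ fT) (hT : 0 < T)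
    (hu : Integrable u) (hum : Measurable u) (hK : 0 ≤ K)
    (hfK : ∀ᵐ q ∂spaceTime d T, |Function.uncurry f q| ≤ K) :
    ∃ f' f₀' fT', IsBddSolution u T K f' f₀' fT' ∧ (∀ x, |f₀' x| ≤ K) ∧ (∀ x, |fT' x| ≤ K) ∧
      Function.uncurry f =ᵐ[spaceTime d T] Function.uncurry f' ∧ f₀ =ᵐ[volume] f₀' ∧
      fT =ᵐ[volume] fT' := by
  obtain ⟨F, hFm, hFK, hF⟩ := exists_measurable_bdd h.memLp.1 hK hfK
  have h0 := h.memLp_zero.1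
  have h1 := h.memLp_final.1
  have hb : IsBddSolution u T K (fun t x => F (t, x)) (h0.mk f₀) (h1.mk fT) :=
    { h.congr (f' := fun t x => F (t, x)) (Filter.EventuallyEq.refl _ u) hF h0.ae_eq_mk
        h1.ae_eq_mk with
      meas := hFm
      bound := fun t x => hFK _
      meas_zero := h0.stronglyMeasurable_mk.measurable
      meas_final := h1.stronglyMeasurable_mk.measurable }
  obtain ⟨hb0, hb1⟩ := hb.ae_abs_le hT hu hum
  obtain ⟨F₀, hF₀m, hF₀K, hF₀⟩ := exists_measurable_bdd hb.meas_zero.aestronglyMeasurable hK hb0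
  obtain ⟨F₁, hF₁m, hF₁K, hF₁⟩ := exists_measurable_bdd hb.meas_final.aestronglyMeasurable hK hb1
  refine ⟨fun t x => F (t, x), F₀, F₁, ?_, hF₀K, hF₁K, hF, h0.ae_eq_mk.trans hF₀,
    h1.ae_eq_mk.trans hF₁⟩
  exact { hb.toIsWeakSolution.congr (Filter.EventuallyEq.refl _ u) (Filter.EventuallyEq.refl _ _)
            hF₀ hF₁ with
          meas := hFm
          bound := fun t x => hFK _
          meas_zero := hF₀m
          meas_final := hF₁m }

lemma IsBddSolution.mono (h : IsBddSolution u T K f f₀ fT) {K' : ℝ} (hK : K ≤ K') :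
    IsBddSolution u T K' f f₀ fT :=
  { h with bound := fun t x => (h.bound t x).trans hK }

lemma I1_congr_ae (hf : f₀ =ᵐ[volume] f₀') (hg : g₀ =ᵐ[volume] g₀') :
    I1 η M Λ δ ε f₀ g₀ = I1 η M Λ δ ε f₀' g₀' := by
  refine integral_congr_ae ?_
  filter_upwards [hf, hg] with x hfx hgx
  simp only [conv_congr_ae hg, hfx, hgx]

lemma I2_congr_ae (hf : f₀ =ᵐ[volume] f₀') (hg : g₀ =ᵐ[volume] g₀') :
    I2 η M Λ δ ε f₀ g₀ = I2 η M Λ δ ε f₀' g₀' := by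
  refine integral_congr_ae ?_
  filter_upwards [hf] with x hfx
  simp only [conv_congr_ae hg, hfx]

lemma I3_congr_ae (hu : u =ᵐ[volume] u')
    (hf : Function.uncurry f =ᵐ[spaceTime d T] Function.uncurry f')
    (hg : Function.uncurry g =ᵐ[spaceTime d T] Function.uncurry g') :
    I3 η M Λ δ ε T u f g = I3 η M Λ δ ε T u' f' g' := by
  unfold I3
  congr 1
  refine integral_congr_ae ?_
  filter_upwards [ae_ae_eq_of_spaceTime hf, ae_ae_eq_of_spaceTime hg] with t hft hgt
  refine integral_congr_ae ?_
  filter_upwards [hft, hu] with x hfx hux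
  simp only [conv_congr_ae hgt, hfx, hux]

/-- Relative to `y` the two arguments are shifted by `sδh` and `(s - 1)δh`, so `s = 0` and `s = 1`
must be excluded to have genuine shifts; these form a null set. -/
lemma ae_commutator_congr [SFinite μ] (hδ : 0 < δ)
    (hf : Function.uncurry f =ᵐ[spaceTime d T] Function.uncurry f')
    (hg : Function.uncurry g =ᵐ[spaceTime d T] Function.uncurry g') :
    ∀ᵐ t ∂volume.restrict (Set.Icc 0 T), ∀ᵐ s ∂volume.restrict (Set.Icc (0 : ℝ) 1), ∀ᵐ h : E d,
      ∀ᵐ y ∂μ, f t (y + proj ((s * δ) • h)) = f' t (y + proj ((s * δ) • h)) ∧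
        g t (y + proj ((s * δ) • h) - proj (δ • h)) =
          g' t (y + proj ((s * δ) • h) - proj (δ • h)) := by
  filter_upwards [ae_ae_eq_of_spaceTime hf, ae_ae_eq_of_spaceTime hg] with t hft hgt
  have h0 : ∀ a : ℝ, ∀ᵐ s ∂volume.restrict (Set.Icc (0 : ℝ) 1), s ≠ a := fun a =>
    ae_restrict_of_ae (by simp [ae_iff])
  filter_upwards [h0 0, h0 1] with s hs0 hs1
  filter_upwards [ae_ae_add_proj (mul_ne_zero hs0 hδ.ne') hft μ,
    ae_ae_add_proj (mul_ne_zero (sub_ne_zero.2 hs1) hδ.ne') hgt μ] with h h1 h2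
  filter_upwards [h1, h2] with y hy1 hy2
  refine ⟨hy1, ?_⟩
  have e : y + proj ((s * δ) • h) - proj (δ • h) = y + proj (((s - 1) * δ) • h) := by
    rw [sub_mul, one_mul, sub_smul, proj_sub, add_sub_assoc]
  rw [e, hy2]

lemma I4_congr_ae [SFinite μ] (hδ : 0 < δ)
    (hf : Function.uncurry f =ᵐ[spaceTime d T] Function.uncurry f')
    (hg : Function.uncurry g =ᵐ[spaceTime d T] Function.uncurry g') :
    I4 η M Λ δ ε T μ σ f g = I4 η M Λ δ ε T μ σ f' g' := by
  refine integral_congr_ae ((ae_commutator_congr (μ := μ) hδ hf hg).mono fun t ht => ?_)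
  refine integral_congr_ae (ht.mono fun s hs => ?_)
  refine integral_congr_ae (hs.mono fun h hh => ?_)
  refine integral_congr_ae (hh.mono fun y hy => ?_)
  simp only [hy.1, hy.2]

lemma I5_congr_ae [SFinite μ] (hδ : 0 < δ)
    (hf : Function.uncurry f =ᵐ[spaceTime d T] Function.uncurry f')
    (hg : Function.uncurry g =ᵐ[spaceTime d T] Function.uncurry g') :
    I5 η M Λ δ ε T μ f g = I5 η M Λ δ ε T μ f' g' := by
  refine integral_congr_ae ((ae_commutator_congr (μ := μ) hδ hf hg).mono fun t ht => ?_)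
  refine integral_congr_ae (ht.mono fun s hs => ?_)
  refine integral_congr_ae (hs.mono fun h hh => ?_)
  refine integral_congr_ae (hh.mono fun y hy => ?_)
  simp only [hy.1, hy.2]

lemma l2NormSq_congr_ae (h : ∀ᵐ t ∂volume.restrict (Set.Icc 0 T), f t =ᵐ[volume] f' t) :
    l2NormSq T f = l2NormSq T f' :=
  integral_congr_ae (h.mono fun t ht => integral_congr_ae (ht.mono fun x hx => by simp only [hx]))

lemma ae_abs_le_of_eLpNorm_top_le {X : Type*} [MeasurableSpace X] {m : Measure X} {f : X → ℝ}
    {K : ℝ} (hK : 0 ≤ K) (h : eLpNorm f ∞ m ≤ ENNReal.ofReal K) : ∀ᵐ x ∂m, |f x| ≤ K := by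
  filter_upwards [ae_le_eLpNormEssSup (f := f) (μ := m)] with x hx
  rw [← eLpNorm_exponent_top, ← ofReal_norm] at hx
  exact (ENNReal.ofReal_le_ofReal_iff hK).1 (hx.trans h)

end

end BVTransport
-- Assembly of the identity and the five bounds.
theorem mainTheorem4 (d : ℕ) (hd : 2 ≤ d) (η : E d → ℝ) (hη : IsMollifier η) :
    ∃ C : ℝ, 0 < C ∧
      ∀ (u : Td d → E d) (μ : Measure (Td d)) (σ : Td d → Matrix (Fin d) (Fin d) ℝ) (T : ℝ)
        (ρ φ : ℝ → Td d → ℝ) (ρ₀ ρT φ₀ φT : Td d → ℝ) (Λ δ ε : ℝ),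
        IsBVWithGradient u μ σ → DivFree u → ∫ x, u x = 0 →
        0 < T →
        IsWeakSolution u T ρ ρ₀ ρT →
        IsWeakSolution u T φ φ₀ φT →
        w1InfNorm φT ≤ 1 →
        eLpNorm (Function.uncurry φ) ∞ (spaceTime d T) ≤ eLpNorm φT ∞ volume →
        0 < Λ → 0 < δ → 0 < ε → δ ≤ ε * Real.exp (-Λ) →
        (∫ x, ρT x * φT x =
          I1 η (matField η μ σ ε) Λ δ ε ρT φT + I2 η (matField η μ σ ε) Λ δ ε ρ₀ φ₀ +
          I3 η (matField η μ σ ε) Λ δ ε T u ρ φ + I4 η (matField η μ σ ε) Λ δ ε T μ σ ρ φ +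
          I5 η (matField η μ σ ε) Λ δ ε T μ ρ φ) ∧
        |I1 η (matField η μ σ ε) Λ δ ε ρT φT| ≤
          C * (δ * Real.exp (((d : ℝ) + 1) * Λ) * linfNorm T ρ) ∧
        |I2 η (matField η μ σ ε) Λ δ ε ρ₀ φ₀| ≤
          C * ((1 + Real.exp Λ / δ + 1 / ε) * wNeg1Norm ρ₀) ∧
        |I3 η (matField η μ σ ε) Λ δ ε T u ρ φ| ≤
          C * (T ^ (((d : ℝ) - 1) / d) * (Real.exp (d * Λ) / ε) * linfNorm T ρ * μ.real Set.univ *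
            (l2NormSq T φ -
              l2NormSq T fun t => conv (φ t) (rescale η (2 * δ * Real.exp Λ))) ^ (1 / (d : ℝ))) ∧
        |I4 η (matField η μ σ ε) Λ δ ε T μ σ ρ φ| ≤
          C * (T * Real.exp (2 * Λ) * linfNorm T ρ * (μ.real Set.univ) ^ (1 / 2 : ℝ) *
            (μ.real Set.univ -
              ∫ x, frob (gradConv μ σ (rescale η (4 * ε)) x)) ^ (1 / 2 : ℝ)) ∧
        |I5 η (matField η μ σ ε) Λ δ ε T μ ρ φ| ≤
          C * (T / Λ * linfNorm T ρ * μ.real Set.univ) := by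
  have hd1 : (1 : ℝ) ≤ d := by exact_mod_cast (by omega : 1 ≤ d)
  obtain ⟨C₀, hC₀, hshift⟩ := hη.exists_shift_bound
  obtain ⟨C₃, hC₃, hI3⟩ := exists_abs_I3_le hd hη
  set L := ∫ h, ‖fderiv ℝ η h‖
  have hL : 0 ≤ L := integral_nonneg fun h => norm_nonneg _
  -- The sum of the constants of the five estimates, in order; each estimate uses one summand and
  -- discards the others, which are nonnegative.
  refine ⟨2 + (1 + d * L) + C₃ + C₀ * L * Real.sqrt 2 + 2 * C₀, by positivity, ?_⟩
  intro u μ σ T ρ φ ρ₀ ρT φ₀ φT Λ δ ε hu hdiv hu0 hT hρ hφ hφT hφb hΛ hδ hε hδε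
  have := hu.finite
  have hum := hu.integrable.1.stronglyMeasurable_mk.measurable
  have huu := hu.integrable.1.ae_eq_mk
  set v := hu.integrable.1.mk u
  have hv := hu.congr huu
  have hv0 : ∫ x, v x = 0 := by rw [← hu0]; exact integral_congr_ae huu.symm
  set M := matField η μ σ ε
  have hMm := hu.measurable_matField hη hε
  have hM : ∀ x, frob (M x) ≤ 1 := frob_matField_le
  have htr := hu.trace_matField hdiv hη hε
  set K := linfNorm T ρ
  have hK : 0 ≤ K := ENNReal.toReal_nonneg
  have hρK := ae_abs_le_of_eLpNorm_top_le hK (ENNReal.ofReal_toReal hρ.memLp.2.ne).ge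
  have hφ1 := ae_abs_le_of_eLpNorm_top_le (K := 1) zero_le_one
    (by simpa using hφb.trans (le_self_add.trans hφT))
  obtain ⟨f, f₀, fT, hf, hf₀K, hfTK, hρf, hρf₀, hρfT⟩ := (hρ.congr huu (Filter.EventuallyEq.refl _ _)
    (Filter.EventuallyEq.refl _ _) (Filter.EventuallyEq.refl _ _)).exists_isBddSolution hT
    hv.integrable hum hK hρK
  obtain ⟨g, g₀, gT, hg, hg₀1, hgT1, hφg, hφg₀, hφgT⟩ := (hφ.congr huu (Filter.EventuallyEq.refl _ _)
    (Filter.EventuallyEq.refl _ _) (Filter.EventuallyEq.refl _ _)).exists_isBddSolution hT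
    hv.integrable hum zero_le_one hφ1
  have hlip : ∀ w, ∀ᵐ x, |gT x - gT (x - proj w)| ≤ 2 * ‖w‖ := by
    intro w
    filter_upwards [exists_lipschitz_of_w1InfNorm_le hφT w, hφgT,
      (measurePreserving_sub_right volume (proj w)).quasiMeasurePreserving.ae hφgT] with x h1 h2 h3
    rwa [← h2, ← h3]
  have hφgt := ae_ae_eq_of_spaceTime hφg
  rw [I1_congr_ae hρfT hφgT, I2_congr_ae (Filter.EventuallyEq.refl _ ρ₀) hφg₀,
    I3_congr_ae huu hρf hφg, I4_congr_ae hδ hρf hφg, I5_congr_ae hδ hρf hφg,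
    l2NormSq_congr_ae hφgt, l2NormSq_congr_ae (f := fun t => conv (φ t) _)
      (hφgt.mono fun t ht => by rw [conv_congr_ae ht])]
  have b1 := abs_I1_le hη hΛ hδ hε hM htr hfTK hg.meas_final hgT1 hlip
  have b2 := abs_I2_le hη hΛ hδ hε hMm hM htr (hρ.memLp_zero.integrable (by simp)) hg.meas_zero hg₀1
  have b3 := hI3 v μ σ M f g T K Λ δ ε hv hv0 hum hT hΛ hδ hε hMm hM htr hf.bound hg.meas hg.bound
  have b4 := hu.abs_I4_le hη hΛ hδ hε hT hδε hC₀ hshift hMm hM htr hf.bound hg.bound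
  have b5 := abs_I5_le (μ := μ) hη hΛ hδ hε hT hδε hC₀ hshift hMm hM htr hf.bound hg.bound
  simp only [sum_matField_mul_gradConv] at b4
  refine ⟨?_, ?_, ?_, ?_, ?_, ?_⟩
  · have e : ∫ x, ρT x * φT x = ∫ x, fT x * gT x := by
      refine integral_congr_ae ?_
      filter_upwards [hρfT, hφgT] with x h1 h2
      rw [h1, h2]
    rw [e, I2_congr_ae hρf₀ (Filter.EventuallyEq.refl _ g₀)]
    -- The identity asks for one bound on both solutions, hence `max K 1`; the estimates keep `K`
    -- and `1` apart.
    exact transport_identity_alberti hη hΛ hδ hε hMm hM hT (hf.mono (le_max_left K 1))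
      (hg.mono (le_max_right K 1)) hv hum (fun x => (hf₀K x).trans (le_max_left _ _))
      (fun x => (hfTK x).trans (le_max_left _ _)) (fun x => (hg₀1 x).trans (le_max_right _ _))
      (fun x => (hgT1 x).trans (le_max_right _ _))
  -- The estimate of the first term gives `e^Λ`; this is enlarged to the stated power.
  · have h1 : Real.exp Λ ≤ Real.exp (((d : ℝ) + 1) * Λ) := Real.exp_le_exp.2 (by nlinarith)
    have hY : 0 ≤ δ * Real.exp (((d : ℝ) + 1) * Λ) * K := by positivity
    calc _ ≤ K * (2 * δ * Real.exp Λ) := b1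
      _ ≤ K * (2 * δ * Real.exp (((d : ℝ) + 1) * Λ)) := by gcongr
      _ = 2 * (δ * Real.exp (((d : ℝ) + 1) * Λ) * K) := by ring
      _ ≤ _ := mul_le_mul_of_nonneg_right (by
          have : 0 ≤ d * L := by positivity
          have : 0 ≤ C₀ * L * Real.sqrt 2 := by positivity
          linarith) hY
  · have hE : 0 ≤ Real.exp Λ / δ + 1 / ε := by positivity
    have hdL : 0 ≤ d * L := by positivity
    -- The sign is read off from the estimate itself, whose right-hand side dominates an absolute
    -- value; the next term is treated in the same way.
    have hW : 0 ≤ wNeg1Norm ρ₀ := by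
      refine nonneg_of_mul_nonneg_right ((abs_nonneg _).trans b2) ?_
      have : 0 ≤ d * L * (Real.exp Λ / δ + 1 / ε) := mul_nonneg hdL hE
      linarith
    refine b2.trans ?_
    rw [← mul_assoc]
    refine mul_le_mul_of_nonneg_right ?_ hW
    have : 0 ≤ C₀ * L * Real.sqrt 2 := by positivity
    calc 1 + d * L * (Real.exp Λ / δ + 1 / ε)
        ≤ (1 + d * L) * (1 + Real.exp Λ / δ + 1 / ε) := by nlinarith
      _ ≤ _ := mul_le_mul_of_nonneg_right (by linarith) (by positivity)
  · have hY := nonneg_of_mul_nonneg_right ((abs_nonneg _).trans b3) hC₃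
    refine b3.trans (mul_le_mul_of_nonneg_right ?_ hY)
    have : 0 ≤ d * L := by positivity
    have : 0 ≤ C₀ * L * Real.sqrt 2 := by positivity
    linarith
  · rw [← Real.sqrt_eq_rpow, ← Real.sqrt_eq_rpow]
    rw [Real.sqrt_mul (by norm_num), Real.sqrt_mul measureReal_nonneg] at b4
    calc _ ≤ _ := b4
      _ = C₀ * L * Real.sqrt 2 * (T * Real.exp (2 * Λ) * K * Real.sqrt (μ.real Set.univ) *
          Real.sqrt (μ.real Set.univ - ∫ x, frob (gradConv μ σ (rescale η (4 * ε)) x))) := by ring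
      _ ≤ _ := mul_le_mul_of_nonneg_right (by
          have : 0 ≤ d * L := by positivity
          linarith) (by positivity)
  · calc _ ≤ _ := b5
      _ = 2 * C₀ * (T / Λ * K * μ.real Set.univ) := by ring
      _ ≤ _ := mul_le_mul_of_nonneg_right (by
          have : 0 ≤ d * L := by positivity
          have : 0 ≤ C₀ * L * Real.sqrt 2 := by positivity
          linarith) (by positivity)
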